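/- **Conventions.** Let $1\le p<\infty$. *Algebras.* An $SQ_p$ space is a Banach space isometric to a subspace of a quotient of a complex $L_p$ space. An $SQ_p$ algebra is a norm-closed subalgebra $A\subseteq B(E)$ with $E$ an $SQ_p$ space, where $M_n(A)\subseteq M_n(B(E))=B(\ell_p^n(E))$ carries the operator norm. If $A$ is nonzero and unital, its unit is taken to be $I_E$. A filtration of $A$ is an increasing family $(A_r)_{r>0}$ of closed linear subspaces of $A$ with $A_rA_{r'}\subseteq A_{r+r'}$ and $\bigcup_r A_r$ dense in $A$, such that every $A_r$ contains the unit if $A$ is unital. A filtered $SQ_p$ algebra is an $SQ_p$ algebra with a filtration. The unitization $A^+$ consists of the pairs $(a,z)\in A\times\mathbb C$. A matrix $(a,z)$ over $A^+$ has norm $\max(\|a+z\|_{B(\ell^n_p(E))},\|z\|_{B(\ell^n_p)})$, which is the norm of $A+\mathbb C I_E$ if $I_E\notin A$. Put $(A^+)_r=A_r+\mathbb C$ and $\pi(a,z)=z$. A subalgebra $B\subseteq A$ carries the subspaces $B_r=B\cap A_r$. *Quasi-idempotents and quasi-invertibles.* Let $0<\varepsilon<\frac1{20}$, $r>0$, $N\ge1$.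 An $(\varepsilon,r,N)$-idempotent is a matrix $e$ with entries in $(A^+)_r$ such that $\|e^2-e\|<\varepsilon$ and $\|e\|,\|1-e\|\le N$. An $(\varepsilon,r,N)$-inverse pair is a pair $(u,v)$ of matrices with entries in $(A^+)_r$ such that $\|uv-1\|,\|vu-1\|<\varepsilon$ and $\|u\|,\|v\|\le N$; then $u$ and $v$ are called $(\varepsilon,r,N)$-invertibles. Homotopies are continuous paths of such objects (of inverse pairs, in the case of invertibles). *Quantitative $K$-groups.* $K_0^{\varepsilon,r,N}(A^+)$ is the Grothendieck group, under $\mathrm{diag}$, of the $(\varepsilon,r,N)$-idempotents in $M_\infty(A^+)$ modulo $(4\varepsilon,r,4N)$-homotopy. $K_1^{\varepsilon,r,N}(A^+)$ is the group of $(\varepsilon,r,N)$-invertibles in $M_\infty(A^+)$ modulo $(4\varepsilon,2r,4N)$-homotopy. Stabilization is by $0$, respectively by $1$. The same definitions apply to $\mathbb C$ with $\mathbb C_r=\mathbb C$, and $K_i^{\varepsilon,r,N}(A)=\ker\bigl(\pi_*:K_i^{\varepsilon,r,N}(A^+)\to K_i^{\varepsilon,r,N}(\mathbb C)\bigr)$.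 The family of these groups is $\mathcal K_i(A)$. For $\varepsilon\le\varepsilon'$, $r\le r'$, $N\le N'$ there is a relaxation map $\iota:K_i^{\varepsilon,r,N}(A)\to K_i^{\varepsilon',r',N'}(A)$. *Control.* A control pair $(\lambda,h)$ consists of a non-decreasing $\lambda:[1,\infty)\to[1,\infty)$ and an $h:(0,\frac1{20})\times[1,\infty)\to[1,\infty)$ that is non-increasing in its first variable. A $(\lambda,h)$-controlled morphism of order $s$ from $\mathcal K_i(A)$ to $\mathcal K_j(B)$ is a family of homomorphisms $F^{\varepsilon,r,N}:K_i^{\varepsilon,r,N}(A)\to K_j^{\lambda_N\varepsilon,\,h_{\varepsilon,N}r,\,\lambda_N}(B)$, for $N\ge1$, $0<\varepsilon<\frac1{20\lambda_N}$, $0<r\le\frac{s}{h_{\varepsilon,N}}$, that commutes with the relaxation maps: $\iota\circ F^{\varepsilon,r,N}=F^{\varepsilon',r',N'}\circ\iota$ whenever $\varepsilon\le\varepsilon'$, $r\le r'$, $N\le N'$ and $\lambda_N\varepsilon\le\lambda_{N'}\varepsilon'$, $h_{\varepsilon,N}r\le h_{\varepsilon',N'}r'$, $\lambda_N\le\lambda_{N'}$.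 Inclusions of algebras induce morphisms that preserve all parameters (so here $\varepsilon<\frac1{20}$, $r\le s$). A composition $\mathcal K\xrightarrow{F}\mathcal K'\xrightarrow{G}\mathcal K''$ is $(\lambda,h)$-exact of order $s$ if $G\circ F=0$ wherever the composition is defined, and the following holds for all $N\ge1$, $\varepsilon,r>0$, with $(\varepsilon_1,r_1,N_1)=(\lambda_N\varepsilon,h_{\varepsilon,N}r,\lambda_N)$: if $F$ is defined at $(\varepsilon_1,r_1,N_1)$ and $G$ at $(\varepsilon,r,N)$, then for each $y$ in the $(\varepsilon,r,N)$-group of $\mathcal K'$ with $G(y)=0$ there is an $x$ in the $(\varepsilon_1,r_1,N_1)$-group of $\mathcal K$ such that the parameters of the group containing $F(x)$ are at least $(\varepsilon,r,N)$ and $F(x)=\iota(y)$ in that group. *Mayer–Vietoris pairs.* Let $A$ be a filtered $SQ_p$ algebra and $s,c>0$. An $(s,c)$-controlled Mayer–Vietoris pair for $A$ is a pair $(A_{\Delta_1},A_{\Delta_2})$ of closed subalgebras of $A$ for which there are closed linear subspaces $\Delta_1,\Delta_2\subseteq A_s$ such that 1. for all $0<r\le s$, $n$, and $x\in M_n(A_r)$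 there are $x_i\in M_n(\Delta_i\cap A_r)$ with $x=x_1+x_2$ and $\max(\|x_1\|,\|x_2\|)\le c\|x\|$; 2. for $i=1,2$, $(A_{\Delta_i}\cap A_r)_{r>0}$ is a filtration of $A_{\Delta_i}$, and $A_{\Delta_i}\supseteq\Delta_i+A_{5s}\Delta_i+\Delta_iA_{5s}+A_{5s}\Delta_iA_{5s}$; 3. for all $0<r\le s$, $\delta>0$, $n$, $x\in M_n(A_{\Delta_1}\cap A_r)$ and $y\in M_n(A_{\Delta_2}\cap A_r)$ with $\|x-y\|<\delta$, there is $z\in M_n(A_{\Delta_1}\cap A_{\Delta_2}\cap A_r)$ with $\max(\|z-x\|,\|z-y\|)<c\delta$. Write $j_i:A_{\Delta_i}\to A$, $j_{1,2}:A_{\Delta_1}\cap A_{\Delta_2}\to A_{\Delta_1}$ and $j_{2,1}:A_{\Delta_1}\cap A_{\Delta_2}\to A_{\Delta_2}$ for the inclusions. *Boundary data.* A boundary datum at $(\varepsilon,r,N)$ consists of matrices as follows: * $(\varepsilon,r,N)$-invertibles $u\in M_n(A^+)$, $v\in M_m(A^+)$ with $\pi(u)=I_n$, $\pi(v)=I_m$,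 such that $\mathrm{diag}(u,v)$ is homotopic to $I_{n+m}$ as $(2\varepsilon,2r,2(N+\varepsilon))$-invertibles; * $(\varepsilon,r,N)$-inverse pairs $(w_i,w_i')$ in $M_{n+m}(A_{\Delta_i}^+)$, $i=1,2$, with $\|\mathrm{diag}(u,v)-w_1w_2\|<\varepsilon$; * an $(\varepsilon,r,N)$-idempotent $e\in M_{n+m}((A_{\Delta_1}\cap A_{\Delta_2})^+)$ with $\|e-w_1'\mathrm{diag}(I_n,0)w_1\|<\varepsilon$ and $\|e-w_2\,\mathrm{diag}(I_n,0)\,w_2'\|<\varepsilon$, such that $\mathrm{diag}(\pi(e),0)$ and $\mathrm{diag}(I_n,0)$ are homotopic as $(\varepsilon,r,N)$-idempotents in $M_{2(n+m)}(\mathbb C)$. **Theorem.** For each $c>0$ there are control pairs $(\lambda,h)$, $(\lambda^{\mathcal D},h^{\mathcal D})$, $(\lambda^{\mathcal B},h^{\mathcal B})$, depending only on $c$, such that for every $p\in[1,\infty)$, every filtered $SQ_p$ algebra $A$, every $s>0$ and every $(s,c)$-controlled Mayer–Vietoris pair $(A_{\Delta_1},A_{\Delta_2})$ for $A$ there is a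 $(\lambda^{\mathcal D},h^{\mathcal D})$-controlled morphism $\partial:\mathcal K_1(A)\to\mathcal K_0(A_{\Delta_1}\cap A_{\Delta_2})$ of order $s$ with the following properties. (a) ($\partial[u]=[e]-[I_n]$.) Let $N\ge1$, $0<\varepsilon<\frac1{20\lambda^{\mathcal D}_N}$, $0<r\le\frac{s}{h^{\mathcal D}_{\varepsilon,N}}$, $x\in K_1^{\varepsilon,r,N}(A)$, and put $q=(\lambda^{\mathcal B}_N\varepsilon,\,h^{\mathcal B}_{\varepsilon,N}r,\,\lambda^{\mathcal B}_N)$. There is a boundary datum $(u,v,w_1,w_1',w_2,w_2',e)$ at $q$ such that $\iota(x)=[u]$ after relaxation of the parameters to $q$; and every such boundary datum satisfies $\partial(x)=[e]-[I_n]$ in $K_0^{\lambda^{\mathcal D}_N\varepsilon,\,h^{\mathcal D}_{\varepsilon,N}r,\,\lambda^{\mathcal D}_N}(A_{\Delta_1}\cap A_{\Delta_2})$. (b) The sequence $$\mathcal K_1(A_{\Delta_1}\cap A_{\Delta_2})\xrightarrow{(j_{1,2*},\,j_{2,1*})}\mathcal K_1(A_{\Delta_1})\oplus\mathcal K_1(A_{\Delta_2})\xrightarrow{j_{1*}-j_{2*}}\mathcal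 K_1(A)\xrightarrow{\ \partial\ }\mathcal K_0(A_{\Delta_1}\cap A_{\Delta_2})\xrightarrow{(j_{1,2*},\,j_{2,1*})}\mathcal K_0(A_{\Delta_1})\oplus\mathcal K_0(A_{\Delta_2})\xrightarrow{j_{1*}-j_{2*}}\mathcal K_0(A)$$ is $(\lambda,h)$-exact of order $s$, that is, at each of its four interior terms. -/

import Mathlib

open scoped ENNReal

noncomputable section

namespace QuantK

/-! ### Matrix norms and `SQ_p` spaces -/

/-- The operator on `ℓ_p^n(E)` given by an `n × n` matrix of bounded operators on `E`. -/
def matCLM (p : ℝ≥0∞) [Fact (1 ≤ p)] {E : Type*} [NormedAddCommGroup E] [NormedSpace ℂ E]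
    {n : ℕ} (X : Matrix (Fin n) (Fin n) (E →L[ℂ] E)) :
    PiLp p (fun _ : Fin n => E) →L[ℂ] PiLp p (fun _ : Fin n => E) :=
  ((PiLp.continuousLinearEquiv p ℂ (fun _ : Fin n => E)).symm :
      (Fin n → E) →L[ℂ] PiLp p (fun _ : Fin n => E)) ∘L
    (ContinuousLinearMap.pi fun i => ∑ j, (X i j) ∘L
      (ContinuousLinearMap.proj (R := ℂ) (φ := fun _ : Fin n => E) j)) ∘L
    ((PiLp.continuousLinearEquiv p ℂ (fun _ : Fin n => E)) :
      PiLp p (fun _ : Fin n => E) →L[ℂ] (Fin n → E))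

/-- The norm of `M_n(B(E)) = B(ℓ_p^n(E))`. -/
def matNorm (p : ℝ≥0∞) [Fact (1 ≤ p)] {E : Type*} [NormedAddCommGroup E] [NormedSpace ℂ E]
    {n : ℕ} (X : Matrix (Fin n) (Fin n) (E →L[ℂ] E)) : ℝ :=
  ‖matCLM p X‖

/-- The norm of `M_n(ℂ) = B(ℓ_p^n)`. -/
def scalarNorm (p : ℝ≥0∞) [Fact (1 ≤ p)] {n : ℕ} (Z : Matrix (Fin n) (Fin n) ℂ) : ℝ :=
  matNorm p (Z.map fun z => z • ContinuousLinearMap.id ℂ ℂ)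

/-- `E` is (isometric to) a subspace of a quotient of an `L_p` space. -/
def IsSQp.{u, v} (p : ℝ≥0∞) [Fact (1 ≤ p)] (E : Type u) [NormedAddCommGroup E]
    [NormedSpace ℂ E] : Prop :=
  ∃ (Ω : Type v) (_ : MeasurableSpace Ω) (μ : MeasureTheory.Measure Ω)
    (F : Submodule ℂ (MeasureTheory.Lp ℂ p μ)),
    IsClosed (F : Set (MeasureTheory.Lp ℂ p μ)) ∧
      Nonempty (E →ₗᵢ[ℂ] (MeasureTheory.Lp ℂ p μ ⧸ F))

/-! ### Quasi-idempotents, quasi-invertibles and their homotopies -/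

/-- The parameters `(ε, r, N)`, ordered componentwise. -/
structure Param where
  ε : ℝ
  r : ℝ
  N : ℝ

instance : LE Param := ⟨fun q q' => q.ε ≤ q'.ε ∧ q.r ≤ q'.r ∧ q.N ≤ q'.N⟩

/-- The data of a filtered algebra with matrix norms from which quasi-idempotents and
quasi-invertibles are formed: norms on all `M_n(R)` and the propagation subspaces of `R`. -/
structure MatFilt (R : Type*) [Ring R] [Module ℂ R] where
  nrm : ∀ {n : ℕ}, Matrix (Fin n) (Fin n) R → ℝ
  fil : ℝ →o Submodule ℂ R

/-- `diag(a, b)`. -/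
def dsum {R : Type*} [Zero R] {n m : ℕ} (a : Matrix (Fin n) (Fin n) R)
    (b : Matrix (Fin m) (Fin m) R) : Matrix (Fin (n + m)) (Fin (n + m)) R :=
  (Matrix.fromBlocks a 0 0 b).submatrix finSumFinEquiv.symm finSumFinEquiv.symm

/-- The `k × k` matrix `diag(a, d, …, d)`, for `n ≤ k`. -/
def pad {R : Type*} [Zero R] (d : R) {n : ℕ} (k : ℕ) (a : Matrix (Fin n) (Fin n) R) :
    Matrix (Fin k) (Fin k) R :=
  fun i j => if h : i.1 < n ∧ j.1 < n then a ⟨i.1, h.1⟩ ⟨j.1, h.2⟩ else if i = j then d else 0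

theorem map_pad {R S : Type*} [Ring R] [Ring S] (φ : R →+* S) (d : R) {n : ℕ} (k : ℕ) (a : Matrix (Fin n) (Fin n) R) :
    (pad d k a).map φ = pad (φ d) k (a.map φ) := by
  ext i j
  simp only [pad, Matrix.map_apply]
  split_ifs <;> simp

theorem map_dsum {R S : Type*} [Ring R] [Ring S] (φ : R →+* S) {n m : ℕ} (a : Matrix (Fin n) (Fin n) R)
    (b : Matrix (Fin m) (Fin m) R) : (dsum a b).map φ = dsum (a.map φ) (b.map φ) := by
  ext i j
  simp only [dsum, Matrix.map_apply, Matrix.submatrix_apply]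
  rcases finSumFinEquiv.symm i with i | i <;> rcases finSumFinEquiv.symm j with j | j <;> simp

namespace MatFilt

section

variable {R : Type*} [Ring R] [Module ℂ R] (X : MatFilt R)

/-- `e ∈ M_n(R)` is an `(ε, r, N)`-idempotent. -/
def IsQuasiIdem (q : Param) {n : ℕ} (e : Matrix (Fin n) (Fin n) R) : Prop :=
  (∀ i j, e i j ∈ X.fil q.r) ∧ X.nrm (e * e - e) < q.ε ∧ X.nrm e ≤ q.N ∧ X.nrm (1 - e) ≤ q.N

/-- `(u, v)` is an `(ε, r, N)`-inverse pair in `M_n(R)`. -/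
def IsInvPair (q : Param) {n : ℕ} (u v : Matrix (Fin n) (Fin n) R) : Prop :=
  (∀ i j, u i j ∈ X.fil q.r) ∧ (∀ i j, v i j ∈ X.fil q.r) ∧ X.nrm u ≤ q.N ∧ X.nrm v ≤ q.N ∧
    X.nrm (u * v - 1) < q.ε ∧ X.nrm (v * u - 1) < q.ε

/-- The `n × n` cycles: `(ε, r, N)`-idempotents in degree `0`, `(ε, r, N)`-invertibles in
degree `1`. -/
def IsCyc (i : Fin 2) (q : Param) {n : ℕ} (a : Matrix (Fin n) (Fin n) R) : Prop :=
  if i = 0 then X.IsQuasiIdem q a else ∃ b, X.IsInvPair q a b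

/-- `Idem_∞^{ε,r,N}` (degree `0`) and `GL_∞^{ε,r,N}` (degree `1`), before the identification of
`a` with `diag(a, 0)`, respectively `diag(a, 1)`; that identification is part of `Sim`. -/
def Cyc (i : Fin 2) (q : Param) : Type _ :=
  Σ n : ℕ, {a : Matrix (Fin n) (Fin n) R // X.IsCyc i q a}

/-- The cycle given by a matrix. -/
def cyc {X : MatFilt R} {i : Fin 2} {q : Param} {n : ℕ} (a : Matrix (Fin n) (Fin n) R)
    (ha : X.IsCyc i q a) : X.Cyc i q :=
  ⟨n, a, ha⟩

end

section

variable {R : Type*} [Ring R] [Module ℂ R] [TopologicalSpace R] (X : MatFilt R)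

/-- `e` and `f` are homotopic as `(ε, r, N)`-idempotents in `M_k(R)`. -/
def IdemHtpy (q : Param) {k : ℕ} (e f : Matrix (Fin k) (Fin k) R) : Prop :=
  JoinedIn {x : Matrix (Fin k) (Fin k) R | X.IsQuasiIdem q x} e f

/-- `u₀` and `u₁` are homotopic as `(ε, r, N)`-invertibles in `M_k(R)`: there is an
`(ε, r, N)`-inverse pair `(u, v)` of paths in `M_k(R)` such that `u` runs from `u₀` to `u₁`. -/
def InvHtpy (q : Param) {k : ℕ} (u₀ u₁ : Matrix (Fin k) (Fin k) R) : Prop :=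
  ∃ v₀ v₁ : Matrix (Fin k) (Fin k) R,
    JoinedIn {x : Matrix (Fin k) (Fin k) R × Matrix (Fin k) (Fin k) R | X.IsInvPair q x.1 x.2}
      (u₀, v₀) (u₁, v₁)

/-- The equivalence relation of the quantitative `K`-groups: `(4ε, r, 4N)`-homotopy of
quasi-idempotents, respectively `(4ε, 2r, 4N)`-homotopy of quasi-invertibles, in `M_∞(R)`. -/
def Sim (i : Fin 2) (q : Param) {n m : ℕ} (a : Matrix (Fin n) (Fin n) R)
    (b : Matrix (Fin m) (Fin m) R) : Prop :=
  ∃ k : ℕ, n ≤ k ∧ m ≤ k ∧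
    if i = 0 then X.IdemHtpy ⟨4 * q.ε, q.r, 4 * q.N⟩ (pad 0 k a) (pad 0 k b)
    else X.InvHtpy ⟨4 * q.ε, 2 * q.r, 4 * q.N⟩ (pad 1 k a) (pad 1 k b)

/-- The relations `[a] = [b]` for `a ∼ b`, and `[diag(a, b)] = [a] + [b]`. -/
def rels (i : Fin 2) (q : Param) : Set (FreeAbelianGroup (X.Cyc i q)) :=
  {z | ∃ a b : X.Cyc i q, X.Sim i q a.2.1 b.2.1 ∧
      z = FreeAbelianGroup.of a - FreeAbelianGroup.of b} ∪
  {z | ∃ (a b : X.Cyc i q) (h : X.IsCyc i q (dsum a.2.1 b.2.1)),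
      z = FreeAbelianGroup.of (cyc _ h) - (FreeAbelianGroup.of a + FreeAbelianGroup.of b)}

/-- For a unital algebra: in degree `0` the Grothendieck group of the abelian semigroup
`Idem_∞^{ε,r,N} / ∼` under `diag`, in degree `1` that of `GL_∞^{ε,r,N} / ∼` under `diag`, which is
an abelian group already and so agrees with its Grothendieck group. The Grothendieck group is
presented by generators and relations. -/
def UK (i : Fin 2) (q : Param) : Type _ :=
  FreeAbelianGroup (X.Cyc i q) ⧸ AddSubgroup.closure (X.rels i q)

instance (i : Fin 2) (q : Param) : AddCommGroup (X.UK i q) :=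
  inferInstanceAs (AddCommGroup (FreeAbelianGroup (X.Cyc i q) ⧸ AddSubgroup.closure (X.rels i q)))

/-- The class `[a]`. -/
def cls (i : Fin 2) (q : Param) {n : ℕ} (a : Matrix (Fin n) (Fin n) R) (ha : X.IsCyc i q a) :
    X.UK i q :=
  QuotientAddGroup.mk (FreeAbelianGroup.of (cyc a ha))

theorem UK_hom_ext {X : MatFilt R} {i : Fin 2} {q : Param} {M : Type*} [AddCommGroup M]
    {f g : X.UK i q →+ M}
    (h : ∀ (n : ℕ) (a : Matrix (Fin n) (Fin n) R) (ha : X.IsCyc i q a),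
      f (X.cls i q a ha) = g (X.cls i q a ha)) : f = g :=
  QuotientAddGroup.addMonoidHom_ext _ (FreeAbelianGroup.lift_ext _ _ fun a => h a.1 a.2.1 a.2.2)

end

/-! ### Functoriality -/

section

variable {R S : Type*} [Ring R] [Module ℂ R] [TopologicalSpace R]
  [Ring S] [Module ℂ S] [TopologicalSpace S]

/-- A continuous unital homomorphism that preserves propagation and is contractive on all matrix
algebras. -/
structure IsContr (X : MatFilt R) (Y : MatFilt S) (φ : R →+* S) : Prop where
  cont : Continuous φ
  fil : ∀ r x, x ∈ X.fil r → φ x ∈ Y.fil r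
  nrm : ∀ (n : ℕ) (a : Matrix (Fin n) (Fin n) R), Y.nrm (a.map φ) ≤ X.nrm a

variable {X : MatFilt R} {Y : MatFilt S} {φ : R →+* S} {q q' : Param}

theorem IsQuasiIdem.map (hφ : IsContr X Y φ) (h : q ≤ q') {n : ℕ}
    {e : Matrix (Fin n) (Fin n) R} (he : X.IsQuasiIdem q e) : Y.IsQuasiIdem q' (e.map φ) := by
  obtain ⟨h1, h2, h3, h4⟩ := he
  refine ⟨fun i j => Y.fil.monotone h.2.1 (hφ.fil _ _ (h1 i j)), ?_, ?_, ?_⟩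
  · have : e.map φ * e.map φ - e.map φ = (e * e - e).map φ := by
      rw [Matrix.map_sub _ (map_sub φ), Matrix.map_mul]
    rw [this]
    exact ((hφ.nrm _ _).trans_lt h2).trans_le h.1
  · exact ((hφ.nrm _ _).trans h3).trans h.2.2
  · have : (1 : Matrix (Fin n) (Fin n) S) - e.map φ = (1 - e).map φ := by
      rw [Matrix.map_sub _ (map_sub φ), Matrix.map_one _ (map_zero φ) (map_one φ)]
    rw [this]
    exact ((hφ.nrm _ _).trans h4).trans h.2.2

theorem IsInvPair.map (hφ : IsContr X Y φ) (h : q ≤ q') {n : ℕ}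
    {u v : Matrix (Fin n) (Fin n) R} (huv : X.IsInvPair q u v) :
    Y.IsInvPair q' (u.map φ) (v.map φ) := by
  obtain ⟨h1, h2, h3, h4, h5, h6⟩ := huv
  have key : ∀ a b : Matrix (Fin n) (Fin n) R, a.map φ * b.map φ - 1 = (a * b - 1).map φ := by
    intro a b
    rw [Matrix.map_sub _ (map_sub φ), Matrix.map_mul,
      Matrix.map_one _ (map_zero φ) (map_one φ)]
  refine ⟨fun i j => Y.fil.monotone h.2.1 (hφ.fil _ _ (h1 i j)),
    fun i j => Y.fil.monotone h.2.1 (hφ.fil _ _ (h2 i j)),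
    ((hφ.nrm _ _).trans h3).trans h.2.2, ((hφ.nrm _ _).trans h4).trans h.2.2, ?_, ?_⟩
  · rw [key]; exact ((hφ.nrm _ _).trans_lt h5).trans_le h.1
  · rw [key]; exact ((hφ.nrm _ _).trans_lt h6).trans_le h.1

theorem IsCyc.map (hφ : IsContr X Y φ) (h : q ≤ q') {i : Fin 2} {n : ℕ}
    {a : Matrix (Fin n) (Fin n) R} (ha : X.IsCyc i q a) : Y.IsCyc i q' (a.map φ) := by
  unfold IsCyc at *
  split_ifs at * with hi
  · exact IsQuasiIdem.map hφ h ha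
  · obtain ⟨b, hb⟩ := ha
    exact ⟨b.map φ, IsInvPair.map hφ h hb⟩

theorem Sim.map (hφ : IsContr X Y φ) (h : q ≤ q') {i : Fin 2} {n m : ℕ}
    {a : Matrix (Fin n) (Fin n) R} {b : Matrix (Fin m) (Fin m) R} (hab : X.Sim i q a b) :
    Y.Sim i q' (a.map φ) (b.map φ) := by
  obtain ⟨k, hn, hm, H⟩ := hab
  refine ⟨k, hn, hm, ?_⟩
  have hc : Continuous fun x : Matrix (Fin k) (Fin k) R => x.map φ :=
    continuous_id.matrix_map hφ.cont
  obtain ⟨h1, h2, h3⟩ := h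
  split_ifs at * with hi
  · obtain ⟨γ, hγ⟩ := H
    have e0 : (pad 0 k a).map φ = pad 0 k (a.map φ) := by rw [map_pad, map_zero]
    have e1 : (pad 0 k b).map φ = pad 0 k (b.map φ) := by rw [map_pad, map_zero]
    rw [← e0, ← e1]
    refine ⟨γ.map hc, fun t => ?_⟩
    refine IsQuasiIdem.map hφ ?_ (hγ t)
    exact ⟨by simpa using h1, h2, by simpa using h3⟩
  · obtain ⟨v₀, v₁, γ, hγ⟩ := H
    have e0 : (pad 1 k a).map φ = pad 1 k (a.map φ) := by rw [map_pad, map_one]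
    have e1 : (pad 1 k b).map φ = pad 1 k (b.map φ) := by rw [map_pad, map_one]
    rw [← e0, ← e1]
    refine ⟨v₀.map φ, v₁.map φ, γ.map (hc.prodMap hc), fun t => ?_⟩
    refine IsInvPair.map hφ ?_ (hγ t)
    exact ⟨by simpa using h1, by simpa using h2, by simpa using h3⟩

theorem closure_rels_le (hφ : IsContr X Y φ) (h : q ≤ q') (i : Fin 2) :
    AddSubgroup.closure (X.rels i q) ≤ (AddSubgroup.closure (Y.rels i q')).comap
      (FreeAbelianGroup.map fun a : X.Cyc i q => cyc (a.2.1.map φ) (IsCyc.map hφ h a.2.2)) := by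
  rw [AddSubgroup.closure_le]
  rintro z (⟨a, b, hab, rfl⟩ | ⟨a, b, hc, rfl⟩)
  · refine AddSubgroup.subset_closure (Or.inl ⟨cyc _ (IsCyc.map hφ h a.2.2),
      cyc _ (IsCyc.map hφ h b.2.2), Sim.map hφ h hab, ?_⟩)
    rw [map_sub, FreeAbelianGroup.map_of_apply, FreeAbelianGroup.map_of_apply]
  · have hd : Y.IsCyc i q' (dsum (a.2.1.map φ) (b.2.1.map φ)) := by
      rw [← map_dsum]; exact IsCyc.map hφ h hc
    refine AddSubgroup.subset_closure (Or.inr ⟨cyc _ (IsCyc.map hφ h a.2.2),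
      cyc _ (IsCyc.map hφ h b.2.2), hd, ?_⟩)
    rw [map_sub, map_add, FreeAbelianGroup.map_of_apply, FreeAbelianGroup.map_of_apply,
      FreeAbelianGroup.map_of_apply]
    congr 2
    simp only [cyc]
    congr 2
    exact map_dsum φ _ _

/-- The homomorphism `[a] ↦ [φ(a)]`, with relaxation of the parameters from `q` to `q'`. -/
def UKmap (hφ : IsContr X Y φ) (h : q ≤ q') (i : Fin 2) : X.UK i q →+ Y.UK i q' :=
  QuotientAddGroup.map _ _
    (FreeAbelianGroup.map fun a : X.Cyc i q => cyc (a.2.1.map φ) (IsCyc.map hφ h a.2.2))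
    (closure_rels_le hφ h i)

end

end MatFilt

/-! ### Quantitative `K`-groups -/

section

variable {p : ℝ≥0∞} [Fact (1 ≤ p)] {E : Type*} [NormedAddCommGroup E] [NormedSpace ℂ E]

/-- The filtered algebra `ℂ`, with `ℂ_r = ℂ` and `M_n(ℂ) = B(ℓ_p^n)`. -/
def scalars (p : ℝ≥0∞) [Fact (1 ≤ p)] : MatFilt ℂ where
  nrm := scalarNorm p
  fil := ⟨fun _ => ⊤, fun _ _ _ => le_rfl⟩

/-- The unitization `A⁺` of an algebra `A ⊆ B(E)` with propagation subspaces `F r = A_r`. The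
element `(a, z)` of `A⁺` is represented by the pair `(a + z I_E, z)`, with norm
`max(‖a + z I_E‖, |z|)` and similarly for matrices, and `(A⁺)_r = A_r + ℂ`.
If `I_E ∉ A` this is the norm of `A + ℂ I_E ⊆ B(E)`, because `(a, z) ↦ z` is then `p`-completely
contractive; if `I_E ∈ A` it is the max-norm of `A ⊕ ℂ`. -/
def unitization (p : ℝ≥0∞) [Fact (1 ≤ p)] (F : ℝ →o Submodule ℂ (E →L[ℂ] E)) :
    MatFilt ((E →L[ℂ] E) × ℂ) where
  nrm a := max (matNorm p (a.map Prod.fst)) (scalarNorm p (a.map Prod.snd))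
  fil := ⟨fun r => (F r).comap (LinearMap.fst ℂ (E →L[ℂ] E) ℂ -
      (LinearMap.snd ℂ (E →L[ℂ] E) ℂ).smulRight (1 : E →L[ℂ] E)),
    fun _ _ h => Submodule.comap_mono (F.monotone h)⟩

theorem Param.le_refl (q : Param) : q ≤ q := ⟨le_rfl, le_rfl, le_rfl⟩

/-- The quotient homomorphism `π : A⁺ → ℂ` is a contractive filtered homomorphism. -/
theorem pi_contr (F : ℝ →o Submodule ℂ (E →L[ℂ] E)) :
    MatFilt.IsContr (unitization p F) (scalars p) (RingHom.snd (E →L[ℂ] E) ℂ) where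
  cont := continuous_snd
  fil _ _ _ := Submodule.mem_top
  nrm _ _ := le_max_right _ _

/-- An inclusion is a contractive filtered homomorphism. -/
theorem incl_contr {F F' : ℝ →o Submodule ℂ (E →L[ℂ] E)} (hF : F ≤ F') :
    MatFilt.IsContr (unitization p F) (unitization p F') (RingHom.id ((E →L[ℂ] E) × ℂ)) where
  cont := continuous_id
  fil r _ hx := hF r hx
  nrm _ _ := le_rfl

/-- `K_i^{ε,r,N}(A) = ker (π_* : K_i^{ε,r,N}(A⁺) → K_i^{ε,r,N}(ℂ))`, for an algebra `A ⊆ B(E)`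
with propagation subspaces `F r = A_r`. -/
def QK (p : ℝ≥0∞) [Fact (1 ≤ p)] (i : Fin 2) (F : ℝ →o Submodule ℂ (E →L[ℂ] E)) (q : Param) :
    AddSubgroup ((unitization p F).UK i q) :=
  (MatFilt.UKmap (pi_contr F) (Param.le_refl q) i).ker

theorem QK_map_aux {F F' : ℝ →o Submodule ℂ (E →L[ℂ] E)} (hF : F ≤ F') {q q' : Param}
    (h : q ≤ q') (i : Fin 2) (x : (unitization p F).UK i q) :
    MatFilt.UKmap (pi_contr F') (Param.le_refl q') i (MatFilt.UKmap (incl_contr hF) h i x) =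
      MatFilt.UKmap (X := scalars p) (Y := scalars p) (φ := RingHom.id ℂ)
        ⟨continuous_id, fun _ _ h => h, fun _ _ => le_rfl⟩ h i
        (MatFilt.UKmap (pi_contr F) (Param.le_refl q) i x) := by
  have := MatFilt.UK_hom_ext (X := unitization p F) (i := i) (q := q)
    (f := (MatFilt.UKmap (pi_contr (p := p) F') (Param.le_refl q') i).comp
      (MatFilt.UKmap (incl_contr hF) h i))
    (g := (MatFilt.UKmap (X := scalars p) (Y := scalars p) (φ := RingHom.id ℂ)
        ⟨continuous_id, fun _ _ h => h, fun _ _ => le_rfl⟩ h i).comp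
      (MatFilt.UKmap (pi_contr F) (Param.le_refl q) i)) (fun n a ha => rfl)
  exact DFunLike.congr_fun this x

/-- The homomorphism induced by an inclusion of algebras and a relaxation of the parameters. -/
def QK.map (p : ℝ≥0∞) [Fact (1 ≤ p)] (i : Fin 2) {F F' : ℝ →o Submodule ℂ (E →L[ℂ] E)}
    (hF : F ≤ F') {q q' : Param} (h : q ≤ q') : QK p i F q →+ QK p i F' q' :=
  ((MatFilt.UKmap (incl_contr hF) h i).comp (QK p i F q).subtype).codRestrict (QK p i F' q')
    fun x => by
      have hx : MatFilt.UKmap (pi_contr F) (Param.le_refl q) i x.1 = 0 := x.2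
      change MatFilt.UKmap (pi_contr F') (Param.le_refl q') i
        (MatFilt.UKmap (incl_contr hF) h i x.1) = 0
      rw [QK_map_aux hF, hx, map_zero]

theorem QK.map_map (i : Fin 2) {F F' F'' : ℝ →o Submodule ℂ (E →L[ℂ] E)}
    (hF : F ≤ F') (hF' : F' ≤ F'') (hF'' : F ≤ F'') {q q' q'' : Param} (h : q ≤ q')
    (h' : q' ≤ q'') (h'' : q ≤ q'') (x : QK p i F q) :
    QK.map p i hF' h' (QK.map p i hF h x) = QK.map p i hF'' h'' x := by
  apply Subtype.ext
  obtain ⟨x, hx⟩ := x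
  change MatFilt.UKmap (incl_contr hF') h' i (MatFilt.UKmap (incl_contr hF) h i x) =
    MatFilt.UKmap (incl_contr hF'') h'' i x
  have := MatFilt.UK_hom_ext (X := unitization p F) (i := i) (q := q)
    (f := (MatFilt.UKmap (incl_contr hF') h' i).comp (MatFilt.UKmap (incl_contr hF) h i))
    (g := MatFilt.UKmap (incl_contr hF'') h'' i) (fun n a ha => rfl)
  exact DFunLike.congr_fun this x

end

/-! ### Control pairs, controlled morphisms and controlled exactness -/

/-- A control pair `(λ, h)`. -/
structure ControlPair where
  lam : ℝ → ℝ
  h : ℝ → ℝ → ℝ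
  one_le_lam : ∀ N, 1 ≤ N → 1 ≤ lam N
  lam_mono : ∀ N N', 1 ≤ N → N ≤ N' → lam N ≤ lam N'
  one_le_h : ∀ ε N, 0 < ε → ε < 1 / 20 → 1 ≤ N → 1 ≤ h ε N
  h_anti : ∀ ε ε' N, 0 < ε → ε ≤ ε' → ε' < 1 / 20 → 1 ≤ N → h ε' N ≤ h ε N

/-- A rule `(ε, r, N) ↦ (a_N ε, h_{ε,N} r, b_N)` for the change of parameters. -/
structure Control where
  a : ℝ → ℝ
  h : ℝ → ℝ → ℝ
  b : ℝ → ℝ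

/-- The new parameters. -/
def Control.app (C : Control) (q : Param) : Param :=
  ⟨C.a q.N * q.ε, C.h q.ε q.N * q.r, C.b q.N⟩

/-- The parameters on which a controlled morphism of order `R` is defined. -/
def Control.Dom (C : Control) (R : ℝ) (q : Param) : Prop :=
  0 < q.ε ∧ q.ε < 1 / 20 ∧ 0 < q.r ∧ 1 ≤ q.N ∧ (C.app q).ε < 1 / 20 ∧ (C.app q).r ≤ R

/-- The rule `(ε, r, N) ↦ (λ_N ε, h_{ε,N} r, λ_N)` of a control pair. -/
def ControlPair.toControl (P : ControlPair) : Control := ⟨P.lam, P.h, P.lam⟩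

/-- The rule that preserves all parameters. -/
def Control.id : Control := ⟨fun _ => 1, fun _ _ => 1, fun N => N⟩

/-- A family of abelian groups indexed by the parameters, with relaxation of control maps. -/
structure Family where
  grp : Param → Type*
  [inst : ∀ q, AddCommGroup (grp q)]
  relax : ∀ {q q' : Param}, q ≤ q' → grp q →+ grp q'

attribute [instance] Family.inst

/-- The direct sum of two families. -/
def Family.prod (G H : Family) : Family where
  grp q := G.grp q × H.grp q
  relax h := (G.relax h).prodMap (H.relax h)

/-- A controlled morphism of order `R`. -/
structure CtrlHom (C : Control) (R : ℝ) (G H : Family) where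
  map : ∀ q, C.Dom R q → G.grp q →+ H.grp (C.app q)
  comm : ∀ q q' (hq : C.Dom R q) (hq' : C.Dom R q') (h : q ≤ q') (h' : C.app q ≤ C.app q')
    (x : G.grp q), H.relax h' (map q hq x) = map q' hq' (G.relax h x)

/-- `(λ, h)`-exactness of order `R` of `G → H → I` at `H`. -/
def IsExactAt (P : ControlPair) (R : ℝ) {C C' : Control} {G H I : Family}
    (f : CtrlHom C R G H) (g : CtrlHom C' R H I) : Prop :=
  (∀ q (hf : C.Dom R q) (hg : C'.Dom R (C.app q)) (x : G.grp q),
    g.map (C.app q) hg (f.map q hf x) = 0) ∧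
  ∀ q (hf : C.Dom R (P.toControl.app q)) (hg : C'.Dom R q) (y : H.grp q), g.map q hg y = 0 →
    ∃ (h : q ≤ C.app (P.toControl.app q)) (x : G.grp (P.toControl.app q)),
      f.map (P.toControl.app q) hf x = H.relax h y

section

variable {E : Type*} [NormedAddCommGroup E] [NormedSpace ℂ E]

/-- The family `𝒦_i(A)`, for an algebra `A ⊆ B(E)` with propagation subspaces `F r = A_r`. -/
def KFam (p : ℝ≥0∞) [Fact (1 ≤ p)] (i : Fin 2) (F : ℝ →o Submodule ℂ (E →L[ℂ] E)) :
    Family where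
  grp q := QK p i F q
  relax h := QK.map p i le_rfl h

theorem Control.le_id_app (q : Param) : q ≤ Control.id.app q :=
  ⟨(one_mul q.ε).ge, (one_mul q.r).ge, le_rfl⟩

/-- The controlled morphism `x ↦ (j₁(x), j₂(x))` for inclusions `j₁`, `j₂`. -/
def inclPair (p : ℝ≥0∞) [Fact (1 ≤ p)] (i : Fin 2) (R : ℝ)
    {F F₁ F₂ : ℝ →o Submodule ℂ (E →L[ℂ] E)} (h₁ : F ≤ F₁) (h₂ : F ≤ F₂) :
    CtrlHom Control.id R (KFam p i F) ((KFam p i F₁).prod (KFam p i F₂)) where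
  map q _ := AddMonoidHom.prod (M := QK p i F q) (N := QK p i F₁ (Control.id.app q))
    (P := QK p i F₂ (Control.id.app q))
    (QK.map p i h₁ (Control.le_id_app q)) (QK.map p i h₂ (Control.le_id_app q))
  comm q q' _ _ h h' x :=
    have hq : q ≤ Control.id.app q' :=
      ⟨h.1.trans (one_mul q'.ε).ge, h.2.1.trans (one_mul q'.r).ge, h.2.2⟩
    Prod.ext
      ((QK.map_map i h₁ le_rfl h₁ _ h' hq x).trans (QK.map_map i le_rfl h₁ h₁ h _ hq x).symm)
      ((QK.map_map i h₂ le_rfl h₂ _ h' hq x).trans (QK.map_map i le_rfl h₂ h₂ h _ hq x).symm)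

/-- The controlled morphism `(y₁, y₂) ↦ j₁(y₁) - j₂(y₂)` for inclusions `j₁`, `j₂`. -/
def inclDiff (p : ℝ≥0∞) [Fact (1 ≤ p)] (i : Fin 2) (R : ℝ)
    {F F₁ F₂ : ℝ →o Submodule ℂ (E →L[ℂ] E)} (h₁ : F₁ ≤ F) (h₂ : F₂ ≤ F) :
    CtrlHom Control.id R ((KFam p i F₁).prod (KFam p i F₂)) (KFam p i F) where
  map q _ :=
    (QK.map p i h₁ (Control.le_id_app q)).comp (AddMonoidHom.fst (QK p i F₁ q) (QK p i F₂ q)) -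
      (QK.map p i h₂ (Control.le_id_app q)).comp (AddMonoidHom.snd (QK p i F₁ q) (QK p i F₂ q))
  comm q q' _ _ h h' x := by
    have hq : q ≤ Control.id.app q' :=
      ⟨h.1.trans (one_mul q'.ε).ge, h.2.1.trans (one_mul q'.r).ge, h.2.2⟩
    obtain ⟨x, y⟩ := x
    change QK.map p i le_rfl h' (QK.map p i h₁ _ x - QK.map p i h₂ _ y) =
      QK.map p i h₁ (Control.le_id_app q') (QK.map p i le_rfl h x) -
        QK.map p i h₂ (Control.le_id_app q') (QK.map p i le_rfl h y)
    rw [map_sub]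
    exact congrArg₂ (· - ·)
      ((QK.map_map i h₁ le_rfl h₁ _ h' hq x).trans (QK.map_map i le_rfl h₁ h₁ h _ hq x).symm)
      ((QK.map_map i h₂ le_rfl h₂ _ h' hq y).trans (QK.map_map i le_rfl h₂ h₂ h _ hq y).symm)

end

/-! ### Filtered `SQ_p` algebras and controlled Mayer-Vietoris pairs -/

section

variable {E : Type*} [NormedAddCommGroup E] [NormedSpace ℂ E]

/-- `e` is a unit of `A`. -/
def IsUnitOf (A : NonUnitalSubalgebra ℂ (E →L[ℂ] E)) (e : E →L[ℂ] E) : Prop :=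
  e ∈ A ∧ ∀ a ∈ A, e * a = a ∧ a * e = a

/-- `(F r)_{r > 0}` is a filtration of the Banach algebra `A`. (Only the indices `r > 0` matter;
the values at `r ≤ 0` can be set to `0`.) -/
structure IsFiltration (A : NonUnitalSubalgebra ℂ (E →L[ℂ] E))
    (F : ℝ →o Submodule ℂ (E →L[ℂ] E)) : Prop where
  le : ∀ r, 0 < r → F r ≤ A.toSubmodule
  isClosed : ∀ r, 0 < r → IsClosed (F r : Set (E →L[ℂ] E))
  mul_mem : ∀ r r', 0 < r → 0 < r' → ∀ x ∈ F r, ∀ y ∈ F r', x * y ∈ F (r + r')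
  dense : (A : Set (E →L[ℂ] E)) ⊆ closure (⋃ r > (0 : ℝ), (F r : Set (E →L[ℂ] E)))
  unit_mem : ∀ e, IsUnitOf A e → ∀ r, 0 < r → e ∈ F r

end

/-- A filtered `SQ_p` algebra: a norm-closed subalgebra of `B(E)`, with `E` an `SQ_p` space, and a
filtration of it. If the algebra is unital and nonzero, its unit `e` (which has norm `1` by
convention) is taken to be `I_E`; this can be achieved by replacing `E` by `e E`. -/
structure FilteredSQpAlgebra.{u, v} (p : ℝ≥0∞) [Fact (1 ≤ p)] (E : Type u)
    [NormedAddCommGroup E] [NormedSpace ℂ E] where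
  isSQp : IsSQp.{u, v} p E
  alg : NonUnitalSubalgebra ℂ (E →L[ℂ] E)
  isClosed : IsClosed (alg : Set (E →L[ℂ] E))
  fil : ℝ →o Submodule ℂ (E →L[ℂ] E)
  isFiltration : IsFiltration alg fil
  unit_eq : ∀ e, IsUnitOf alg e → e ≠ 0 → e = 1

namespace FilteredSQpAlgebra

variable {p : ℝ≥0∞} [Fact (1 ≤ p)] {E : Type*} [NormedAddCommGroup E] [NormedSpace ℂ E]
  (A : FilteredSQpAlgebra p E)

/-- The subspaces `B_r = B ∩ A_r` of a subalgebra `B`. -/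
def sub (B : NonUnitalSubalgebra ℂ (E →L[ℂ] E)) : ℝ →o Submodule ℂ (E →L[ℂ] E) :=
  ⟨fun r => B.toSubmodule ⊓ A.fil r, fun _ _ h => inf_le_inf_left _ (A.fil.monotone h)⟩

theorem sub_le (B : NonUnitalSubalgebra ℂ (E →L[ℂ] E)) : A.sub B ≤ A.fil :=
  fun _ => inf_le_right

theorem sub_mono {B B' : NonUnitalSubalgebra ℂ (E →L[ℂ] E)} (h : B ≤ B') : A.sub B ≤ A.sub B' :=
  fun _ => inf_le_inf_right _ h

/-- `(Δ₁, Δ₂)` is a completely coercive decomposition pair of degree `s` with coercity `c`. -/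
def IsDecompPair (s c : ℝ) (Δ₁ Δ₂ : Submodule ℂ (E →L[ℂ] E)) : Prop :=
  ∀ r, 0 < r → r ≤ s → ∀ (n : ℕ) (x : Matrix (Fin n) (Fin n) (E →L[ℂ] E)),
    (∀ i j, x i j ∈ A.fil r) → ∃ x₁ x₂ : Matrix (Fin n) (Fin n) (E →L[ℂ] E),
      (∀ i j, x₁ i j ∈ Δ₁ ⊓ A.fil r) ∧ (∀ i j, x₂ i j ∈ Δ₂ ⊓ A.fil r) ∧
      max (matNorm p x₁) (matNorm p x₂) ≤ c * matNorm p x ∧ x = x₁ + x₂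

/-- The neighborhood `Δ + A_R Δ + Δ A_R + A_R Δ A_R`. -/
def nbhd (R : ℝ) (Δ : Submodule ℂ (E →L[ℂ] E)) : Submodule ℂ (E →L[ℂ] E) :=
  Δ ⊔ A.fil R * Δ ⊔ Δ * A.fil R ⊔ A.fil R * Δ * A.fil R

/-- The Banach subalgebra `B` of `A` is an `s`-controlled `Δ`-neighborhood in `A`. -/
structure IsCtrlNbhd (s : ℝ) (Δ : Submodule ℂ (E →L[ℂ] E))
    (B : NonUnitalSubalgebra ℂ (E →L[ℂ] E)) : Prop where
  le : B ≤ A.alg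
  isClosed : IsClosed (B : Set (E →L[ℂ] E))
  isFiltration : IsFiltration B (A.sub B)
  nbhd_le : A.nbhd (5 * s) Δ ≤ B.toSubmodule

/-- `(S₁, S₂)` has the complete intersection approximation property with coercity `c`. -/
def HasCIA (p : ℝ≥0∞) [Fact (1 ≤ p)] (c : ℝ) (S₁ S₂ : Submodule ℂ (E →L[ℂ] E)) : Prop :=
  ∀ ε, 0 < ε → ∀ (n : ℕ) (x y : Matrix (Fin n) (Fin n) (E →L[ℂ] E)),
    (∀ i j, x i j ∈ S₁) → (∀ i j, y i j ∈ S₂) → matNorm p (x - y) < ε →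
    ∃ z : Matrix (Fin n) (Fin n) (E →L[ℂ] E), (∀ i j, z i j ∈ S₁ ⊓ S₂) ∧
      max (matNorm p (z - x)) (matNorm p (z - y)) < c * ε

/-- `(A₁, A₂)` is an `(s, c)`-controlled Mayer-Vietoris pair for `A`. -/
def IsMVPair (s c : ℝ) (A₁ A₂ : NonUnitalSubalgebra ℂ (E →L[ℂ] E)) : Prop :=
  0 < s ∧ 0 < c ∧ ∃ Δ₁ Δ₂ : Submodule ℂ (E →L[ℂ] E),
    (IsClosed (Δ₁ : Set (E →L[ℂ] E)) ∧ Δ₁ ≤ A.fil s) ∧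
    (IsClosed (Δ₂ : Set (E →L[ℂ] E)) ∧ Δ₂ ≤ A.fil s) ∧
    A.IsDecompPair s c Δ₁ Δ₂ ∧ A.IsCtrlNbhd s Δ₁ A₁ ∧ A.IsCtrlNbhd s Δ₂ A₂ ∧
    ∀ r, 0 < r → r ≤ s → HasCIA p c (A.sub A₁ r) (A.sub A₂ r)

/-! ### The boundary map -/

/-- The choices, with parameters `q = (ε, r, N)`, that enter the boundary map:
`u ∈ M_n(A⁺)` and `v ∈ M_m(A⁺)` are quasi-invertibles, equal to the identity modulo `A`, such that
`diag(u, v)` is homotopic to the identity; `(w_i, w_i')` is a quasi-inverse pair over `A_i⁺`, with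
`diag(u, v)` close to `w₁ w₂`; and `e` is a quasi-idempotent over `(A₁ ∩ A₂)⁺` close to
`w₁' diag(I_n, 0) w₁` and to `w₂ diag(I_n, 0) w₂'`, with `π(e)` homotopic to `diag(I_n, 0)`. -/
structure IsBoundaryDatum (A₁ A₂ : NonUnitalSubalgebra ℂ (E →L[ℂ] E)) (q : Param) {n m : ℕ}
    (u : Matrix (Fin n) (Fin n) ((E →L[ℂ] E) × ℂ)) (v : Matrix (Fin m) (Fin m) ((E →L[ℂ] E) × ℂ))
    (w₁ w₁' w₂ w₂' e : Matrix (Fin (n + m)) (Fin (n + m)) ((E →L[ℂ] E) × ℂ)) : Prop where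
  u_inv : (unitization p A.fil).IsCyc 1 q u
  u_pi : u.map Prod.snd = 1
  v_inv : (unitization p A.fil).IsCyc 1 q v
  v_pi : v.map Prod.snd = 1
  uv_htpy : (unitization p A.fil).InvHtpy ⟨2 * q.ε, 2 * q.r, 2 * (q.N + q.ε)⟩ (dsum u v) 1
  w₁_inv : (unitization p (A.sub A₁)).IsInvPair q w₁ w₁'
  w₂_inv : (unitization p (A.sub A₂)).IsInvPair q w₂ w₂'
  uv_near : (unitization p A.fil).nrm (dsum u v - w₁ * w₂) < q.ε
  e_idem : (unitization p (A.sub (A₁ ⊓ A₂))).IsQuasiIdem q e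
  e_near₁ : (unitization p A.fil).nrm (e - w₁' * dsum 1 0 * w₁) < q.ε
  e_near₂ : (unitization p A.fil).nrm (e - w₂ * dsum 1 0 * w₂') < q.ε
  e_pi : (scalars p).IdemHtpy q (pad 0 (2 * (n + m)) (e.map Prod.snd))
    (pad 0 (2 * (n + m)) (1 : Matrix (Fin n) (Fin n) ℂ))

/-- `x ∈ K_1^q(A)` has the representative `u` after relaxation of the parameters to `q'`. -/
def Represents {q : Param} (q' : Param) {n : ℕ} (u : Matrix (Fin n) (Fin n) ((E →L[ℂ] E) × ℂ))
    (x : QK p 1 A.fil q) : Prop :=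
  ∃ (h : q ≤ q') (hu : (unitization p A.fil).IsCyc 1 q' u),
    (QK.map p 1 le_rfl h x : (unitization p A.fil).UK 1 q') = MatFilt.cls _ 1 q' u hu

/-- `∂` is the boundary map `∂[u] = [e] - [I_n]`: with respect to the control pair `B`, every
class `[u]` admits choices as in `IsBoundaryDatum`, and all of them give the value of `∂`. -/
def IsBoundaryMap (A₁ A₂ : NonUnitalSubalgebra ℂ (E →L[ℂ] E)) (B D : ControlPair) {s : ℝ}
    (bd : CtrlHom D.toControl s (KFam p 1 A.fil) (KFam p 0 (A.sub (A₁ ⊓ A₂)))) : Prop :=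
  ∀ (q : Param) (hq : D.toControl.Dom s q) (x : QK p 1 A.fil q),
    (∃ (n m : ℕ) (u : Matrix (Fin n) (Fin n) ((E →L[ℂ] E) × ℂ))
      (v : Matrix (Fin m) (Fin m) ((E →L[ℂ] E) × ℂ))
      (w₁ w₁' w₂ w₂' e : Matrix (Fin (n + m)) (Fin (n + m)) ((E →L[ℂ] E) × ℂ)),
      A.Represents (B.toControl.app q) u x ∧
        A.IsBoundaryDatum A₁ A₂ (B.toControl.app q) u v w₁ w₁' w₂ w₂' e) ∧
    ∀ (n m : ℕ) (u : Matrix (Fin n) (Fin n) ((E →L[ℂ] E) × ℂ))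
      (v : Matrix (Fin m) (Fin m) ((E →L[ℂ] E) × ℂ))
      (w₁ w₁' w₂ w₂' e : Matrix (Fin (n + m)) (Fin (n + m)) ((E →L[ℂ] E) × ℂ)),
      A.Represents (B.toControl.app q) u x →
      A.IsBoundaryDatum A₁ A₂ (B.toControl.app q) u v w₁ w₁' w₂ w₂' e →
      ∃ (he : (unitization p (A.sub (A₁ ⊓ A₂))).IsCyc 0 (D.toControl.app q) e)
        (hI : (unitization p (A.sub (A₁ ⊓ A₂))).IsCyc 0 (D.toControl.app q)
          (1 : Matrix (Fin n) (Fin n) ((E →L[ℂ] E) × ℂ))),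
        (QK p 0 (A.sub (A₁ ⊓ A₂)) (D.toControl.app q)).subtype (bd.map q hq x) =
          MatFilt.cls _ 0 _ e he - MatFilt.cls _ 0 _ 1 hI

end FilteredSQpAlgebra

end QuantK
end

universe u v

/-! The boundary map is Milnor patching with error terms. Trivial modules over the two subalgebras,
glued along an invertible u over A⁺, give a module over the intersection; it is the range of a
quasi-idempotent e, and ∂[u] = [e] - [1]. `IsPatch` records such a gluing: two frames (α_i, β_i) of
e, one over each subalgebra, with transition matrix β₁α₂ ≈ u. Two gluings along the same u have
equivalent idempotents, because the comparison map α₁'β₁ ≈ α₂'β₂ is close to both subalgebras and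
can therefore be approximated over the intersection (`Patch.unique`).

Gluings exist because products of elementary matrices factor through the two subalgebras
(`MV.exists_factor`). The coercive decomposition splits an elementary matrix as 1 + x + y = (1 +
x)(1 + y), where xy = 0 because x and y sit in the same off-diagonal corner. The factors 1 + x are
moved to the left past everything in front of them and become 1 + WxW⁻¹; these lie over the first
subalgebra because it contains a neighborhood of Δ₁. Thus U · (product of elementary matrices) ≈
z₁Uz₂, with z_i over the i-th subalgebra and homotopic to 1 there. By Whitehead's lemma diag(u, u⁻¹)
is a product of six elementary matrices, so it factors up to an error as z₁z₂, and this yields the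
boundary data (`MV.exists_datum`).

The quantitative difficulty is that homotopies are arbitrarily long, whereas the factorization costs
propagation for each elementary matrix. It is resolved by two swindles. The points of a fine
subdivision are placed on a block diagonal, and the homotopy is replaced by a shift by one block.
Norm, propagation and error of a block diagonal matrix are governed by its worst block, so the
number of steps does not enter. Consequently equality in K₀ is stable Murray-von Neumann equivalence
with fixed bounds (`HT.mvN`, `exists_mvN_of_kcls_eq`), and equality in K₁ is, stably, multiplication
by 18 elementary matrices (`HT.lEq`, `lEq_of_kcls_eq`). Hence [e] - [1] depends only on [u]
(`Patch.kcls_sub`). Additivity of ∂, its compatibility with relaxation, and its independence of the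
boundary datum all follow from this uniqueness.

Exactness is the classical Mayer-Vietoris argument. If classes over the two subalgebras agree over
A, the factorization produces matrices over the two subalgebras that are close to each other, and
these are approximated over the intersection (`MV.exists_lift_one`, `MV.exists_lift_zero`). If ∂[u]
= 0, the frames of the trivialized module split u into two factors (`MV.exists_split`). If e is
trivial over both subalgebras, the two trivializations differ by the required u (`MV.exists_bd`).

All parameters are measured on a `Scale`: at index k the propagation is at most kρ, norms are at
most M^k and errors at most M^k δ. Products add indices and sums cost one more, so bookkeeping is
linear arithmetic over ℕ. With M = N + 3c + 3, ρ = r and δ = ε this gives the control pairs (M^k,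
k). The `SQ_p` hypothesis enters only through `IsAmplifiable`: scalar matrices act on ℓ_p^n(E) with
norm at most their norm on ℓ_p^n, so the scalar part of a matrix over A⁺ can be split off with
bounded norm. -/

open scoped ENNReal Matrix

set_option linter.unusedSectionVars false
set_option linter.unusedSimpArgs false

noncomputable section

namespace QuantK

/-! ### Matrix norms, scales and the calculus of controlled matrices -/

/-- A compatible family of submultiplicative norms on the rectangular matrices over `R`. -/
structure MNorm (R : Type*) [Ring R] [Algebra ℂ R] [TopologicalSpace R] where
  nrm : ∀ {ι κ : Type} [Fintype ι] [Fintype κ], Matrix ι κ R → ℝ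
  nonneg : ∀ {ι κ : Type} [Fintype ι] [Fintype κ] (X : Matrix ι κ R), 0 ≤ nrm X
  add_le : ∀ {ι κ : Type} [Fintype ι] [Fintype κ] (X Y : Matrix ι κ R),
    nrm (X + Y) ≤ nrm X + nrm Y
  smul_le : ∀ {ι κ : Type} [Fintype ι] [Fintype κ] (z : ℂ) (X : Matrix ι κ R),
    nrm (z • X) ≤ ‖z‖ * nrm X
  mul_le : ∀ {ι κ η : Type} [Fintype ι] [Fintype κ] [Fintype η] (X : Matrix ι κ R)
    (Y : Matrix κ η R), nrm (X * Y) ≤ nrm X * nrm Y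
  one_le : ∀ {ι : Type} [Fintype ι] [DecidableEq ι], nrm (1 : Matrix ι ι R) ≤ 1
  submatrix_le : ∀ {ι κ ι' κ' : Type} [Fintype ι] [Fintype κ] [Fintype ι'] [Fintype κ']
    (X : Matrix ι κ R) (f : ι' → ι) (g : κ' → κ), f.Injective → g.Injective →
    nrm (X.submatrix f g) ≤ nrm X
  diag_le : ∀ {ι κ ι' κ' : Type} [Fintype ι] [Fintype κ] [Fintype ι'] [Fintype κ']
    (A : Matrix ι κ R) (D : Matrix ι' κ' R),
    nrm (Matrix.fromBlocks A 0 0 D) ≤ max (nrm A) (nrm D)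
  blockDiagonal_le : ∀ {ι κ o : Type} [Fintype ι] [Fintype κ] [Fintype o] [DecidableEq o]
    (X : o → Matrix ι κ R) (C : ℝ), 0 ≤ C → (∀ k, nrm (X k) ≤ C) →
    nrm (Matrix.blockDiagonal X) ≤ C
  cont : ∀ {ι κ : Type} [Fintype ι] [Fintype κ],
    Continuous (nrm : Matrix ι κ R → ℝ)

/-- The subspaces `S r` contain the unit and are submultiplicative. -/
structure IsFilt {R : Type*} [Ring R] [Algebra ℂ R] (S : ℝ →o Submodule ℂ R) : Prop where
  one_mem : ∀ r, 1 ∈ S r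
  mul_mem : ∀ {r r'}, 0 < r → 0 < r' → ∀ {x y}, x ∈ S r → y ∈ S r' → x * y ∈ S (r + r')

/-- Units of measurement for norms, propagations and errors. -/
structure Scale where
  M : ℝ
  ρ : ℝ
  δ : ℝ
  two_le : 2 ≤ M
  ρ_pos : 0 < ρ
  δ_pos : 0 < δ

theorem Scale.M_pos (c : Scale) : 0 < c.M := by linarith [c.two_le]
theorem Scale.one_le (c : Scale) : 1 ≤ c.M := by linarith [c.two_le]
theorem Scale.pow_pos (c : Scale) (k : ℕ) : 0 < c.M ^ k := _root_.pow_pos c.M_pos k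
theorem Scale.one_le_pow (c : Scale) (k : ℕ) : 1 ≤ c.M ^ k := one_le_pow₀ c.one_le
theorem Scale.pow_le (c : Scale) {k l : ℕ} (h : k ≤ l) : c.M ^ k ≤ c.M ^ l :=
  pow_le_pow_right₀ c.one_le h
-- The assumption M ≥ 2 absorbs a sum of two bounds of index k into index k + 1. This keeps all
-- later estimates linear in the indices.
theorem Scale.two_mul_pow (c : Scale) (k : ℕ) : c.M ^ k + c.M ^ k ≤ c.M ^ (k + 1) := by
  rw [pow_succ]; nlinarith [c.two_le, c.pow_pos k]
theorem Scale.four_mul_pow (c : Scale) (k : ℕ) : 4 * c.M ^ k ≤ c.M ^ (k + 2) := by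
  have h := c.two_mul_pow k
  have h' := c.two_mul_pow (k + 1)
  rw [show k + 2 = k + 1 + 1 from rfl]; linarith

/-- The parameters `(M^k δ, k ρ, M^k)`. -/
def Scale.q (c : Scale) (k : ℕ) : Param := ⟨c.M ^ k * c.δ, k * c.ρ, c.M ^ k⟩

theorem Scale.q_le (c : Scale) {k l : ℕ} (h : k ≤ l) : c.q k ≤ c.q l :=
  ⟨mul_le_mul_of_nonneg_right (c.pow_le h) c.δ_pos.le,
    mul_le_mul_of_nonneg_right (Nat.cast_le.2 h) c.ρ_pos.le, c.pow_le h⟩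

section calculus

variable {R : Type*} [Ring R] [Algebra ℂ R] [TopologicalSpace R] (ν : MNorm R) (c : Scale)
  (S : ℝ →o Submodule ℂ R)

/-- `X` has propagation at most `kρ` and norm at most `M^k`. -/
structure Ctl (k : ℕ) {ι κ : Type} [Fintype ι] [Fintype κ] (X : Matrix ι κ R) : Prop where
  pos : 1 ≤ k
  mem : ∀ i j, X i j ∈ S (k * c.ρ)
  bd : ν.nrm X ≤ c.M ^ k

/-- `X` and `Y` agree up to an error `M^k δ`. -/
def Nr (k : ℕ) {ι κ : Type} [Fintype ι] [Fintype κ] (X Y : Matrix ι κ R) : Prop :=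
  ν.nrm (X - Y) ≤ c.M ^ k * c.δ

variable {ν c S}
variable {ι κ η ι' κ' : Type} [Fintype ι] [Fintype κ] [Fintype η] [Fintype ι'] [Fintype κ']

namespace MNorm

theorem neg_le (ν : MNorm R) (X : Matrix ι κ R) : ν.nrm (-X) ≤ ν.nrm X := by
  simpa using ν.smul_le (-1) X

theorem neg (ν : MNorm R) (X : Matrix ι κ R) : ν.nrm (-X) = ν.nrm X :=
  le_antisymm (ν.neg_le X) (by simpa using ν.neg_le (-X))

theorem zero (ν : MNorm R) : ν.nrm (0 : Matrix ι κ R) = 0 :=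
  le_antisymm (by simpa using ν.smul_le 0 (0 : Matrix ι κ R)) (ν.nonneg _)

theorem sub_le (ν : MNorm R) (X Y : Matrix ι κ R) : ν.nrm (X - Y) ≤ ν.nrm X + ν.nrm Y := by
  rw [sub_eq_add_neg, ← ν.neg Y]; exact ν.add_le _ _

theorem sub_comm (ν : MNorm R) (X Y : Matrix ι κ R) : ν.nrm (X - Y) = ν.nrm (Y - X) := by
  rw [← ν.neg, neg_sub]

theorem reindex (ν : MNorm R) (X : Matrix ι κ R) (f : ι' ≃ ι) (g : κ' ≃ κ) :
    ν.nrm (X.submatrix f g) = ν.nrm X := by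
  refine le_antisymm (ν.submatrix_le _ _ _ f.injective g.injective) ?_
  have := ν.submatrix_le (X.submatrix f g) f.symm g.symm f.symm.injective g.symm.injective
  simpa using this

theorem offDiag_le (ν : MNorm R) (B : Matrix ι κ R) (C : Matrix ι' κ' R) :
    ν.nrm (Matrix.fromBlocks 0 B C 0) ≤ max (ν.nrm B) (ν.nrm C) := by
  have h : Matrix.fromBlocks 0 B C 0 =
      (Matrix.fromBlocks B 0 0 C).submatrix id (Equiv.sumComm κ' κ) := by
    ext (i | i) (j | j) <;> simp
  rw [h]
  exact (ν.submatrix_le _ _ _ Function.injective_id (Equiv.injective _)).trans (ν.diag_le _ _)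

end MNorm

theorem Ctl.mono {k l : ℕ} {X : Matrix ι κ R} (h : Ctl ν c S k X) (hkl : k ≤ l) :
    Ctl ν c S l X :=
  ⟨h.pos.trans hkl, fun i j => S.monotone
    (mul_le_mul_of_nonneg_right (Nat.cast_le.2 hkl) c.ρ_pos.le) (h.mem i j),
    h.bd.trans (c.pow_le hkl)⟩

theorem Ctl.filt_mono {S' : ℝ →o Submodule ℂ R} {k : ℕ} {X : Matrix ι κ R} (h : Ctl ν c S k X)
    (hS : S ≤ S') : Ctl ν c S' k X :=
  ⟨h.pos, fun i j => hS _ (h.mem i j), h.bd⟩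

/-- The condition 1 ≤ k in `Ctl` is needed here: A_r A_r' ⊆ A_{r+r'} is available for positive radii
only. -/
theorem Ctl.mul (hS : IsFilt S) {k l : ℕ} {X : Matrix ι κ R} {Y : Matrix κ η R}
    (hX : Ctl ν c S k X) (hY : Ctl ν c S l Y) : Ctl ν c S (k + l) (X * Y) := by
  have hk : (0 : ℝ) < k := by exact_mod_cast hX.pos
  have hl : (0 : ℝ) < l := by exact_mod_cast hY.pos
  refine ⟨by linarith [hX.pos], fun i j => ?_, ?_⟩
  · rw [Matrix.mul_apply]
    refine Submodule.sum_mem _ fun m _ => ?_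
    have := hS.mul_mem (mul_pos hk c.ρ_pos) (mul_pos hl c.ρ_pos) (hX.mem i m) (hY.mem m j)
    rwa [← add_mul, ← Nat.cast_add] at this
  · rw [pow_add]
    exact (ν.mul_le _ _).trans (mul_le_mul hX.bd hY.bd (ν.nonneg _) (c.pow_pos _).le)

theorem Ctl.add {k : ℕ} {X Y : Matrix ι κ R}
    (hX : Ctl ν c S k X) (hY : Ctl ν c S k Y) : Ctl ν c S (k + 1) (X + Y) := by
  refine ⟨by omega, fun i j => ?_,
    (ν.add_le _ _).trans ((add_le_add hX.bd hY.bd).trans (c.two_mul_pow k))⟩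
  exact Submodule.add_mem _ ((hX.mono (Nat.le_succ k)).mem i j) ((hY.mono (Nat.le_succ k)).mem i j)

theorem Ctl.smul {k : ℕ} {X : Matrix ι κ R} (hX : Ctl ν c S k X) {z : ℂ} (hz : ‖z‖ ≤ 1) :
    Ctl ν c S k (z • X) :=
  ⟨hX.pos, fun i j => Submodule.smul_mem _ _ (hX.mem i j), (ν.smul_le _ _).trans
    ((mul_le_of_le_one_left (ν.nonneg _) hz).trans hX.bd)⟩

theorem Ctl.neg {k : ℕ} {X : Matrix ι κ R} (hX : Ctl ν c S k X) : Ctl ν c S k (-X) := by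
  simpa using hX.smul (z := -1) (by simp)

theorem Ctl.sub {k : ℕ} {X Y : Matrix ι κ R}
    (hX : Ctl ν c S k X) (hY : Ctl ν c S k Y) : Ctl ν c S (k + 1) (X - Y) := by
  rw [sub_eq_add_neg]; exact hX.add hY.neg

theorem Ctl.zero {k : ℕ} (hk : 1 ≤ k) : Ctl ν c S k (0 : Matrix ι κ R) :=
  ⟨hk, fun _ _ => Submodule.zero_mem _, by rw [ν.zero]; exact (c.pow_pos k).le⟩

theorem Ctl.one [DecidableEq ι] (hS : IsFilt S) {k : ℕ} (hk : 1 ≤ k) :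
    Ctl ν c S k (1 : Matrix ι ι R) :=
  ⟨hk, fun i j => by
    rw [Matrix.one_apply]; split_ifs
    exacts [hS.one_mem _, Submodule.zero_mem _], ν.one_le.trans (c.one_le_pow k)⟩

theorem Ctl.submatrix {k : ℕ} {X : Matrix ι κ R} (hX : Ctl ν c S k X) {f : ι' → ι} {g : κ' → κ}
    (hf : f.Injective) (hg : g.Injective) : Ctl ν c S k (X.submatrix f g) :=
  ⟨hX.pos, fun _ _ => hX.mem _ _, (ν.submatrix_le _ _ _ hf hg).trans hX.bd⟩

theorem Ctl.reindex {k : ℕ} {X : Matrix ι κ R} (hX : Ctl ν c S k X) (f : ι' ≃ ι) (g : κ' ≃ κ) :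
    Ctl ν c S k (X.submatrix f g) := hX.submatrix f.injective g.injective

theorem Ctl.diag {k : ℕ} {X : Matrix ι κ R} {Y : Matrix ι' κ' R} (hX : Ctl ν c S k X)
    (hY : Ctl ν c S k Y) : Ctl ν c S k (Matrix.fromBlocks X 0 0 Y) := by
  refine ⟨hX.pos, ?_, (ν.diag_le _ _).trans (max_le hX.bd hY.bd)⟩
  rintro (i | i) (j | j)
  exacts [hX.mem i j, Submodule.zero_mem _, Submodule.zero_mem _, hY.mem i j]

theorem Ctl.offDiag {k : ℕ} {X : Matrix ι κ R} {Y : Matrix ι' κ' R} (hX : Ctl ν c S k X)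
    (hY : Ctl ν c S k Y) : Ctl ν c S k (Matrix.fromBlocks 0 X Y 0) := by
  refine ⟨hX.pos, ?_, (ν.offDiag_le _ _).trans (max_le hX.bd hY.bd)⟩
  rintro (i | i) (j | j)
  exacts [Submodule.zero_mem _, hX.mem i j, hY.mem i j, Submodule.zero_mem _]

theorem Ctl.blocks {k : ℕ} {A : Matrix ι κ R} {B : Matrix ι κ' R} {C : Matrix ι' κ R}
    {D : Matrix ι' κ' R} (hA : Ctl ν c S k A) (hB : Ctl ν c S k B) (hC : Ctl ν c S k C)
    (hD : Ctl ν c S k D) : Ctl ν c S (k + 1) (Matrix.fromBlocks A B C D) := by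
  have := (hA.diag hD).add (hB.offDiag hC)
  rwa [Matrix.fromBlocks_add, add_zero, zero_add, zero_add, add_zero] at this

/-- The index does not grow with the number of blocks. Together with `Nr.blockDiagonal` this makes
the swindles independent of the length of a homotopy. -/
theorem Ctl.blockDiagonal {o : Type} [Fintype o] [DecidableEq o] {k : ℕ} (hk : 1 ≤ k)
    {X : o → Matrix ι κ R} (hX : ∀ j, Ctl ν c S k (X j)) :
    Ctl ν c S k (Matrix.blockDiagonal X) :=
  ⟨hk, fun i j => by
    rw [Matrix.blockDiagonal_apply]; split_ifs
    exacts [(hX _).mem _ _, Submodule.zero_mem _],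
    ν.blockDiagonal_le _ _ (c.pow_pos k).le fun j => (hX j).bd⟩

theorem Nr.mono {k l : ℕ} {X Y : Matrix ι κ R} (h : Nr ν c k X Y) (hkl : k ≤ l) :
    Nr ν c l X Y :=
  h.trans (mul_le_mul_of_nonneg_right (c.pow_le hkl) c.δ_pos.le)

theorem Nr.refl (k : ℕ) (X : Matrix ι κ R) : Nr ν c k X X := by
  rw [Nr, sub_self, ν.zero]; exact (mul_pos (c.pow_pos k) c.δ_pos).le

theorem Nr.of_eq (k : ℕ) {X Y : Matrix ι κ R} (h : X = Y) : Nr ν c k X Y := h ▸ Nr.refl k X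

theorem Nr.symm {k : ℕ} {X Y : Matrix ι κ R} (h : Nr ν c k X Y) : Nr ν c k Y X := by
  rw [Nr, ν.sub_comm]; exact h

theorem Nr.add {k : ℕ} {X Y X' Y' : Matrix ι κ R} (h : Nr ν c k X Y) (h' : Nr ν c k X' Y') :
    Nr ν c (k + 1) (X + X') (Y + Y') := by
  rw [Nr, add_sub_add_comm]
  refine (ν.add_le _ _).trans ((add_le_add h h').trans ?_)
  rw [← add_mul]
  exact mul_le_mul_of_nonneg_right (c.two_mul_pow k) c.δ_pos.le

theorem Nr.neg {k : ℕ} {X Y : Matrix ι κ R} (h : Nr ν c k X Y) : Nr ν c k (-X) (-Y) := by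
  rw [Nr, neg_sub_neg, ν.sub_comm]; exact h

theorem Nr.sub {k : ℕ} {X Y X' Y' : Matrix ι κ R} (h : Nr ν c k X Y) (h' : Nr ν c k X' Y') :
    Nr ν c (k + 1) (X - X') (Y - Y') := by
  rw [sub_eq_add_neg, sub_eq_add_neg]; exact h.add h'.neg

theorem Nr.smul {k : ℕ} {X Y : Matrix ι κ R} (h : Nr ν c k X Y) {z : ℂ} (hz : ‖z‖ ≤ 1) :
    Nr ν c k (z • X) (z • Y) := by
  rw [Nr, ← smul_sub]
  exact (ν.smul_le _ _).trans ((mul_le_of_le_one_left (ν.nonneg _) hz).trans h)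

theorem Nr.trans' {k : ℕ} {X Y Z : Matrix ι κ R} (h : Nr ν c k X Y) (h' : Nr ν c k Y Z) :
    Nr ν c (k + 1) X Z := by
  rw [Nr, ← sub_add_sub_cancel X Y Z]
  refine (ν.add_le _ _).trans ((add_le_add h h').trans ?_)
  rw [← add_mul]
  exact mul_le_mul_of_nonneg_right (c.two_mul_pow k) c.δ_pos.le

theorem Nr.trans {k l : ℕ} {X Y Z : Matrix ι κ R} (h : Nr ν c k X Y) (h' : Nr ν c l Y Z) :
    Nr ν c (max k l + 1) X Z :=
  (h.mono (le_max_left _ _)).trans' (h'.mono (le_max_right _ _))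

theorem Nr.mul_left {k l : ℕ} {X : Matrix ι κ R} {Y Y' : Matrix κ η R} (hX : Ctl ν c S k X)
    (h : Nr ν c l Y Y') : Nr ν c (k + l) (X * Y) (X * Y') := by
  rw [Nr, ← Matrix.mul_sub, pow_add, mul_assoc]
  exact (ν.mul_le _ _).trans (mul_le_mul hX.bd h (ν.nonneg _) (c.pow_pos _).le)

theorem Nr.mul_right {k l : ℕ} {X X' : Matrix ι κ R} {Y : Matrix κ η R} (h : Nr ν c l X X')
    (hY : Ctl ν c S k Y) : Nr ν c (l + k) (X * Y) (X' * Y) := by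
  rw [Nr, ← Matrix.sub_mul, pow_add, mul_right_comm]
  exact (ν.mul_le _ _).trans (mul_le_mul h hY.bd (ν.nonneg _)
    (mul_pos (c.pow_pos _) c.δ_pos).le)

/-- Telescoping: XY - X'Y' = X(Y - Y') + (X - X')Y', so bounds are needed for X and Y' only. -/
theorem Nr.mul {k l a b : ℕ} {X X' : Matrix ι κ R} {Y Y' : Matrix κ η R} (h : Nr ν c k X X')
    (h' : Nr ν c l Y Y') (hX : Ctl ν c S a X) (hY : Ctl ν c S b Y') :
    Nr ν c (max (a + l) (k + b) + 1) (X * Y) (X' * Y') :=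
  (h'.mul_left hX).trans (h.mul_right hY)

theorem Nr.submatrix {k : ℕ} {X Y : Matrix ι κ R} (h : Nr ν c k X Y) {f : ι' → ι} {g : κ' → κ}
    (hf : f.Injective) (hg : g.Injective) : Nr ν c k (X.submatrix f g) (Y.submatrix f g) :=
  (ν.submatrix_le (X - Y) f g hf hg).trans h

theorem Nr.reindex {k : ℕ} {X Y : Matrix ι κ R} (h : Nr ν c k X Y) (f : ι' ≃ ι) (g : κ' ≃ κ) :
    Nr ν c k (X.submatrix f g) (Y.submatrix f g) := h.submatrix f.injective g.injective

theorem Nr.diag {k : ℕ} {X X' : Matrix ι κ R} {Y Y' : Matrix ι' κ' R} (h : Nr ν c k X X')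
    (h' : Nr ν c k Y Y') :
    Nr ν c k (Matrix.fromBlocks X 0 0 Y) (Matrix.fromBlocks X' 0 0 Y') := by
  have : Matrix.fromBlocks X 0 0 Y - Matrix.fromBlocks X' 0 0 Y' =
      Matrix.fromBlocks (X - X') 0 0 (Y - Y') := by ext (i | i) (j | j) <;> simp
  rw [Nr, this]
  exact (ν.diag_le _ _).trans (max_le h h')

theorem Nr.blocks {k : ℕ} {A A' : Matrix ι κ R} {B B' : Matrix ι κ' R} {C C' : Matrix ι' κ R}
    {D D' : Matrix ι' κ' R} (hA : Nr ν c k A A') (hB : Nr ν c k B B') (hC : Nr ν c k C C')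
    (hD : Nr ν c k D D') :
    Nr ν c (k + 1) (Matrix.fromBlocks A B C D) (Matrix.fromBlocks A' B' C' D') := by
  have : Matrix.fromBlocks A B C D - Matrix.fromBlocks A' B' C' D' =
      Matrix.fromBlocks (A - A') 0 0 (D - D') + Matrix.fromBlocks 0 (B - B') (C - C') 0 := by
    ext (i | i) (j | j) <;> simp
  rw [Nr, this]
  refine (ν.add_le _ _).trans ((add_le_add ((ν.diag_le _ _).trans (max_le hA hD))
    ((ν.offDiag_le _ _).trans (max_le hB hC))).trans ?_)
  rw [← add_mul]
  exact mul_le_mul_of_nonneg_right (c.two_mul_pow k) c.δ_pos.le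

theorem Nr.blockDiagonal {o : Type} [Fintype o] [DecidableEq o] {k : ℕ}
    {X Y : o → Matrix ι κ R} (h : ∀ j, Nr ν c k (X j) (Y j)) :
    Nr ν c k (Matrix.blockDiagonal X) (Matrix.blockDiagonal Y) := by
  rw [Nr, ← Matrix.blockDiagonal_sub]
  exact ν.blockDiagonal_le _ _ (mul_pos (c.pow_pos k) c.δ_pos).le h

end calculus


/-! ### Cycles and homotopies over arbitrary finite index sets -/

/-- The matrix norms and the propagation subspaces of square matrices. -/
def MNorm.toMatFilt {R : Type*} [Ring R] [Algebra ℂ R] [TopologicalSpace R] (ν : MNorm R)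
    (S : ℝ →o Submodule ℂ R) : MatFilt R := ⟨fun a => ν.nrm a, S⟩

section homotopy

variable {R : Type*} [Ring R] [Algebra ℂ R] [TopologicalSpace R] (ν : MNorm R)
  (S : ℝ →o Submodule ℂ R)

/-- Quasi-idempotents indexed by an arbitrary finite type. -/
def QI (q : Param) {ι : Type} [Fintype ι] [DecidableEq ι] (e : Matrix ι ι R) : Prop :=
  (∀ i j, e i j ∈ S q.r) ∧ ν.nrm (e * e - e) < q.ε ∧ ν.nrm e ≤ q.N ∧ ν.nrm (1 - e) ≤ q.N

/-- Quasi-inverse pairs indexed by an arbitrary finite type. -/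
def QP (q : Param) {ι : Type} [Fintype ι] [DecidableEq ι] (u v : Matrix ι ι R) : Prop :=
  (∀ i j, u i j ∈ S q.r) ∧ (∀ i j, v i j ∈ S q.r) ∧ ν.nrm u ≤ q.N ∧ ν.nrm v ≤ q.N ∧
    ν.nrm (u * v - 1) < q.ε ∧ ν.nrm (v * u - 1) < q.ε

/-- Cycles indexed by an arbitrary finite type. -/
def Cy (i : Fin 2) (q : Param) {ι : Type} [Fintype ι] [DecidableEq ι] (a : Matrix ι ι R) : Prop :=
  if i = 0 then QI ν S q a else ∃ b, QP ν S q a b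

/-- Homotopy of cycles indexed by an arbitrary finite type. -/
def HT (i : Fin 2) (q : Param) {ι : Type} [Fintype ι] [DecidableEq ι] (a b : Matrix ι ι R) :
    Prop :=
  if i = 0 then JoinedIn {x : Matrix ι ι R | QI ν S q x} a b
  else ∃ v₀ v₁ : Matrix ι ι R,
    JoinedIn {x : Matrix ι ι R × Matrix ι ι R | QP ν S q x.1 x.2} (a, v₀) (b, v₁)

/-- The matrix used for stabilization: `0` in degree `0` and `1` in degree `1`. -/
def dm (R : Type*) [Ring R] (i : Fin 2) (α : Type) [DecidableEq α] : Matrix α α R :=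
  if i = 0 then 0 else 1

/-- The parameters of the homotopies in the definition of the quantitative `K`-groups. -/
def four (i : Fin 2) (q : Param) : Param := ⟨4 * q.ε, if i = 0 then q.r else 2 * q.r, 4 * q.N⟩

/-- Stable homotopy, up to a bijection of the index sets. -/
def SH (i : Fin 2) (q : Param) {ι κ : Type} [Fintype ι] [DecidableEq ι] [Fintype κ]
    [DecidableEq κ] (a : Matrix ι ι R) (b : Matrix κ κ R) : Prop :=
  ∃ (l l' : ℕ) (τ : ι ⊕ Fin l ≃ κ ⊕ Fin l'),
    HT ν S i (four i q) (Matrix.fromBlocks a 0 0 (dm R i (Fin l)))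
      ((Matrix.fromBlocks b 0 0 (dm R i (Fin l'))).submatrix τ τ)

variable {ν S}
variable {i : Fin 2} {q q' : Param} {ι κ η : Type} [Fintype ι] [DecidableEq ι] [Fintype κ]
  [DecidableEq κ] [Fintype η] [DecidableEq η]

theorem le_four (hε : 0 ≤ q.ε) (hr : 0 ≤ q.r) (hN : 0 ≤ q.N) (i : Fin 2) : q ≤ four i q := by
  refine ⟨?_, ?_, ?_⟩
  · change q.ε ≤ 4 * q.ε; linarith
  · change q.r ≤ if i = 0 then q.r else 2 * q.r; split_ifs <;> linarith
  · change q.N ≤ 4 * q.N; linarith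

theorem QI.mono {e : Matrix ι ι R} (h : QI ν S q e) (hq : q ≤ q') : QI ν S q' e :=
  ⟨fun i j => S.monotone hq.2.1 (h.1 i j), h.2.1.trans_le hq.1, h.2.2.1.trans hq.2.2,
    h.2.2.2.trans hq.2.2⟩

theorem QP.mono {u v : Matrix ι ι R} (h : QP ν S q u v) (hq : q ≤ q') : QP ν S q' u v :=
  ⟨fun i j => S.monotone hq.2.1 (h.1 i j), fun i j => S.monotone hq.2.1 (h.2.1 i j),
    h.2.2.1.trans hq.2.2, h.2.2.2.1.trans hq.2.2, h.2.2.2.2.1.trans_le hq.1,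
    h.2.2.2.2.2.trans_le hq.1⟩

theorem Cy.mono {a : Matrix ι ι R} (h : Cy ν S i q a) (hq : q ≤ q') : Cy ν S i q' a := by
  unfold Cy at *
  split_ifs at * with hi
  · exact QI.mono h hq
  · obtain ⟨b, hb⟩ := h
    exact ⟨b, hb.mono hq⟩

theorem reindex_sub {ι' κ' : Type} (X Y : Matrix ι κ R) (f : ι' → ι) (g : κ' → κ) :
    X.submatrix f g - Y.submatrix f g = (X - Y).submatrix f g := rfl

theorem QI.reindex {e : Matrix ι ι R} (h : QI ν S q e) (f : κ ≃ ι) :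
    QI ν S q (e.submatrix f f) := by
  refine ⟨fun i j => h.1 _ _, ?_, ?_, ?_⟩
  · rw [Matrix.submatrix_mul_equiv, reindex_sub, ν.reindex]; exact h.2.1
  · rw [ν.reindex]; exact h.2.2.1
  · rw [← Matrix.submatrix_one_equiv f, reindex_sub, ν.reindex]; exact h.2.2.2

theorem QP.reindex {u v : Matrix ι ι R} (h : QP ν S q u v) (f : κ ≃ ι) :
    QP ν S q (u.submatrix f f) (v.submatrix f f) := by
  refine ⟨fun i j => h.1 _ _, fun i j => h.2.1 _ _, ?_, ?_, ?_, ?_⟩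
  · rw [ν.reindex]; exact h.2.2.1
  · rw [ν.reindex]; exact h.2.2.2.1
  · rw [Matrix.submatrix_mul_equiv, ← Matrix.submatrix_one_equiv f, reindex_sub,
      ν.reindex]
    exact h.2.2.2.2.1
  · rw [Matrix.submatrix_mul_equiv, ← Matrix.submatrix_one_equiv f, reindex_sub,
      ν.reindex]
    exact h.2.2.2.2.2

theorem Cy.reindex {a : Matrix ι ι R} (h : Cy ν S i q a) (f : κ ≃ ι) :
    Cy ν S i q (a.submatrix f f) := by
  unfold Cy at *
  split_ifs at * with hi
  · exact h.reindex f
  · obtain ⟨b, hb⟩ := h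
    exact ⟨_, hb.reindex f⟩

theorem blocks_mem {a : Matrix ι ι R} {b : Matrix κ κ R} {r : ℝ} (ha : ∀ i j, a i j ∈ S r)
    (hb : ∀ i j, b i j ∈ S r) : ∀ i j, Matrix.fromBlocks a 0 0 b i j ∈ S r := by
  rintro (i | i) (j | j)
  exacts [ha i j, Submodule.zero_mem _, Submodule.zero_mem _, hb i j]

theorem blocks_sub_one (a : Matrix ι ι R) (b : Matrix κ κ R) :
    Matrix.fromBlocks a 0 0 b - 1 = Matrix.fromBlocks (a - 1) 0 0 (b - 1) := by
  rw [← Matrix.fromBlocks_one]; ext (i | i) (j | j) <;> simp [Matrix.one_apply]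

theorem one_sub_blocks (a : Matrix ι ι R) (b : Matrix κ κ R) :
    1 - Matrix.fromBlocks a 0 0 b = Matrix.fromBlocks (1 - a) 0 0 (1 - b) := by
  rw [← Matrix.fromBlocks_one]; ext (i | i) (j | j) <;> simp [Matrix.one_apply]

theorem blocks_mul_blocks (a a' : Matrix ι ι R) (b b' : Matrix κ κ R) :
    Matrix.fromBlocks a 0 0 b * Matrix.fromBlocks a' 0 0 b' =
      Matrix.fromBlocks (a * a') 0 0 (b * b') := by
  simp [Matrix.fromBlocks_multiply]

theorem QI.diag {e : Matrix ι ι R} {f : Matrix κ κ R} (he : QI ν S q e) (hf : QI ν S q f) :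
    QI ν S q (Matrix.fromBlocks e 0 0 f) := by
  refine ⟨blocks_mem he.1 hf.1, ?_, (ν.diag_le _ _).trans (max_le he.2.2.1 hf.2.2.1), ?_⟩
  · rw [blocks_mul_blocks]
    have : Matrix.fromBlocks (e * e) 0 0 (f * f) - Matrix.fromBlocks e 0 0 f =
        Matrix.fromBlocks (e * e - e) 0 0 (f * f - f) := by ext (i | i) (j | j) <;> simp
    rw [this]
    exact (ν.diag_le _ _).trans_lt (max_lt he.2.1 hf.2.1)
  · rw [one_sub_blocks]
    exact (ν.diag_le _ _).trans (max_le he.2.2.2 hf.2.2.2)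

theorem QP.diag {u v : Matrix ι ι R} {u' v' : Matrix κ κ R} (h : QP ν S q u v)
    (h' : QP ν S q u' v') :
    QP ν S q (Matrix.fromBlocks u 0 0 u') (Matrix.fromBlocks v 0 0 v') := by
  refine ⟨blocks_mem h.1 h'.1, blocks_mem h.2.1 h'.2.1,
    (ν.diag_le _ _).trans (max_le h.2.2.1 h'.2.2.1),
    (ν.diag_le _ _).trans (max_le h.2.2.2.1 h'.2.2.2.1), ?_, ?_⟩
  · rw [blocks_mul_blocks, blocks_sub_one]
    exact (ν.diag_le _ _).trans_lt (max_lt h.2.2.2.2.1 h'.2.2.2.2.1)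
  · rw [blocks_mul_blocks, blocks_sub_one]
    exact (ν.diag_le _ _).trans_lt (max_lt h.2.2.2.2.2 h'.2.2.2.2.2)

theorem Cy.diag {a : Matrix ι ι R} {b : Matrix κ κ R} (h : Cy ν S i q a) (h' : Cy ν S i q b) :
    Cy ν S i q (Matrix.fromBlocks a 0 0 b) := by
  unfold Cy at *
  split_ifs at * with hi
  · exact h.diag h'
  · obtain ⟨v, hv⟩ := h
    obtain ⟨v', hv'⟩ := h'
    exact ⟨_, hv.diag hv'⟩

theorem Cy.dm (hS : IsFilt S) (hε : 0 < q.ε) (hN : 1 ≤ q.N) : Cy ν S i q (dm R i ι) := by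
  have h1 : ν.nrm (1 : Matrix ι ι R) ≤ q.N := ν.one_le.trans hN
  unfold Cy QuantK.dm
  split_ifs with hi
  · refine ⟨fun i j => Submodule.zero_mem _, ?_, ?_, ?_⟩
    · rw [mul_zero, sub_zero, ν.zero]; exact hε
    · rw [ν.zero]; linarith
    · rwa [sub_zero]
  · have hm : ∀ i j, (1 : Matrix ι ι R) i j ∈ S q.r := fun i j => by
      rw [Matrix.one_apply]; split_ifs
      exacts [hS.one_mem _, Submodule.zero_mem _]
    refine ⟨1, hm, hm, h1, h1, ?_, ?_⟩ <;> rw [mul_one, sub_self, ν.zero] <;> exact hε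

theorem HT.mono {a b : Matrix ι ι R} (h : HT ν S i q a b) (hq : q ≤ q') : HT ν S i q' a b := by
  unfold HT at *
  split_ifs at * with hi
  · exact JoinedIn.mono h fun x hx => QI.mono hx hq
  · obtain ⟨v₀, v₁, h⟩ := h
    exact ⟨v₀, v₁, JoinedIn.mono h fun x hx => QP.mono hx hq⟩

theorem HT.refl {a : Matrix ι ι R} (h : Cy ν S i q a) : HT ν S i q a a := by
  unfold HT Cy at *
  split_ifs at * with hi
  · exact JoinedIn.refl h
  · obtain ⟨b, hb⟩ := h
    exact ⟨b, b, JoinedIn.refl hb⟩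

theorem HT.symm {a b : Matrix ι ι R} (h : HT ν S i q a b) : HT ν S i q b a := by
  unfold HT at *
  split_ifs at * with hi
  · exact JoinedIn.symm h
  · obtain ⟨v₀, v₁, h⟩ := h
    exact ⟨v₁, v₀, h.symm⟩

/-- Convex combinations have bounded norm. -/
theorem MNorm.line_le (ν : MNorm R) {X Y : Matrix ι κ R} {C : ℝ} (hX : ν.nrm X ≤ C)
    (hY : ν.nrm Y ≤ C) {t : ℝ} (ht : t ∈ Set.Icc (0 : ℝ) 1) :
    ν.nrm (((1 - t : ℝ) : ℂ) • X + (t : ℂ) • Y) ≤ C := by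
  have h0 : ‖((1 - t : ℝ) : ℂ)‖ = 1 - t := by
    rw [Complex.norm_real, Real.norm_of_nonneg (by linarith [ht.2])]
  have h1 : ‖(t : ℂ)‖ = t := by rw [Complex.norm_real, Real.norm_of_nonneg ht.1]
  refine (ν.add_le _ _).trans ((add_le_add (ν.smul_le _ _) (ν.smul_le _ _)).trans ?_)
  rw [h0, h1]
  nlinarith [ht.1, ht.2, ν.nonneg X, ν.nonneg Y]

theorem MNorm.line_lt (ν : MNorm R) {X Y : Matrix ι κ R} {C : ℝ} (hX : ν.nrm X < C)
    (hY : ν.nrm Y < C) {t : ℝ} (ht : t ∈ Set.Icc (0 : ℝ) 1) :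
    ν.nrm (((1 - t : ℝ) : ℂ) • X + (t : ℂ) • Y) < C :=
  (ν.line_le (le_max_left _ _) (le_max_right _ _) ht).trans_lt (max_lt hX hY)

section top

variable [IsTopologicalRing R] [ContinuousSMul ℂ R]

/-- For fixed u the conditions on an approximate inverse are convex in v. This allows homotopies to
be concatenated although their paths of inverses do not match at the common endpoint. -/
theorem QP.joined_right {u v v' : Matrix ι ι R} (h : QP ν S q u v) (h' : QP ν S q u v') :
    JoinedIn {x : Matrix ι ι R × Matrix ι ι R | QP ν S q x.1 x.2} (u, v) (u, v') := by
  refine JoinedIn.ofLine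
    (f := fun t : ℝ => (u, ((1 - t : ℝ) : ℂ) • v + (t : ℂ) • v')) (by fun_prop) (by simp)
    (by simp) ?_
  rintro _ ⟨t, ht, rfl⟩
  have e1 : u * (((1 - t : ℝ) : ℂ) • v + (t : ℂ) • v') - 1 =
      ((1 - t : ℝ) : ℂ) • (u * v - 1) + (t : ℂ) • (u * v' - 1) := by
    rw [mul_add, Matrix.mul_smul, Matrix.mul_smul]; push_cast; module
  have e2 : (((1 - t : ℝ) : ℂ) • v + (t : ℂ) • v') * u - 1 =
      ((1 - t : ℝ) : ℂ) • (v * u - 1) + (t : ℂ) • (v' * u - 1) := by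
    rw [add_mul, Matrix.smul_mul, Matrix.smul_mul]; push_cast; module
  refine ⟨h.1, fun i j => ?_, h.2.2.1, ν.line_le h.2.2.2.1 h'.2.2.2.1 ht, ?_, ?_⟩
  · exact Submodule.add_mem _ (Submodule.smul_mem _ _ (h.2.1 i j))
      (Submodule.smul_mem _ _ (h'.2.1 i j))
  · rw [e1]; exact ν.line_lt h.2.2.2.2.1 h'.2.2.2.2.1 ht
  · rw [e2]; exact ν.line_lt h.2.2.2.2.2 h'.2.2.2.2.2 ht

theorem HT.trans {a b d : Matrix ι ι R} (h : HT ν S i q a b) (h' : HT ν S i q b d) :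
    HT ν S i q a d := by
  unfold HT at *
  split_ifs at * with hi
  · exact JoinedIn.trans h h'
  · obtain ⟨v₀, v₁, h⟩ := h
    obtain ⟨w₀, w₁, h'⟩ := h'
    -- The first homotopy ends with one approximate inverse of b and the second starts with another;
    -- a segment joins them.
    exact ⟨v₀, w₁, (h.trans (QP.joined_right h.target_mem h'.source_mem)).trans h'⟩

/-- Cycles and their inverses may need different maps: padding by d on the one corresponds to
padding by an inverse of d on the other. -/
theorem HT.map {a b : Matrix ι ι R} (h : HT ν S i q a b) (Φ : Matrix ι ι R → Matrix κ κ R)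
    (Ψ : Matrix ι ι R → Matrix κ κ R) (hΦ : Continuous Φ) (hΨ : Continuous Ψ)
    (h0 : i = 0 → ∀ x, QI ν S q x → QI ν S q' (Φ x))
    (h1 : i ≠ 0 → ∀ x y, QP ν S q x y → QP ν S q' (Φ x) (Ψ y)) :
    HT ν S i q' (Φ a) (Φ b) := by
  unfold HT at *
  split_ifs at * with hi
  · exact (JoinedIn.map h hΦ).mono (by rintro _ ⟨x, hx, rfl⟩; exact h0 hi x hx)
  · obtain ⟨v₀, v₁, h⟩ := h
    refine ⟨Ψ v₀, Ψ v₁, (JoinedIn.map h (hΦ.prodMap hΨ)).mono ?_⟩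
    rintro _ ⟨x, hx, rfl⟩
    exact h1 hi _ _ hx

theorem HT.reindex {a b : Matrix ι ι R} (h : HT ν S i q a b) (f : κ ≃ ι) :
    HT ν S i q (a.submatrix f f) (b.submatrix f f) :=
  h.map (fun x => x.submatrix f f) (fun x => x.submatrix f f)
    (continuous_id.matrix_submatrix _ _) (continuous_id.matrix_submatrix _ _)
    (fun _ _ hx => hx.reindex f) (fun _ _ _ hx => hx.reindex f)

theorem HT.diag_right {a b : Matrix ι ι R} (h : HT ν S i q a b) {d : Matrix κ κ R}
    (hd : Cy ν S i q d) :
    HT ν S i q (Matrix.fromBlocks a 0 0 d) (Matrix.fromBlocks b 0 0 d) := by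
  by_cases hi : i = 0
  · refine h.map (fun x => Matrix.fromBlocks x 0 0 d) (fun _ => 0) (by fun_prop)
      continuous_const
      (fun _ x hx => hx.diag (by simpa [Cy, hi] using hd)) (fun h => absurd hi h)
  · obtain ⟨d', hd'⟩ : ∃ d', QP ν S q d d' := by simpa [Cy, hi] using hd
    exact h.map (fun x => Matrix.fromBlocks x 0 0 d) (fun x => Matrix.fromBlocks x 0 0 d')
      (by fun_prop) (by fun_prop) (fun h => absurd h hi) (fun _ x y hx => hx.diag hd')

theorem blocks_swap (a : Matrix ι ι R) (b : Matrix κ κ R) :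
    (Matrix.fromBlocks a 0 0 b).submatrix (Equiv.sumComm κ ι) (Equiv.sumComm κ ι) =
      Matrix.fromBlocks b 0 0 a := by
  ext (i | i) (j | j) <;> simp

/-- The entries of `X` are scalars. -/
def Sc (X : Matrix ι κ R) : Prop := ∀ i j, ∃ z : ℂ, X i j = algebraMap ℂ R z

theorem Sc.mul_mem {X : Matrix ι κ R} {Y : Matrix κ η R} (hX : Sc X) {r : ℝ}
    (hY : ∀ i j, Y i j ∈ S r) (i : ι) (j : η) : (X * Y) i j ∈ S r := by
  rw [Matrix.mul_apply]
  refine Submodule.sum_mem _ fun m _ => ?_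
  obtain ⟨z, hz⟩ := hX i m
  rw [hz, ← Algebra.smul_def]
  exact Submodule.smul_mem _ _ (hY m j)

theorem Sc.mem_mul {X : Matrix κ η R} {Y : Matrix ι κ R} (hX : Sc X) {r : ℝ}
    (hY : ∀ i j, Y i j ∈ S r) (i : ι) (j : η) : (Y * X) i j ∈ S r := by
  rw [Matrix.mul_apply]
  refine Submodule.sum_mem _ fun m _ => ?_
  obtain ⟨z, hz⟩ := hX m j
  rw [hz, ← Algebra.commutes, ← Algebra.smul_def]
  exact Submodule.smul_mem _ _ (hY i m)

theorem MNorm.conj_le (ν : MNorm R) {X : Matrix ι κ R} {X' : Matrix κ ι R}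
    (h : ν.nrm X * ν.nrm X' ≤ 2) (Y : Matrix κ κ R) : ν.nrm (X * Y * X') ≤ 2 * ν.nrm Y := by
  refine (ν.mul_le _ _).trans ((mul_le_mul_of_nonneg_right (ν.mul_le _ _) (ν.nonneg _)).trans ?_)
  nlinarith [ν.nonneg Y, ν.nonneg X, ν.nonneg X']

/-- Scalar matrices do not increase propagation, and ‖X‖‖X⁻¹‖ ≤ 2 multiplies norms and errors by at
most 2, well within the factor 4 that the homotopy relation allows. -/
theorem QI.conj {X X' : Matrix ι ι R} (hX : Sc X) (hX' : Sc X') (h : X * X' = 1)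
    (h' : X' * X = 1) (hn : ν.nrm X * ν.nrm X' ≤ 2) {e : Matrix ι ι R} (he : QI ν S q e) :
    QI ν S ⟨4 * q.ε, q.r, 4 * q.N⟩ (X * e * X') := by
  have hε : 0 < q.ε := (ν.nonneg _).trans_lt he.2.1
  have hN : 0 ≤ q.N := (ν.nonneg _).trans he.2.2.1
  have e1 : X * e * X' * (X * e * X') - X * e * X' = X * (e * e - e) * X' := by
    rw [show X * e * X' * (X * e * X') = X * e * (X' * X) * e * X' by simp only [mul_assoc], h']
    noncomm_ring
  have e2 : 1 - X * e * X' = X * (1 - e) * X' := by rw [mul_sub, sub_mul, mul_one, h]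
  refine ⟨hX'.mem_mul (hX.mul_mem he.1), ?_, ?_, ?_⟩
  · rw [e1]
    change _ < 4 * q.ε
    linarith [ν.conj_le hn (e * e - e), he.2.1]
  · change _ ≤ 4 * q.N
    linarith [ν.conj_le hn e, he.2.2.1]
  · rw [e2]
    change _ ≤ 4 * q.N
    linarith [ν.conj_le hn (1 - e), he.2.2.2]

theorem QP.conj {X X' : Matrix ι ι R} (hX : Sc X) (hX' : Sc X') (h : X * X' = 1)
    (h' : X' * X = 1) (hn : ν.nrm X * ν.nrm X' ≤ 2) (hr : 0 ≤ q.r) {u v : Matrix ι ι R}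
    (huv : QP ν S q u v) :
    QP ν S ⟨4 * q.ε, 2 * q.r, 4 * q.N⟩ (X * u * X') (X * v * X') := by
  have hε : 0 < q.ε := (ν.nonneg _).trans_lt huv.2.2.2.2.1
  have hN : 0 ≤ q.N := (ν.nonneg _).trans huv.2.2.1
  have hr' : q.r ≤ 2 * q.r := by linarith
  have e1 : ∀ a b : Matrix ι ι R, X * a * X' * (X * b * X') - 1 = X * (a * b - 1) * X' := by
    intro a b
    rw [show X * a * X' * (X * b * X') = X * a * (X' * X) * b * X' by simp only [mul_assoc], h',
      mul_one, mul_sub, sub_mul, mul_one, h, mul_assoc X a b]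
  refine ⟨hX'.mem_mul (hX.mul_mem fun i j => S.monotone hr' (huv.1 i j)),
    hX'.mem_mul (hX.mul_mem fun i j => S.monotone hr' (huv.2.1 i j)), ?_, ?_, ?_, ?_⟩
  · change _ ≤ 4 * q.N
    linarith [ν.conj_le hn u, huv.2.2.1]
  · change _ ≤ 4 * q.N
    linarith [ν.conj_le hn v, huv.2.2.2.1]
  · rw [e1]
    change _ < 4 * q.ε
    linarith [ν.conj_le hn (u * v - 1), huv.2.2.2.2.1]
  · rw [e1]
    change _ < 4 * q.ε
    linarith [ν.conj_le hn (v * u - 1), huv.2.2.2.2.2]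

/-- The rotation `[[c, -s σ⁻¹], [s σ, c]]`. -/
def rot (R : Type*) [Ring R] [Algebra ℂ R] {ι κ : Type} [DecidableEq ι] [DecidableEq κ]
    (σ : κ ≃ ι) (c s : ℂ) : Matrix (ι ⊕ κ) (ι ⊕ κ) R :=
  Matrix.fromBlocks (c • 1) (-(s • (1 : Matrix ι ι R).submatrix id σ))
    (s • (1 : Matrix ι ι R).submatrix σ id) (c • 1)

theorem rot_sc (σ : κ ≃ ι) (c s : ℂ) : Sc (rot R σ c s) := by
  have h1 : ∀ (z : ℂ) (P : Prop) [Decidable P], ∃ w : ℂ, z • (if P then (1 : R) else 0) =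
      algebraMap ℂ R w := fun z P _ => by
    split_ifs
    · exact ⟨z, by rw [Algebra.algebraMap_eq_smul_one]⟩
    · exact ⟨0, by simp⟩
  rintro (i | i) (j | j)
  · simpa [rot, Matrix.one_apply] using h1 c (i = j)
  · obtain ⟨w, hw⟩ := h1 s (i = σ j)
    exact ⟨-w, by rw [map_neg, ← hw]; simp [rot, Matrix.one_apply]⟩
  · simpa [rot, Matrix.one_apply] using h1 s (σ i = j)
  · simpa [rot, Matrix.one_apply] using h1 c (i = j)

theorem rot_mul (σ : κ ≃ ι) {c s : ℂ} (h : c * c + s * s = 1) :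
    rot R σ c s * rot R σ c (-s) = 1 := by
  have h1 : (1 : Matrix ι ι R).submatrix id σ * (1 : Matrix ι ι R).submatrix σ id = 1 := by
    rw [Matrix.submatrix_mul_equiv]; simp
  have h2 : (1 : Matrix ι ι R).submatrix σ id * (1 : Matrix ι ι R).submatrix id σ = 1 := by
    rw [← Matrix.submatrix_mul _ _ _ _ _ Function.bijective_id]; simp
  rw [rot, rot, Matrix.fromBlocks_multiply, ← Matrix.fromBlocks_one]
  simp only [neg_smul, neg_neg, Matrix.smul_mul, Matrix.mul_smul, Matrix.mul_one, Matrix.one_mul,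
    neg_mul, mul_neg, Matrix.neg_mul, Matrix.mul_neg, h1, h2, smul_smul, ← add_smul, h, one_smul]
  congr 1
  · trans (c * c + s * s) • (1 : Matrix ι ι R)
    · module
    · rw [h, one_smul]
  · module
  · module
  · trans (c * c + s * s) • (1 : Matrix κ κ R)
    · module
    · rw [h, one_smul]

/-- The rotation is c times the identity plus s times an off-diagonal matrix of norm at most 1. For
p ≠ 2 rotations are not isometric, and this crude bound replaces unitarity. -/
theorem rot_le (ν : MNorm R) (σ : κ ≃ ι) (c s : ℂ) : ν.nrm (rot R σ c s) ≤ ‖c‖ + ‖s‖ := by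
  have h1 : rot R σ c s = c • (1 : Matrix (ι ⊕ κ) (ι ⊕ κ) R) +
      s • Matrix.fromBlocks 0 (-(1 : Matrix ι ι R).submatrix id σ)
        ((1 : Matrix ι ι R).submatrix σ id) 0 := by
    rw [rot, ← Matrix.fromBlocks_one, Matrix.fromBlocks_smul, Matrix.fromBlocks_smul,
      Matrix.fromBlocks_add]
    simp
  rw [h1]
  refine (ν.add_le _ _).trans (add_le_add ((ν.smul_le _ _).trans
    (mul_le_of_le_one_right (norm_nonneg _) ν.one_le)) ((ν.smul_le _ _).trans
    (mul_le_of_le_one_right (norm_nonneg _) ((ν.offDiag_le _ _).trans (max_le ?_ ?_)))))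
  · rw [ν.neg]
    exact (ν.submatrix_le _ _ _ Function.injective_id σ.injective).trans ν.one_le
  · exact (ν.submatrix_le _ _ _ σ.injective Function.injective_id).trans ν.one_le

/-- A cycle is homotopic to any reindexing of it, after stabilization. -/
theorem Cy.rotate {a : Matrix ι ι R} (ha : Cy ν S i q a) (hS : IsFilt S) (hε : 0 < q.ε)
    (hr : 0 ≤ q.r) (hN : 1 ≤ q.N) (σ : κ ≃ ι) :
    HT ν S i (four i q) (Matrix.fromBlocks a 0 0 (QuantK.dm R i κ))
      (Matrix.fromBlocks (QuantK.dm R i ι) 0 0 (a.submatrix σ σ)) := by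
  set co : ℝ → ℂ := fun t => ((Real.cos (t * (Real.pi / 2)) : ℝ) : ℂ)
  set si : ℝ → ℂ := fun t => ((Real.sin (t * (Real.pi / 2)) : ℝ) : ℂ)
  have hco : Continuous co := by fun_prop
  have hsi : Continuous si := by fun_prop
  have hcs : ∀ t, co t * co t + si t * si t = 1 := fun t => by
    simp only [co, si]; norm_cast
    nlinarith [Real.sin_sq_add_cos_sq (t * (Real.pi / 2))]
  have hcs' : ∀ t, co t * co t + -si t * -si t = 1 := fun t => by rw [neg_mul_neg, hcs]
  have hR : ∀ t, rot R σ (co t) (si t) * rot R σ (co t) (-si t) = 1 := fun t => rot_mul σ (hcs t)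
  have hR' : ∀ t, rot R σ (co t) (-si t) * rot R σ (co t) (si t) = 1 := fun t => by
    simpa using rot_mul (R := R) σ (hcs' t)
  -- (|c| + |s|)² ≤ 2(|c|² + |s|²) = 2.
  have hn : ∀ t, ν.nrm (rot R σ (co t) (si t)) * ν.nrm (rot R σ (co t) (-si t)) ≤ 2 := fun t => by
    have h1 := rot_le ν σ (co t) (si t)
    have h2 := rot_le ν σ (co t) (-si t)
    rw [norm_neg] at h2
    have h3 : ‖co t‖ ^ 2 + ‖si t‖ ^ 2 = 1 := by
      simp only [co, si, Complex.norm_real, Real.norm_eq_abs, sq_abs]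
      rw [add_comm, Real.sin_sq_add_cos_sq]
    nlinarith [ν.nonneg (rot R σ (co t) (si t)), ν.nonneg (rot R σ (co t) (-si t)),
      norm_nonneg (co t), norm_nonneg (si t), sq_nonneg (‖co t‖ - ‖si t‖),
      mul_le_mul h1 h2 (ν.nonneg _) (by positivity)]
  have hc0 : ∀ f : ℝ → ℂ, Continuous f → Continuous fun t => rot R σ (co t) (f t) :=
    fun f hf => by unfold rot; fun_prop
  have hcr := hc0 si hsi
  have hcr' := hc0 (fun t => -si t) hsi.neg
  have h0 : ∀ x : Matrix (ι ⊕ κ) (ι ⊕ κ) R,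
      rot R σ (co 0) (si 0) * x * rot R σ (co 0) (-si 0) = x := fun x => by
    have : ∀ s : ℂ, s = 0 → rot R σ (co 0) s = 1 := fun s hs => by
      simp [rot, co, hs]
    rw [this _ (by simp [si]), this _ (by simp [si]), one_mul, mul_one]
  have h1 : ∀ (x : Matrix ι ι R) (y : Matrix ι ι R), rot R σ (co 1) (si 1) *
      Matrix.fromBlocks x 0 0 (y.submatrix σ σ) * rot R σ (co 1) (-si 1) =
      Matrix.fromBlocks y 0 0 (x.submatrix σ σ) := fun x y => by
    have hc1 : co 1 = 0 := by simp [co]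
    have hs1 : si 1 = 1 := by simp [si]
    have l1 : ∀ z : Matrix ι ι R,
        (1 : Matrix ι ι R).submatrix σ id * z = z.submatrix σ id := fun z => by
      simpa using Matrix.one_submatrix_mul σ (Equiv.refl ι) z
    have l2 : ∀ z : Matrix κ ι R, z * (1 : Matrix ι ι R).submatrix id σ = z.submatrix id σ :=
      fun z => by
        simpa using Matrix.mul_submatrix_one (Equiv.refl ι) σ z
    have l3 : (1 : Matrix ι ι R).submatrix id σ * y.submatrix σ σ *
        (1 : Matrix ι ι R).submatrix σ id = y := by
      rw [Matrix.submatrix_mul_equiv, Matrix.submatrix_mul_equiv]; simp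
    simp [rot, hc1, hs1, Matrix.fromBlocks_multiply, l1, l2, l3, Matrix.submatrix_submatrix]
  have hdm : ((QuantK.dm R i ι).submatrix σ σ : Matrix κ κ R) = QuantK.dm R i κ := by
    unfold QuantK.dm; split_ifs <;> simp
  have hd := ha.diag (Cy.dm (ι := κ) hS hε hN)
  unfold HT Cy at *
  unfold four
  split_ifs at * with hi
  · refine JoinedIn.ofLine (f := fun t => rot R σ (co t) (si t) *
      Matrix.fromBlocks a 0 0 (QuantK.dm R i κ) * rot R σ (co t) (-si t)) (by fun_prop) (h0 _)
      (by rw [← hdm]; exact h1 _ _) ?_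
    rintro _ ⟨t, -, rfl⟩
    exact hd.conj (rot_sc _ _ _) (rot_sc _ _ _) (hR t) (hR' t) (hn t)
  · obtain ⟨w, hw⟩ := hd
    refine ⟨_, _, JoinedIn.ofLine (f := fun t => (rot R σ (co t) (si t) *
      Matrix.fromBlocks a 0 0 (QuantK.dm R i κ) * rot R σ (co t) (-si t),
      rot R σ (co t) (si t) * w * rot R σ (co t) (-si t)))
      (by fun_prop) (Prod.ext (h0 _) rfl)
      (Prod.ext (by rw [← hdm]; exact h1 _ _) rfl) ?_⟩
    rintro _ ⟨t, -, rfl⟩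
    exact hw.conj (rot_sc _ _ _) (rot_sc _ _ _) (hR t) (hR' t) (hn t) hr

end top

end homotopy


/-! ### Stable homotopy and the relation that defines the K-groups -/

/-- Admissible parameters. -/
structure Param.Good (q : Param) : Prop where
  ε_pos : 0 < q.ε
  r_nonneg : 0 ≤ q.r
  one_le : 1 ≤ q.N

theorem Param.Good.le_four {q : Param} (h : q.Good) (i : Fin 2) : q ≤ four i q :=
  QuantK.le_four h.ε_pos.le h.r_nonneg (zero_le_one.trans h.one_le) i

theorem Param.Good.four {q : Param} (h : q.Good) (i : Fin 2) : (QuantK.four i q).Good := by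
  have h0 := h.le_four i
  exact ⟨h.ε_pos.trans_le h0.1, h.r_nonneg.trans h0.2.1, h.one_le.trans h0.2.2⟩

section stable

variable {R : Type*} [Ring R] [Algebra ℂ R] [TopologicalSpace R]
  [IsTopologicalRing R] [ContinuousSMul ℂ R] {ν : MNorm R} {S : ℝ →o Submodule ℂ R}
  {i : Fin 2} {q q' : Param} {ι κ η α β : Type} [Fintype ι] [DecidableEq ι] [Fintype κ]
  [DecidableEq κ] [Fintype η] [DecidableEq η] [Fintype α] [DecidableEq α] [Fintype β]
  [DecidableEq β]

theorem blocks_reindex (a : Matrix ι ι R) (b : Matrix κ κ R) (f : α ≃ ι) (g : β ≃ κ) :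
    (Matrix.fromBlocks a 0 0 b).submatrix (Equiv.sumCongr f g) (Equiv.sumCongr f g) =
      Matrix.fromBlocks (a.submatrix f f) 0 0 (b.submatrix g g) := by
  ext (i | i) (j | j) <;> simp

theorem dm_reindex (i : Fin 2) (f : α ≃ ι) : (dm R i ι).submatrix f f = dm R i α := by
  unfold dm; split_ifs <;> simp

theorem dm_sum (i : Fin 2) : dm R i (α ⊕ β) = Matrix.fromBlocks (dm R i α) 0 0 (dm R i β) := by
  unfold dm; split_ifs <;> simp

/-- `(ι ⊕ α) ⊕ κ ≃ (ι ⊕ κ) ⊕ α`. -/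
def swapRight (ι α κ : Type) : (ι ⊕ α) ⊕ κ ≃ (ι ⊕ κ) ⊕ α :=
  (Equiv.sumAssoc ι α κ).trans
    (((Equiv.refl ι).sumCongr (Equiv.sumComm α κ)).trans (Equiv.sumAssoc ι κ α).symm)

theorem blocks_swapRight (a : Matrix ι ι R) (b : Matrix α α R) (d : Matrix κ κ R) :
    (Matrix.fromBlocks (Matrix.fromBlocks a 0 0 d) 0 0 b).submatrix
      (swapRight ι α κ) (swapRight ι α κ) =
      Matrix.fromBlocks (Matrix.fromBlocks a 0 0 b) 0 0 d := by
  ext ((i | i) | i) ((j | j) | j) <;> simp [swapRight]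

theorem blocks_assoc (a : Matrix ι ι R) (b : Matrix α α R) (d : Matrix κ κ R) :
    (Matrix.fromBlocks a 0 0 (Matrix.fromBlocks b 0 0 d)).submatrix
      (Equiv.sumAssoc ι α κ) (Equiv.sumAssoc ι α κ) =
      Matrix.fromBlocks (Matrix.fromBlocks a 0 0 b) 0 0 d := by
  ext ((i | i) | i) ((j | j) | j) <;> simp

theorem blocks_assoc' (a : Matrix ι ι R) (b : Matrix α α R) (d : Matrix κ κ R) :
    (Matrix.fromBlocks (Matrix.fromBlocks a 0 0 b) 0 0 d).submatrix
      (Equiv.sumAssoc ι α κ).symm (Equiv.sumAssoc ι α κ).symm =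
      Matrix.fromBlocks a 0 0 (Matrix.fromBlocks b 0 0 d) := by
  ext (i | i | i) (j | j | j) <;> simp

/-- The stabilizing index sets in `SH` are of the form `Fin l` only to stay clear of universe and
instance arguments; any finite type serves. -/
theorem SH.intro {a : Matrix ι ι R} {b : Matrix κ κ R} (τ : ι ⊕ α ≃ κ ⊕ β)
    (h : HT ν S i (four i q) (Matrix.fromBlocks a 0 0 (dm R i α))
      ((Matrix.fromBlocks b 0 0 (dm R i β)).submatrix τ τ)) : SH ν S i q a b := by
  let f : ι ⊕ Fin (Fintype.card α) ≃ ι ⊕ α := (Equiv.refl ι).sumCongr (Fintype.equivFin α).symm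
  let g : κ ⊕ β ≃ κ ⊕ Fin (Fintype.card β) := (Equiv.refl κ).sumCongr (Fintype.equivFin β)
  refine ⟨_, _, (f.trans τ).trans g, ?_⟩
  convert h.reindex f using 1
  · rw [blocks_reindex, dm_reindex]; rfl
  · rw [Equiv.coe_trans, Equiv.coe_trans, ← Matrix.submatrix_submatrix,
      ← Matrix.submatrix_submatrix, blocks_reindex, dm_reindex]
    rfl

theorem SH.elim {a : Matrix ι ι R} {b : Matrix κ κ R} (h : SH ν S i q a b) :
    ∃ (l l' : ℕ) (τ : ι ⊕ Fin l ≃ κ ⊕ Fin l'),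
    HT ν S i (four i q) (Matrix.fromBlocks a 0 0 (dm R i (Fin l)))
      ((Matrix.fromBlocks b 0 0 (dm R i (Fin l'))).submatrix τ τ) := h

theorem SH.of_HT (hS : IsFilt S) (hq : q.Good) {a b : Matrix ι ι R}
    (h : HT ν S i (four i q) a b) : SH ν S i q a b :=
  SH.intro (Equiv.refl (ι ⊕ Fin 0)) (by
    simpa using h.diag_right (Cy.dm (ι := Fin 0) hS (hq.four i).ε_pos (hq.four i).one_le))

theorem SH.reindex (hS : IsFilt S) (hq : q.Good) {a : Matrix ι ι R}
    (h : Cy ν S i q a) (f : κ ≃ ι) : SH ν S i q (a.submatrix f f) a := by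
  refine SH.intro (f.sumCongr (Equiv.refl (Fin 0))) ?_
  rw [blocks_reindex, dm_reindex]
  exact HT.refl (((h.mono (hq.le_four i)).reindex f).diag
    (Cy.dm hS (hq.four i).ε_pos (hq.four i).one_le))

theorem SH.stab (hS : IsFilt S) (hq : q.Good) {a : Matrix ι ι R}
    (h : Cy ν S i q a) (α : Type) [Fintype α] [DecidableEq α] :
    SH ν S i q (Matrix.fromBlocks a 0 0 (dm R i α)) a := by
  refine SH.intro (α := Fin 0) (Equiv.sumAssoc ι α (Fin 0)) ?_
  rw [dm_sum, blocks_assoc]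
  have := hq.four i
  exact HT.refl (((h.mono (hq.le_four i)).diag (Cy.dm hS this.ε_pos this.one_le)).diag
    (Cy.dm hS this.ε_pos this.one_le))

theorem SH.symm {a : Matrix ι ι R} {b : Matrix κ κ R} (h : SH ν S i q a b) :
    SH ν S i q b a := by
  obtain ⟨l, l', τ, h⟩ := h.elim
  refine SH.intro τ.symm ?_
  have := (h.reindex τ.symm).symm
  rwa [Matrix.submatrix_submatrix, τ.self_comp_symm, Matrix.submatrix_id_id] at this

theorem SH.trans (hS : IsFilt S) (hq : q.Good) {a : Matrix ι ι R} {b : Matrix κ κ R}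
    {d : Matrix η η R} (h : SH ν S i q a b) (h' : SH ν S i q b d) : SH ν S i q a d := by
  obtain ⟨l, l', τ, h⟩ := h.elim
  obtain ⟨m, m', σ, h'⟩ := h'.elim
  have hf := hq.four i
  -- Each homotopy is stabilized by the padding of the other one, so that both have the same middle
  -- term up to reindexing.
  let f : (ι ⊕ Fin l) ⊕ Fin m ≃ (κ ⊕ Fin m) ⊕ Fin l' :=
    (τ.sumCongr (Equiv.refl _)).trans (swapRight _ _ _)
  let e0 := (Equiv.sumAssoc ι (Fin l) (Fin m)).symm
  have H1 := h.diag_right (Cy.dm (ι := Fin m) hS hf.ε_pos hf.one_le)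
  have H2 := (h'.diag_right (Cy.dm (ι := Fin l') hS hf.ε_pos hf.one_le)).reindex f
  have e1 : (Matrix.fromBlocks (Matrix.fromBlocks b 0 0 (dm R i (Fin m))) 0 0
      (dm R i (Fin l'))).submatrix f f = Matrix.fromBlocks
      ((Matrix.fromBlocks b 0 0 (dm R i (Fin l'))).submatrix τ τ) 0 0 (dm R i (Fin m)) := by
    rw [Equiv.coe_trans, ← Matrix.submatrix_submatrix, blocks_swapRight, blocks_reindex]
    rfl
  rw [e1] at H2
  have H := (H1.trans H2).reindex e0
  rw [blocks_assoc', ← dm_sum] at H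
  refine SH.intro ((e0.trans f).trans ((σ.sumCongr (Equiv.refl _)).trans
    (Equiv.sumAssoc η (Fin m') (Fin l')))) ?_
  convert H using 1
  rw [Equiv.coe_trans, Equiv.coe_trans, Equiv.coe_trans, ← Matrix.submatrix_submatrix,
    ← Matrix.submatrix_submatrix, ← Matrix.submatrix_submatrix, dm_sum, blocks_assoc,
    blocks_reindex]
  rfl

theorem SH.diag_right {a : Matrix ι ι R} {b : Matrix κ κ R} (hq : q.Good)
    (h : SH ν S i q a b) {d : Matrix η η R} (hd : Cy ν S i q d) :
    SH ν S i q (Matrix.fromBlocks a 0 0 d) (Matrix.fromBlocks b 0 0 d) := by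
  obtain ⟨l, l', τ, h⟩ := h.elim
  refine SH.intro ((swapRight _ _ _).trans ((τ.sumCongr (Equiv.refl _)).trans
    (swapRight _ _ _))) ?_
  have H := (h.diag_right (hd.mono (hq.le_four i))).reindex (swapRight _ _ _)
  rw [blocks_swapRight] at H
  convert H using 1
  rw [Equiv.coe_trans, Equiv.coe_trans, ← Matrix.submatrix_submatrix,
    ← Matrix.submatrix_submatrix, blocks_swapRight, blocks_reindex]
  rfl

theorem SH.comm (hS : IsFilt S) (hq : q.Good) {a : Matrix ι ι R} {b : Matrix κ κ R}
    (ha : Cy ν S i q a) (hb : Cy ν S i q b) :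
    SH ν S i q (Matrix.fromBlocks a 0 0 b) (Matrix.fromBlocks b 0 0 a) := by
  have := SH.reindex hS hq (hb.diag ha) (Equiv.sumComm ι κ)
  rwa [blocks_swap] at this

theorem SH.assoc (hS : IsFilt S) (hq : q.Good) {a : Matrix ι ι R} {b : Matrix κ κ R}
    {d : Matrix η η R} (ha : Cy ν S i q a) (hb : Cy ν S i q b) (hd : Cy ν S i q d) :
    SH ν S i q (Matrix.fromBlocks (Matrix.fromBlocks a 0 0 b) 0 0 d)
      (Matrix.fromBlocks a 0 0 (Matrix.fromBlocks b 0 0 d)) := by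
  have := SH.reindex hS hq (ha.diag (hb.diag hd)) (Equiv.sumAssoc ι κ η)
  rwa [blocks_assoc] at this

/-- Commuting the summands reduces this to `SH.diag_right`; the commutation needs a and b to be
cycles at q itself. -/
theorem SH.diag_left (hS : IsFilt S) {a : Matrix ι ι R} {b : Matrix κ κ R} (hq : q.Good)
    (ha : Cy ν S i q a) (hb : Cy ν S i q b) (h : SH ν S i q a b) {d : Matrix η η R}
    (hd : Cy ν S i q d) :
    SH ν S i q (Matrix.fromBlocks d 0 0 a) (Matrix.fromBlocks d 0 0 b) :=
  ((SH.comm hS hq hd ha).trans hS hq (h.diag_right hq hd)).trans hS hq (SH.comm hS hq hb hd)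

theorem pad_add (d : R) {n : ℕ} (l : ℕ) (a : Matrix (Fin n) (Fin n) R) :
    pad d (n + l) a = (Matrix.fromBlocks a 0 0 (Matrix.diagonal fun _ => d)).submatrix
      finSumFinEquiv.symm finSumFinEquiv.symm := by
  ext i j
  obtain ⟨i, rfl⟩ := finSumFinEquiv.surjective i
  obtain ⟨j, rfl⟩ := finSumFinEquiv.surjective j
  rcases i with i | i <;> rcases j with j | j <;>
    simp [pad, Matrix.diagonal_apply, Fin.ext_iff]
  all_goals omega

theorem pad_pad (d : R) {n k K : ℕ} (h : n ≤ k) (a : Matrix (Fin n) (Fin n) R) :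
    pad d K (pad d k a) = pad d K a := by
  ext i j
  simp only [pad]
  split_ifs <;> first | rfl | omega | simp_all [Fin.ext_iff]

/-- The value used for stabilization. -/
def dv (R : Type*) [Ring R] (i : Fin 2) : R := if i = 0 then 0 else 1

theorem dm_eq_diagonal (i : Fin 2) (α : Type) [DecidableEq α] :
    dm R i α = Matrix.diagonal fun _ => dv R i := by
  unfold dm dv; split_ifs <;> simp

theorem sim_iff (i : Fin 2) (q : Param) {n m : ℕ} (a : Matrix (Fin n) (Fin n) R)
    (b : Matrix (Fin m) (Fin m) R) : (ν.toMatFilt S).Sim i q a b ↔ ∃ k : ℕ, n ≤ k ∧ m ≤ k ∧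
      HT ν S i (four i q) (pad (dv R i) k a) (pad (dv R i) k b) := by
  unfold MatFilt.Sim HT dv four
  refine exists_congr fun k => and_congr_right fun _ => and_congr_right fun _ => ?_
  split_ifs <;> rfl

theorem SH.of_sim {n m : ℕ} {a : Matrix (Fin n) (Fin n) R}
    {b : Matrix (Fin m) (Fin m) R} (h : (ν.toMatFilt S).Sim i q a b) : SH ν S i q a b := by
  obtain ⟨k, hn, hm, h⟩ := (sim_iff i q a b).1 h
  obtain ⟨l, rfl⟩ := Nat.exists_eq_add_of_le hn
  obtain ⟨l', hl⟩ := Nat.exists_eq_add_of_le hm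
  refine SH.intro ((finSumFinEquiv.trans (finCongr hl)).trans finSumFinEquiv.symm) ?_
  convert h.reindex finSumFinEquiv using 1
  · rw [pad_add, Matrix.submatrix_submatrix, finSumFinEquiv.symm_comp_self,
      Matrix.submatrix_id_id, dm_eq_diagonal]
  · have : pad (dv R i) (n + l) b =
        (pad (dv R i) (m + l') b).submatrix (finCongr hl) (finCongr hl) := by
      ext i j; simp [pad, Fin.ext_iff]
    rw [this, pad_add, Matrix.submatrix_submatrix, Matrix.submatrix_submatrix, dm_eq_diagonal]
    rfl

/-- The K-groups are defined by padding without reindexing, so the bijection inside `SH` must be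
removed. After doubling the size it is realized by a rotation. Rotating b, a cycle at q, stays
within `four i q`, so no parameters are lost. -/
theorem SH.sim (hS : IsFilt S) (hq : q.Good) {n m : ℕ} {a : Matrix (Fin n) (Fin n) R}
    {b : Matrix (Fin m) (Fin m) R} (hb : Cy ν S i q b)
    (h : SH ν S i q a b) : (ν.toMatFilt S).Sim i q a b := by
  obtain ⟨l, l', τ, h⟩ := h.elim
  have hk : n + l = m + l' := by simpa using Fintype.card_congr τ
  have hf := hq.four i
  set B := pad (dv R i) (n + l) b with hB
  have hB' : B = (Matrix.fromBlocks b 0 0 (dm R i (Fin l'))).submatrix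
      ((finCongr hk).trans finSumFinEquiv.symm) ((finCongr hk).trans finSumFinEquiv.symm) := by
    have : B = (pad (dv R i) (m + l') b).submatrix (finCongr hk) (finCongr hk) := by
      ext i j; simp [hB, pad, Fin.ext_iff]
    rw [this, pad_add, Matrix.submatrix_submatrix, dm_eq_diagonal]
    rfl
  have hBc : Cy ν S i q B := by
    rw [hB']; exact (hb.diag (Cy.dm hS hq.ε_pos hq.one_le)).reindex _
  have h1 := h.reindex finSumFinEquiv.symm
  rw [dm_eq_diagonal, ← pad_add] at h1
  set σ : Fin (n + l) ≃ Fin (n + l) := (finSumFinEquiv.symm.trans τ).trans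
    (((finCongr hk).trans finSumFinEquiv.symm).symm) with hσ
  have h2 : ((Matrix.fromBlocks b 0 0 (dm R i (Fin l'))).submatrix τ τ).submatrix
      finSumFinEquiv.symm finSumFinEquiv.symm = B.submatrix σ σ := by
    rw [hB', Matrix.submatrix_submatrix, Matrix.submatrix_submatrix, ← Equiv.coe_trans,
      ← Equiv.coe_trans]
    congr 1 <;> ext x <;> simp [hσ]
  rw [h2] at h1
  have hd := Cy.dm (ν := ν) (i := i) (ι := Fin (n + l)) hS hf.ε_pos hf.one_le
  have h3 := h1.diag_right hd
  -- The reindexed matrix and B itself both rotate into the same matrix, with B in the lower corner.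
  have r1 := (hBc.reindex σ).rotate (hS := hS) hq.ε_pos hq.r_nonneg hq.one_le σ.symm
  rw [Matrix.submatrix_submatrix, σ.self_comp_symm, Matrix.submatrix_id_id] at r1
  have r2 := hBc.rotate (hS := hS) hq.ε_pos hq.r_nonneg hq.one_le (Equiv.refl _)
  have h4 := ((h3.trans r1).trans r2.symm).reindex finSumFinEquiv.symm
  rw [dm_eq_diagonal, ← pad_add, ← pad_add, pad_pad _ (by omega), hB, pad_pad _ (by omega)] at h4
  exact (sim_iff i q a b).2 ⟨_, by omega, by omega, h4⟩

end stable


/-! ### The K-groups as Grothendieck groups; classes over arbitrary index sets -/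

section groups

variable {R : Type*} [Ring R] [Algebra ℂ R] [TopologicalSpace R]
  [IsTopologicalRing R] [ContinuousSMul ℂ R] {ν : MNorm R} {S : ℝ →o Submodule ℂ R}
  {i : Fin 2} {q q' : Param} {ι κ η α β : Type} [Fintype ι] [DecidableEq ι] [Fintype κ]
  [DecidableEq κ] [Fintype η] [DecidableEq η] [Fintype α] [DecidableEq α] [Fintype β]
  [DecidableEq β]

theorem Cy.dsum {n m : ℕ} {a : Matrix (Fin n) (Fin n) R} {b : Matrix (Fin m) (Fin m) R}
    (ha : Cy ν S i q a) (hb : Cy ν S i q b) : Cy ν S i q (dsum a b) :=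
  (ha.diag hb).reindex finSumFinEquiv.symm

theorem SH.dsum (hS : IsFilt S) (hq : q.Good) {n m : ℕ} {a : Matrix (Fin n) (Fin n) R}
    {b : Matrix (Fin m) (Fin m) R} (ha : Cy ν S i q a) (hb : Cy ν S i q b) :
    SH ν S i q (dsum a b) (Matrix.fromBlocks a 0 0 b) :=
  SH.reindex hS hq (ha.diag hb) finSumFinEquiv.symm

/-- Stable homotopy of cycles. -/
def cycSetoid (ν : MNorm R) (hS : IsFilt S) (hq : q.Good) (i : Fin 2) :
    Setoid ((ν.toMatFilt S).Cyc i q) where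
  r a b := SH ν S i q a.2.1 b.2.1
  iseqv := ⟨fun a => SH.of_HT hS hq ((HT.refl a.2.2).mono (hq.le_four i)), fun h => h.symm,
    fun h h' => h.trans hS hq h'⟩

/-- The sum of stable homotopy classes. -/
@[reducible]
def cycAdd (ν : MNorm R) (hS : IsFilt S) (hq : q.Good) (i : Fin 2) :
    Add (Quotient (cycSetoid ν hS hq i)) where
  add := Quotient.map₂ (fun a b => ⟨a.1 + b.1, dsum a.2.1 b.2.1, Cy.dsum a.2.2 b.2.2⟩)
    fun a a' h b b' h' => by
      refine (SH.dsum hS hq a.2.2 b.2.2).trans hS hq (SH.trans hS hq ?_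
        (SH.dsum hS hq a'.2.2 b'.2.2).symm)
      exact (SH.diag_right hq h b.2.2).trans hS hq (SH.diag_left hS hq b.2.2 b'.2.2 h' a'.2.2)

/-- The class of the empty matrix. -/
@[reducible]
def cycZero (ν : MNorm R) (hS : IsFilt S) (hq : q.Good) (i : Fin 2) :
    Zero (Quotient (cycSetoid ν hS hq i)) where
  zero := Quotient.mk _ ⟨0, dm R i (Fin 0), Cy.dm hS hq.ε_pos hq.one_le⟩

/-- The semigroup of cycles up to stable homotopy. -/
@[reducible]
def cycMonoid (ν : MNorm R) (hS : IsFilt S) (hq : q.Good) (i : Fin 2) :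
    AddCommMonoid (Quotient (cycSetoid ν hS hq i)) where
  __ := cycAdd ν hS hq i
  __ := cycZero ν hS hq i
  nsmul := @nsmulRec _ (cycZero ν hS hq i) (cycAdd ν hS hq i)
  add_comm := by
    rintro ⟨a⟩ ⟨b⟩
    refine Quotient.sound ?_
    exact ((SH.dsum hS hq a.2.2 b.2.2).trans hS hq (SH.comm hS hq a.2.2 b.2.2)).trans hS hq
      (SH.dsum hS hq b.2.2 a.2.2).symm
  add_assoc := by
    rintro ⟨a⟩ ⟨b⟩ ⟨d⟩
    refine Quotient.sound ?_
    have h1 := (SH.dsum hS hq (Cy.dsum a.2.2 b.2.2) d.2.2).trans hS hq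
      ((SH.dsum hS hq a.2.2 b.2.2).diag_right hq d.2.2)
    have h2 := (SH.dsum hS hq a.2.2 (Cy.dsum b.2.2 d.2.2)).trans hS hq
      (SH.diag_left hS hq (Cy.dsum b.2.2 d.2.2) (Cy.diag b.2.2 d.2.2)
        (SH.dsum hS hq b.2.2 d.2.2) a.2.2)
    exact (h1.trans hS hq (SH.assoc hS hq a.2.2 b.2.2 d.2.2)).trans hS hq h2.symm
  zero_add := by
    rintro ⟨a⟩
    refine Quotient.sound ?_
    have hd := Cy.dm (ν := ν) (i := i) (ι := Fin 0) hS hq.ε_pos hq.one_le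
    exact ((SH.dsum hS hq hd a.2.2).trans hS hq (SH.comm hS hq hd a.2.2)).trans hS hq
      (SH.stab hS hq a.2.2 _)
  add_zero := by
    rintro ⟨a⟩
    refine Quotient.sound ?_
    have hd := Cy.dm (ν := ν) (i := i) (ι := Fin 0) hS hq.ε_pos hq.one_le
    exact (SH.dsum hS hq a.2.2 hd).trans hS hq (SH.stab hS hq a.2.2 _)

/-- The quotient map onto the quantitative `K`-group. -/
def mkUK (ν : MNorm R) (S : ℝ →o Submodule ℂ R) (i : Fin 2) (q : Param) :
    FreeAbelianGroup ((ν.toMatFilt S).Cyc i q) →+ (ν.toMatFilt S).UK i q :=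
  QuotientAddGroup.mk' _

theorem mkUK_surjective : Function.Surjective (mkUK ν S i q) := QuotientAddGroup.mk_surjective

theorem mkUK_eq_of_mem {x y : FreeAbelianGroup ((ν.toMatFilt S).Cyc i q)}
    (h : x - y ∈ (ν.toMatFilt S).rels i q) : mkUK ν S i q x = mkUK ν S i q y :=
  QuotientAddGroup.eq_iff_sub_mem.2 (AddSubgroup.subset_closure h)

/-- The class of a cycle. -/
def ucls (ν : MNorm R) (S : ℝ →o Submodule ℂ R) (i : Fin 2) (q : Param) {n : ℕ}
    (a : Matrix (Fin n) (Fin n) R) (h : Cy ν S i q a) : (ν.toMatFilt S).UK i q :=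
  mkUK ν S i q (FreeAbelianGroup.of ⟨n, a, h⟩)

/-- The presentation by generators and relations maps to the Grothendieck group of the monoid of
stable homotopy classes. There two elements of the monoid coincide exactly when they become equal
after adding a common summand. -/
theorem exists_SH_of_ucls_eq (hS : IsFilt S) (hq : q.Good) {n m : ℕ}
    {a : Matrix (Fin n) (Fin n) R} {b : Matrix (Fin m) (Fin m) R}
    {ha : Cy ν S i q a} {hb : Cy ν S i q b}
    (h : ucls ν S i q a ha = ucls ν S i q b hb) :
    ∃ (l : ℕ) (d : Matrix (Fin l) (Fin l) R), Cy ν S i q d ∧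
      SH ν S i q (Matrix.fromBlocks a 0 0 d) (Matrix.fromBlocks b 0 0 d) := by
  let _ := cycMonoid ν hS hq i
  let g : (ν.toMatFilt S).Cyc i q →
      Algebra.GrothendieckAddGroup (Quotient (cycSetoid ν hS hq i)) :=
    fun a => Algebra.GrothendieckAddGroup.of (Quotient.mk (cycSetoid ν hS hq i) a)
  have hF : AddSubgroup.closure ((ν.toMatFilt S).rels i q) ≤ (FreeAbelianGroup.lift g).ker := by
    rw [AddSubgroup.closure_le]
    rintro z (⟨a, b, hab, rfl⟩ | ⟨a, b, hc, rfl⟩)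
    · change FreeAbelianGroup.lift g _ = 0
      rw [map_sub, sub_eq_zero, FreeAbelianGroup.lift_apply_of, FreeAbelianGroup.lift_apply_of]
      exact congrArg Algebra.GrothendieckAddGroup.of
        (Quotient.sound (s := cycSetoid ν hS hq i) (SH.of_sim hab))
    · change FreeAbelianGroup.lift g _ = 0
      rw [map_sub, sub_eq_zero, map_add, FreeAbelianGroup.lift_apply_of,
        FreeAbelianGroup.lift_apply_of, FreeAbelianGroup.lift_apply_of]
      exact map_add Algebra.GrothendieckAddGroup.of
        (Quotient.mk (cycSetoid ν hS hq i) a) (Quotient.mk (cycSetoid ν hS hq i) b)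
  have h1 : g ⟨n, a, ha⟩ = g ⟨m, b, hb⟩ := (FreeAbelianGroup.lift_apply_of g _).symm.trans
    ((congrArg (QuotientAddGroup.lift _ (FreeAbelianGroup.lift g) hF) h).trans
      (FreeAbelianGroup.lift_apply_of g _))
  obtain ⟨⟨d, _⟩, hd⟩ :=
    (AddSubmonoid.LocalizationMap.eq_iff_exists (AddLocalization.addMonoidOf ⊤)).1 h1
  obtain ⟨d, rfl⟩ := Quotient.exists_rep d
  refine ⟨d.1, d.2.1, d.2.2, ?_⟩
  have h2 := Quotient.exact (s := cycSetoid ν hS hq i) hd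
  have h3 := ((SH.dsum hS hq d.2.2 ha).symm.trans hS hq h2).trans hS hq
    (SH.dsum hS hq d.2.2 hb)
  exact ((SH.comm hS hq ha d.2.2).trans hS hq h3).trans hS hq (SH.comm hS hq d.2.2 hb)

theorem ucls_eq_of_sim {n m : ℕ}
    {a : Matrix (Fin n) (Fin n) R} {b : Matrix (Fin m) (Fin m) R}
    (ha : Cy ν S i q a) (hb : Cy ν S i q b)
    (h : (ν.toMatFilt S).Sim i q a b) : ucls ν S i q a ha = ucls ν S i q b hb :=
  mkUK_eq_of_mem (Or.inl ⟨_, _, h, rfl⟩)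

theorem ucls_dsum {n m : ℕ}
    {a : Matrix (Fin n) (Fin n) R} {b : Matrix (Fin m) (Fin m) R}
    (ha : Cy ν S i q a) (hb : Cy ν S i q b) (h : Cy ν S i q (dsum a b)) :
    ucls ν S i q (dsum a b) h = ucls ν S i q a ha + ucls ν S i q b hb := by
  rw [ucls, ucls, ucls, ← map_add]
  exact mkUK_eq_of_mem (Or.inr ⟨⟨n, a, ha⟩, ⟨m, b, hb⟩, h, rfl⟩)

/-- The class of a cycle indexed by an arbitrary finite type. -/
def kcls (ν : MNorm R) (S : ℝ →o Submodule ℂ R) (i : Fin 2) (q : Param) (a : Matrix ι ι R)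
    (h : Cy ν S i q a) : (ν.toMatFilt S).UK i q :=
  ucls ν S i q
    (a.submatrix (Fintype.equivFin ι).symm (Fintype.equivFin ι).symm) (h.reindex _)

theorem kcls_eq_of_SH (hS : IsFilt S) (hq : q.Good) {a : Matrix ι ι R} {b : Matrix κ κ R}
    (ha : Cy ν S i q a) (hb : Cy ν S i q b) (h : SH ν S i q a b) :
    kcls ν S i q a ha = kcls ν S i q b hb :=
  ucls_eq_of_sim _ _ (SH.sim hS hq (hb.reindex _)
    (((SH.reindex hS hq ha _).trans hS hq h).trans hS hq (SH.reindex hS hq hb _).symm))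

theorem kcls_fin (hS : IsFilt S) (hq : q.Good) {n : ℕ} {a : Matrix (Fin n) (Fin n) R}
    (ha : Cy ν S i q a) : kcls ν S i q a ha = ucls ν S i q a ha :=
  ucls_eq_of_sim _ _ (SH.sim hS hq ha (SH.reindex hS hq ha _))

theorem kcls_diag (hS : IsFilt S) (hq : q.Good) {a : Matrix ι ι R} {b : Matrix κ κ R}
    (ha : Cy ν S i q a) (hb : Cy ν S i q b) (h : Cy ν S i q (Matrix.fromBlocks a 0 0 b)) :
    kcls ν S i q (Matrix.fromBlocks a 0 0 b) h = kcls ν S i q a ha + kcls ν S i q b hb := by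
  rw [kcls, kcls, kcls, ← ucls_dsum _ _ (Cy.dsum (ha.reindex _) (hb.reindex _)), ← kcls_fin hS hq,
    ← kcls_fin hS hq]
  refine kcls_eq_of_SH hS hq _ _ (((SH.reindex hS hq h _).trans hS hq ?_).trans hS hq
    (SH.dsum hS hq (ha.reindex _) (hb.reindex _)).symm)
  have := SH.reindex hS hq h
    ((Fintype.equivFin ι).symm.sumCongr (Fintype.equivFin κ).symm)
  rw [blocks_reindex] at this
  exact this.symm

theorem kcls_reindex (hS : IsFilt S) (hq : q.Good) {a : Matrix ι ι R}
    (ha : Cy ν S i q a) (f : κ ≃ ι) (h : Cy ν S i q (a.submatrix f f)) :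
    kcls ν S i q (a.submatrix f f) h = kcls ν S i q a ha :=
  kcls_eq_of_SH hS hq _ _ (SH.reindex hS hq ha f)

theorem kcls_stab (hS : IsFilt S) (hq : q.Good) {a : Matrix ι ι R}
    (ha : Cy ν S i q a) (α : Type) [Fintype α] [DecidableEq α]
    (h : Cy ν S i q (Matrix.fromBlocks a 0 0 (dm R i α))) :
    kcls ν S i q _ h = kcls ν S i q a ha :=
  kcls_eq_of_SH hS hq _ _ (SH.stab hS hq ha α)

/-- The sum of two stabilizing matrices is a stabilization of one of them, so the class x satisfies
x + x = x. -/
theorem kcls_dm (hS : IsFilt S) (hq : q.Good) (h : Cy ν S i q (dm R i α)) :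
    kcls ν S i q (dm R i α) h = 0 := by
  have h1 := kcls_stab hS hq h α (h.diag h)
  rw [kcls_diag hS hq h h] at h1
  simpa using h1

theorem exists_kcls_sub (hS : IsFilt S) (hq : q.Good) (x : (ν.toMatFilt S).UK i q) :
    ∃ (n m : ℕ) (a : Matrix (Fin n) (Fin n) R) (b : Matrix (Fin m) (Fin m) R)
      (ha : Cy ν S i q a) (hb : Cy ν S i q b),
      x = kcls ν S i q a ha - kcls ν S i q b hb := by
  have h0 := Cy.dm (ν := ν) (i := i) (ι := Fin 0) hS hq.ε_pos hq.one_le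
  obtain ⟨z, rfl⟩ := mkUK_surjective x
  induction z using FreeAbelianGroup.induction_on with
  | zero => exact ⟨0, 0, _, _, h0, h0, by rw [sub_self, map_zero]⟩
  | of a =>
    exact ⟨a.1, 0, a.2.1, _, a.2.2, h0, by
      rw [kcls_dm hS hq, sub_zero]
      exact (kcls_fin hS hq (show Cy ν S i q a.2.1 from a.2.2)).symm⟩
  | neg a _ =>
    exact ⟨0, a.1, _, a.2.1, h0, a.2.2, by
      rw [kcls_dm hS hq, zero_sub, map_neg]
      exact congrArg Neg.neg (kcls_fin hS hq (show Cy ν S i q a.2.1 from a.2.2)).symm⟩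
  | add x y hx hy =>
    obtain ⟨n, m, a, b, ha, hb, hx⟩ := hx
    obtain ⟨n', m', a', b', ha', hb', hy⟩ := hy
    refine ⟨n + n', m + m', dsum a a', dsum b b', ha.dsum ha', hb.dsum hb', ?_⟩
    rw [kcls_fin hS hq, kcls_fin hS hq, ucls_dsum ha ha', ucls_dsum hb hb', map_add, hx, hy,
      kcls_fin hS hq, kcls_fin hS hq, kcls_fin hS hq, kcls_fin hS hq]
    abel

theorem exists_SH_of_kcls_eq (hS : IsFilt S) (hq : q.Good) {a : Matrix ι ι R}
    {b : Matrix κ κ R} {ha : Cy ν S i q a} {hb : Cy ν S i q b}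
    (h : kcls ν S i q a ha = kcls ν S i q b hb) :
    ∃ (l : ℕ) (d : Matrix (Fin l) (Fin l) R), Cy ν S i q d ∧
      SH ν S i q (Matrix.fromBlocks a 0 0 d) (Matrix.fromBlocks b 0 0 d) := by
  obtain ⟨l, d, hd, h⟩ := exists_SH_of_ucls_eq hS hq h
  refine ⟨l, d, hd, ?_⟩
  exact (((SH.reindex hS hq ha _).diag_right hq hd).symm.trans hS hq h).trans hS hq
    ((SH.reindex hS hq hb _).diag_right hq hd)

end groups


/-! ### Murray-von Neumann equivalence of quasi-idempotents -/

theorem Scale.good (c : Scale) (k : ℕ) : (c.q k).Good :=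
  ⟨mul_pos (c.pow_pos k) c.δ_pos, mul_nonneg (Nat.cast_nonneg k) c.ρ_pos.le, c.one_le_pow k⟩

theorem Scale.pow_lt (c : Scale) {k l : ℕ} (h : k + 1 ≤ l) : c.M ^ k * c.δ < c.M ^ l * c.δ :=
  mul_lt_mul_of_pos_right (pow_lt_pow_right₀ (by linarith [c.two_le]) h) c.δ_pos

/-- A factor 4 costs two indices, and doubling the propagation doubles the index. -/
theorem Scale.four_le (c : Scale) (i : Fin 2) (k : ℕ) : four i (c.q k) ≤ c.q (2 * k + 2) := by
  have h1 := c.four_mul_pow k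
  have h2 := c.pow_le (show k + 2 ≤ 2 * k + 2 by omega)
  refine ⟨?_, ?_, h1.trans h2⟩
  · change 4 * (c.M ^ k * c.δ) ≤ c.M ^ (2 * k + 2) * c.δ
    rw [← mul_assoc]
    exact mul_le_mul_of_nonneg_right (h1.trans h2) c.δ_pos.le
  · change (if i = 0 then k * c.ρ else 2 * (k * c.ρ)) ≤ ((2 * k + 2 : ℕ) : ℝ) * c.ρ
    have h3 : (0 : ℝ) ≤ k * c.ρ := mul_nonneg (Nat.cast_nonneg k) c.ρ_pos.le
    push_cast
    split_ifs <;> nlinarith [c.ρ_pos]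

section degreeZero

variable {R : Type*} [Ring R] [Algebra ℂ R] [TopologicalSpace R]
  [IsTopologicalRing R] [ContinuousSMul ℂ R] (ν : MNorm R) (c : Scale) (S : ℝ →o Submodule ℂ R)
  {ι κ η α β : Type} [Fintype ι] [DecidableEq ι] [Fintype κ]
  [DecidableEq κ] [Fintype η] [DecidableEq η] [Fintype α] [DecidableEq α] [Fintype β]
  [DecidableEq β]

/-- Quasi-idempotents, in terms of the scale. -/
def QId (k : ℕ) (e : Matrix ι ι R) : Prop := Ctl ν c S k e ∧ Nr ν c k (e * e) e

/-- Quasi-inverse pairs, in terms of the scale. -/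
def QInv (k : ℕ) (u v : Matrix ι ι R) : Prop :=
  Ctl ν c S k u ∧ Ctl ν c S k v ∧ Nr ν c k (u * v) 1 ∧ Nr ν c k (v * u) 1

/-- Approximate Murray-von Neumann equivalence. -/
def MvN (k : ℕ) (e : Matrix ι ι R) (f : Matrix κ κ R) : Prop :=
  ∃ (s : Matrix ι κ R) (t : Matrix κ ι R), Ctl ν c S k s ∧ Ctl ν c S k t ∧
    Nr ν c k (s * t) e ∧ Nr ν c k (t * s) f

variable {ν c S} {k l : ℕ}

/-- One index pays both for the strict inequality in the definition of quasi-idempotents and for the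
bound on 1 - e. -/
theorem QId.cy {e : Matrix ι ι R} (h : QId ν c S k e) (hl : k + 1 ≤ l) :
    Cy ν S 0 (c.q l) e := by
  have hk : k ≤ l := by omega
  refine (if_pos rfl : Cy ν S 0 (c.q l) e = _).mpr
    ⟨(h.1.mono hk).mem, lt_of_le_of_lt h.2 (c.pow_lt hl), (h.1.mono hk).bd, ?_⟩
  refine (ν.sub_le _ _).trans ((add_le_add (ν.one_le.trans (c.one_le_pow k)) h.1.bd).trans ?_)
  exact (c.two_mul_pow k).trans (c.pow_le hl)

theorem QI.qid {e : Matrix ι ι R} (h : QI ν S (c.q k) e) (hk : 1 ≤ k) : QId ν c S k e :=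
  ⟨⟨hk, h.1, h.2.2.1⟩, h.2.1.le⟩

theorem Cy.qid {e : Matrix ι ι R} (h : Cy ν S 0 (c.q k) e) (hk : 1 ≤ k) : QId ν c S k e :=
  QI.qid (show QI ν S (c.q k) e by simpa [Cy] using h) hk

theorem QInv.qp {u v : Matrix ι ι R} (h : QInv ν c S k u v) (hl : k + 1 ≤ l) :
    QP ν S (c.q l) u v := by
  have hk : k ≤ l := by omega
  exact ⟨(h.1.mono hk).mem, (h.2.1.mono hk).mem, (h.1.mono hk).bd, (h.2.1.mono hk).bd,
    lt_of_le_of_lt h.2.2.1 (c.pow_lt hl), lt_of_le_of_lt h.2.2.2 (c.pow_lt hl)⟩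

theorem QInv.cy {u v : Matrix ι ι R} (h : QInv ν c S k u v) (hl : k + 1 ≤ l) :
    Cy ν S 1 (c.q l) u :=
  (if_neg (by decide) : Cy ν S 1 (c.q l) u = _).mpr ⟨v, h.qp hl⟩

theorem QP.qinv {u v : Matrix ι ι R} (h : QP ν S (c.q k) u v) (hk : 1 ≤ k) : QInv ν c S k u v :=
  ⟨⟨hk, h.1, h.2.2.1⟩, ⟨hk, h.2.1, h.2.2.2.1⟩, h.2.2.2.2.1.le, h.2.2.2.2.2.le⟩

theorem Cy.qinv {u : Matrix ι ι R} (h : Cy ν S 1 (c.q k) u) (hk : 1 ≤ k) :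
    ∃ v, QInv ν c S k u v := by
  obtain ⟨v, hv⟩ : ∃ v, QP ν S (c.q k) u v := by simpa [Cy] using h
  exact ⟨v, QP.qinv hv hk⟩

theorem QId.mono {e : Matrix ι ι R} (h : QId ν c S k e) (hl : k ≤ l) : QId ν c S l e :=
  ⟨h.1.mono hl, h.2.mono hl⟩

theorem QInv.mono {u v : Matrix ι ι R} (h : QInv ν c S k u v) (hl : k ≤ l) :
    QInv ν c S l u v :=
  ⟨h.1.mono hl, h.2.1.mono hl, h.2.2.1.mono hl, h.2.2.2.mono hl⟩

theorem QInv.symm {u v : Matrix ι ι R} (h : QInv ν c S k u v) : QInv ν c S k v u :=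
  ⟨h.2.1, h.1, h.2.2.2, h.2.2.1⟩

theorem QInv.filt_mono {S' : ℝ →o Submodule ℂ R} {u v : Matrix ι ι R} (h : QInv ν c S k u v)
    (hS : S ≤ S') : QInv ν c S' k u v :=
  ⟨h.1.filt_mono hS, h.2.1.filt_mono hS, h.2.2⟩

theorem QId.filt_mono {S' : ℝ →o Submodule ℂ R} {e : Matrix ι ι R} (h : QId ν c S k e)
    (hS : S ≤ S') : QId ν c S' k e :=
  ⟨h.1.filt_mono hS, h.2⟩

theorem MvN.mono {e : Matrix ι ι R} {f : Matrix κ κ R} (h : MvN ν c S k e f) (hl : k ≤ l) :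
    MvN ν c S l e f := by
  obtain ⟨s, t, hs, ht, h1, h2⟩ := h
  exact ⟨s, t, hs.mono hl, ht.mono hl, h1.mono hl, h2.mono hl⟩

theorem MvN.symm {e : Matrix ι ι R} {f : Matrix κ κ R} (h : MvN ν c S k e f) :
    MvN ν c S k f e := by
  obtain ⟨s, t, hs, ht, h1, h2⟩ := h
  exact ⟨t, s, ht, hs, h2, h1⟩

theorem QId.diag {e : Matrix ι ι R} {f : Matrix κ κ R} (h : QId ν c S k e)
    (h' : QId ν c S k f) : QId ν c S k (Matrix.fromBlocks e 0 0 f) :=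
  ⟨h.1.diag h'.1, by rw [blocks_mul_blocks]; exact h.2.diag h'.2⟩

theorem QInv.diag {u v : Matrix ι ι R} {u' v' : Matrix κ κ R} (h : QInv ν c S k u v)
    (h' : QInv ν c S k u' v') :
    QInv ν c S k (Matrix.fromBlocks u 0 0 u') (Matrix.fromBlocks v 0 0 v') := by
  refine ⟨h.1.diag h'.1, h.2.1.diag h'.2.1, ?_, ?_⟩ <;>
    rw [blocks_mul_blocks, ← Matrix.fromBlocks_one]
  exacts [h.2.2.1.diag h'.2.2.1, h.2.2.2.diag h'.2.2.2]

theorem QInv.reindex {u v : Matrix ι ι R} (h : QInv ν c S k u v) (f : κ ≃ ι) :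
    QInv ν c S k (u.submatrix f f) (v.submatrix f f) := by
  refine ⟨h.1.reindex f f, h.2.1.reindex f f, ?_, ?_⟩ <;>
    rw [Matrix.submatrix_mul_equiv, ← Matrix.submatrix_one_equiv f]
  exacts [h.2.2.1.reindex f f, h.2.2.2.reindex f f]

theorem QId.reindex {e : Matrix ι ι R} (h : QId ν c S k e) (f : κ ≃ ι) :
    QId ν c S k (e.submatrix f f) :=
  ⟨h.1.reindex f f, by rw [Matrix.submatrix_mul_equiv]; exact h.2.reindex f f⟩

theorem QId.one (hS : IsFilt S) (hk : 1 ≤ k) : QId ν c S k (1 : Matrix ι ι R) :=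
  ⟨Ctl.one hS hk, Nr.of_eq _ (mul_one _)⟩

theorem QInv.one (hS : IsFilt S) (hk : 1 ≤ k) : QInv ν c S k (1 : Matrix ι ι R) 1 :=
  ⟨Ctl.one hS hk, Ctl.one hS hk, Nr.of_eq _ (mul_one _), Nr.of_eq _ (mul_one _)⟩

theorem QId.zero (hk : 1 ≤ k) : QId ν c S k (0 : Matrix ι ι R) :=
  ⟨Ctl.zero hk, Nr.of_eq _ (mul_zero _)⟩

theorem QId.compl (hS : IsFilt S) {e : Matrix ι ι R} (h : QId ν c S k e) :
    QId ν c S (k + 1) (1 - e) := by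
  refine ⟨(Ctl.one hS h.1.pos).sub h.1, Nr.mono ?_ (Nat.le_succ k)⟩
  have : (1 - e) * (1 - e) - (1 - e) = e * e - e := by noncomm_ring
  rw [Nr, this]; exact h.2

theorem QId.mul_compl {e : Matrix ι ι R} (h : QId ν c S k e) :
    Nr ν c k (e * (1 - e)) 0 := by
  have : e * (1 - e) - 0 = -(e * e - e) := by noncomm_ring
  rw [Nr, this, ν.neg]; exact h.2

theorem QId.compl_mul {e : Matrix ι ι R} (h : QId ν c S k e) :
    Nr ν c k ((1 - e) * e) 0 := by
  have : (1 - e) * e - 0 = -(e * e - e) := by noncomm_ring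
  rw [Nr, this, ν.neg]; exact h.2

theorem MvN.refl {e : Matrix ι ι R} (h : QId ν c S k e) : MvN ν c S k e e :=
  ⟨e, e, h.1, h.1, h.2, h.2⟩

theorem MvN.diag {e : Matrix ι ι R} {f : Matrix κ κ R} {e' : Matrix α α R} {f' : Matrix β β R}
    (h : MvN ν c S k e f) (h' : MvN ν c S k e' f') :
    MvN ν c S k (Matrix.fromBlocks e 0 0 e') (Matrix.fromBlocks f 0 0 f') := by
  obtain ⟨s, t, hs, ht, h1, h2⟩ := h
  obtain ⟨s', t', hs', ht', h1', h2'⟩ := h'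
  refine ⟨Matrix.fromBlocks s 0 0 s', Matrix.fromBlocks t 0 0 t', hs.diag hs', ht.diag ht', ?_, ?_⟩
  · simpa [Matrix.fromBlocks_multiply] using h1.diag h1'
  · simpa [Matrix.fromBlocks_multiply] using h2.diag h2'

theorem MvN.reindex {e : Matrix ι ι R} (h : QId ν c S k e) (f : κ ≃ ι) :
    MvN ν c S k (e.submatrix f f) e := by
  refine ⟨e.submatrix f id, e.submatrix id f, h.1.reindex f (Equiv.refl _),
    h.1.reindex (Equiv.refl _) f, ?_, ?_⟩
  · rw [← Matrix.submatrix_mul _ _ _ _ _ Function.bijective_id]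
    exact h.2.reindex f f
  · rw [Matrix.submatrix_mul_equiv]; exact h.2

theorem MvN.stab_zero {e : Matrix ι ι R} (h : QId ν c S k e) (α : Type) [Fintype α]
    [DecidableEq α] : MvN ν c S k (Matrix.fromBlocks e 0 0 (0 : Matrix α α R)) e := by
  have hz := h.1.diag (Ctl.zero (ν := ν) (c := c) (S := S) (ι := α) (κ := α) h.1.pos)
  refine ⟨(Matrix.fromBlocks e 0 0 (0 : Matrix α α R)).submatrix id Sum.inl,
    (Matrix.fromBlocks e 0 0 (0 : Matrix α α R)).submatrix Sum.inl id,
    hz.submatrix Function.injective_id Sum.inl_injective,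
    hz.submatrix Sum.inl_injective Function.injective_id, ?_, ?_⟩
  · have : (Matrix.fromBlocks e 0 0 (0 : Matrix α α R)).submatrix id Sum.inl *
        (Matrix.fromBlocks e 0 0 (0 : Matrix α α R)).submatrix Sum.inl id =
        Matrix.fromBlocks (e * e) 0 0 0 := by
      ext (i | i) (j | j) <;> simp [Matrix.mul_apply]
    rw [this]
    exact h.2.diag (Nr.refl _ _)
  · have : (Matrix.fromBlocks e 0 0 (0 : Matrix α α R)).submatrix Sum.inl id *
        (Matrix.fromBlocks e 0 0 (0 : Matrix α α R)).submatrix id Sum.inl = e * e := by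
      ext i j; simp [Matrix.mul_apply]
    rw [this]; exact h.2

/-- With ss' and t't: ss't't ≈ sft ≈ (st)² ≈ e² ≈ e, and symmetrically on the other side. -/
theorem MvN.trans (hS : IsFilt S) {e : Matrix ι ι R} {f : Matrix κ κ R} {g : Matrix η η R}
    (he : QId ν c S k e) (hg : QId ν c S k g)
    (h : MvN ν c S k e f) (h' : MvN ν c S k f g) : MvN ν c S (6 * k) e g := by
  obtain ⟨s, t, hs, ht, h1, h2⟩ := h
  obtain ⟨s', t', hs', ht', h1', h2'⟩ := h'
  have hk := he.1.pos
  refine ⟨s * s', t' * t, (hs.mul hS hs').mono (by omega), (ht'.mul hS ht).mono (by omega),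
    ?_, ?_⟩
  · have a1 : Nr ν c _ (s * (s' * t') * t) (s * (t * s) * t) :=
      ((h1'.trans h2.symm).mul_left hs).mul_right ht
    have a2 := (h1.mul h1 (hs.mul hS ht) he.1).trans he.2
    rw [show s * s' * (t' * t) = s * (s' * t') * t by simp only [Matrix.mul_assoc]]
    rw [show s * (t * s) * t = s * t * (s * t) by simp only [Matrix.mul_assoc]] at a1
    exact (a1.trans a2).mono (by omega)
  · have a1 : Nr ν c _ (t' * (t * s) * s') (t' * (s' * t') * s') :=
      ((h2.trans h1'.symm).mul_left ht').mul_right hs'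
    have a2 := (h2'.mul h2' (ht'.mul hS hs') hg.1).trans hg.2
    rw [show t' * t * (s * s') = t' * (t * s) * s' by simp only [Matrix.mul_assoc]]
    rw [show t' * (s' * t') * s' = t' * s' * (t' * s') by simp only [Matrix.mul_assoc]] at a1
    exact (a1.trans a2).mono (by omega)

/-- Replacing s, t by esf, fte makes them behave as partial isometries between the ranges of e and
f. The rotation in `MvN.HT` and the swap in `MvN.exists_swap` rely on the four absorption relations.
-/
theorem MvN.normalize (hS : IsFilt S) {e : Matrix ι ι R} {f : Matrix κ κ R}
    (he : QId ν c S k e) (hf : QId ν c S k f) (h : MvN ν c S k e f) :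
    ∃ (s : Matrix ι κ R) (t : Matrix κ ι R), Ctl ν c S (3 * k) s ∧ Ctl ν c S (3 * k) t ∧
      Nr ν c (10 * k) (s * t) e ∧ Nr ν c (10 * k) (t * s) f ∧
      Nr ν c (10 * k) (e * s) s ∧ Nr ν c (10 * k) (s * f) s ∧
      Nr ν c (10 * k) (f * t) t ∧ Nr ν c (10 * k) (t * e) t := by
  have hk := he.1.pos
  obtain ⟨s, t, hs, ht, h1, h2⟩ := h
  have key : ∀ {ι κ : Type} [Fintype ι] [DecidableEq ι] [Fintype κ] [DecidableEq κ]
      {e : Matrix ι ι R} {f : Matrix κ κ R} {s : Matrix ι κ R} {t : Matrix κ ι R},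
      QId ν c S k e → QId ν c S k f → Ctl ν c S k s → Ctl ν c S k t → Nr ν c k (s * t) e →
      Nr ν c k (t * s) f → Nr ν c (10 * k) (e * s * f * (f * t * e)) e := by
    intro ι κ _ _ _ _ e f s t he hf hs ht h1 h2
    have a1 : Nr ν c _ (s * (f * f) * t) (s * (t * s) * t) :=
      ((hf.2.trans h2.symm).mul_left hs).mul_right ht
    rw [show s * (t * s) * t = s * t * (s * t) by simp only [Matrix.mul_assoc]] at a1
    have a2 := a1.trans ((h1.mul h1 (hs.mul hS ht) he.1).trans he.2)
    have a3 := (((a2.mul_left he.1).mul_right he.1).trans (he.2.mul_right he.1)).trans he.2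
    rw [show e * s * f * (f * t * e) = e * (s * (f * f) * t) * e by
      simp only [Matrix.mul_assoc]]
    exact a3.mono (by omega)
  refine ⟨e * s * f, f * t * e, ((he.1.mul hS hs).mul hS hf.1).mono (by omega),
    ((hf.1.mul hS ht).mul hS he.1).mono (by omega), key he hf hs ht h1 h2,
    key hf he ht hs h2 h1, ?_, ?_, ?_, ?_⟩
  · rw [show e * (e * s * f) = e * e * (s * f) by simp only [Matrix.mul_assoc],
      Matrix.mul_assoc e s f]
    exact (he.2.mul_right (hs.mul hS hf.1)).mono (by omega)
  · rw [Matrix.mul_assoc (e * s) f f]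
    exact (hf.2.mul_left (he.1.mul hS hs)).mono (by omega)
  · rw [show f * (f * t * e) = f * f * (t * e) by simp only [Matrix.mul_assoc],
      Matrix.mul_assoc f t e]
    exact (hf.2.mul_right (ht.mul hS he.1)).mono (by omega)
  · rw [Matrix.mul_assoc (f * t) e e]
    exact (he.2.mul_left (hf.1.mul hS ht)).mono (by omega)

theorem HT.of_qid_path {f : ℝ → Matrix ι ι R} (hf : Continuous f)
    (h : ∀ t ∈ Set.Icc (0 : ℝ) 1, QId ν c S k (f t)) (hl : k + 1 ≤ l) :
    HT ν S 0 (c.q l) (f 0) (f 1) := by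
  refine (if_pos rfl : HT ν S 0 (c.q l) (f 0) (f 1) = _).mpr
    (JoinedIn.ofLine hf.continuousOn rfl rfl ?_)
  rintro _ ⟨t, ht, rfl⟩
  have := (h t ht).cy hl
  simpa [Cy] using this

theorem HT.of_qinv_path {f g : ℝ → Matrix ι ι R} (hf : Continuous f) (hg : Continuous g)
    (h : ∀ t ∈ Set.Icc (0 : ℝ) 1, QInv ν c S k (f t) (g t)) (hl : k + 1 ≤ l) :
    HT ν S 1 (c.q l) (f 0) (f 1) := by
  refine (if_neg (by decide) : HT ν S 1 (c.q l) (f 0) (f 1) = _).mpr ⟨g 0, g 1,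
    JoinedIn.ofLine (f := fun t => (f t, g t)) (hf.prodMk hg).continuousOn rfl rfl ?_⟩
  rintro _ ⟨t, ht, rfl⟩
  exact (h t ht).qp hl

theorem kcls_eq_of_HT {i : Fin 2} (hS : IsFilt S) {a b : Matrix ι ι R}
    (h : HT ν S i (c.q k) a b) (ha : Cy ν S i (c.q k) a) (hb : Cy ν S i (c.q k) b) :
    kcls ν S i (c.q k) a ha = kcls ν S i (c.q k) b hb :=
  kcls_eq_of_SH hS (c.good k) _ _
    (SH.of_HT hS (c.good k) (h.mono ((c.good k).le_four i)))

theorem Ctl.line {X Y : Matrix ι κ R} (hX : Ctl ν c S k X) (hY : Ctl ν c S k Y) {t : ℝ}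
    (ht : t ∈ Set.Icc (0 : ℝ) 1) :
    Ctl ν c S k (((1 - t : ℝ) : ℂ) • X + (t : ℂ) • Y) :=
  ⟨hX.pos, fun i j => Submodule.add_mem _ (Submodule.smul_mem _ _ (hX.mem i j))
    (Submodule.smul_mem _ _ (hY.mem i j)), ν.line_le hX.bd hY.bd ht⟩

theorem Nr.line {X Y : Matrix ι κ R} (h : Nr ν c k X Y) {t : ℝ}
    (ht : t ∈ Set.Icc (0 : ℝ) 1) : Nr ν c k (((1 - t : ℝ) : ℂ) • X + (t : ℂ) • Y) X := by
  have e : ((1 - t : ℝ) : ℂ) • X + (t : ℂ) • Y - X = (t : ℂ) • (Y - X) := by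
    push_cast; module
  have h1 : ‖(t : ℂ)‖ ≤ 1 := by
    rw [Complex.norm_real, Real.norm_of_nonneg ht.1]; exact ht.2
  rw [Nr, e]
  exact (ν.smul_le _ _).trans ((mul_le_of_le_one_left (ν.nonneg _) h1).trans h.symm)

/-- A single approximate inverse of u serves along the whole segment from u to u'. -/
theorem HT.line_one {u v u' : Matrix ι ι R} (h : QInv ν c S k u v) (hu' : Ctl ν c S k u')
    (hu : Nr ν c k u u') (hl : 3 * k + 1 ≤ l) : HT ν S 1 (c.q l) u u' := by
  have hk := h.1.pos
  have := HT.of_qinv_path (ν := ν) (c := c) (S := S) (k := 3 * k) (l := l)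
    (f := fun t : ℝ => ((1 - t : ℝ) : ℂ) • u + (t : ℂ) • u') (g := fun _ => v)
    (by fun_prop) (by fun_prop) ?_ hl
  · simpa using this
  · intro t ht
    have h1 := h.1.line hu' ht
    have h2 := hu.line ht
    exact ⟨h1.mono (by omega), h.2.1.mono (by omega),
      ((h2.mul_right h.2.1).trans h.2.2.1).mono (by omega),
      ((h2.mul_left h.2.1).trans h.2.2.2).mono (by omega)⟩

theorem norm_cos_sin (x : ℝ) : ‖((Real.cos x : ℝ) : ℂ)‖ ≤ 1 ∧ ‖((Real.sin x : ℝ) : ℂ)‖ ≤ 1 := by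
  simp only [Complex.norm_real, Real.norm_eq_abs]
  exact ⟨Real.abs_cos_le_one x, Real.abs_sin_le_one x⟩

/-- Murray-von Neumann equivalent quasi-idempotents are homotopic after stabilization. -/
theorem MvN.HT (hS : IsFilt S) {e : Matrix ι ι R} {f : Matrix κ κ R}
    (he : QId ν c S k e) (hf : QId ν c S k f) (h : MvN ν c S k e f) (hl : 20 * k ≤ l) :
    HT ν S 0 (c.q l) (Matrix.fromBlocks e 0 0 0) (Matrix.fromBlocks 0 0 0 f) := by
  have hk := he.1.pos
  obtain ⟨s, t, hs, ht, hst, hts, hes, hsf, hft, hte⟩ := h.normalize hS he hf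
  set co : ℝ → ℂ := fun x => ((Real.cos (x * (Real.pi / 2)) : ℝ) : ℂ) with hco
  set si : ℝ → ℂ := fun x => ((Real.sin (x * (Real.pi / 2)) : ℝ) : ℂ) with hsi
  have h2 : ∀ x, co x * co x + si x * si x = 1 := fun x => by
    simp only [co, si]; norm_cast
    nlinarith [Real.sin_sq_add_cos_sq (x * (Real.pi / 2))]
  have nc : ∀ x, ‖co x‖ ≤ 1 := fun x => (norm_cos_sin _).1
  have ns : ∀ x, ‖si x‖ ≤ 1 := fun x => (norm_cos_sin _).2
  have nm : ∀ {a b : ℂ}, ‖a‖ ≤ 1 → ‖b‖ ≤ 1 → ‖a * b‖ ≤ 1 := fun ha hb => by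
    rw [norm_mul]; exact mul_le_one₀ ha (norm_nonneg _) hb
  -- With C = cos and D = sin, the matrix [[C²e, CDs], [CDt, D²f]] is the projection rotated from e
  -- to f. Its square has the blocks C²(C² + D²)e, CD(C² + D²)s, and so on, up to errors, because es
  -- ≈ s ≈ sf and ft ≈ t ≈ te.
  have := HT.of_qid_path (ν := ν) (c := c) (S := S) (k := 19 * k) (l := l)
    (f := fun x : ℝ => Matrix.fromBlocks ((co x * co x) • e) ((co x * si x) • s)
      ((co x * si x) • t) ((si x * si x) • f)) (by fun_prop) ?_ (by omega)
  · simpa [hco, hsi] using this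
  · intro x _
    set C := co x
    set D := si x
    have hCD : C * C + D * D = 1 := h2 x
    have c2 : ‖C * C‖ ≤ 1 := nm (nc x) (nc x)
    have d2 : ‖D * D‖ ≤ 1 := nm (ns x) (ns x)
    have cd : ‖C * D‖ ≤ 1 := nm (nc x) (ns x)
    refine ⟨((((he.1.mono (by omega)).smul c2).blocks (hs.smul cd) (ht.smul cd)
      ((hf.1.mono (by omega)).smul d2))).mono (by omega), ?_⟩
    rw [Matrix.fromBlocks_multiply]
    refine (Nr.blocks (k := 10 * k + 1) ?_ ?_ ?_ ?_).mono (by omega)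
    · have a1 := ((he.2.mono (show k ≤ 10 * k by omega)).smul (nm c2 c2)).add
        (hst.smul (nm cd cd))
      convert a1 using 1
      · simp only [Matrix.smul_mul, Matrix.mul_smul, smul_smul]
      · trans ((C * C) * (C * C + D * D)) • e
        · rw [hCD, mul_one]
        · module
    · have a1 := (hes.smul (nm c2 cd)).add (hsf.smul (nm cd d2))
      convert a1 using 1
      · simp only [Matrix.smul_mul, Matrix.mul_smul, smul_smul]
        ring_nf
      · trans ((C * D) * (C * C + D * D)) • s
        · rw [hCD, mul_one]
        · module
    · have a1 := (hte.smul (nm c2 cd)).add (hft.smul (nm cd d2))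
      convert a1 using 1
      · simp only [Matrix.smul_mul, Matrix.mul_smul, smul_smul]
      · trans ((C * D) * (C * C + D * D)) • t
        · rw [hCD, mul_one]
        · module
    · have a1 := (hts.smul (nm cd cd)).add
        ((hf.2.mono (show k ≤ 10 * k by omega)).smul (nm d2 d2))
      convert a1 using 1
      · simp only [Matrix.smul_mul, Matrix.mul_smul, smul_smul]
      · trans ((D * D) * (C * C + D * D)) • f
        · rw [hCD, mul_one]
        · module

/-- Murray-von Neumann equivalent quasi-idempotents have the same class. -/
theorem MvN.kcls_eq (hS : IsFilt S) {e : Matrix ι ι R} {f : Matrix κ κ R}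
    (he : QId ν c S k e) (hf : QId ν c S k f) (h : MvN ν c S k e f) (hl : 20 * k ≤ l)
    (ha : Cy ν S 0 (c.q l) e) (hb : Cy ν S 0 (c.q l) f) :
    kcls ν S 0 (c.q l) e ha = kcls ν S 0 (c.q l) f hb := by
  have hg := c.good l
  have h0 : ∀ (α : Type) [Fintype α] [DecidableEq α], Cy ν S 0 (c.q l) (0 : Matrix α α R) :=
    fun α _ _ => Cy.dm (i := 0) hS hg.ε_pos hg.one_le
  have h1 := kcls_eq_of_HT hS (h.HT hS he hf hl) (ha.diag (h0 _)) ((h0 _).diag hb)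
  rw [kcls_diag hS hg ha (h0 _), kcls_diag hS hg (h0 _) hb] at h1
  have h2 : ∀ (α : Type) [Fintype α] [DecidableEq α],
      kcls ν S 0 (c.q l) (0 : Matrix α α R) (h0 α) = 0 := fun α _ _ => kcls_dm hS hg (i := 0) _
  rwa [h2, h2, add_zero, zero_add] at h1

/-- The column (e, 1 - e) times the row (e, 1 - e) is close to diag(e, 1 - e), and the row times the
column is e² + (1 - e)² ≈ 1. Both are cut out of square block matrices in order to inherit their
bounds. -/
theorem MvN.compl (hS : IsFilt S) {e : Matrix ι ι R} (h : QId ν c S k e) :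
    MvN ν c S (4 * k + 4) (Matrix.fromBlocks e 0 0 (1 - e)) (1 : Matrix ι ι R) := by
  have hk := h.1.pos
  have hc := h.compl hS
  have hX : Ctl ν c S (k + 2) (Matrix.fromBlocks e 0 (1 - e) 0 : Matrix (ι ⊕ ι) (ι ⊕ ι) R) :=
    (h.1.mono (Nat.le_succ k)).blocks (Ctl.zero hc.1.pos) hc.1 (Ctl.zero hc.1.pos)
  have hY : Ctl ν c S (k + 2) (Matrix.fromBlocks e (1 - e) 0 0 : Matrix (ι ⊕ ι) (ι ⊕ ι) R) :=
    (h.1.mono (Nat.le_succ k)).blocks hc.1 (Ctl.zero hc.1.pos) (Ctl.zero hc.1.pos)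
  refine ⟨(Matrix.fromBlocks e 0 (1 - e) 0 : Matrix (ι ⊕ ι) (ι ⊕ ι) R).submatrix id Sum.inl,
    (Matrix.fromBlocks e (1 - e) 0 0 : Matrix (ι ⊕ ι) (ι ⊕ ι) R).submatrix Sum.inl id,
    (hX.submatrix Function.injective_id Sum.inl_injective).mono (by omega),
    (hY.submatrix Sum.inl_injective Function.injective_id).mono (by omega), ?_, ?_⟩
  · have : (Matrix.fromBlocks e 0 (1 - e) 0 : Matrix (ι ⊕ ι) (ι ⊕ ι) R).submatrix id Sum.inl *
        (Matrix.fromBlocks e (1 - e) 0 0 : Matrix (ι ⊕ ι) (ι ⊕ ι) R).submatrix Sum.inl id =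
        Matrix.fromBlocks (e * e) (e * (1 - e)) ((1 - e) * e) ((1 - e) * (1 - e)) := by
      ext (i | i) (j | j) <;> simp [Matrix.mul_apply]
    rw [this]
    exact (Nr.blocks (h.2.mono (Nat.le_succ k)) ((h.mul_compl).mono (Nat.le_succ k))
      ((h.compl_mul).mono (Nat.le_succ k)) hc.2).mono (by omega)
  · have : (Matrix.fromBlocks e (1 - e) 0 0 : Matrix (ι ⊕ ι) (ι ⊕ ι) R).submatrix Sum.inl id *
        (Matrix.fromBlocks e 0 (1 - e) 0 : Matrix (ι ⊕ ι) (ι ⊕ ι) R).submatrix id Sum.inl =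
        e * e + (1 - e) * (1 - e) := by
      ext i j; simp [Matrix.mul_apply]
    rw [this]
    have := (h.2.mono (Nat.le_succ k)).add hc.2
    rw [add_sub_cancel] at this
    exact this.mono (by omega)

end degreeZero


/-! ### The swindle for idempotents -/

/-- `ι × {0, …, n} ≃ ι ⊕ ι × {1, …, n}`, singling out the index `i₀`. -/
def splitEquiv (ι : Type) {n : ℕ} (i₀ : Fin (n + 1)) : ι × Fin (n + 1) ≃ ι ⊕ ι × Fin n :=
  (Equiv.ofBijective (fun x : ι ⊕ ι × Fin n =>
    Sum.elim (fun i => (i, i₀)) (fun y => (y.1, i₀.succAbove y.2)) x) (by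
      constructor
      · rintro (x | ⟨x, i⟩) (y | ⟨y, j⟩) h
        · simpa using h
        · simp only [Sum.elim_inl, Sum.elim_inr, Prod.mk.injEq] at h
          exact absurd h.2.symm (Fin.succAbove_ne _ _)
        · simp only [Sum.elim_inl, Sum.elim_inr, Prod.mk.injEq] at h
          exact absurd h.2 (Fin.succAbove_ne _ _)
        · simp only [Sum.elim_inr, Prod.mk.injEq] at h
          rw [h.1, Fin.succAbove_right_injective h.2]
      · rintro ⟨x, j⟩
        rcases Fin.eq_self_or_eq_succAbove i₀ j with rfl | ⟨y, rfl⟩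
        exacts [⟨Sum.inl x, rfl⟩, ⟨Sum.inr (x, y), rfl⟩])).symm

theorem splitEquiv_symm_inl {ι : Type} {n : ℕ} (i₀ : Fin (n + 1)) (x : ι) :
    (splitEquiv ι i₀).symm (Sum.inl x) = (x, i₀) := rfl

theorem splitEquiv_symm_inr {ι : Type} {n : ℕ} (i₀ : Fin (n + 1)) (x : ι × Fin n) :
    (splitEquiv ι i₀).symm (Sum.inr x) = (x.1, i₀.succAbove x.2) := rfl

section swindle

variable {R : Type*} [Ring R] [Algebra ℂ R] [TopologicalSpace R]
  [IsTopologicalRing R] [ContinuousSMul ℂ R] {ν : MNorm R} {c : Scale} {S : ℝ →o Submodule ℂ R}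
  {k l : ℕ}
  {ι κ η α β : Type} [Fintype ι] [DecidableEq ι] [Fintype κ]
  [DecidableEq κ] [Fintype η] [DecidableEq η] [Fintype α] [DecidableEq α] [Fintype β]
  [DecidableEq β]

theorem blockDiagonal_ite {n : ℕ} (i₀ : Fin (n + 1)) (a : Matrix ι ι R) :
    Matrix.blockDiagonal (fun i => if i = i₀ then a else 1) =
      (Matrix.fromBlocks a 0 0 (1 : Matrix (ι × Fin n) (ι × Fin n) R)).submatrix
        (splitEquiv ι i₀) (splitEquiv ι i₀) := by
  ext x y
  obtain ⟨x, rfl⟩ := (splitEquiv ι i₀).symm.surjective x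
  obtain ⟨y, rfl⟩ := (splitEquiv ι i₀).symm.surjective y
  simp only [Matrix.submatrix_apply, Equiv.apply_symm_apply]
  rcases x with x | x <;> rcases y with y | y <;>
    simp [splitEquiv_symm_inl, splitEquiv_symm_inr, Matrix.blockDiagonal_apply,
      Fin.succAbove_ne, (Fin.succAbove_ne _ _).symm, Matrix.one_apply, Prod.ext_iff, and_comm,
      ite_and]
  split_ifs <;> rfl

/-- Uniform continuity of ‖f(s) - f(t)‖ on the square. The number of steps depends on the path and
is not controlled, which is harmless by the block diagonal bounds. -/
theorem exists_subdivision (ν : MNorm R) {f : unitInterval → Matrix ι κ R} (hf : Continuous f)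
    {ε : ℝ} (hε : 0 < ε) : ∃ (n : ℕ) (p : Fin (n + 1) → unitInterval), p 0 = 0 ∧
      p (Fin.last n) = 1 ∧ ∀ j : Fin n, ν.nrm (f (p j.castSucc) - f (p j.succ)) ≤ ε := by
  have hg : Continuous fun x : unitInterval × unitInterval => ν.nrm (f x.1 - f x.2) :=
    ν.cont.comp ((hf.comp continuous_fst).sub (hf.comp continuous_snd))
  obtain ⟨δ, hδ, h⟩ := Metric.uniformContinuous_iff.1
    (CompactSpace.uniformContinuous_of_continuous hg) ε hε
  obtain ⟨n, hn⟩ := exists_nat_one_div_lt hδ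
  have hn0 : (0 : ℝ) < n + 1 := by positivity
  refine ⟨n + 1, fun j => ⟨(j : ℕ) / (n + 1 : ℝ), by positivity, ?_⟩, ?_, ?_, fun j => ?_⟩
  · rw [div_le_one hn0]
    have := j.is_le
    exact_mod_cast this
  · ext; simp
  · ext; simp [hn0.ne']
  · set s : unitInterval := ⟨((j.castSucc : Fin (n + 2)) : ℕ) / (n + 1 : ℝ), _⟩
    set t : unitInterval := ⟨((j.succ : Fin (n + 2)) : ℕ) / (n + 1 : ℝ), _⟩
    have hd : dist (s, t) (s, s) < δ := by
      rw [Prod.dist_eq, dist_self, max_lt_iff]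
      refine ⟨hδ, ?_⟩
      have : dist t s = 1 / (n + 1 : ℝ) := by
        rw [Subtype.dist_eq, Real.dist_eq]
        simp only [s, t, Fin.val_succ, Fin.val_castSucc]
        rw [← sub_div]
        push_cast
        rw [add_sub_cancel_left, abs_of_pos (by positivity)]
      rw [this]; exact hn
    have h1 := h hd
    simp only [sub_self, ν.zero, dist_zero_right, Real.norm_eq_abs] at h1
    exact (le_abs_self _).trans h1.le

/-- The cyclic shift matrix and its inverse. -/
def shiftMat (R : Type*) [Ring R] (ι : Type) [DecidableEq ι] (n : ℕ) :
    Matrix (ι × Fin (n + 1)) (ι × Fin (n + 1)) R :=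
  (1 : Matrix (ι × Fin (n + 1)) (ι × Fin (n + 1)) R).submatrix
    ((Equiv.refl ι).prodCongr (finRotate (n + 1))) id

/-- The inverse of the cyclic shift matrix. -/
def shiftMat' (R : Type*) [Ring R] (ι : Type) [DecidableEq ι] (n : ℕ) :
    Matrix (ι × Fin (n + 1)) (ι × Fin (n + 1)) R :=
  (1 : Matrix (ι × Fin (n + 1)) (ι × Fin (n + 1)) R).submatrix id
    ((Equiv.refl ι).prodCongr (finRotate (n + 1)))

theorem shift_mul_shift' (n : ℕ) : shiftMat R ι n * shiftMat' R ι n = 1 := by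
  rw [shiftMat, shiftMat', ← Matrix.submatrix_mul _ _ _ _ _ Function.bijective_id, mul_one]
  exact Matrix.submatrix_one_equiv _

theorem shift'_mul_shift (n : ℕ) : shiftMat' R ι n * shiftMat R ι n = 1 := by
  rw [shiftMat, shiftMat', Matrix.submatrix_mul_equiv]; simp

theorem shift_conj {n : ℕ} (f : Fin (n + 1) → Matrix ι ι R) :
    shiftMat R ι n * Matrix.blockDiagonal f * shiftMat' R ι n =
      Matrix.blockDiagonal fun j => f (finRotate (n + 1) j) := by
  have h1 : shiftMat R ι n * Matrix.blockDiagonal f = (Matrix.blockDiagonal f).submatrix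
      ((Equiv.refl ι).prodCongr (finRotate (n + 1))) id := by
    simpa [shiftMat] using Matrix.one_submatrix_mul
      ((Equiv.refl ι).prodCongr (finRotate (n + 1))) (Equiv.refl _) (Matrix.blockDiagonal f)
  rw [h1]
  have h2 := Matrix.mul_submatrix_one (Equiv.refl _)
      ((Equiv.refl ι).prodCongr (finRotate (n + 1))) ((Matrix.blockDiagonal f).submatrix
      ((Equiv.refl ι).prodCongr (finRotate (n + 1))) id)
  refine Eq.trans (by simpa [shiftMat'] using h2) ?_
  ext ⟨x, i⟩ ⟨y, j⟩
  simp [Matrix.blockDiagonal_apply]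

theorem Ctl.shift (hS : IsFilt S) (n : ℕ) : Ctl ν c S 1 (shiftMat R ι n) :=
  (Ctl.one hS le_rfl).submatrix (Equiv.injective _) Function.injective_id

theorem Ctl.shift' (hS : IsFilt S) (n : ℕ) : Ctl ν c S 1 (shiftMat' R ι n) :=
  (Ctl.one hS le_rfl).submatrix Function.injective_id (Equiv.injective _)

theorem finRotate_castSucc' {n : ℕ} (j : Fin n) : finRotate (n + 1) j.castSucc = j.succ := by
  rw [finRotate_apply]; exact Fin.coeSucc_eq_succ

/-- Homotopic quasi-idempotents are stably Murray-von Neumann equivalent, with bounds that do not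
depend on the homotopy. -/
theorem HT.mvN (hS : IsFilt S) (hk : 1 ≤ k) {e f : Matrix ι ι R} (h : HT ν S 0 (c.q k) e f) :
    ∃ n : ℕ, MvN ν c S (1000 * k) (Matrix.fromBlocks e 0 0 (1 : Matrix (ι × Fin n) (ι × Fin n) R))
      (Matrix.fromBlocks f 0 0 (1 : Matrix (ι × Fin n) (ι × Fin n) R)) := by
  have h' : JoinedIn {x : Matrix ι ι R | QI ν S (c.q k) x} e f := by simpa [HT] using h
  obtain ⟨n, p, hp0, hp1, hp⟩ := exists_subdivision ν h'.somePath.continuous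
    (mul_pos (c.pow_pos k) c.δ_pos)
  set E : Fin (n + 1) → Matrix ι ι R := fun j => h'.somePath (p j) with hE
  have hQ : ∀ j, QId ν c S k (E j) := fun j => QI.qid (h'.somePath_mem (p j)) hk
  have hE0 : E 0 = e := by simp [hE, hp0]
  have hE1 : E (Fin.last n) = f := by simp [hE, hp1]
  have hEE : ∀ j : Fin n, Nr ν c k (E j.castSucc) (E j.succ) := hp
  -- In block j the sum E_j + g_j is e for j = 0 and 1 otherwise. After a cyclic shift of g, block j
  -- contains E_j + g_{j+1}, which is close to 1 for j < n and is f for j = n, because g₀ = 0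
  -- returns to the last place. Moving the complements by one block thus turns e with n identities
  -- into f with n identities.
  set g : Fin (n + 1) → Matrix ι ι R := fun j => if j = 0 then 0 else 1 - E j with hg
  have hgc : ∀ j, Ctl ν c S (k + 1) (g j) := fun j => by
    simp only [hg]; split_ifs
    exacts [Ctl.zero (by omega), ((hQ j).compl hS).1]
  have hsucc : ∀ j : Fin n, g (finRotate (n + 1) j.castSucc) = 1 - E j.succ := fun j => by
    rw [finRotate_castSucc']; simp [hg, Fin.succ_ne_zero]
  have hlast : g (finRotate (n + 1) (Fin.last n)) = 0 := by rw [finRotate_last]; simp [hg]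
  have hcs : ∀ j : Fin n, Nr ν c (k + 2) (1 - E j.succ) (1 - E j.castSucc) := fun j =>
    ((Nr.refl k _).sub (hEE j).symm).mono (by omega)
  have hEg : ∀ j, Nr ν c (3 * k + 5) (E j * g (finRotate (n + 1) j)) 0 := fun j => by
    refine Fin.lastCases ?_ (fun j => ?_) j
    · rw [hlast, mul_zero]; exact Nr.refl _ _
    · rw [hsucc]
      exact (((hcs j).mul_left (hQ _).1).trans (hQ _).mul_compl).mono (by omega)
  have hgE : ∀ j, Nr ν c (3 * k + 5) (g (finRotate (n + 1) j) * E j) 0 := fun j => by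
    refine Fin.lastCases ?_ (fun j => ?_) j
    · rw [hlast, zero_mul]; exact Nr.refl _ _
    · rw [hsucc]
      exact (((hcs j).mul_right (hQ _).1).trans (hQ _).compl_mul).mono (by omega)
  have hEg0 : ∀ j, Nr ν c (3 * k + 5) (E j * g j) 0 := fun j => by
    simp only [hg]; split_ifs
    · rw [mul_zero]; exact Nr.refl _ _
    · exact (hQ j).mul_compl.mono (by omega)
  have hgE0 : ∀ j, Nr ν c (3 * k + 5) (g j * E j) 0 := fun j => by
    simp only [hg]; split_ifs
    · rw [zero_mul]; exact Nr.refl _ _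
    · exact (hQ j).compl_mul.mono (by omega)
  have hst : ∀ j, Nr ν c (3 * k + 5) (E j * E j + g j * g j) (if j = 0 then e else 1) :=
    fun j => by
      simp only [hg]; split_ifs with hj
      · rw [mul_zero, add_zero, hj, hE0]
        rw [← hE0]; exact (hQ _).2.mono (by omega)
      · have := ((hQ j).2.mono (Nat.le_succ k)).add ((hQ j).compl hS).2
        rw [add_sub_cancel] at this
        exact this.mono (by omega)
  have hts : ∀ j, Nr ν c (3 * k + 5) (E j * E j + g (finRotate (n + 1) j) *
      g (finRotate (n + 1) j)) (if j = Fin.last n then f else 1) := fun j => by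
    refine Fin.lastCases ?_ (fun j => ?_) j
    · rw [hlast, mul_zero, add_zero, if_pos rfl, ← hE1]; exact (hQ _).2.mono (by omega)
    · rw [hsucc, if_neg (Fin.castSucc_lt_last j).ne]
      have := ((hQ j.castSucc).2.mono (show k ≤ k + 3 by omega)).add
        ((((hQ j.succ).compl hS).2.trans (hcs j)).mono (show _ ≤ k + 3 by omega))
      rw [add_sub_cancel] at this
      exact this.mono (by omega)
  set P := shiftMat R ι n
  set P' := shiftMat' R ι n
  have hPP' : P * P' = 1 := shift_mul_shift' n
  have hP'P : P' * P = 1 := shift'_mul_shift n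
  set D := Matrix.blockDiagonal E with hD
  set G := Matrix.blockDiagonal g with hG
  have cD : Ctl ν c S k D := Ctl.blockDiagonal hk fun j => (hQ j).1
  have cG : Ctl ν c S (k + 1) G := Ctl.blockDiagonal (by omega) hgc
  have cP : Ctl ν c S 1 P := Ctl.shift hS n
  have cP' : Ctl ν c S 1 P' := Ctl.shift' hS n
  have z0 : (0 : Matrix (ι × Fin (n + 1)) (ι × Fin (n + 1)) R) =
      Matrix.blockDiagonal fun _ => 0 := Matrix.blockDiagonal_zero.symm
  -- The four cross terms vanish approximately: up to shifts their blocks are products of E_j with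
  -- g_j or g_{j+1}, and both are close to 0 in either order.
  have m1 : Nr ν c (3 * k + 6) (D * P * G) 0 := by
    have : D * P * G = D * (P * G * P') * P := by
      rw [show D * (P * G * P') * P = D * P * G * (P' * P) by simp only [Matrix.mul_assoc], hP'P,
        Matrix.mul_one]
    rw [this, hG, shift_conj, hD, ← Matrix.blockDiagonal_mul,
      ← Matrix.zero_mul (n := ι × Fin (n + 1)) P]
    refine Nr.mul_right (l := 3 * k + 5) ?_ cP
    rw [z0]; exact Nr.blockDiagonal hEg
  have m2 : Nr ν c (3 * k + 6) (G * P' * D) 0 := by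
    have : G * P' * D = P' * ((P * G * P') * D) := by
      rw [show P' * ((P * G * P') * D) = (P' * P) * (G * P' * D) by
        simp only [Matrix.mul_assoc], hP'P, Matrix.one_mul]
    rw [this, hG, shift_conj, hD, ← Matrix.blockDiagonal_mul,
      ← Matrix.mul_zero (m := ι × Fin (n + 1)) P', show 3 * k + 6 = 1 + (3 * k + 5) by omega]
    refine Nr.mul_left cP' ?_
    rw [z0]; exact Nr.blockDiagonal hgE
  have m3 : Nr ν c (3 * k + 6) (D * G * P') 0 := by
    rw [hG, hD, ← Matrix.blockDiagonal_mul, ← Matrix.zero_mul (n := ι × Fin (n + 1)) P']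
    refine Nr.mul_right (l := 3 * k + 5) ?_ cP'
    rw [z0]; exact Nr.blockDiagonal hEg0
  have m4 : Nr ν c (3 * k + 6) (P * (G * D)) 0 := by
    rw [hG, hD, ← Matrix.blockDiagonal_mul, ← Matrix.mul_zero (m := ι × Fin (n + 1)) P,
      show 3 * k + 6 = 1 + (3 * k + 5) by omega]
    refine Nr.mul_left cP ?_
    rw [z0]; exact Nr.blockDiagonal hgE0
  have hmv : MvN ν c S (4 * k + 10)
      (Matrix.blockDiagonal (fun j => if j = (0 : Fin (n + 1)) then e else 1))
      (Matrix.blockDiagonal (fun j => if j = Fin.last n then f else 1)) := by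
    -- The equivalence keeps the diagonal part D in place and shifts G. Its two products are D² + G²
    -- and D² + PG²P' plus cross terms.
    refine ⟨D + G * P', D + P * G, ((cD.mono (show k ≤ k + 2 by omega)).add
      (cG.mul hS cP')).mono (by omega), ((cD.mono (show k ≤ 1 + (k + 1) by omega)).add
      (cP.mul hS cG)).mono (by omega), ?_, ?_⟩
    · have : (D + G * P') * (D + P * G) = D * D + G * G + (D * P * G + G * P' * D) := by
        rw [Matrix.add_mul, Matrix.mul_add, Matrix.mul_add,
          show G * P' * (P * G) = G * (P' * P) * G by simp only [Matrix.mul_assoc], hP'P,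
          Matrix.mul_one, Matrix.mul_assoc D P G]
        abel
      rw [this]
      have hb : Nr ν c (3 * k + 5) (D * D + G * G)
          (Matrix.blockDiagonal (fun j => if j = (0 : Fin (n + 1)) then e else 1)) := by
        rw [hD, hG, ← Matrix.blockDiagonal_mul, ← Matrix.blockDiagonal_mul,
          ← Matrix.blockDiagonal_add]
        exact Nr.blockDiagonal hst
      have := (hb.mono (show _ ≤ 3 * k + 7 by omega)).add (m1.add m2)
      rw [add_zero, add_zero] at this
      exact this.mono (by omega)
    · have : (D + P * G) * (D + G * P') = D * D + P * (G * G) * P' +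
          (D * G * P' + P * (G * D)) := by
        simp only [Matrix.add_mul, Matrix.mul_add, Matrix.mul_assoc]
        abel
      rw [this]
      have hb : Nr ν c (3 * k + 5) (D * D + P * (G * G) * P')
          (Matrix.blockDiagonal (fun j => if j = Fin.last n then f else 1)) := by
        rw [hD, hG, ← Matrix.blockDiagonal_mul, ← Matrix.blockDiagonal_mul, shift_conj,
          ← Matrix.blockDiagonal_add]
        exact Nr.blockDiagonal hts
      have := (hb.mono (show _ ≤ 3 * k + 7 by omega)).add (m3.add m4)
      rw [add_zero, add_zero] at this
      exact this.mono (by omega)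
  -- The special block is the first one on the left and the last one on the right; each is singled
  -- out by its own bijection.
  rw [blockDiagonal_ite, blockDiagonal_ite] at hmv
  have he := ((hQ 0).diag (QId.one (ι := ι × Fin n) hS hk)).mono (show k ≤ 14 * k by omega)
  have hf := ((hQ (Fin.last n)).diag (QId.one (ι := ι × Fin n) hS hk)).mono
    (show k ≤ 14 * k by omega)
  rw [hE0] at he
  rw [hE1] at hf
  have t1 := (MvN.reindex he (splitEquiv ι 0)).symm.trans hS he (hf.reindex _)
    (hmv.mono (by omega))
  have hk2 : 14 * k ≤ 6 * (14 * k) := by omega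
  exact ⟨n, (t1.trans hS (he.mono hk2) (hf.mono hk2)
    ((MvN.reindex hf (splitEquiv ι (Fin.last n))).mono hk2)).mono (by omega)⟩

end swindle


/-! ### From equal classes in K₀ to stable equivalence -/

section cancellation

variable {R : Type*} [Ring R] [Algebra ℂ R] [TopologicalSpace R]
  [IsTopologicalRing R] [ContinuousSMul ℂ R] {ν : MNorm R} {c : Scale} {S : ℝ →o Submodule ℂ R}
  {i : Fin 2} {q q' : Param} {k l : ℕ}
  {ι κ η α β : Type} [Fintype ι] [DecidableEq ι] [Fintype κ]
  [DecidableEq κ] [Fintype η] [DecidableEq η] [Fintype α] [DecidableEq α] [Fintype β]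
  [DecidableEq β]

theorem four_mono (hq : q ≤ q') : four i q ≤ four i q' := by
  refine ⟨mul_le_mul_of_nonneg_left hq.1 (by norm_num), ?_,
    mul_le_mul_of_nonneg_left hq.2.2 (by norm_num)⟩
  change (if i = 0 then q.r else 2 * q.r) ≤ if i = 0 then q'.r else 2 * q'.r
  have := hq.2.1
  split_ifs <;> linarith

theorem SH.mono (hq : q ≤ q') {a : Matrix ι ι R} {b : Matrix κ κ R}
    (h : SH ν S i q a b) : SH ν S i q' a b := by
  obtain ⟨l, l', τ, h⟩ := h.elim
  exact SH.intro τ (h.mono (four_mono hq))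

/-- Adding d' to both sides completes the unknown common summand d to a known matrix z. -/
theorem SH.cancel (hS : IsFilt S) (hq : q.Good) {a : Matrix ι ι R} {b : Matrix κ κ R}
    {d : Matrix η η R} {d' : Matrix α α R} {z : Matrix β β R} (ha : Cy ν S i q a)
    (hb : Cy ν S i q b) (hd : Cy ν S i q d) (hd' : Cy ν S i q d') (hz : Cy ν S i q z)
    (hdz : SH ν S i q (Matrix.fromBlocks d 0 0 d') z)
    (h : SH ν S i q (Matrix.fromBlocks a 0 0 d) (Matrix.fromBlocks b 0 0 d)) :
    SH ν S i q (Matrix.fromBlocks a 0 0 z) (Matrix.fromBlocks b 0 0 z) := by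
  have h1 := SH.diag_left hS hq (hd.diag hd') hz hdz ha
  have h2 := SH.diag_left hS hq (hd.diag hd') hz hdz hb
  have h3 := ((SH.assoc hS hq ha hd hd').symm.trans hS hq (h.diag_right hq hd')).trans hS hq
    (SH.assoc hS hq hb hd hd')
  exact (h1.symm.trans hS hq h3).trans hS hq h2

theorem MvN.submatrix {e : Matrix ι ι R} {f : Matrix κ κ R} (h : MvN ν c S k e f) (σ : α ≃ ι)
    (τ : β ≃ κ) : MvN ν c S k (e.submatrix σ σ) (f.submatrix τ τ) := by
  obtain ⟨s, t, hs, ht, h1, h2⟩ := h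
  refine ⟨s.submatrix σ τ, t.submatrix τ σ, hs.reindex σ τ, ht.reindex τ σ, ?_, ?_⟩ <;>
    rw [Matrix.submatrix_mul_equiv]
  exacts [h1.reindex σ σ, h2.reindex τ τ]

theorem MvN.SH (hS : IsFilt S) {e : Matrix ι ι R} {f : Matrix κ κ R}
    (he : QId ν c S k e) (hf : QId ν c S k f) (h : MvN ν c S k e f) (hl : 20 * k ≤ l) :
    SH ν S 0 (c.q l) e f := by
  have hk := he.1.pos
  have hg := c.good l
  have ce := he.cy (show k + 1 ≤ l by omega)
  have cf := hf.cy (show k + 1 ≤ l by omega)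
  have h1 := SH.of_HT hS hg ((h.HT hS he hf hl).mono (hg.le_four 0))
  have h2 := SH.stab hS hg ce κ
  have h3 := SH.stab hS hg cf ι
  have h4 := SH.comm hS hg (Cy.dm (i := 0) (ι := ι) hS hg.ε_pos hg.one_le) cf
  exact (h2.symm.trans hS hg h1).trans hS hg (h4.trans hS hg h3)

theorem blocks_unpad {L X M : Type} [DecidableEq L] [DecidableEq X] (f : Matrix κ κ R) :
    (Matrix.fromBlocks (Matrix.fromBlocks (Matrix.fromBlocks f 0 0 (1 : Matrix L L R)) 0 0
      (0 : Matrix M M R)) 0 0 (1 : Matrix X X R)).submatrix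
      ((swapRight κ (L ⊕ X) M).trans ((Equiv.sumAssoc (κ ⊕ M) L X).symm.trans
          ((swapRight κ M L).sumCongr (Equiv.refl _))))
      ((swapRight κ (L ⊕ X) M).trans ((Equiv.sumAssoc (κ ⊕ M) L X).symm.trans
          ((swapRight κ M L).sumCongr (Equiv.refl _)))) =
      Matrix.fromBlocks (Matrix.fromBlocks f 0 0 (1 : Matrix (L ⊕ X) (L ⊕ X) R)) 0 0
        (0 : Matrix M M R) := by
  ext ((i | i | i) | i) ((j | j | j) | j) <;> simp [swapRight, Matrix.one_apply]

/-- Zero summands are invisible to Murray-von Neumann equivalence, and the two identity summands,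
one from cancellation and one from the swindle, merge into one. -/
theorem MvN.unpad (hS : IsFilt S) {L M M' X : Type} [Fintype L] [DecidableEq L] [Fintype M]
    [DecidableEq M] [Fintype M'] [DecidableEq M'] [Fintype X] [DecidableEq X] {e : Matrix ι ι R}
    {f : Matrix κ κ R} (he : QId ν c S k e) (hf : QId ν c S k f)
    (τ : (ι ⊕ L) ⊕ M ≃ (κ ⊕ L) ⊕ M')
    (h : MvN ν c S k (Matrix.fromBlocks (Matrix.fromBlocks (Matrix.fromBlocks e 0 0
        (1 : Matrix L L R)) 0 0 (0 : Matrix M M R)) 0 0 (1 : Matrix X X R))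
      (Matrix.fromBlocks ((Matrix.fromBlocks (Matrix.fromBlocks f 0 0
        (1 : Matrix L L R)) 0 0 (0 : Matrix M' M' R)).submatrix τ τ) 0 0 (1 : Matrix X X R))) :
    MvN ν c S (36 * k) (Matrix.fromBlocks e 0 0 (1 : Matrix (L ⊕ X) (L ⊕ X) R))
      (Matrix.fromBlocks f 0 0 (1 : Matrix (L ⊕ X) (L ⊕ X) R)) := by
  have hk := he.1.pos
  have r := blocks_reindex (Matrix.fromBlocks (Matrix.fromBlocks f 0 0 (1 : Matrix L L R)) 0 0
    (0 : Matrix M' M' R)) (1 : Matrix X X R) τ (Equiv.refl _)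
  rw [Equiv.coe_refl, Matrix.submatrix_id_id] at r
  rw [← r] at h
  have h5 := (h.submatrix (Equiv.refl _) (τ.sumCongr (Equiv.refl _)).symm).submatrix
    ((swapRight ι (L ⊕ X) M).trans ((Equiv.sumAssoc (ι ⊕ M) L X).symm.trans
          ((swapRight ι M L).sumCongr (Equiv.refl _))))
    ((swapRight κ (L ⊕ X) M').trans ((Equiv.sumAssoc (κ ⊕ M') L X).symm.trans
          ((swapRight κ M' L).sumCongr (Equiv.refl _))))
  rw [Matrix.submatrix_submatrix _ (Equiv.sumCongr τ _), Equiv.self_comp_symm,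
    Matrix.submatrix_id_id, Equiv.coe_refl, Matrix.submatrix_id_id, blocks_unpad,
    blocks_unpad] at h5
  have q1 := he.diag (QId.one (ι := L ⊕ X) hS hk)
  have q2 := hf.diag (QId.one (ι := L ⊕ X) hS hk)
  have s1 := (MvN.stab_zero q1 M).mono (show k ≤ 6 * k by omega)
  have h6 := h5.trans hS (q1.diag (QId.zero hk)) q2 (MvN.stab_zero q2 M')
  exact (s1.symm.trans hS (q1.mono (by omega)) (q2.mono (by omega)) h6).mono (by omega)

/-- Quasi-idempotents with the same class are stably Murray-von Neumann equivalent. -/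
theorem exists_mvN_of_kcls_eq (hS : IsFilt S) (hk : 1 ≤ k) {e : Matrix ι ι R} {f : Matrix κ κ R}
    {he : Cy ν S 0 (c.q k) e} {hf : Cy ν S 0 (c.q k) f}
    (h : kcls ν S 0 (c.q k) e he = kcls ν S 0 (c.q k) f hf) :
    ∃ (J : Type) (_ : Fintype J) (_ : DecidableEq J), MvN ν c S (36 * (402000 * k))
      (Matrix.fromBlocks e 0 0 (1 : Matrix J J R)) (Matrix.fromBlocks f 0 0 (1 : Matrix J J R)) := by
  obtain ⟨l, d, hd, h⟩ := exists_SH_of_kcls_eq hS (c.good k) h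
  have hg := c.good (200 * k)
  have hkK : k ≤ 200 * k := by omega
  have hd1 := hd.qid hk
  -- The common summand d is completed by 1 - d to an identity matrix.
  have h1 := MvN.SH (l := 200 * k) hS ((hd1.mono (show k ≤ k + 1 by omega)).diag (hd1.compl hS)
      |>.mono (show k + 1 ≤ 4 * k + 4 by omega))
    (QId.one hS (by omega)) (MvN.compl hS hd1) (by omega)
  have c1 : Cy ν S 0 (c.q (200 * k)) (1 : Matrix (Fin l) (Fin l) R) :=
    (QId.one hS hk).cy (by omega)
  have h2 := SH.cancel hS hg (he.mono (c.q_le hkK)) (hf.mono (c.q_le hkK))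
    (hd.mono (c.q_le hkK)) ((hd1.compl hS).cy (by omega)) c1 h1
    (h.mono (c.q_le hkK))
  obtain ⟨m, m', τ, h3⟩ := h2.elim
  -- The homotopy has parameters `four 0` of index 200k, hence index 2 · 200k + 2 ≤ 402k; the
  -- swindle multiplies this by 1000.
  obtain ⟨n, h4⟩ := ((h3.mono (c.four_le 0 (200 * k))).mono
    (c.q_le (show 2 * (200 * k) + 2 ≤ 402 * k by omega))).mvN hS (by omega)
  have e1 := (he.qid hk).mono (show k ≤ 402000 * k by omega)
  have f1 := (hf.qid hk).mono (show k ≤ 402000 * k by omega)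
  exact ⟨_, _, _, MvN.unpad hS e1 f1 τ (h4.mono (show _ ≤ 402000 * k by omega))⟩

/-- [b] + [1 - b] = [1] lets the negative part of a class be an identity matrix. -/
theorem kcls_sub_eq (hS : IsFilt S) (hk : 1 ≤ k) {a : Matrix ι ι R} {b : Matrix κ κ R}
    (hb : QId ν c S k b) (hl : 160 * k ≤ l) (h1 : Cy ν S 0 (c.q l) a)
    (h2 : Cy ν S 0 (c.q l) b) (h3 : Cy ν S 0 (c.q l) (Matrix.fromBlocks a 0 0 (1 - b)))
    (h4 : Cy ν S 0 (c.q l) (1 : Matrix κ κ R)) :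
    kcls ν S 0 (c.q l) a h1 - kcls ν S 0 (c.q l) b h2 =
      kcls ν S 0 (c.q l) _ h3 - kcls ν S 0 (c.q l) 1 h4 := by
  have hg := c.good l
  have hb' := (hb.compl hS).cy (show k + 1 + 1 ≤ l by omega)
  have h5 := MvN.kcls_eq hS (((hb.mono (Nat.le_succ k)).diag (hb.compl hS)).mono
    (show k + 1 ≤ 4 * k + 4 by omega)) (QId.one hS (by omega)) (MvN.compl hS hb)
    (show _ ≤ l by omega) (h2.diag hb') h4
  rw [← h5, kcls_diag hS hg h2 hb', kcls_diag hS hg h1 hb']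
  abel

end cancellation


/-! ### Elementary matrices, Whitehead's lemma and the swindle for invertibles -/

section letters

variable {R : Type*} [Ring R] [Algebra ℂ R] [TopologicalSpace R]
  [IsTopologicalRing R] [ContinuousSMul ℂ R] {ν : MNorm R} {c : Scale} {S : ℝ →o Submodule ℂ R}
  {q q' : Param} {k l : ℕ}
  {ι κ η α β Λ : Type} [Fintype ι] [DecidableEq ι] [Fintype κ]
  [DecidableEq κ] [Fintype η] [DecidableEq η] [Fintype α] [DecidableEq α] [Fintype β]
  [DecidableEq β] [Fintype Λ] [DecidableEq Λ]

/-- The strictly triangular block matrix with the single nonzero block `a`, in the upper right or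
in the lower left corner. -/
def lm (a : Bool × Matrix Λ Λ R) : Matrix (Λ ⊕ Λ) (Λ ⊕ Λ) R :=
  if a.1 then Matrix.fromBlocks 0 a.2 0 0 else Matrix.fromBlocks 0 0 a.2 0

/-- The product of the elementary matrices `1 + lm a`. -/
def lprod (L : List (Bool × Matrix Λ Λ R)) : Matrix (Λ ⊕ Λ) (Λ ⊕ Λ) R :=
  (L.map fun a => 1 + lm a).prod

/-- The inverse of `lprod`. -/
def lprod' : List (Bool × Matrix Λ Λ R) → Matrix (Λ ⊕ Λ) (Λ ⊕ Λ) R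
  | [] => 1
  | a :: L => lprod' L * (1 - lm a)

/-- Scaling of letters. -/
def lscale (t : ℂ) (L : List (Bool × Matrix Λ Λ R)) : List (Bool × Matrix Λ Λ R) :=
  L.map fun a => (a.1, t • a.2)

theorem lprod_nil : lprod ([] : List (Bool × Matrix Λ Λ R)) = 1 := rfl

theorem lprod_cons (a : Bool × Matrix Λ Λ R) (L : List (Bool × Matrix Λ Λ R)) :
    lprod (a :: L) = (1 + lm a) * lprod L := by simp [lprod]

theorem lprod_append (L L' : List (Bool × Matrix Λ Λ R)) :
    lprod (L ++ L') = lprod L * lprod L' := by simp [lprod]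

theorem lm_mul_self (a : Bool × Matrix Λ Λ R) : lm a * lm a = 0 := by
  unfold lm; split_ifs <;> simp [Matrix.fromBlocks_multiply]

theorem lm_scale (t : ℂ) (a : Bool × Matrix Λ Λ R) : lm (a.1, t • a.2) = t • lm a := by
  unfold lm; simp only; split_ifs <;> simp [Matrix.fromBlocks_smul]

theorem one_add_lm_mul (a : Bool × Matrix Λ Λ R) : (1 + lm a) * (1 - lm a) = 1 := by
  rw [add_mul, one_mul, mul_sub, mul_one, lm_mul_self]; abel

theorem one_sub_lm_mul (a : Bool × Matrix Λ Λ R) : (1 - lm a) * (1 + lm a) = 1 := by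
  rw [sub_mul, one_mul, mul_add, mul_one, lm_mul_self]; abel

theorem lprod_mul_lprod' (L : List (Bool × Matrix Λ Λ R)) : lprod L * lprod' L = 1 := by
  induction L with
  | nil => simp [lprod, lprod']
  | cons a L ih =>
    rw [lprod_cons, lprod', Matrix.mul_assoc, ← Matrix.mul_assoc (lprod L), ih, Matrix.one_mul,
      one_add_lm_mul]

theorem lprod'_mul_lprod (L : List (Bool × Matrix Λ Λ R)) : lprod' L * lprod L = 1 := by
  induction L with
  | nil => simp [lprod, lprod']
  | cons a L ih =>
    rw [lprod_cons, lprod', Matrix.mul_assoc, ← Matrix.mul_assoc (1 - lm a), one_sub_lm_mul,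
      Matrix.one_mul, ih]

theorem Ctl.lm {a : Bool × Matrix Λ Λ R} (h : Ctl ν c S k a.2) :
    Ctl ν c S k (QuantK.lm a) := by
  unfold QuantK.lm; split_ifs
  exacts [h.offDiag (Ctl.zero h.pos), (Ctl.zero h.pos).offDiag h]

theorem Ctl.lprod (hS : IsFilt S) (hk : 1 ≤ k) {L : List (Bool × Matrix Λ Λ R)}
    (h : ∀ a ∈ L, Ctl ν c S k a.2) : Ctl ν c S (L.length * (k + 1) + 1) (lprod L) := by
  induction L with
  | nil => exact Ctl.one hS (by omega)
  | cons a L ih =>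
    rw [lprod_cons]
    have h1 := ((Ctl.one hS hk).add (h a (by simp)).lm).mul hS (ih fun b hb => h b (by simp [hb]))
    refine h1.mono (le_of_eq ?_)
    simp; ring

theorem Ctl.lprod' (hS : IsFilt S) (hk : 1 ≤ k) {L : List (Bool × Matrix Λ Λ R)}
    (h : ∀ a ∈ L, Ctl ν c S k a.2) : Ctl ν c S (L.length * (k + 1) + 1) (lprod' L) := by
  induction L with
  | nil => exact Ctl.one hS (by omega)
  | cons a L ih =>
    have h1 := (ih fun b hb => h b (by simp [hb])).mul hS ((Ctl.one hS hk).sub (h a (by simp)).lm)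
    refine h1.mono (le_of_eq ?_)
    simp; ring

theorem continuous_lprod (L : List (Bool × Matrix Λ Λ R)) :
    Continuous fun t : ℝ => lprod (lscale (t : ℂ) L) := by
  induction L with
  | nil => exact continuous_const
  | cons a L ih =>
    have : (fun t : ℝ => lprod (lscale (t : ℂ) (a :: L))) =
        fun t : ℝ => (1 + (t : ℂ) • lm a) * lprod (lscale (t : ℂ) L) := by
      ext1 t; rw [← lm_scale, ← lprod_cons]; rfl
    rw [this]
    fun_prop

theorem continuous_lprod' (L : List (Bool × Matrix Λ Λ R)) :
    Continuous fun t : ℝ => lprod' (lscale (t : ℂ) L) := by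
  induction L with
  | nil => exact continuous_const
  | cons a L ih =>
    have : (fun t : ℝ => lprod' (lscale (t : ℂ) (a :: L))) =
        fun t : ℝ => lprod' (lscale (t : ℂ) L) * (1 - (t : ℂ) • lm a) := by
      ext1 t; rw [← lm_scale]; rfl
    rw [this]
    fun_prop

theorem lscale_zero_lprod (L : List (Bool × Matrix Λ Λ R)) : lprod (lscale 0 L) = 1 := by
  induction L with
  | nil => rfl
  | cons a L ih =>
    change lprod ((a.1, (0 : ℂ) • a.2) :: lscale 0 L) = 1
    rw [lprod_cons, lm_scale, ih, zero_smul, add_zero, mul_one]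

theorem lscale_one (L : List (Bool × Matrix Λ Λ R)) : lscale 1 L = L := by
  simp [lscale]

theorem lscale_length (t : ℂ) (L : List (Bool × Matrix Λ Λ R)) :
    (lscale t L).length = L.length := by simp [lscale]

theorem lscale_ctl {L : List (Bool × Matrix Λ Λ R)} (h : ∀ a ∈ L, Ctl ν c S k a.2) {t : ℝ}
    (ht : t ∈ Set.Icc (0 : ℝ) 1) : ∀ a ∈ lscale (t : ℂ) L, Ctl ν c S k a.2 := by
  intro a ha
  obtain ⟨b, hb, rfl⟩ := List.mem_map.1 ha
  refine (h b hb).smul ?_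
  rw [Complex.norm_real, Real.norm_of_nonneg ht.1]; exact ht.2

theorem QInv.lprod (hS : IsFilt S) (hk : 1 ≤ k) {L : List (Bool × Matrix Λ Λ R)}
    (h : ∀ a ∈ L, Ctl ν c S k a.2) :
    QInv ν c S (L.length * (k + 1) + 1) (lprod L) (lprod' L) :=
  ⟨Ctl.lprod hS hk h, Ctl.lprod' hS hk h, Nr.of_eq _ (lprod_mul_lprod' L),
    Nr.of_eq _ (lprod'_mul_lprod L)⟩

theorem QInv.mul (hS : IsFilt S) {u v u' v' : Matrix ι ι R} (h : QInv ν c S k u v)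
    (h' : QInv ν c S l u' v') : QInv ν c S (2 * k + 2 * l + 1) (u * u') (v' * v) := by
  have p1 := h.1.pos
  have p2 := h'.1.pos
  refine ⟨(h.1.mul hS h'.1).mono (by omega), (h'.2.1.mul hS h.2.1).mono (by omega), ?_, ?_⟩
  · have := ((h'.2.2.1.mul_left h.1).mul_right h.2.1).trans
      ((Nr.of_eq l (by rw [Matrix.mul_one])).trans h.2.2.1)
    rw [show u * u' * (v' * v) = u * (u' * v') * v by simp only [Matrix.mul_assoc]]
    exact this.mono (by omega)
  · have := ((h.2.2.2.mul_left h'.2.1).mul_right h'.1).trans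
      ((Nr.of_eq k (by rw [Matrix.mul_one])).trans h'.2.2.2)
    rw [show v' * v * (u * u') = v' * (v * u) * u' by simp only [Matrix.mul_assoc]]
    exact this.mono (by omega)

theorem QInv.of_nr {u v u' : Matrix ι ι R} (h : QInv ν c S k u v) (hu' : Ctl ν c S l u')
    (hu : Nr ν c l u u') : QInv ν c S (2 * k + 2 * l + 1) u' v :=
  ⟨hu'.mono (by omega), h.2.1.mono (by omega),
    ((hu.symm.mul_right h.2.1).trans h.2.2.1).mono (by omega),
    ((hu.symm.mul_left h.2.1).trans h.2.2.2).mono (by omega)⟩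

/-- Multiplication by elementary matrices does not change the homotopy class. -/
theorem HT.of_letters (hS : IsFilt S) {U V U' : Matrix (Λ ⊕ Λ) (Λ ⊕ Λ) R}
    (hU : QInv ν c S k U V) (hU' : Ctl ν c S k U') {L : List (Bool × Matrix Λ Λ R)}
    (h : ∀ a ∈ L, Ctl ν c S k a.2) (hn : Nr ν c k (U * lprod L) U')
    (hl : 15 * (L.length + 1) * (k + 1) ≤ l) : HT ν S 1 (c.q l) U U' := by
  have hk := hU.1.pos
  set n := L.length with hnn
  set K := (n + 1) * (k + 1) with hK
  have hnk : n * (k + 1) + (k + 1) = K := by rw [hK]; ring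
  have hl' : 15 * K ≤ l := by rw [hK, ← mul_assoc]; exact hl
  -- Scaling all letters by t contracts the product of elementary matrices to 1 through exactly
  -- invertible matrices, with bounds depending only on the number of letters.
  have key : ∀ t ∈ Set.Icc (0 : ℝ) 1,
      QInv ν c S (4 * K) (U * lprod (lscale (t : ℂ) L)) (lprod' (lscale (t : ℂ) L) * V) := by
    intro t ht
    have := hU.mul hS (QInv.lprod hS hk (lscale_ctl h ht))
    rw [lscale_length, ← hnn] at this
    exact this.mono (by omega)
  have h1 := HT.of_qinv_path (ν := ν) (c := c) (S := S) (k := 4 * K) (l := l)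
    (f := fun t : ℝ => U * lprod (lscale (t : ℂ) L))
    (continuous_const.mul (continuous_lprod L)) ((continuous_lprod' L).mul continuous_const) key
    (by omega)
  have h2 := key 1 ⟨zero_le_one, le_rfl⟩
  simp only [Complex.ofReal_zero, Complex.ofReal_one, lscale_zero_lprod, lscale_one,
    mul_one] at h1 h2
  exact h1.trans (HT.line_one (k := 4 * K) h2 (hU'.mono (by omega)) (hn.mono (by omega)) (by omega))

/-- Elementary matrices whose product is close to `[[0, a], [-b, 0]]`. -/
def wl (a b : Matrix Λ Λ R) : List (Bool × Matrix Λ Λ R) := [(true, a), (false, -b), (true, a)]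

/-- Elementary matrices whose product is close to `diag(a, b)`. -/
def whl (a b : Matrix Λ Λ R) : List (Bool × Matrix Λ Λ R) := wl a b ++ wl (-1) (-1)

theorem whl_length (a b : Matrix Λ Λ R) : (whl a b).length = 6 := rfl

theorem whl_ctl (hS : IsFilt S) {a b : Matrix Λ Λ R} (h : QInv ν c S k a b) :
    ∀ x ∈ whl a b, Ctl ν c S k x.2 := by
  have h1 := Ctl.one (ν := ν) (c := c) (ι := Λ) hS h.1.pos
  intro x hx
  simp only [whl, wl, List.cons_append, List.nil_append, List.mem_cons, List.not_mem_nil,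
    or_false] at hx
  rcases hx with rfl | rfl | rfl | rfl | rfl | rfl
  exacts [h.1, h.2.1.neg, h.1, h1.neg, h1.neg.neg, h1.neg]

theorem lprod_wl (a b : Matrix Λ Λ R) :
    lprod (wl a b) = Matrix.fromBlocks (1 - a * b) (a + (1 - a * b) * a) (-b) (1 - b * a) := by
  simp only [wl, lprod_cons, lprod_nil, lm, if_true, Bool.false_eq_true, if_false, mul_one]
  rw [← Matrix.fromBlocks_one, Matrix.fromBlocks_add, Matrix.fromBlocks_add,
    Matrix.fromBlocks_multiply, Matrix.fromBlocks_multiply]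
  congr 1 <;> noncomm_ring

/-- Whitehead's lemma: the first three letters give approximately [[0, a], [-b, 0]], the last three
give exactly [[0, -1], [1, 0]], and the product of the two is diag(a, b). -/
theorem whl_nr {a b : Matrix Λ Λ R} (h : QInv ν c S k a b) :
    Nr ν c (2 * k + 1) (lprod (whl a b)) (Matrix.fromBlocks a 0 0 b) := by
  have e : lprod (whl a b) = Matrix.fromBlocks (a + (1 - a * b) * a) (-(1 - a * b)) (1 - b * a)
      b := by
    rw [whl, lprod_append, lprod_wl, lprod_wl, Matrix.fromBlocks_multiply]
    congr 1 <;> noncomm_ring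
  have z1 : Nr ν c k (1 - a * b) 0 := by
    rw [Nr, sub_zero, ν.sub_comm]; exact h.2.2.1
  have z2 : Nr ν c k (1 - b * a) 0 := by
    rw [Nr, sub_zero, ν.sub_comm]; exact h.2.2.2
  have z3 := z1.mul_right h.1
  rw [zero_mul] at z3
  have z4 : Nr ν c (2 * k) (a + (1 - a * b) * a) a := by
    rw [Nr, add_sub_cancel_left]
    have := z3.mono (show k + k ≤ 2 * k by omega)
    rwa [Nr, sub_zero] at this
  have z5 := z1.neg
  rw [neg_zero] at z5
  rw [e]
  exact z4.blocks (z5.mono (by omega)) (z2.mono (by omega)) (Nr.refl _ _)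

theorem QInv.HT_one (hS : IsFilt S) {a b : Matrix Λ Λ R} (h : QInv ν c S k a b)
    (hl : 700 * k ≤ l) : HT ν S 1 (c.q l) 1 (Matrix.fromBlocks a 0 0 b) := by
  have hk := h.1.pos
  refine HT.of_letters hS (k := 2 * k + 1) (QInv.one hS (by omega)) ((h.diag h.symm).1.mono
    (by omega)) (L := whl a b) (fun x hx => (whl_ctl hS h x hx).mono (by omega)) ?_ ?_
  · rw [one_mul]; exact whl_nr h
  · rw [whl_length]; omega

/-- `[b] = -[a]` for an inverse pair `(a, b)`. -/
theorem kcls_inv (hS : IsFilt S) {a b : Matrix ι ι R} (h : QInv ν c S k a b)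
    (hl : 700 * k ≤ l) (ha : Cy ν S 1 (c.q l) a) (hb : Cy ν S 1 (c.q l) b) :
    kcls ν S 1 (c.q l) a ha + kcls ν S 1 (c.q l) b hb = 0 := by
  have hg := c.good l
  have h1 : Cy ν S 1 (c.q l) (1 : Matrix (ι ⊕ ι) (ι ⊕ ι) R) :=
    (QInv.one hS h.1.pos).cy (by have := h.1.pos; omega)
  rw [← kcls_diag hS hg ha hb (ha.diag hb), ← kcls_eq_of_HT hS (h.HT_one hS hl) h1]
  exact kcls_dm (i := 1) hS hg h1

theorem kcls_one_eq_zero (hS : IsFilt S) (h : Cy ν S 1 (c.q l) (1 : Matrix ι ι R)) :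
    kcls ν S 1 (c.q l) 1 h = 0 := kcls_dm (i := 1) hS (c.good l) h

/-- diag(aa', 1) diag(b', a') = diag(aa'b', a') ≈ diag(a, a'), and the second factor is close to a
product of six elementary matrices. -/
theorem kcls_mul (hS : IsFilt S) {a b a' b' : Matrix ι ι R} (h : QInv ν c S k a b)
    (h' : QInv ν c S k a' b') (hl : 2000 * k ≤ l) (h1 : Cy ν S 1 (c.q l) a)
    (h2 : Cy ν S 1 (c.q l) a') (h3 : Cy ν S 1 (c.q l) (a * a')) :
    kcls ν S 1 (c.q l) (a * a') h3 = kcls ν S 1 (c.q l) a h1 + kcls ν S 1 (c.q l) a' h2 := by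
  have hk := h.1.pos
  have hg := c.good l
  have hh := (h.mul hS h').mono (show _ ≤ 5 * k by omega)
  have c1 : Cy ν S 1 (c.q l) (1 : Matrix ι ι R) := (QInv.one hS hk).cy (by omega)
  have hd := hh.diag (QInv.one (ι := ι) hS (show 1 ≤ 5 * k by omega))
  have nn := (whl_nr h'.symm).mul_left hd.1
  have e1 : Matrix.fromBlocks (a * a') 0 0 (1 : Matrix ι ι R) * Matrix.fromBlocks b' 0 0 a' =
      Matrix.fromBlocks (a * (a' * b')) 0 0 a' := by
    rw [blocks_mul_blocks, one_mul, mul_assoc]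
  have n2 : Nr ν c (2 * k) (Matrix.fromBlocks (a * (a' * b')) 0 0 a')
      (Matrix.fromBlocks a 0 0 a') := by
    refine Nr.diag ?_ (Nr.refl _ _)
    have := h'.2.2.1.mul_left h.1
    rw [mul_one] at this
    exact this.mono (by omega)
  rw [e1] at nn
  have h4 := HT.of_letters hS (k := 8 * k + 2) (l := l) (hd.mono (by omega))
    ((h.diag h').1.mono (by omega)) (fun x hx => (whl_ctl hS h'.symm x hx).mono (by omega))
    ((nn.trans n2).mono (by omega)) (by rw [whl_length]; omega)
  have h5 := kcls_eq_of_HT hS h4 (h3.diag c1) (h1.diag h2)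
  rw [kcls_diag hS hg h3 c1, kcls_diag hS hg h1 h2, kcls_one_eq_zero hS c1, add_zero] at h5
  exact h5

/-- `U` is, up to a bijection of the index sets, of the form `diag(u, 1)`. -/
def Stab (U : Matrix κ κ R) (u : Matrix ι ι R) : Prop :=
  ∃ (α : Type) (_ : Fintype α) (_ : DecidableEq α) (f : κ ≃ ι ⊕ α),
    U = (Matrix.fromBlocks u 0 0 (1 : Matrix α α R)).submatrix f f

theorem Stab.diag_one (u : Matrix ι ι R) (α : Type) [Fintype α] [DecidableEq α] :
    Stab (Matrix.fromBlocks u 0 0 (1 : Matrix α α R)) u :=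
  ⟨α, inferInstance, inferInstance, Equiv.refl _, rfl⟩

theorem Stab.reindex {U : Matrix κ κ R} {u : Matrix ι ι R} (h : Stab U u) (g : η ≃ κ) :
    Stab (U.submatrix g g) u := by
  obtain ⟨α, _, _, f, rfl⟩ := h
  exact ⟨α, inferInstance, inferInstance, g.trans f, rfl⟩

theorem Stab.trans {U : Matrix κ κ R} {u : Matrix ι ι R} {w : Matrix η η R} (h : Stab U u)
    (h' : Stab u w) : Stab U w := by
  obtain ⟨α, _, _, f, rfl⟩ := h
  obtain ⟨β, _, _, g, rfl⟩ := h'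
  refine ⟨β ⊕ α, inferInstance, inferInstance,
    (f.trans (g.sumCongr (Equiv.refl _))).trans (Equiv.sumAssoc _ _ _), ?_⟩
  have h1 := blocks_reindex (Matrix.fromBlocks w 0 0 (1 : Matrix β β R)) (1 : Matrix α α R) g
    (Equiv.refl α)
  have h2 := blocks_assoc w (1 : Matrix β β R) (1 : Matrix α α R)
  rw [Equiv.coe_refl, Matrix.submatrix_id_id] at h1
  rw [Matrix.fromBlocks_one] at h2
  rw [← h1, ← h2]
  rfl

theorem Stab.diag {U : Matrix κ κ R} {u : Matrix ι ι R} (h : Stab U u) (α : Type) [Fintype α]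
    [DecidableEq α] : Stab (Matrix.fromBlocks U 0 0 (1 : Matrix α α R)) u :=
  (Stab.diag_one U α).trans h

theorem Stab.qinv (hS : IsFilt S) {U : Matrix κ κ R} {u v : Matrix ι ι R} (h : Stab U u)
    (hu : QInv ν c S k u v) : ∃ V, QInv ν c S k U V := by
  obtain ⟨α, _, _, f, rfl⟩ := h
  exact ⟨_, (hu.diag (QInv.one hS hu.1.pos)).reindex f⟩

/-- Stable equality up to `18` elementary matrices. -/
def LEq (ν : MNorm R) (c : Scale) (S : ℝ →o Submodule ℂ R) (k : ℕ) (u : Matrix ι ι R)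
    (u' : Matrix κ κ R) : Prop :=
  ∃ (Λ : Type) (_ : Fintype Λ) (_ : DecidableEq Λ) (U U' : Matrix (Λ ⊕ Λ) (Λ ⊕ Λ) R)
    (L : List (Bool × Matrix Λ Λ R)), Stab U u ∧ Stab U' u' ∧ L.length = 18 ∧
      (∀ a ∈ L, Ctl ν c S k a.2) ∧ Nr ν c k (U * lprod L) U'

/-- Homotopic quasi-invertibles agree stably up to elementary matrices. -/
theorem HT.lEq (hS : IsFilt S) (hk : 1 ≤ k) {u u' : Matrix ι ι R} (h : HT ν S 1 (c.q k) u u') :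
    LEq ν c S (100 * k) u u' := by
  obtain ⟨w₀, w₁, h'⟩ : ∃ v₀ v₁ : Matrix ι ι R,
    JoinedIn {x : Matrix ι ι R × Matrix ι ι R | QP ν S (c.q k) x.1 x.2} (u, v₀) (u', v₁) := by
    simpa [HT] using h
  obtain ⟨n, p, hp0, hp1, hp⟩ := exists_subdivision ν
    (continuous_fst.comp h'.somePath.continuous) (mul_pos (c.pow_pos k) c.δ_pos)
  set a : Fin (n + 1) → Matrix ι ι R := fun j => (h'.somePath (p j)).1 with ha
  set b : Fin (n + 1) → Matrix ι ι R := fun j => (h'.somePath (p j)).2 with hb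
  have hQ : ∀ j, QInv ν c S k (a j) (b j) := fun j => QP.qinv (h'.somePath_mem (p j)) hk
  have ha0 : a 0 = u := by simp [ha, hp0]
  have ha1 : a (Fin.last n) = u' := by simp [ha, hp1]
  have haa : ∀ j : Fin n, Nr ν c k (a j.castSucc) (a j.succ) := hp
  -- XY has the blocks a₀, a₁b₀, …, a_n b_{n-1}, so it is close to F₀ = diag(u, 1, …, 1). After the
  -- shift, X(PYP') has the blocks a₀b₀, …, a_{n-1}b_{n-1}, a_n, close to F₁ = diag(1, …, 1, u').
  -- Since Z is an approximate inverse of Y, it follows that F₁ ≈ F₀ · ZPYP', and F₀ and F₁ differ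
  -- by a commutator.
  set y : Fin (n + 1) → Matrix ι ι R := Fin.cons 1 fun j : Fin n => b j.castSucc with hy
  set z : Fin (n + 1) → Matrix ι ι R := Fin.cons 1 fun j : Fin n => a j.castSucc with hz
  have hzy : ∀ j, QInv ν c S k (z j) (y j) := fun j => by
    refine Fin.cases ?_ (fun j => ?_) j
    · exact QInv.one hS hk
    · exact hQ j.castSucc
  set P := shiftMat R ι n
  set P' := shiftMat' R ι n
  have hPP' : P * P' = 1 := shift_mul_shift' n
  have hP'P : P' * P = 1 := shift'_mul_shift n
  have qP : QInv ν c S 1 P P' := ⟨Ctl.shift hS n, Ctl.shift' hS n, Nr.of_eq _ hPP',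
    Nr.of_eq _ hP'P⟩
  set X := Matrix.blockDiagonal a with hX
  set Y := Matrix.blockDiagonal y with hY
  set Z := Matrix.blockDiagonal z with hZ
  have qX : Ctl ν c S k X := Ctl.blockDiagonal hk fun j => (hQ j).1
  have qZY : QInv ν c S k Z Y := by
    refine ⟨Ctl.blockDiagonal hk fun j => (hzy j).1, Ctl.blockDiagonal hk fun j => (hzy j).2.1,
      ?_, ?_⟩
    all_goals
      rw [hZ, hY, ← Matrix.blockDiagonal_mul, ← Matrix.blockDiagonal_one]
    exacts [Nr.blockDiagonal fun j => (hzy j).2.2.1, Nr.blockDiagonal fun j => (hzy j).2.2.2]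
  set F₀ := Matrix.blockDiagonal fun j : Fin (n + 1) => if j = 0 then u else 1 with hF₀
  set F₁ := Matrix.blockDiagonal fun j : Fin (n + 1) => if j = Fin.last n then u' else 1 with hF₁
  have n0 : Nr ν c (2 * k + 1) (X * Y) F₀ := by
    rw [hX, hY, ← Matrix.blockDiagonal_mul, hF₀]
    refine Nr.blockDiagonal fun j => ?_
    refine Fin.cases ?_ (fun j => ?_) j
    · simp only [hy, Fin.cons_zero, mul_one, if_true, ha0]; exact Nr.refl _ _
    · simp only [hy, Fin.cons_succ, Fin.succ_ne_zero, if_false]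
      exact (((haa j).symm.mul_right (hQ _).2.1).trans (hQ _).2.2.1).mono (by omega)
  have n1 : Nr ν c (2 * k + 1) (X * (P * Y * P')) F₁ := by
    rw [hX, hY, shift_conj, ← Matrix.blockDiagonal_mul, hF₁]
    refine Nr.blockDiagonal fun j => ?_
    refine Fin.lastCases ?_ (fun j => ?_) j
    · rw [finRotate_last]
      simp only [hy, Fin.cons_zero, mul_one, if_true, ha1]; exact Nr.refl _ _
    · rw [finRotate_castSucc']
      simp only [hy, Fin.cons_succ, (Fin.castSucc_lt_last j).ne, if_false]
      exact (hQ _).2.2.1.mono (by omega)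
  have qPY : QInv ν c S (2 * k + 3) (P * Y) (Z * P') := (qP.mul hS qZY.symm).mono (by omega)
  -- diag(Z, Y), diag(PY, ZP') and diag(P', P) multiply to diag(ZPYP', YZP'P), whose second entry is
  -- close to 1. Six letters for each factor give 18 in all, whatever the number of steps.
  set L := whl Z Y ++ (whl (P * Y) (Z * P') ++ whl P' P) with hL
  have cF : Ctl ν c S k F₀ := Ctl.blockDiagonal hk fun j => by
    split_ifs
    exacts [ha0 ▸ (hQ 0).1, Ctl.one hS hk]
  have cFL := cF.diag (Ctl.one (ν := ν) (c := c) (S := S) (ι := ι × Fin (n + 1)) hS hk)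
  have l1 := whl_nr qZY
  have l2 := whl_nr qPY
  have l3 := whl_nr qP.symm
  have cw3 := Ctl.lprod hS le_rfl (whl_ctl hS qP.symm)
  have cw2 := Ctl.lprod hS (by omega) (whl_ctl hS qPY)
  rw [whl_length] at cw2 cw3
  have l23 := l2.mul l3 cw2 (qP.symm.diag qP).1
  have l123 := l1.mul l23 (Ctl.lprod hS hk (whl_ctl hS qZY)) ((qPY.diag qPY.symm).1.mul hS
    (qP.symm.diag qP).1)
  rw [← lprod_append, ← lprod_append, ← hL, blocks_mul_blocks, blocks_mul_blocks, whl_length] at l123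
  have l4 := l123.mul_left cFL
  rw [blocks_mul_blocks] at l4
  have l5 : Nr ν c (10 * k + 10) (Matrix.fromBlocks (F₀ * (Z * (P * Y * P'))) 0 0
      (1 * (Y * (Z * P' * P)))) (Matrix.fromBlocks F₁ 0 0 1) := by
    refine Nr.diag ?_ ?_
    · have cPYP : Ctl ν c S (k + 2) (P * Y * P') :=
        ((qP.1.mul hS qZY.2.1).mul hS qP.2.1).mono (by omega)
      have m1 := n0.symm.mul_right (qZY.1.mul hS cPYP)
      have m2 := (qZY.2.2.2.mul_left qX).mul_right cPYP
      rw [show X * Y * (Z * (P * Y * P')) = X * (Y * Z) * (P * Y * P') by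
        simp only [Matrix.mul_assoc]] at m1
      rw [Matrix.mul_one] at m2
      exact ((m1.trans m2).trans n1).mono (by omega)
    · rw [Matrix.mul_assoc, hP'P, Matrix.one_mul, Matrix.mul_one]
      exact qZY.2.2.2.mono (by omega)
  refine ⟨ι × Fin (n + 1), inferInstance, inferInstance, Matrix.fromBlocks F₀ 0 0 1,
    Matrix.fromBlocks F₁ 0 0 1, L, ?_, ?_, rfl, ?_, (l4.trans l5).mono (by omega)⟩
  · rw [hF₀, blockDiagonal_ite]
    exact ((Stab.diag_one u _).reindex _).diag _
  · rw [hF₁, blockDiagonal_ite]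
    exact ((Stab.diag_one u' _).reindex _).diag _
  · intro x hx
    rw [hL, List.mem_append, List.mem_append] at hx
    rcases hx with hx | hx | hx
    exacts [(whl_ctl hS qZY x hx).mono (by omega), (whl_ctl hS qPY x hx).mono (by omega),
      (whl_ctl hS qP.symm x hx).mono (by omega)]

/-- Quasi-invertibles with the same class agree stably up to elementary matrices. -/
theorem lEq_of_kcls_eq (hS : IsFilt S) (hk : 1 ≤ k) {a : Matrix ι ι R} {b : Matrix κ κ R}
    {ha : Cy ν S 1 (c.q k) a} {hb : Cy ν S 1 (c.q k) b}
    (h : kcls ν S 1 (c.q k) a ha = kcls ν S 1 (c.q k) b hb) : LEq ν c S (200000 * k) a b := by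
  obtain ⟨l, d, hd, h⟩ := exists_SH_of_kcls_eq hS (c.good k) h
  have hg := c.good (700 * k)
  have hkK : k ≤ 700 * k := by omega
  obtain ⟨d', hdd⟩ := hd.qinv hk
  have c1 : Cy ν S 1 (c.q (700 * k)) (1 : Matrix (Fin l ⊕ Fin l) (Fin l ⊕ Fin l) R) :=
    (QInv.one hS hk).cy (by omega)
  -- The common summand d is completed by an approximate inverse; by Whitehead's lemma the sum is
  -- homotopic to an identity matrix.
  have h1 := SH.of_HT hS hg ((hdd.HT_one hS le_rfl).symm.mono (hg.le_four 1))
  have h2 := SH.cancel hS hg (ha.mono (c.q_le hkK)) (hb.mono (c.q_le hkK))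
    (hd.mono (c.q_le hkK)) (hdd.symm.cy (by omega)) c1 h1 (h.mono (c.q_le hkK))
  obtain ⟨m, m', τ, h3⟩ := h2.elim
  obtain ⟨Λ, i1, i2, U, U', L, s1, s2, hL⟩ := ((h3.mono (c.four_le 1 (700 * k))).mono
    (c.q_le (show 2 * (700 * k) + 2 ≤ 2000 * k by omega))).lEq hS (by omega)
  refine ⟨Λ, i1, i2, U, U', L, s1.trans ((Stab.diag_one a _).diag _),
    s2.trans ((((Stab.diag_one b _).diag _).reindex τ)), hL.1, fun x hx => (hL.2.1 x hx).mono
    (by omega), hL.2.2.mono (by omega)⟩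

end letters


/-! ### Factorization of elementary products through the two subalgebras -/

/-- A controlled Mayer-Vietoris pair, in terms of a scale. The subspaces `T k` are spanned by the
elements of the first coercive summand that have propagation at most `kρ`. -/
structure MV {R : Type*} [Ring R] [Algebra ℂ R] [TopologicalSpace R] (ν : MNorm R)
    (νs : MNorm ℂ) (π : R →ₐ[ℂ] ℂ) (c : Scale) (K : ℕ) (S S₁ S₂ S₁₂ : ℝ →o Submodule ℂ R)
    (T : ℕ → Submodule ℂ R) : Prop where
  filt : IsFilt S
  filt₁ : IsFilt S₁
  filt₂ : IsFilt S₂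
  filt₁₂ : IsFilt S₁₂
  le₁ : S₁ ≤ S
  le₂ : S₂ ≤ S
  le₁₂₁ : S₁₂ ≤ S₁
  le₁₂₂ : S₁₂ ≤ S₂
  δ_le : c.δ ≤ 1
  lift : ∀ {ι κ : Type} [Fintype ι] [Fintype κ] (Z : Matrix ι κ ℂ),
    ν.nrm (Z.map (algebraMap ℂ R)) ≤ νs.nrm Z
  contr : ∀ {ι κ : Type} [Fintype ι] [Fintype κ] (X : Matrix ι κ R), νs.nrm (X.map π) ≤ ν.nrm X
  dec : ∀ {k : ℕ} {ι : Type} [Fintype ι] [DecidableEq ι] (X : Matrix ι ι R), k ≤ K →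
    Ctl ν c S k X → ∃ x y : Matrix ι ι R, X = x + y ∧ (∀ i j, x i j ∈ T k) ∧
      ν.nrm x ≤ c.M ^ (k + 1) ∧ Ctl ν c S₂ (k + 1) y
  T_le : ∀ k, T k ≤ S (k * c.ρ)
  π_T : ∀ {k : ℕ} {x : R}, x ∈ T k → π x = 0
  nbhd : ∀ {k l m : ℕ} {g x h : R}, 1 ≤ k → k ≤ K → 1 ≤ l → l ≤ K → 1 ≤ m → m ≤ K →
    g ∈ S (l * c.ρ) → x ∈ T k → h ∈ S (m * c.ρ) → g * x * h ∈ S₁ ((l + k + m : ℕ) * c.ρ)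
  cia : ∀ {k l : ℕ} {ι κ : Type} [Fintype ι] [DecidableEq ι] [Fintype κ] [DecidableEq κ]
    (X Y : Matrix ι κ R), k ≤ K →
    Ctl ν c S₁ k X → Ctl ν c S₂ k Y → Nr ν c l X Y → ∃ Z : Matrix ι κ R,
      (∀ i j, Z i j ∈ S₁₂ (k * c.ρ)) ∧ Nr ν c (l + 1) Z X ∧ Nr ν c (l + 1) Z Y ∧
      Z.map π = X.map π

section factorization

variable {R : Type*} [Ring R] [Algebra ℂ R] [TopologicalSpace R]
  [IsTopologicalRing R] [ContinuousSMul ℂ R] {ν : MNorm R} {νs : MNorm ℂ} {π : R →ₐ[ℂ] ℂ}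
  {c : Scale} {K : ℕ} {S S₁ S₂ S₁₂ : ℝ →o Submodule ℂ R} {T : ℕ → Submodule ℂ R}
  {k l m n B : ℕ}
  {ι κ η α β Λ Ω : Type} [Fintype ι] [DecidableEq ι] [Fintype κ]
  [DecidableEq κ] [Fintype η] [DecidableEq η] [Fintype α] [DecidableEq α] [Fintype β]
  [DecidableEq β] [Fintype Λ] [DecidableEq Λ] [Fintype Ω] [DecidableEq Ω]

/-- The norm bound on Z comes from ‖Z - X‖ + ‖X‖; errors are at most norms because `MV` demands δ ≤
1. -/
theorem MV.exists_cia (mv : MV ν νs π c K S S₁ S₂ S₁₂ T) {X Y : Matrix ι κ R}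
    (hX : Ctl ν c S₁ k X) (hY : Ctl ν c S₂ k Y) (h : Nr ν c k X Y) (hk : k ≤ K) :
    ∃ Z : Matrix ι κ R, Ctl ν c S₁₂ (k + 2) Z ∧ Nr ν c (k + 1) Z X ∧ Nr ν c (k + 1) Z Y ∧
      Z.map π = X.map π := by
  obtain ⟨Z, h1, h2, h3, h4⟩ := mv.cia X Y hk hX hY h
  refine ⟨Z, ⟨by omega, fun i j => S₁₂.monotone
    (mul_le_mul_of_nonneg_right (Nat.cast_le.2 (show k ≤ k + 2 by omega)) c.ρ_pos.le) (h1 i j),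
    ?_⟩, h2, h3, h4⟩
  have h5 := ν.add_le (Z - X) X
  rw [sub_add_cancel] at h5
  have h6 : ν.nrm (Z - X) ≤ c.M ^ (k + 1) :=
    le_trans h2 (mul_le_of_le_one_right (c.pow_pos _).le mv.δ_le)
  exact h5.trans ((add_le_add h6 (hX.bd.trans (c.pow_le (Nat.le_succ k)))).trans
    (c.two_mul_pow (k + 1)))

/-- The first factor of the product of `1 + x + y`, conjugated by `U`. -/
def zf (U V : Matrix Ω Ω R) : List (Matrix Ω Ω R × Matrix Ω Ω R) → Matrix Ω Ω R
  | [] => 1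
  | a :: L => (1 + U * a.1 * V) * zf (U * (1 + a.2)) ((1 - a.2) * V) L

/-- The approximate inverse of `zf`. -/
def zf' (U V : Matrix Ω Ω R) : List (Matrix Ω Ω R × Matrix Ω Ω R) → Matrix Ω Ω R
  | [] => 1
  | a :: L => zf' (U * (1 + a.2)) ((1 - a.2) * V) L * (1 - U * a.1 * V)

/-- The second factor of the product of `1 + x + y`. -/
def zs : List (Matrix Ω Ω R × Matrix Ω Ω R) → Matrix Ω Ω R
  | [] => 1
  | a :: L => (1 + a.2) * zs L

/-- The inverse of `zs`. -/
def zs' : List (Matrix Ω Ω R × Matrix Ω Ω R) → Matrix Ω Ω R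
  | [] => 1
  | a :: L => zs' L * (1 - a.2)

/-- The product of the matrices `1 + x + y`. -/
def zp : List (Matrix Ω Ω R × Matrix Ω Ω R) → Matrix Ω Ω R
  | [] => 1
  | a :: L => (1 + (a.1 + a.2)) * zp L

/-- The decomposed letters: `x` comes from the first coercive summand and `y` from `S₂`, and both
are strictly triangular. -/
structure DLet (ν : MNorm R) (c : Scale) (S₂ : ℝ →o Submodule ℂ R)
    (T : ℕ → Submodule ℂ R) (k : ℕ) (a : Matrix Ω Ω R × Matrix Ω Ω R) : Prop where
  mem : ∀ i j, a.1 i j ∈ T k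
  bd : ν.nrm a.1 ≤ c.M ^ (k + 1)
  ctl : Ctl ν c S₂ (k + 1) a.2
  xx : a.1 * a.1 = 0
  xy : a.1 * a.2 = 0
  yy : a.2 * a.2 = 0

/-- Scaling of decomposed letters. -/
def dscale (t : ℝ) (L : List (Matrix Ω Ω R × Matrix Ω Ω R)) :
    List (Matrix Ω Ω R × Matrix Ω Ω R) :=
  L.map fun a => ((t : ℂ) • a.1, (t : ℂ) • a.2)

theorem DLet.scale {a : Matrix Ω Ω R × Matrix Ω Ω R} (h : DLet ν c S₂ T k a) {t : ℝ}
    (ht : t ∈ Set.Icc (0 : ℝ) 1) : DLet ν c S₂ T k ((t : ℂ) • a.1, (t : ℂ) • a.2) := by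
  have h1 : ‖(t : ℂ)‖ ≤ 1 := by
    rw [Complex.norm_real, Real.norm_of_nonneg ht.1]; exact ht.2
  exact ⟨fun i j => Submodule.smul_mem _ _ (h.mem i j),
    (ν.smul_le _ _).trans ((mul_le_of_le_one_left (ν.nonneg _) h1).trans h.bd), h.ctl.smul h1,
    by simp [h.xx], by simp [h.xy], by simp [h.yy]⟩

theorem continuous_zf (L : List (Matrix Ω Ω R × Matrix Ω Ω R)) {f g : ℝ → Matrix Ω Ω R}
    (hf : Continuous f) (hg : Continuous g) : Continuous fun t => zf (f t) (g t) (dscale t L) := by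
  induction L generalizing f g with
  | nil => exact continuous_const
  | cons a L ih =>
    refine Continuous.mul (f := fun t : ℝ => 1 + f t * ((t : ℂ) • a.1) * g t) (by fun_prop)
      (ih (f := fun t => f t * (1 + (t : ℂ) • a.2)) (g := fun t => (1 - (t : ℂ) • a.2) * g t)
      (by fun_prop) (by fun_prop))

theorem continuous_zf' (L : List (Matrix Ω Ω R × Matrix Ω Ω R)) {f g : ℝ → Matrix Ω Ω R}
    (hf : Continuous f) (hg : Continuous g) :
    Continuous fun t => zf' (f t) (g t) (dscale t L) := by
  induction L generalizing f g with
  | nil => exact continuous_const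
  | cons a L ih =>
    refine Continuous.mul (g := fun t : ℝ => 1 - f t * ((t : ℂ) • a.1) * g t)
      (ih (f := fun t => f t * (1 + (t : ℂ) • a.2)) (g := fun t => (1 - (t : ℂ) • a.2) * g t)
      (by fun_prop) (by fun_prop)) (by fun_prop)

theorem continuous_zs (L : List (Matrix Ω Ω R × Matrix Ω Ω R)) :
    Continuous fun t => zs (dscale t L) := by
  induction L with
  | nil => exact continuous_const
  | cons a L ih =>
    exact Continuous.mul (f := fun t : ℝ => 1 + ((t : ℂ) • a.2)) (by fun_prop) ih

theorem continuous_zs' (L : List (Matrix Ω Ω R × Matrix Ω Ω R)) :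
    Continuous fun t => zs' (dscale t L) := by
  induction L with
  | nil => exact continuous_const
  | cons a L ih =>
    exact Continuous.mul (g := fun t : ℝ => 1 - ((t : ℂ) • a.2)) ih (by fun_prop)

theorem zf_zero (U V : Matrix Ω Ω R) (L : List (Matrix Ω Ω R × Matrix Ω Ω R)) :
    zf U V (dscale 0 L) = 1 := by
  induction L generalizing U V with
  | nil => rfl
  | cons a L ih =>
    change (1 + U * (((0 : ℝ) : ℂ) • a.1) * V) * zf _ _ (dscale 0 L) = 1
    rw [ih]; simp

theorem zs_zero (L : List (Matrix Ω Ω R × Matrix Ω Ω R)) : zs (dscale 0 L) = 1 := by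
  induction L with
  | nil => rfl
  | cons a L ih =>
    change (1 + (((0 : ℝ) : ℂ) • a.2)) * zs (dscale 0 L) = 1
    rw [ih]; simp

theorem dscale_one (L : List (Matrix Ω Ω R × Matrix Ω Ω R)) : dscale 1 L = L := by
  simp [dscale]

theorem dscale_length (t : ℝ) (L : List (Matrix Ω Ω R × Matrix Ω Ω R)) :
    (dscale t L).length = L.length := by simp [dscale]

theorem dscale_dlet {L : List (Matrix Ω Ω R × Matrix Ω Ω R)} (h : ∀ a ∈ L, DLet ν c S₂ T k a)
    {t : ℝ} (ht : t ∈ Set.Icc (0 : ℝ) 1) : ∀ a ∈ dscale t L, DLet ν c S₂ T k a := by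
  intro a ha
  obtain ⟨b, hb, rfl⟩ := List.mem_map.1 ha
  exact (h b hb).scale ht

theorem DLet.mul_inv {a : Matrix Ω Ω R × Matrix Ω Ω R} (h : DLet ν c S₂ T k a) :
    (1 + a.2) * (1 - a.2) = 1 ∧ (1 - a.2) * (1 + a.2) = 1 := by
  constructor
  · rw [add_mul, one_mul, mul_sub, mul_one, h.yy]; abel
  · rw [sub_mul, one_mul, mul_add, mul_one, h.yy]; abel

theorem zs_mul_zs' {L : List (Matrix Ω Ω R × Matrix Ω Ω R)} (h : ∀ a ∈ L, DLet ν c S₂ T k a) :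
    zs L * zs' L = 1 ∧ zs' L * zs L = 1 := by
  induction L with
  | nil => simp [zs, zs']
  | cons a L ih =>
    obtain ⟨h1, h2⟩ := ih fun b hb => h b (by simp [hb])
    obtain ⟨h3, h4⟩ := (h a (by simp)).mul_inv
    constructor
    · rw [zs, zs', show (1 + a.2) * zs L * (zs' L * (1 - a.2)) =
        (1 + a.2) * (zs L * zs' L) * (1 - a.2) by simp only [mul_assoc], h1, mul_one, h3]
    · rw [zs, zs', show zs' L * (1 - a.2) * ((1 + a.2) * zs L) =
        zs' L * ((1 - a.2) * (1 + a.2)) * zs L by simp only [mul_assoc], h4, mul_one, h2]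

theorem zs_qinv (hS₂ : IsFilt S₂) {L : List (Matrix Ω Ω R × Matrix Ω Ω R)}
    (h : ∀ a ∈ L, DLet ν c S₂ T k a) :
    QInv ν c S₂ (L.length * (k + 2) + 1) (zs L) (zs' L) := by
  obtain ⟨h1, h2⟩ := zs_mul_zs' h
  refine ⟨?_, ?_, Nr.of_eq _ h1, Nr.of_eq _ h2⟩
  · clear h1 h2
    induction L with
    | nil => exact Ctl.one hS₂ (by omega)
    | cons a L ih =>
      refine (((Ctl.one hS₂ (by omega)).add (h a (by simp)).ctl).mul hS₂
        (ih fun b hb => h b (by simp [hb]))).mono (le_of_eq ?_)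
      simp; ring
  · clear h1 h2
    induction L with
    | nil => exact Ctl.one hS₂ (by omega)
    | cons a L ih =>
      refine ((ih fun b hb => h b (by simp [hb])).mul hS₂
        ((Ctl.one hS₂ (by omega)).sub (h a (by simp)).ctl)).mono (le_of_eq ?_)
      simp; ring

theorem QInv.dlet (mv : MV ν νs π c K S S₁ S₂ S₁₂ T) {U V : Matrix Ω Ω R}
    (hU : QInv ν c S m U V) {a : Matrix Ω Ω R × Matrix Ω Ω R} (ha : DLet ν c S₂ T k a) :
    QInv ν c S (m + 2 * (k + 2)) (U * (1 + a.2)) ((1 - a.2) * V) := by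
  have c1 := Ctl.one (ν := ν) (c := c) (ι := Ω) mv.filt (show 1 ≤ k + 1 by omega)
  have ca := ha.ctl.filt_mono mv.le₂
  obtain ⟨h1, h2⟩ := ha.mul_inv
  refine ⟨(hU.1.mul mv.filt (c1.add ca)).mono (by omega),
    ((c1.sub ca).mul mv.filt hU.2.1).mono (by omega), ?_, ?_⟩
  · rw [show U * (1 + a.2) * ((1 - a.2) * V) = U * ((1 + a.2) * (1 - a.2)) * V by
      simp only [Matrix.mul_assoc], h1, Matrix.mul_one]
    exact hU.2.2.1.mono (by omega)
  · have := (hU.2.2.2.mul_left (c1.sub ca)).mul_right (c1.add ca)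
    rw [Matrix.mul_one, h2] at this
    rw [show (1 - a.2) * V * (U * (1 + a.2)) = (1 - a.2) * (V * U) * (1 + a.2) by
      simp only [Matrix.mul_assoc]]
    exact this.mono (by omega)

/-- This is where the neighborhood of Δ₁ is used: both conjugating factors have bounded propagation,
so UxV lies over the first subalgebra. As VU ≈ 1 and x² = 0, its square nearly vanishes, which makes
1 + UxV and 1 - UxV approximate inverses. -/
theorem DLet.conj (mv : MV ν νs π c K S S₁ S₂ S₁₂ T) (hk : 1 ≤ k) (hkm : k ≤ m) (hm : m ≤ K)
    {U V : Matrix Ω Ω R}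
    (hU : QInv ν c S m U V) {a : Matrix Ω Ω R × Matrix Ω Ω R} (ha : DLet ν c S₂ T k a) :
    Ctl ν c S₁ (2 * m + k + 1) (U * a.1 * V) ∧ (U * a.1 * V).map π = 0 ∧
      Nr ν c (5 * m + 2 * k + 2) (U * a.1 * V * (U * a.1 * V)) 0 ∧
      Nr ν c (2 * m + k + 1) (U * a.1 * V * U) (U * a.1) := by
  have cx : Ctl ν c S (k + 1) a.1 := ⟨by omega, fun i j => S.monotone
    (mul_le_mul_of_nonneg_right (Nat.cast_le.2 (Nat.le_succ k)) c.ρ_pos.le)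
    (mv.T_le k (ha.mem i j)), ha.bd⟩
  have hg := (hU.1.mul mv.filt cx).mul mv.filt hU.2.1
  refine ⟨⟨by omega, fun i j => ?_, hg.bd.trans (c.pow_le (by omega))⟩, ?_, ?_, ?_⟩
  · rw [Matrix.mul_apply]
    refine Submodule.sum_mem _ fun p _ => ?_
    rw [Matrix.mul_apply, Finset.sum_mul]
    refine Submodule.sum_mem _ fun r _ => ?_
    refine S₁.monotone ?_ (mv.nbhd hk (hkm.trans hm) (hk.trans hkm) hm (hk.trans hkm) hm
      (hU.1.mem i r) (ha.mem r p) (hU.2.1.mem p j))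
    exact mul_le_mul_of_nonneg_right (Nat.cast_le.2 (by omega)) c.ρ_pos.le
  · have h0 : a.1.map π = 0 := by ext i j; exact mv.π_T (ha.mem i j)
    rw [Matrix.map_mul, Matrix.map_mul, h0, Matrix.mul_zero, Matrix.zero_mul]
  · have := (hU.2.2.2.mul_left (hU.1.mul mv.filt cx)).mul_right (cx.mul mv.filt hU.2.1)
    rw [Matrix.mul_one, show U * a.1 * (a.1 * V) = U * (a.1 * a.1) * V by
      simp only [Matrix.mul_assoc], ha.xx, Matrix.mul_zero, Matrix.zero_mul] at this
    rw [show U * a.1 * V * (U * a.1 * V) = U * a.1 * (V * U) * (a.1 * V) by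
      simp only [Matrix.mul_assoc]]
    exact this.mono (by omega)
  · have := hU.2.2.2.mul_left (hU.1.mul mv.filt cx)
    rw [Matrix.mul_one] at this
    rw [Matrix.mul_assoc (U * a.1)]
    exact this.mono (by omega)

theorem zp_ctl (mv : MV ν νs π c K S S₁ S₂ S₁₂ T) {L : List (Matrix Ω Ω R × Matrix Ω Ω R)}
    (h : ∀ a ∈ L, DLet ν c S₂ T k a) : Ctl ν c S (L.length * (k + 3) + 1) (zp L) := by
  induction L with
  | nil => exact Ctl.one mv.filt (by omega)
  | cons a L ih =>
    have ha := h a (by simp)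
    have cx : Ctl ν c S (k + 1) a.1 := ⟨by omega, fun i j => S.monotone
      (mul_le_mul_of_nonneg_right (Nat.cast_le.2 (Nat.le_succ k)) c.ρ_pos.le)
      (mv.T_le k (ha.mem i j)), ha.bd⟩
    refine (((Ctl.one mv.filt (by omega)).add (cx.add (ha.ctl.filt_mono mv.le₂))).mul mv.filt
      (ih fun b hb => h b (by simp [hb]))).mono (le_of_eq ?_)
    simp; ring

/-- One step of the induction is U(1 + x)(1 + y) ≈ (1 + UxV) · U(1 + y), after which U(1 + y) takes
the place of U. The number B dominates the index of every conjugating matrix that occurs; each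
letter raises it by 2(k + 2), and only the final value has to stay below K. -/
theorem zf_spec (mv : MV ν νs π c K S S₁ S₂ S₁₂ T) (hk : 1 ≤ k)
    {L : List (Matrix Ω Ω R × Matrix Ω Ω R)} (hL : ∀ a ∈ L, DLet ν c S₂ T k a)
    {U V : Matrix Ω Ω R} (hU : QInv ν c S m U V) (hkm : k ≤ m)
    (hB : m + L.length * (2 * (k + 2)) ≤ B) (hBK : B ≤ K) :
    Ctl ν c S₁ (L.length * (2 * B + k + 2) + 1) (zf U V L) ∧
    Ctl ν c S₁ (L.length * (2 * B + k + 2) + 1) (zf' U V L) ∧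
    (zf U V L).map π = 1 ∧ (zf' U V L).map π = 1 ∧
    Nr ν c (L.length * (4 * B + 2 * k + 5) + (5 * B + 2 * k + 2)) (zf U V L * zf' U V L) 1 ∧
    Nr ν c (L.length * (4 * B + 2 * k + 5) + (5 * B + 2 * k + 2)) (zf' U V L * zf U V L) 1 ∧
    Nr ν c (L.length * (2 * B + k + 3) + 2 * B + k + 1) (zf U V L * U * zs L) (U * zp L) := by
  induction L generalizing U V m with
  | nil =>
    refine ⟨Ctl.one mv.filt₁ (by simp), Ctl.one mv.filt₁ (by simp), ?_, ?_,
      Nr.of_eq _ (mul_one _), Nr.of_eq _ (mul_one _), Nr.of_eq _ ?_⟩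
    · exact Matrix.map_one _ (map_zero π) (map_one π)
    · exact Matrix.map_one _ (map_zero π) (map_one π)
    · simp [zf, zs, zp]
  | cons a L ih =>
    have ha := hL a (by simp)
    rw [List.length_cons] at hB ⊢
    set n := L.length
    have e1 : (n + 1) * (2 * (k + 2)) = n * (2 * (k + 2)) + 2 * (k + 2) := by ring
    have e2 : (n + 1) * (2 * B + k + 2) = n * (2 * B + k + 2) + (2 * B + k + 2) := by ring
    have e3 : (n + 1) * (4 * B + 2 * k + 5) = n * (4 * B + 2 * k + 5) + (4 * B + 2 * k + 5) := by
      ring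
    have e4 : (n + 1) * (2 * B + k + 3) = n * (2 * B + k + 3) + (2 * B + k + 3) := by ring
    have e5 : n * (2 * B + k + 3) = n * (2 * B + k + 2) + n := by ring
    obtain ⟨i1, i2, i3, i4, i5, i6, i7⟩ := ih (fun b hb => hL b (by simp [hb]))
      (hU.dlet mv ha) (by omega) (by omega)
    obtain ⟨g1, g2, g3, g4⟩ := ha.conj mv hk hkm (by omega) hU
    have c1 := Ctl.one (ν := ν) (c := c) (ι := Ω) mv.filt₁ (show 1 ≤ 2 * m + k + 1 by omega)
    have m1 : (1 : Matrix Ω Ω R).map π = 1 := Matrix.map_one _ (map_zero π) (map_one π)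
    set g := U * a.1 * V with hg
    have cp : Ctl ν c S₁ (2 * B + k + 2) (1 + g) := (c1.add g1).mono (by omega)
    have cm : Ctl ν c S₁ (2 * B + k + 2) (1 - g) := (c1.sub g1).mono (by omega)
    have sq1 : Nr ν c (5 * B + 2 * k + 2) ((1 + g) * (1 - g)) 1 := by
      have : (1 + g) * (1 - g) - 1 = -(g * g - 0) := by noncomm_ring
      rw [Nr, this, ν.neg]; exact g3.mono (by omega)
    have sq2 : Nr ν c (5 * B + 2 * k + 2) ((1 - g) * (1 + g)) 1 := by
      have : (1 - g) * (1 + g) - 1 = -(g * g - 0) := by noncomm_ring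
      rw [Nr, this, ν.neg]; exact g3.mono (by omega)
    rw [zf, zf', zs, zp, ← hg]
    set Z := zf (U * (1 + a.2)) ((1 - a.2) * V) L
    set Z' := zf' (U * (1 + a.2)) ((1 - a.2) * V) L
    refine ⟨(cp.mul mv.filt₁ i1).mono (by omega), (i2.mul mv.filt₁ cm).mono (by omega), ?_, ?_,
      ?_, ?_, ?_⟩
    · rw [Matrix.map_mul, i3, Matrix.map_add _ (map_add π), m1, g2]; simp
    · rw [Matrix.map_mul, i4, Matrix.map_sub _ (map_sub π), m1, g2]; simp
    · have h1 := ((i5.mul_left cp).mul_right cm)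
      rw [Matrix.mul_one] at h1
      rw [show (1 + g) * Z * (Z' * (1 - g)) = (1 + g) * (Z * Z') * (1 - g) by
        simp only [Matrix.mul_assoc]]
      exact (h1.trans sq1).mono (by omega)
    · have h1 := ((sq2.mul_left i2).mul_right i1).trans
        ((Nr.of_eq 0 (by rw [Matrix.mul_one])).trans i6)
      rw [show Z' * (1 - g) * ((1 + g) * Z) = Z' * ((1 - g) * (1 + g)) * Z by
        simp only [Matrix.mul_assoc]]
      have e6 : n * (4 * B + 2 * k + 5) = 2 * (n * (2 * B + k + 2)) + n := by ring
      exact h1.mono (by omega)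
    · have h1 := i7.mul_left cp
      -- VU ≈ 1 moves the letter from the left of U to its right: (1 + UxV)U ≈ U(1 + x).
      have h2 : Nr ν c (2 * m + k + 2) ((1 + g) * U) (U * (1 + a.1)) := by
        have := (Nr.refl (ν := ν) (c := c) (2 * m + k + 1) U).add g4
        rwa [show U + g * U = (1 + g) * U by noncomm_ring,
          show U + U * a.1 = U * (1 + a.1) by noncomm_ring] at this
      have cy := (Ctl.one (ν := ν) (c := c) (ι := Ω) mv.filt (show 1 ≤ k + 1 by omega)).add
        (ha.ctl.filt_mono mv.le₂)
      have cz : Ctl ν c S (n * (k + 3) + 1) (zp L) := zp_ctl mv fun b hb => hL b (by simp [hb])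
      have h3 := h2.mul_right (cy.mul mv.filt cz)
      have e6 : n * (2 * B + k + 3) = n * (k + 3) + n * (2 * B) := by ring
      rw [show (1 + g) * (Z * (U * (1 + a.2)) * zs L) = (1 + g) * Z * U * ((1 + a.2) * zs L) by
        simp only [Matrix.mul_assoc]] at h1
      -- (1 + x)(1 + y) = 1 + x + y because xy = 0.
      rw [show (1 + g) * U * ((1 + a.2) * zp L) = (1 + g) * (U * (1 + a.2) * zp L) by
        simp only [Matrix.mul_assoc],
        show U * (1 + a.1) * ((1 + a.2) * zp L) = U * (((1 + a.1) * (1 + a.2)) * zp L) by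
        simp only [Matrix.mul_assoc],
        show (1 + a.1) * (1 + a.2) = 1 + (a.1 + a.2) + a.1 * a.2 by noncomm_ring, ha.xy,
        add_zero] at h3
      exact (h1.trans h3).mono (by omega)

/-- Both parts of a decomposed letter stay in the corner of the letter, so all products between them
vanish. -/
theorem MV.exists_dlet (mv : MV ν νs π c K S S₁ S₂ S₁₂ T) (hk : k ≤ K)
    {L : List (Bool × Matrix Λ Λ R)} (hL : ∀ a ∈ L, Ctl ν c S k a.2) :
    ∃ L' : List (Matrix (Λ ⊕ Λ) (Λ ⊕ Λ) R × Matrix (Λ ⊕ Λ) (Λ ⊕ Λ) R),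
      L'.length = L.length ∧ (∀ a ∈ L', DLet ν c S₂ T k a) ∧ lprod L = zp L' := by
  induction L with
  | nil => exact ⟨[], rfl, by simp, rfl⟩
  | cons a L ih =>
    obtain ⟨L', h1, h2, h3⟩ := ih fun b hb => hL b (by simp [hb])
    obtain ⟨x, y, hxy, hx, hxn, hy⟩ := mv.dec a.2 hk (hL a (by simp))
    refine ⟨(lm (a.1, x), lm (a.1, y)) :: L', by simp [h1], ?_, ?_⟩
    · intro b hb
      rcases List.mem_cons.1 hb with rfl | hb
      · have hm : ∀ x y : Matrix Λ Λ R, lm (a.1, x) * lm (a.1, y) = 0 := fun x y => by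
          unfold lm; simp only; split_ifs <;> simp [Matrix.fromBlocks_multiply]
        refine ⟨?_, ?_, hy.lm, hm _ _, hm _ _, hm _ _⟩
        · unfold lm; simp only
          split_ifs <;> rintro (i | i) (j | j) <;> first | exact hx i j | exact Submodule.zero_mem _
        · unfold lm; simp only
          split_ifs
          · exact (ν.offDiag_le _ _).trans (max_le hxn (by rw [ν.zero]; exact (c.pow_pos _).le))
          · exact (ν.offDiag_le _ _).trans (max_le (by rw [ν.zero]; exact (c.pow_pos _).le) hxn)
      · exact h2 b hb
    · rw [lprod_cons, zp, ← h3]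
      congr 2
      unfold lm; simp only [hxy]
      split_ifs <;> simp [Matrix.fromBlocks_add]

/-- A product of few elementary matrices factors through the two subalgebras, up to conjugation
of the first factor. -/
theorem MV.exists_factor (mv : MV ν νs π c K S S₁ S₂ S₁₂ T) {U V : Matrix (Λ ⊕ Λ) (Λ ⊕ Λ) R}
    (hU : QInv ν c S k U V) {L : List (Bool × Matrix Λ Λ R)} (hL : ∀ a ∈ L, Ctl ν c S k a.2)
    (hn : L.length ≤ 18) (hK : 20000 * k ≤ K) :
    ∃ z₁ z₁' z₂ z₂' : Matrix (Λ ⊕ Λ) (Λ ⊕ Λ) R, QInv ν c S₁ (12000 * k) z₁ z₁' ∧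
      QInv ν c S₂ (12000 * k) z₂ z₂' ∧ z₁.map π = 1 ∧ z₁'.map π = 1 ∧ z₂ * z₂' = 1 ∧
      Nr ν c (12000 * k) (z₁ * U * z₂) (U * lprod L) ∧
      HT ν S₁ 1 (c.q (20000 * k)) 1 z₁ ∧ HT ν S₂ 1 (c.q (20000 * k)) 1 z₂ := by
  have hk := hU.1.pos
  obtain ⟨L', h1, h2, h3⟩ := mv.exists_dlet (by omega) hL
  -- Scaling the decomposed letters joins each factor to 1 inside its own subalgebra; exactness in
  -- degree one depends on this.
  have key : ∀ t ∈ Set.Icc (0 : ℝ) 1, QInv ν c S₁ (12000 * k) (zf U V (dscale t L'))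
      (zf' U V (dscale t L')) := by
    intro t ht
    -- For at most 18 letters the conjugating index is at most k + 18 · 2(k + 2) = 37k + 72 ≤ 109k.
    obtain ⟨a1, a2, -, -, a5, a6, -⟩ := zf_spec (B := 109 * k) mv hk (dscale_dlet h2 ht) hU le_rfl
      (by rw [dscale_length, h1]; nlinarith) (by omega)
    rw [dscale_length, h1] at *
    have b1 : L.length * (2 * (109 * k) + k + 2) ≤ 18 * (2 * (109 * k) + k + 2) :=
      Nat.mul_le_mul_right _ hn
    have b2 : L.length * (4 * (109 * k) + 2 * k + 5) ≤ 18 * (4 * (109 * k) + 2 * k + 5) :=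
      Nat.mul_le_mul_right _ hn
    exact ⟨a1.mono (by omega), a2.mono (by omega), a5.mono (by omega), a6.mono (by omega)⟩
  have key2 : ∀ t ∈ Set.Icc (0 : ℝ) 1, QInv ν c S₂ (12000 * k) (zs (dscale t L'))
      (zs' (dscale t L')) := by
    intro t ht
    have := zs_qinv mv.filt₂ (dscale_dlet h2 ht)
    rw [dscale_length, h1] at this
    have b1 : L.length * (k + 2) ≤ 18 * (k + 2) := Nat.mul_le_mul_right _ hn
    exact this.mono (by omega)
  have H1 := HT.of_qinv_path (l := 20000 * k) (continuous_zf L' continuous_const continuous_const)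
    (continuous_zf' L' continuous_const continuous_const) key (by omega)
  have H2 := HT.of_qinv_path (l := 20000 * k) (continuous_zs L') (continuous_zs' L') key2
    (by omega)
  rw [zf_zero, dscale_one] at H1
  rw [zs_zero, dscale_one] at H2
  have k1 := key 1 ⟨zero_le_one, le_rfl⟩
  have k2 := key2 1 ⟨zero_le_one, le_rfl⟩
  rw [dscale_one] at k1 k2
  obtain ⟨-, -, a3, a4, -, -, a7⟩ := zf_spec (B := 109 * k) mv hk h2 hU le_rfl
      (by rw [h1]; nlinarith) (by omega)
  rw [h1, ← h3] at a7
  have b1 : L.length * (2 * (109 * k) + k + 3) ≤ 18 * (2 * (109 * k) + k + 3) :=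
    Nat.mul_le_mul_right _ hn
  exact ⟨_, _, _, _, k1, k2, a3, a4, (zs_mul_zs' h2).1, a7.mono (by omega), H1, H2⟩

end factorization


/-! ### Gluing of modules and its uniqueness -/

/-- The module obtained from trivial modules over two subalgebras by gluing along `u` is, up to
errors, the range of `e`. -/
structure IsPatch {R : Type*} [Ring R] [Algebra ℂ R] [TopologicalSpace R] (ν : MNorm R)
    (c : Scale) (S₁ S₂ : ℝ →o Submodule ℂ R) (k : ℕ) {ι Ω : Type} [Fintype ι] [DecidableEq ι]
    [Fintype Ω] [DecidableEq Ω] (u : Matrix ι ι R) (e : Matrix Ω Ω R) (α₁ : Matrix Ω ι R)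
    (β₁ : Matrix ι Ω R) (α₂ : Matrix Ω ι R) (β₂ : Matrix ι Ω R) : Prop where
  ca₁ : Ctl ν c S₁ k α₁
  cb₁ : Ctl ν c S₁ k β₁
  ca₂ : Ctl ν c S₂ k α₂
  cb₂ : Ctl ν c S₂ k β₂
  ab₁ : Nr ν c k (α₁ * β₁) e
  ab₂ : Nr ν c k (α₂ * β₂) e
  ba₁ : Nr ν c k (β₁ * α₁) 1
  ba₂ : Nr ν c k (β₂ * α₂) 1
  glue : Nr ν c k (β₁ * α₂) u

/-- The idempotent `e` arises from `u` by gluing. -/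
def Patch {R : Type*} [Ring R] [Algebra ℂ R] [TopologicalSpace R] (ν : MNorm R)
    (c : Scale) (S₁ S₂ : ℝ →o Submodule ℂ R) (k : ℕ) {ι Ω : Type} [Fintype ι] [DecidableEq ι]
    [Fintype Ω] [DecidableEq Ω] (u : Matrix ι ι R) (e : Matrix Ω Ω R) : Prop :=
  ∃ α₁ β₁ α₂ β₂, IsPatch ν c S₁ S₂ k u e α₁ β₁ α₂ β₂

section patching

variable {R : Type*} [Ring R] [Algebra ℂ R] [TopologicalSpace R]
  [IsTopologicalRing R] [ContinuousSMul ℂ R] {ν : MNorm R} {νs : MNorm ℂ} {π : R →ₐ[ℂ] ℂ}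
  {c : Scale} {K : ℕ} {S S₁ S₂ S₁₂ : ℝ →o Submodule ℂ R} {T : ℕ → Submodule ℂ R}
  {k l m n B : ℕ}
  {ι κ η α β Λ Ω Ω' : Type} [Fintype ι] [DecidableEq ι] [Fintype κ]
  [DecidableEq κ] [Fintype η] [DecidableEq η] [Fintype α] [DecidableEq α] [Fintype β]
  [DecidableEq β] [Fintype Λ] [DecidableEq Λ] [Fintype Ω] [DecidableEq Ω] [Fintype Ω']
  [DecidableEq Ω']

theorem Patch.mono {u : Matrix ι ι R} {e : Matrix Ω Ω R} (h : Patch ν c S₁ S₂ k u e)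
    (hl : k ≤ l) : Patch ν c S₁ S₂ l u e := by
  obtain ⟨α₁, β₁, α₂, β₂, h⟩ := h
  exact ⟨α₁, β₁, α₂, β₂, h.ca₁.mono hl, h.cb₁.mono hl, h.ca₂.mono hl, h.cb₂.mono hl,
    h.ab₁.mono hl, h.ab₂.mono hl, h.ba₁.mono hl, h.ba₂.mono hl, h.glue.mono hl⟩

/-- α₁'β₁ ≈ α₁'β₁α₂β₂ ≈ α₁'uβ₂ ≈ α₁'β₁'α₂'β₂ ≈ α₂'β₂'α₂'β₂ ≈ α₂'β₂. Thus the comparison map formed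
over the first subalgebra agrees with the one formed over the second. -/
theorem IsPatch.compare {u : Matrix ι ι R} {e : Matrix Ω Ω R} {e' : Matrix Ω' Ω' R}
    {α₁ β₁ α₂ β₂ α₁' β₁' α₂' β₂'} (h : IsPatch ν c S₁ S₂ k u e α₁ β₁ α₂ β₂)
    (h' : IsPatch ν c S₁ S₂ k u e' α₁' β₁' α₂' β₂') :
    Nr ν c (10 * k) (α₁' * β₁) (α₂' * β₂) := by
  have hk := h.ca₁.pos
  have h1 := (h.ab₁.trans h.ab₂.symm).mul_left h.cb₁
  rw [← Matrix.mul_assoc] at h1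
  have h2 := h.ba₁.mul_right h.cb₁
  rw [Matrix.one_mul] at h2
  have h3 := (h2.symm.trans h1).mul_left h'.ca₁
  have h4 := ((h.glue.trans h'.glue.symm).mul_right h.cb₂).mul_left h'.ca₁
  rw [Matrix.mul_assoc β₁ α₂] at h4
  have h5 := ((h'.ab₁.trans h'.ab₂.symm).mul_right h'.ca₂).mul_right h.cb₂
  have h6 := (h'.ba₂.mul_left h'.ca₂).mul_right h.cb₂
  rw [Matrix.mul_one] at h6
  rw [show α₁' * (β₁' * α₂' * β₂) = α₁' * β₁' * α₂' * β₂ by simp only [Matrix.mul_assoc]] at h4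
  rw [show α₂' * β₂' * α₂' * β₂ = α₂' * (β₂' * α₂') * β₂ by simp only [Matrix.mul_assoc]] at h5
  exact (((h3.trans h4).trans h5).trans h6).mono (by omega)

/-- The comparison maps in both directions are close to both subalgebras. Intersection approximation
moves them into the intersection, where they implement the equivalence. -/
theorem Patch.unique (mv : MV ν νs π c K S S₁ S₂ S₁₂ T) {u : Matrix ι ι R} {e : Matrix Ω Ω R}
    {e' : Matrix Ω' Ω' R} (h : Patch ν c S₁ S₂ k u e) (h' : Patch ν c S₁ S₂ k u e')
    (hK : 10 * k ≤ K) : MvN ν c S₁₂ (40 * k) e e' := by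
  obtain ⟨α₁, β₁, α₂, β₂, h⟩ := h
  obtain ⟨α₁', β₁', α₂', β₂', h'⟩ := h'
  have hk := h.ca₁.pos
  obtain ⟨t, ct, t1, -, -⟩ := mv.exists_cia ((h'.ca₁.mul mv.filt₁ h.cb₁).mono (by omega))
    ((h'.ca₂.mul mv.filt₂ h.cb₂).mono (by omega)) (h.compare h') hK
  obtain ⟨s, cs, s1, -, -⟩ := mv.exists_cia ((h.ca₁.mul mv.filt₁ h'.cb₁).mono (by omega))
    ((h.ca₂.mul mv.filt₂ h'.cb₂).mono (by omega)) (h'.compare h) hK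
  refine ⟨s, t, cs.mono (by omega), ct.mono (by omega), ?_, ?_⟩
  · have h1 := (t1.mul_left cs).trans (s1.mul_right (h'.ca₁.mul mv.filt₁ h.cb₁))
    have h2 := (h'.ba₁.mul_left h.ca₁).mul_right h.cb₁
    rw [Matrix.mul_one] at h2
    rw [show α₁ * β₁' * (α₁' * β₁) = α₁ * (β₁' * α₁') * β₁ by simp only [Matrix.mul_assoc]] at h1
    exact ((h1.trans h2).trans h.ab₁).mono (by omega)
  · have h1 := (s1.mul_left ct).trans (t1.mul_right (h.ca₁.mul mv.filt₁ h'.cb₁))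
    have h2 := (h.ba₁.mul_left h'.ca₁).mul_right h'.cb₁
    rw [Matrix.mul_one] at h2
    rw [show α₁' * β₁ * (α₁ * β₁') = α₁' * (β₁ * α₁) * β₁' by simp only [Matrix.mul_assoc]] at h1
    exact ((h1.trans h2).trans h'.ab₁).mono (by omega)

theorem Patch.nr {u u' : Matrix ι ι R} {e : Matrix Ω Ω R} (h : Patch ν c S₁ S₂ k u e)
    (hu : Nr ν c k u u') : Patch ν c S₁ S₂ (k + 1) u' e := by
  obtain ⟨α₁, β₁, α₂, β₂, h⟩ := h
  have hl := Nat.le_succ k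
  exact ⟨α₁, β₁, α₂, β₂, h.ca₁.mono hl, h.cb₁.mono hl, h.ca₂.mono hl, h.cb₂.mono hl,
    h.ab₁.mono hl, h.ab₂.mono hl, h.ba₁.mono hl, h.ba₂.mono hl, h.glue.trans' hu⟩

/-- z₁ and z₂ change the frames over the respective subalgebras; the glued module stays the same. -/
theorem Patch.mul (hS₁ : IsFilt S₁) (hS₂ : IsFilt S₂) {u z₁ z₁' z₂ z₂' : Matrix ι ι R}
    {e : Matrix Ω Ω R} (h : Patch ν c S₁ S₂ k u e) (h1 : QInv ν c S₁ k z₁ z₁')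
    (h2 : QInv ν c S₂ k z₂ z₂') : Patch ν c S₁ S₂ (6 * k) (z₁ * u * z₂) e := by
  obtain ⟨α₁, β₁, α₂, β₂, h⟩ := h
  have hk := h.ca₁.pos
  have key : ∀ {α : Matrix Ω ι R} {β : Matrix ι Ω R} {z z' : Matrix ι ι R}
      {S' : ℝ →o Submodule ℂ R}, Ctl ν c S' k α → Ctl ν c S' k β → QInv ν c S' k z z' →
      Nr ν c k (α * β) e → Nr ν c k (β * α) 1 →
      Nr ν c (6 * k) (α * z' * (z * β)) e ∧ Nr ν c (6 * k) (z * β * (α * z')) 1 := by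
    intro α β z z' S' ca cb hz hab hba
    constructor
    · have h3 := (hz.2.2.2.mul_left ca).mul_right cb
      rw [Matrix.mul_one] at h3
      rw [show α * z' * (z * β) = α * (z' * z) * β by simp only [Matrix.mul_assoc]]
      exact (h3.trans hab).mono (by omega)
    · have h3 := (hba.mul_left hz.1).mul_right hz.2.1
      rw [Matrix.mul_one] at h3
      rw [show z * β * (α * z') = z * (β * α) * z' by simp only [Matrix.mul_assoc]]
      exact (h3.trans hz.2.2.1).mono (by omega)
  obtain ⟨p1, p2⟩ := key h.ca₁ h.cb₁ h1 h.ab₁ h.ba₁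
  obtain ⟨p3, p4⟩ := key h.ca₂ h.cb₂ h2.symm h.ab₂ h.ba₂
  refine ⟨α₁ * z₁', z₁ * β₁, α₂ * z₂, z₂' * β₂, (h.ca₁.mul hS₁ h1.2.1).mono (by omega),
    (h1.1.mul hS₁ h.cb₁).mono (by omega), (h.ca₂.mul hS₂ h2.1).mono (by omega),
    (h2.2.1.mul hS₂ h.cb₂).mono (by omega), p1, p3, p2, p4, ?_⟩
  rw [show z₁ * β₁ * (α₂ * z₂) = z₁ * (β₁ * α₂) * z₂ by simp only [Matrix.mul_assoc]]
  exact ((h.glue.mul_left h1.1).mul_right h2.1).mono (by omega)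

theorem Patch.diag {u : Matrix ι ι R} {e : Matrix Ω Ω R} {u' : Matrix κ κ R}
    {e' : Matrix Ω' Ω' R} (h : Patch ν c S₁ S₂ k u e) (h' : Patch ν c S₁ S₂ k u' e') :
    Patch ν c S₁ S₂ k (Matrix.fromBlocks u 0 0 u') (Matrix.fromBlocks e 0 0 e') := by
  obtain ⟨α₁, β₁, α₂, β₂, h⟩ := h
  obtain ⟨α₁', β₁', α₂', β₂', h'⟩ := h'
  refine ⟨_, _, _, _, h.ca₁.diag h'.ca₁, h.cb₁.diag h'.cb₁, h.ca₂.diag h'.ca₂,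
    h.cb₂.diag h'.cb₂, ?_, ?_, ?_, ?_, ?_⟩ <;>
    simp only [Matrix.fromBlocks_multiply, Matrix.zero_mul, Matrix.mul_zero, add_zero, zero_add]
  · exact h.ab₁.diag h'.ab₁
  · exact h.ab₂.diag h'.ab₂
  · rw [← Matrix.fromBlocks_one]; exact h.ba₁.diag h'.ba₁
  · rw [← Matrix.fromBlocks_one]; exact h.ba₂.diag h'.ba₂
  · exact h.glue.diag h'.glue

theorem Patch.reindex {u : Matrix ι ι R} {e : Matrix Ω Ω R} (h : Patch ν c S₁ S₂ k u e)
    (f : κ ≃ ι) (g : Ω' ≃ Ω) : Patch ν c S₁ S₂ k (u.submatrix f f) (e.submatrix g g) := by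
  obtain ⟨α₁, β₁, α₂, β₂, h⟩ := h
  refine ⟨α₁.submatrix g f, β₁.submatrix f g, α₂.submatrix g f, β₂.submatrix f g,
    h.ca₁.reindex _ _, h.cb₁.reindex _ _, h.ca₂.reindex _ _, h.cb₂.reindex _ _,
    ?_, ?_, ?_, ?_, ?_⟩ <;> rw [Matrix.submatrix_mul_equiv]
  · exact h.ab₁.reindex _ _
  · exact h.ab₂.reindex _ _
  · rw [← Matrix.submatrix_one_equiv f]; exact h.ba₁.reindex _ _
  · rw [← Matrix.submatrix_one_equiv f]; exact h.ba₂.reindex _ _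
  · exact h.glue.reindex _ _

/-- If the transition matrix is a product of factors from the two subalgebras, these factors serve
as frames of the trivial module. -/
theorem Patch.of_mul {z₁ z₁' z₂ z₂' : Matrix ι ι R}
    (h1 : QInv ν c S₁ k z₁ z₁') (h2 : QInv ν c S₂ k z₂ z₂') :
    Patch ν c S₁ S₂ k (z₁ * z₂) (1 : Matrix ι ι R) :=
  ⟨z₁', z₁, z₂, z₂', h1.2.1, h1.1, h2.1, h2.2.1, h1.2.2.2, h2.2.2.1, h1.2.2.1, h2.2.2.2,
    Nr.refl _ _⟩

theorem Patch.one (hS₁ : IsFilt S₁) (hS₂ : IsFilt S₂) (hk : 1 ≤ k) :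
    Patch ν c S₁ S₂ k (1 : Matrix ι ι R) (1 : Matrix ι ι R) := by
  have := Patch.of_mul (ν := ν) (c := c) (ι := ι) (QInv.one hS₁ hk) (QInv.one hS₂ hk)
  rwa [mul_one] at this

/-- The idempotent may be replaced by an equivalent one. -/
theorem Patch.mvN (hS₁ : IsFilt S₁) (hS₂ : IsFilt S₂) {u : Matrix ι ι R} {e : Matrix Ω Ω R}
    {e' : Matrix Ω' Ω' R} (h : Patch ν c S₁ S₂ k u e) (he : MvN ν c S₁₂ k e e')
    (he' : QId ν c S₁₂ k e') (hl₁ : S₁₂ ≤ S₁) (hl₂ : S₁₂ ≤ S₂) :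
    Patch ν c S₁ S₂ (10 * k) u e' := by
  obtain ⟨α₁, β₁, α₂, β₂, h⟩ := h
  obtain ⟨s, t, cs, ct, hst, hts⟩ := he
  have hk := h.ca₁.pos
  have key1 : ∀ {α : Matrix Ω ι R} {β : Matrix ι Ω R} {S' : ℝ →o Submodule ℂ R},
      Ctl ν c S' k α → Ctl ν c S' k β → Nr ν c k (α * β) e →
      Nr ν c (10 * k) (t * α * (β * s)) e' := by
    intro α β S' ca cb hab
    have h1 := ((hab.trans hst.symm).mul_left ct).mul_right cs
    have h2 := (hts.mul_right ct).mul_right cs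
    have h3 := (hts.mul_left he'.1).trans he'.2
    rw [show t * α * (β * s) = t * (α * β) * s by simp only [Matrix.mul_assoc]]
    rw [show t * (s * t) * s = t * s * t * s by simp only [Matrix.mul_assoc]] at h1
    rw [Matrix.mul_assoc e' t s] at h2
    exact ((h1.trans h2).trans h3).mono (by omega)
  have key2 : ∀ {α α' : Matrix Ω ι R} {β : Matrix ι Ω R} {S' S'' : ℝ →o Submodule ℂ R},
      Ctl ν c S' k α → Ctl ν c S' k β → Ctl ν c S'' k α' → Nr ν c k (α * β) e →
      Nr ν c k (β * α) 1 → Nr ν c (6 * k) (β * s * (t * α')) (β * α') := by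
    intro α α' β S' S'' ca cb ca' hab hba
    have h1 := ((hst.trans hab.symm).mul_left cb).mul_right ca'
    have h2 := (hba.mul_right cb).mul_right ca'
    rw [Matrix.one_mul] at h2
    rw [show β * s * (t * α') = β * (s * t) * α' by simp only [Matrix.mul_assoc]]
    rw [show β * (α * β) * α' = β * α * β * α' by simp only [Matrix.mul_assoc]] at h1
    exact (h1.trans h2).mono (by omega)
  have cs1 := cs.filt_mono hl₁
  have cs2 := cs.filt_mono hl₂
  have ct1 := ct.filt_mono hl₁
  have ct2 := ct.filt_mono hl₂
  exact ⟨t * α₁, β₁ * s, t * α₂, β₂ * s, (ct1.mul hS₁ h.ca₁).mono (by omega),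
    (h.cb₁.mul hS₁ cs1).mono (by omega), (ct2.mul hS₂ h.ca₂).mono (by omega),
    (h.cb₂.mul hS₂ cs2).mono (by omega), key1 h.ca₁ h.cb₁ h.ab₁, key1 h.ca₂ h.cb₂ h.ab₂,
    ((key2 h.ca₁ h.cb₁ h.ca₁ h.ab₁ h.ba₁).trans h.ba₁).mono (by omega),
    ((key2 h.ca₂ h.cb₂ h.ca₂ h.ab₂ h.ba₂).trans h.ba₂).mono (by omega),
    ((key2 h.ca₁ h.cb₁ h.ca₂ h.ab₁ h.ba₁).trans h.glue).mono (by omega)⟩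

/-- `U = diag(u, 1)` up to reindexing, with the index set made explicit. -/
theorem Patch.stab (hS₁ : IsFilt S₁) (hS₂ : IsFilt S₂) {u : Matrix ι ι R} {e : Matrix Ω Ω R}
    (h : Patch ν c S₁ S₂ k u e) {U : Matrix κ κ R} (hU : Stab U u) :
    ∃ (α : Type) (_ : Fintype α) (_ : DecidableEq α) (_ : κ ≃ ι ⊕ α),
      Patch ν c S₁ S₂ k U (Matrix.fromBlocks e 0 0 (1 : Matrix α α R)) := by
  obtain ⟨α, i1, i2, f, rfl⟩ := hU
  have hk : 1 ≤ k := by obtain ⟨α₁, β₁, α₂, β₂, h⟩ := h; exact h.ca₁.pos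
  exact ⟨α, i1, i2, f, by
    simpa using (h.diag (Patch.one (ι := α) hS₁ hS₂ hk)).reindex f (Equiv.refl _)⟩

theorem kcls_one_equiv {S : ℝ →o Submodule ℂ R} {i : Fin 2} {q : Param} (hS : IsFilt S)
    (hq : q.Good) (f : κ ≃ ι)
    (h1 : Cy ν S i q (1 : Matrix κ κ R)) (h2 : Cy ν S i q (1 : Matrix ι ι R)) :
    kcls ν S i q 1 h1 = kcls ν S i q 1 h2 := by
  have := kcls_reindex hS hq h2 f (by rw [Matrix.submatrix_one_equiv]; exact h1)
  simpa only [Matrix.submatrix_one_equiv] using this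

theorem kcls_one_sum {S : ℝ →o Submodule ℂ R} {i : Fin 2} {q : Param} (hS : IsFilt S)
    (hq : q.Good) (h1 : Cy ν S i q (1 : Matrix (ι ⊕ κ) (ι ⊕ κ) R))
    (h2 : Cy ν S i q (1 : Matrix ι ι R)) (h3 : Cy ν S i q (1 : Matrix κ κ R)) :
    kcls ν S i q 1 h1 = kcls ν S i q 1 h2 + kcls ν S i q 1 h3 := by
  rw [← kcls_diag hS hq h2 h3 (h2.diag h3)]
  simp only [Matrix.fromBlocks_one]

/-- The class obtained by gluing depends only on the class of `u`. -/
theorem Patch.kcls_sub (mv : MV ν νs π c K S S₁ S₂ S₁₂ T) {u : Matrix ι ι R}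
    {u' : Matrix κ κ R} {e : Matrix Ω Ω R} {e' : Matrix Ω' Ω' R}
    {hu : Cy ν S 1 (c.q k) u} {hu' : Cy ν S 1 (c.q k) u'}
    (huu : kcls ν S 1 (c.q k) u hu = kcls ν S 1 (c.q k) u' hu')
    (h : Patch ν c S₁ S₂ k u e) (h' : Patch ν c S₁ S₂ k u' e')
    (he : QId ν c S₁₂ k e) (he' : QId ν c S₁₂ k e')
    (hK : 20000000000000 * k ≤ K) (hl : 20000000000000 * k ≤ l)
    (h1 : Cy ν S₁₂ 0 (c.q l) e) (h2 : Cy ν S₁₂ 0 (c.q l) (1 : Matrix ι ι R))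
    (h3 : Cy ν S₁₂ 0 (c.q l) e') (h4 : Cy ν S₁₂ 0 (c.q l) (1 : Matrix κ κ R)) :
    kcls ν S₁₂ 0 (c.q l) e h1 - kcls ν S₁₂ 0 (c.q l) 1 h2 =
      kcls ν S₁₂ 0 (c.q l) e' h3 - kcls ν S₁₂ 0 (c.q l) 1 h4 := by
  have hk := he.1.pos
  have hg := c.good l
  -- Equality of the classes is turned into 18 letters, and these are factored into changes of
  -- frame: z₁Uz₂ ≈ U'.
  obtain ⟨Λ, i1, i2, U, U', L, s1, s2, hn, hL, hUU⟩ := lEq_of_kcls_eq mv.filt hk huu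
  obtain ⟨v, hv⟩ := hu.qinv hk
  obtain ⟨V, hV⟩ := s1.qinv mv.filt hv
  obtain ⟨z₁, z₁', z₂, z₂', q1, q2, -, -, -, hz, -, -⟩ := mv.exists_factor
    (hV.mono (show k ≤ 200000 * k by omega)) hL hn.le (by omega)
  obtain ⟨α, _, _, f, p1⟩ := h.stab mv.filt₁ mv.filt₂ s1
  obtain ⟨β, _, _, g, p2⟩ := h'.stab mv.filt₁ mv.filt₂ s2
  -- The index 2400000000k is 12000 · 200000k, the cost of the factorization after that of the
  -- swindle. Now both idempotents are glued along the same U'.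
  have p3 := (((p1.mono (show k ≤ 2400000000 * k by omega)).mul mv.filt₁ mv.filt₂
    (q1.mono (by omega)) (q2.mono (by omega)))).nr ((hz.trans hUU).mono (by omega))
  have h5 := p3.unique mv (p2.mono (by omega)) (by omega)
  have o1 : ∀ (α : Type) [Fintype α] [DecidableEq α], QId ν c S₁₂ k (1 : Matrix α α R) :=
    fun α _ _ => QId.one mv.filt₁₂ hk
  have o2 : ∀ (α : Type) [Fintype α] [DecidableEq α], Cy ν S₁₂ 0 (c.q l) (1 : Matrix α α R) :=
    fun α _ _ => (o1 α).cy (by omega)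
  have h6 := MvN.kcls_eq mv.filt₁₂ ((he.diag (o1 α)).mono (by omega))
    ((he'.diag (o1 β)).mono (by omega)) h5 (show _ ≤ l by omega) (h1.diag (o2 α)) (h3.diag (o2 β))
  rw [kcls_diag mv.filt₁₂ hg h1 (o2 α), kcls_diag mv.filt₁₂ hg h3 (o2 β)] at h6
  -- The index sets of u and u', enlarged by α and β respectively, are both in bijection with Λ ⊕ Λ;
  -- hence the identity summands that were added cancel in the difference.
  have h7 := kcls_one_equiv (ν := ν) mv.filt₁₂ hg f (o2 _) (o2 _)
  have h8 := kcls_one_equiv (ν := ν) mv.filt₁₂ hg g (o2 _) (o2 _)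
  rw [kcls_one_sum mv.filt₁₂ hg _ h2 (o2 α)] at h7
  rw [kcls_one_sum mv.filt₁₂ hg _ h4 (o2 β)] at h8
  have h9 := h7.symm.trans h8
  rw [sub_eq_sub_iff_add_eq_add]
  have h10 := congrArg₂ (· - ·) h6 h9
  rw [add_sub_add_right_eq_sub, add_sub_add_right_eq_sub] at h10
  exact sub_eq_sub_iff_add_eq_add.1 h10

end patching


/-! ### Boundary data and normalized representatives -/

/-- The trivial filtration of `ℂ`. -/
def topFil : ℝ →o Submodule ℂ ℂ := ⟨fun _ => ⊤, fun _ _ _ => le_rfl⟩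

theorem isFilt_topFil : IsFilt topFil := ⟨fun _ => trivial, fun _ _ _ _ _ _ => trivial⟩

section representatives

variable {R : Type*} [Ring R] [Algebra ℂ R] [TopologicalSpace R]
  [IsTopologicalRing R] [ContinuousSMul ℂ R] {ν : MNorm R} {νs : MNorm ℂ} {π : R →ₐ[ℂ] ℂ}
  {c : Scale} {K : ℕ} {S S₁ S₂ S₁₂ S' : ℝ →o Submodule ℂ R} {T : ℕ → Submodule ℂ R}
  {k l m n B : ℕ}
  {ι κ η α β Λ Ω Ω' : Type} [Fintype ι] [DecidableEq ι] [Fintype κ]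
  [DecidableEq κ] [Fintype η] [DecidableEq η] [Fintype α] [DecidableEq α] [Fintype β]
  [DecidableEq β] [Fintype Λ] [DecidableEq Λ] [Fintype Ω] [DecidableEq Ω] [Fintype Ω']
  [DecidableEq Ω']

theorem QId.of_nr {e e' : Matrix ι ι R} (h : QId ν c S k e) (h' : Ctl ν c S k e')
    (hn : Nr ν c k e e') : QId ν c S (5 * k) e' := by
  have hk := h.1.pos
  exact ⟨h'.mono (by omega),
    (((hn.symm.mul hn.symm h' h.1).trans h.2).trans hn).mono (by omega)⟩

theorem QId.conj (hS : IsFilt S) {e z z' : Matrix ι ι R} (h : QId ν c S k e)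
    (hz : QInv ν c S k z z') : QId ν c S (8 * k) (z' * e * z) := by
  have hk := h.1.pos
  have h1 := (hz.2.2.1.mul_left (hz.2.1.mul hS h.1)).mul_right (h.1.mul hS hz.1)
  have h2 := (h.2.mul_left hz.2.1).mul_right hz.1
  rw [Matrix.mul_one] at h1
  refine ⟨((hz.2.1.mul hS h.1).mul hS hz.1).mono (by omega), ?_⟩
  rw [show z' * e * z * (z' * e * z) = z' * e * (z * z') * (e * z) by
    simp only [Matrix.mul_assoc]]
  rw [show z' * e * (e * z) = z' * (e * e) * z by simp only [Matrix.mul_assoc]] at h1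
  exact (h1.trans h2).mono (by omega)

theorem MvN.conj (hS : IsFilt S) {e z z' : Matrix ι ι R} (h : QId ν c S k e)
    (hz : QInv ν c S k z z') : MvN ν c S (8 * k) (z' * e * z) e := by
  have hk := h.1.pos
  refine ⟨z' * e, e * z, (hz.2.1.mul hS h.1).mono (by omega), (h.1.mul hS hz.1).mono (by omega),
    ?_, ?_⟩
  · rw [show z' * e * (e * z) = z' * (e * e) * z by simp only [Matrix.mul_assoc]]
    exact ((h.2.mul_left hz.2.1).mul_right hz.1).mono (by omega)
  · have h1 := (hz.2.2.1.mul_left h.1).mul_right h.1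
    rw [Matrix.mul_one] at h1
    rw [show e * z * (z' * e) = e * (z * z') * e by simp only [Matrix.mul_assoc]]
    exact (h1.trans h.2).mono (by omega)

theorem MvN.of_nr {e f : Matrix ι ι R} (he : QId ν c S k e)
    (hn : Nr ν c k e f) : MvN ν c S (4 * k) e f := by
  have hk := he.1.pos
  exact ⟨e, e, he.1.mono (by omega), he.1.mono (by omega), he.2.mono (by omega),
    (he.2.trans hn).mono (by omega)⟩

/-- The data of the boundary map define a gluing. -/
theorem Patch.of_datum {u : Matrix ι ι R} {v : Matrix κ κ R}
    {w₁ w₁' w₂ w₂' e : Matrix (ι ⊕ κ) (ι ⊕ κ) R} (h1 : QInv ν c S₁ k w₁ w₁')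
    (h2 : QInv ν c S₂ k w₂ w₂') (huv : Nr ν c k (Matrix.fromBlocks u 0 0 v) (w₁ * w₂))
    (he1 : Nr ν c k e (w₁' * Matrix.fromBlocks 1 0 0 0 * w₁))
    (he2 : Nr ν c k e (w₂ * Matrix.fromBlocks 1 0 0 0 * w₂')) : Patch ν c S₁ S₂ k u e := by
  have key : ∀ a b : Matrix (ι ⊕ κ) (ι ⊕ κ) R, a.submatrix id Sum.inl * b.submatrix Sum.inl id =
      a * Matrix.fromBlocks (1 : Matrix ι ι R) 0 0 (0 : Matrix κ κ R) * b := by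
    intro a b
    rw [← Matrix.fromBlocks_toBlocks a, ← Matrix.fromBlocks_toBlocks b,
      Matrix.fromBlocks_multiply, Matrix.fromBlocks_multiply]
    ext (i | i) (j | j) <;> simp [Matrix.mul_apply]
  have key2 : ∀ a b : Matrix (ι ⊕ κ) (ι ⊕ κ) R, a.submatrix Sum.inl id * b.submatrix id Sum.inl =
      (a * b).submatrix Sum.inl (Sum.inl : ι → ι ⊕ κ) := by
    intro a b; ext i j; simp [Matrix.mul_apply]
  have hi : Function.Injective (Sum.inl : ι → ι ⊕ κ) := Sum.inl_injective
  have one : (1 : Matrix (ι ⊕ κ) (ι ⊕ κ) R).submatrix (Sum.inl : ι → ι ⊕ κ) Sum.inl = 1 := by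
    ext i j; simp [Matrix.one_apply]
  -- The frames are the first block column of w₁' with the first block row of w₁, and the first
  -- block column of w₂ with the first block row of w₂'. Their transition matrix is the upper left
  -- corner of w₁w₂ ≈ diag(u, v).
  refine ⟨w₁'.submatrix id Sum.inl, w₁.submatrix Sum.inl id, w₂.submatrix id Sum.inl,
    w₂'.submatrix Sum.inl id, h1.2.1.submatrix Function.injective_id hi,
    h1.1.submatrix hi Function.injective_id, h2.1.submatrix Function.injective_id hi,
    h2.2.1.submatrix hi Function.injective_id, ?_, ?_, ?_, ?_, ?_⟩
  · rw [key]; exact he1.symm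
  · rw [key]; exact he2.symm
  · rw [key2, ← one]; exact h1.2.2.1.submatrix hi hi
  · rw [key2, ← one]; exact h2.2.2.2.submatrix hi hi
  · rw [key2]
    exact huv.symm.submatrix hi hi

/-- Existence of the data of the boundary map. -/
theorem MV.exists_datum (mv : MV ν νs π c K S S₁ S₂ S₁₂ T) {u v : Matrix ι ι R}
    (hu : QInv ν c S k u v) (hK : 100000 * k ≤ K) :
    ∃ w₁ w₁' w₂ w₂' e : Matrix (ι ⊕ ι) (ι ⊕ ι) R, QInv ν c S₁ (600000 * k) w₁ w₁' ∧
      QInv ν c S₂ (600000 * k) w₂ w₂' ∧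
      Nr ν c (600000 * k) (Matrix.fromBlocks u 0 0 v) (w₁ * w₂) ∧
      QId ν c S₁₂ (600000 * k) e ∧
      Nr ν c (600000 * k) e (w₁' * Matrix.fromBlocks 1 0 0 0 * w₁) ∧
      Nr ν c (600000 * k) e (w₂ * Matrix.fromBlocks 1 0 0 0 * w₂') ∧
      e.map π = Matrix.fromBlocks 1 0 0 0 := by
  have hk := hu.1.pos
  -- The factorization is applied with U = 1 to the six letters of diag(u, v).
  obtain ⟨z₁, z₁', z₂, z₂', q1, q2, p1, p1', -, hz, -, -⟩ := mv.exists_factor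
    (QInv.one (ν := ν) (c := c) (ι := ι ⊕ ι) mv.filt hk) (whl_ctl mv.filt hu)
    (by rw [whl_length]; norm_num) (by omega)
  rw [Matrix.mul_one, Matrix.one_mul] at hz
  set D := Matrix.fromBlocks u 0 0 v
  set p : Matrix (ι ⊕ ι) (ι ⊕ ι) R := Matrix.fromBlocks 1 0 0 0 with hp
  have hD : Nr ν c (13000 * k) D (z₁ * z₂) := ((hz.trans (whl_nr hu)).symm).mono (by omega)
  have cp : ∀ {S' : ℝ →o Submodule ℂ R}, IsFilt S' → Ctl ν c S' k p := fun h =>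
    (Ctl.one h hk).diag (Ctl.zero hk)
  have hpp : p * p = p := by rw [hp, blocks_mul_blocks, mul_one, mul_zero]
  have hpD : p * D = D * p := by
    rw [hp, blocks_mul_blocks, blocks_mul_blocks]; simp
  have n1 := ((q2.2.2.1.symm.mul_left (cp mv.filt)).mul_left q1.1).mul_left q1.2.1
  -- Since p commutes with D ≈ z₁z₂: z₁'pz₁ ≈ z₁'pz₁z₂z₂' ≈ z₁'pDz₂' = z₁'Dpz₂' ≈ z₂pz₂'.
  have n2 : Nr ν c (100000 * k) (z₁' * p * z₁) (z₂ * p * z₂') := by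
    have a1 := (((q2.2.2.1.symm).mul_left q1.1).mul_left (cp mv.filt)).mul_left q1.2.1
    rw [Matrix.mul_one] at a1
    have a2 := ((hD.symm.mul_right q2.2.1).mul_left (cp mv.filt)).mul_left q1.2.1
    have a3 := (((hD.mul_right (cp mv.filt)).mul_right q2.2.1)).mul_left q1.2.1
    have a4 := ((q1.2.2.2.mul_right q2.1).mul_right (cp mv.filt)).mul_right q2.2.1
    rw [Matrix.one_mul] at a4
    rw [← Matrix.mul_assoc p D, hpD] at a2
    rw [show z₁' * (z₁ * z₂ * p * z₂') = z₁' * z₁ * z₂ * p * z₂' by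
      simp only [Matrix.mul_assoc]] at a3
    rw [show z₁' * (p * (z₁ * (z₂ * z₂'))) = z₁' * (p * (z₁ * z₂ * z₂')) by
      simp only [Matrix.mul_assoc], ← Matrix.mul_assoc z₁' p z₁] at a1
    exact ((((a1.trans a2).trans a3).trans a4)).mono (by omega)
  have qp : QId ν c S₁ (12000 * k) p := ⟨(cp mv.filt₁).mono (by omega), Nr.of_eq _ hpp⟩
  have qe := qp.conj mv.filt₁ q1
  obtain ⟨e, ce, e1, e2, e3⟩ := mv.exists_cia (qe.1.mono (by omega))
    (((q2.1.mul mv.filt₂ (cp mv.filt₂)).mul mv.filt₂ q2.2.1).mono (by omega)) n2 hK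
  have mp : p.map π = Matrix.fromBlocks 1 0 0 0 := by
    rw [hp]; ext (i | i) (j | j) <;> simp [Matrix.one_apply, apply_ite π]
  have qe' := QId.of_nr (qe.mono (show _ ≤ 100000 * k + 2 by omega)) (ce.filt_mono mv.le₁₂₁)
    (e1.symm.mono (by omega))
  refine ⟨z₁, z₁', z₂, z₂', e, q1.mono (by omega), q2.mono (by omega), hD.mono (by omega),
    ⟨ce.mono (by omega), qe'.2.mono (by omega)⟩, e1.mono (by omega), e2.mono (by omega), ?_⟩
  -- π(e) = π(z₁'pz₁) is exactly the standard projection, because the conjugated letters in z₁ and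
  -- z₁' die under π.
  rw [e3, Matrix.map_mul, Matrix.map_mul, p1, p1', mp, Matrix.one_mul, Matrix.mul_one]

/-- The scalar matrix over `R` given by a matrix over `ℂ`. -/
def sc (R : Type*) [Ring R] [Algebra ℂ R] (Z : Matrix ι κ ℂ) : Matrix ι κ R :=
  Z.map (algebraMap ℂ R)

theorem sc_mul (X : Matrix ι κ ℂ) (Y : Matrix κ η ℂ) : sc R (X * Y) = sc R X * sc R Y :=
  Matrix.map_mul

theorem sc_sub (X Y : Matrix ι κ ℂ) : sc R (X - Y) = sc R X - sc R Y :=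
  Matrix.map_sub _ (map_sub (algebraMap ℂ R)) _ _

theorem sc_one : sc R (1 : Matrix ι ι ℂ) = 1 :=
  Matrix.map_one _ (map_zero _) (map_one _)

theorem sc_map (π : R →ₐ[ℂ] ℂ) (X : Matrix ι κ ℂ) : (sc R X).map π = X := by
  ext i j; simp [sc]

theorem map_π_one (π : R →ₐ[ℂ] ℂ) : (1 : Matrix ι ι R).map π = 1 :=
  Matrix.map_one _ (map_zero π) (map_one π)

theorem map_π_sub (π : R →ₐ[ℂ] ℂ) (X Y : Matrix ι κ R) : (X - Y).map π = X.map π - Y.map π :=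
  Matrix.map_sub _ (map_sub π) _ _

theorem MV.sc_ctl (mv : MV ν νs π c K S S₁ S₂ S₁₂ T) (hS' : IsFilt S') {X : Matrix ι κ ℂ}
    (h : Ctl νs c topFil k X) : Ctl ν c S' k (sc R X) :=
  ⟨h.pos, fun i j => by
    rw [sc, Matrix.map_apply, Algebra.algebraMap_eq_smul_one]
    exact Submodule.smul_mem _ _ (hS'.one_mem _), (mv.lift X).trans h.bd⟩

theorem MV.sc_nr (mv : MV ν νs π c K S S₁ S₂ S₁₂ T) {X Y : Matrix ι κ ℂ}
    (h : Nr νs c k X Y) : Nr ν c k (sc R X) (sc R Y) := by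
  rw [Nr, ← sc_sub]; exact (mv.lift _).trans h

theorem MV.π_ctl (mv : MV ν νs π c K S S₁ S₂ S₁₂ T) {X : Matrix ι κ R}
    (h : Ctl ν c S' k X) : Ctl νs c topFil k (X.map π) :=
  ⟨h.pos, fun _ _ => trivial, (mv.contr X).trans h.bd⟩

theorem MV.π_nr (mv : MV ν νs π c K S S₁ S₂ S₁₂ T) {X Y : Matrix ι κ R}
    (h : Nr ν c k X Y) : Nr νs c k (X.map π) (Y.map π) := by
  rw [Nr, ← map_π_sub]; exact (mv.contr _).trans h

theorem MV.π_qinv (mv : MV ν νs π c K S S₁ S₂ S₁₂ T) {u v : Matrix ι ι R}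
    (h : QInv ν c S' k u v) : QInv νs c topFil k (u.map π) (v.map π) := by
  refine ⟨mv.π_ctl h.1, mv.π_ctl h.2.1, ?_, ?_⟩
  · rw [← Matrix.map_mul, ← map_π_one π]; exact mv.π_nr h.2.2.1
  · rw [← Matrix.map_mul, ← map_π_one π]; exact mv.π_nr h.2.2.2

theorem MV.sc_qinv (mv : MV ν νs π c K S S₁ S₂ S₁₂ T) (hS' : IsFilt S') {u v : Matrix ι ι ℂ}
    (h : QInv νs c topFil k u v) : QInv ν c S' k (sc R u) (sc R v) := by
  refine ⟨mv.sc_ctl hS' h.1, mv.sc_ctl hS' h.2.1, ?_, ?_⟩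
  · rw [← sc_mul, ← sc_one]; exact mv.sc_nr h.2.2.1
  · rw [← sc_mul, ← sc_one]; exact mv.sc_nr h.2.2.2

theorem map_blocks_π (π : R →ₐ[ℂ] ℂ) (a : Matrix ι ι R) (b : Matrix κ κ R) :
    (Matrix.fromBlocks a 0 0 b).map π = Matrix.fromBlocks (a.map π) 0 0 (b.map π) := by
  ext (i | i) (j | j) <;> simp

theorem Stab.eq_one {U : Matrix κ κ R} (h : Stab U (1 : Matrix ι ι R)) : U = 1 := by
  obtain ⟨α, _, _, f, rfl⟩ := h
  rw [Matrix.fromBlocks_one, Matrix.submatrix_one_equiv]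

theorem Stab.kcls_eq (hS : IsFilt S) {U : Matrix κ κ R} {u : Matrix ι ι R} (h : Stab U u)
    (h1 : Cy ν S 1 (c.q l) U) (h2 : Cy ν S 1 (c.q l) u) :
    kcls ν S 1 (c.q l) U h1 = kcls ν S 1 (c.q l) u h2 := by
  obtain ⟨α, _, _, f, rfl⟩ := h
  have hg := c.good l
  have h3 : Cy ν S 1 (c.q l) (1 : Matrix α α R) := Cy.dm (i := 1) hS hg.ε_pos hg.one_le
  rw [kcls_reindex hS hg (h2.diag h3) f, kcls_diag hS hg h2 h3, kcls_one_eq_zero hS h3, add_zero]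

theorem kcls_of_nr_one (hS : IsFilt S) {u : Matrix ι ι R} (h : Ctl ν c S k u) (hn : Nr ν c k u 1)
    (hl : 3 * k + 1 ≤ l) (h1 : Cy ν S 1 (c.q l) u) : kcls ν S 1 (c.q l) u h1 = 0 := by
  have h2 : Cy ν S 1 (c.q l) (1 : Matrix ι ι R) := (QInv.one hS h.pos).cy (by omega)
  rw [← kcls_eq_of_HT hS (HT.line_one (QInv.one hS h.pos) h hn.symm hl) h2]
  exact kcls_one_eq_zero hS h2

theorem QInv.of_nr' {u v u' v' : Matrix ι ι R} (h : QInv ν c S k u v)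
    (hu' : Ctl ν c S k u') (hu : Nr ν c k u u') (hv' : Ctl ν c S k v') (hv : Nr ν c k v v') :
    QInv ν c S (25 * k) u' v' := by
  have hk := h.1.pos
  have h1 := h.of_nr hu' hu
  exact ((h1.symm.of_nr (l := k) hv' hv).symm).mono (by omega)

theorem whl_sc (X : List (Bool × Matrix Λ Λ ℂ)) :
    lprod (X.map fun a => (a.1, sc R a.2)) = sc R (lprod X) := by
  induction X with
  | nil => exact sc_one.symm
  | cons a X ih =>
    rw [List.map_cons, lprod_cons, lprod_cons, sc_mul, ih]
    congr 1
    have : sc R (1 + lm a) = sc R 1 + sc R (lm a) := Matrix.map_add _ (map_add (algebraMap ℂ R)) _ _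
    rw [this, sc_one]
    congr 1
    unfold lm sc; simp only
    split_ifs <;> ext (i | i) (j | j) <;> simp

/-- A quasi-invertible whose image over `ℂ` is trivial in `K_1` may be replaced by one that is the
identity modulo the ideal. -/
theorem MV.exists_rep (mv : MV ν νs π c K S S₁ S₂ S₁₂ T) (hS' : IsFilt S') {w : Matrix ι ι R}
    (hw : Cy ν S' 1 (c.q k) w) (hk : 1 ≤ k) (h0 : Cy νs topFil 1 (c.q k) (w.map π))
    (h : kcls νs topFil 1 (c.q k) (w.map π) h0 = 0) (hl : 20000000000 * k ≤ l) :
    ∃ (Λ : Type) (_ : Fintype Λ) (_ : DecidableEq Λ) (u v : Matrix Λ Λ R),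
      QInv ν c S' (20000000000 * k) u v ∧ u.map π = 1 ∧ v.map π = 1 ∧
      ∀ (h1 : Cy ν S' 1 (c.q l) u) (h2 : Cy ν S' 1 (c.q l) w),
        kcls ν S' 1 (c.q l) u h1 = kcls ν S' 1 (c.q l) w h2 := by
  have h1 : Cy νs topFil 1 (c.q k) (1 : Matrix ι ι ℂ) :=
    Cy.dm (i := 1) isFilt_topFil (c.good k).ε_pos (c.good k).one_le
  rw [← kcls_one_eq_zero isFilt_topFil h1] at h
  obtain ⟨Λ, i1, i2, U, U', L, ⟨α, _, _, f, s1⟩, s2, hn, hL, hUU⟩ := lEq_of_kcls_eq isFilt_topFil hk h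
  rw [s2.eq_one] at hUU
  obtain ⟨w', hw'⟩ := hw.qinv hk
  set W := (Matrix.fromBlocks w 0 0 (1 : Matrix α α R)).submatrix f f with hW
  have sW : Stab W w := ⟨α, inferInstance, inferInstance, f, rfl⟩
  obtain ⟨V, hV⟩ := sW.qinv hS' hw'
  have hWU : W.map π = U := by
    rw [s1, hW, ← Matrix.submatrix_map, map_blocks_π, map_π_one]
  -- The letters that trivialize π(w) over ℂ are lifted to scalar letters over R. Multiplying by
  -- them preserves the class and makes the image under π close to 1.
  set L' : List (Bool × Matrix Λ Λ R) := L.map fun a => (a.1, sc R a.2) with hL'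
  have hL1 : ∀ a ∈ L', Ctl ν c S' (200000 * k) a.2 := by
    intro a ha
    obtain ⟨b, hb, rfl⟩ := List.mem_map.1 ha
    exact mv.sc_ctl hS' (hL b hb)
  have hn' : L'.length = 18 := by rw [hL', List.length_map, hn]
  have hq := hV.mul hS' (QInv.lprod hS' (by omega) hL1)
  rw [hn'] at hq
  have hq' := hq.mono (show _ ≤ 8000000 * k by omega)
  set u₁ := W * lprod L' with hu₁
  set v₁ := lprod' L' * V with hv₁
  have hπ : u₁.map π = U * lprod L := by
    rw [hu₁, Matrix.map_mul, hWU, hL', whl_sc, sc_map]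
  have n1 : Nr νs c (200000 * k) (u₁.map π) 1 := by rw [hπ]; exact hUU
  have hqπ := mv.π_qinv hq'
  have n2 : Nr νs c (20000000 * k) (v₁.map π) 1 := by
    have a1 := n1.symm.mul_left hqπ.2.1
    rw [Matrix.mul_one] at a1
    exact (a1.trans hqπ.2.2.2).mono (by omega)
  -- Subtracting the small scalar matrix π(x) - 1 makes the image exactly 1. Both u and its inverse
  -- are corrected this way.
  have fix : ∀ {x : Matrix (Λ ⊕ Λ) (Λ ⊕ Λ) R}, Ctl ν c S' (8000000 * k) x →
      Nr νs c (20000000 * k) (x.map π) 1 →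
      Ctl ν c S' (30000000 * k) (x - sc R (x.map π - 1)) ∧
      Nr ν c (30000000 * k) x (x - sc R (x.map π - 1)) ∧
      (x - sc R (x.map π - 1)).map π = 1 := by
    intro x cx nx
    refine ⟨?_, ?_, ?_⟩
    · have := mv.sc_ctl hS' ((mv.π_ctl cx).sub (Ctl.one isFilt_topFil (by omega)))
      exact ((cx.mono (Nat.le_succ _)).sub this).mono (by omega)
    · rw [Nr, sub_sub_cancel]
      exact ((mv.lift _).trans nx).trans (mul_le_mul_of_nonneg_right (c.pow_le (by omega))
        c.δ_pos.le)
    · rw [map_π_sub, sc_map]; abel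
  obtain ⟨f1, f2, f3⟩ := fix hq'.1 (n1.mono (by omega))
  obtain ⟨g1, g2, g3⟩ := fix hq'.2.1 n2
  have hQ := (hq'.mono (show _ ≤ 30000000 * k by omega)).of_nr' f1 f2 g1 g2
  refine ⟨Λ ⊕ Λ, inferInstance, inferInstance, _, _, hQ.mono (by omega), f3, g3, ?_⟩
  intro h1 h2
  have hWc : Cy ν S' 1 (c.q l) W := hV.cy (by omega)
  have := HT.of_letters (l := l) hS' (hV.mono (show k ≤ 30000000 * k by omega)) f1
    (fun a ha => (hL1 a ha).mono (by omega)) f2 (by rw [hn']; omega)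
  rw [← kcls_eq_of_HT hS' this hWc]
  exact sW.kcls_eq hS' _ _

end representatives


/-! ### Exactness at the level of matrices -/

section exactness

variable {R : Type*} [Ring R] [Algebra ℂ R] [TopologicalSpace R]
  [IsTopologicalRing R] [ContinuousSMul ℂ R] {ν : MNorm R} {νs : MNorm ℂ} {π : R →ₐ[ℂ] ℂ}
  {c : Scale} {K : ℕ} {S S₁ S₂ S₁₂ S' S'' : ℝ →o Submodule ℂ R} {T : ℕ → Submodule ℂ R}
  {k l m n B : ℕ}
  {ι κ η α β Λ Ω Ω' J J' : Type} [Fintype ι] [DecidableEq ι] [Fintype κ]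
  [DecidableEq κ] [Fintype η] [DecidableEq η] [Fintype α] [DecidableEq α] [Fintype β]
  [DecidableEq β] [Fintype Λ] [DecidableEq Λ] [Fintype Ω] [DecidableEq Ω] [Fintype Ω']
  [DecidableEq Ω'] [Fintype J] [DecidableEq J] [Fintype J'] [DecidableEq J']

/-- X' ≈ X'YY' ≈ X'XY' ≈ Y'. The inverse pairs may come from different filtrations. -/
theorem QInv.nr_inv {X X' Y Y' : Matrix ι ι R} (h : QInv ν c S' k X X') (h' : QInv ν c S'' k Y Y')
    (hn : Nr ν c k X Y) : Nr ν c (6 * k) X' Y' := by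
  have hk := h.1.pos
  have h1 := h'.2.2.1.symm.mul_left h.2.1
  have h2 := (hn.symm.mul_right h'.2.1).mul_left h.2.1
  have h3 := h.2.2.2.mul_right h'.2.1
  rw [Matrix.mul_one] at h1
  rw [← Matrix.mul_assoc X' X] at h2
  rw [Matrix.one_mul] at h3
  exact ((h1.trans h2).trans h3).mono (by omega)

/-- Quasi-invertibles over the two subalgebras with the same class over the whole algebra come
from the intersection. -/
theorem MV.exists_lift_one (mv : MV ν νs π c K S S₁ S₂ S₁₂ T) {u₁ v₁ : Matrix ι ι R}
    {u₂ v₂ : Matrix κ κ R} (q₁ : QInv ν c S₁ k u₁ v₁) (q₂ : QInv ν c S₂ k u₂ v₂)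
    {h₁ : Cy ν S 1 (c.q k) u₁} {h₂ : Cy ν S 1 (c.q k) u₂}
    (h : kcls ν S 1 (c.q k) u₁ h₁ = kcls ν S 1 (c.q k) u₂ h₂) (hK : 1000000000000 * k ≤ K)
    (hl : 1000000000000000000 * k ≤ l) :
    ∃ (Ω : Type) (_ : Fintype Ω) (_ : DecidableEq Ω) (ξ ξ' : Matrix Ω Ω R),
      QInv ν c S₁₂ (100000000000000 * k) ξ ξ' ∧
      (∀ (h1 : Cy ν S₁ 1 (c.q l) ξ) (h2 : Cy ν S₁ 1 (c.q l) u₁),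
        kcls ν S₁ 1 (c.q l) ξ h1 = kcls ν S₁ 1 (c.q l) u₁ h2) ∧
      ∀ (h1 : Cy ν S₂ 1 (c.q l) ξ) (h2 : Cy ν S₂ 1 (c.q l) u₂),
        kcls ν S₂ 1 (c.q l) ξ h1 = kcls ν S₂ 1 (c.q l) u₂ h2 := by
  have hk := q₁.1.pos
  obtain ⟨Λ, i1, i2, U₁, U₂, L, s1, s2, hn, hL, hU⟩ := lEq_of_kcls_eq mv.filt hk h
  obtain ⟨V₁, Q₁⟩ := s1.qinv mv.filt₁ q₁
  obtain ⟨V₂, Q₂⟩ := s2.qinv mv.filt₂ q₂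
  obtain ⟨z₁, z₁', z₂, z₂', a1, a2, -, -, a5, a6, a7, a8⟩ := mv.exists_factor
    ((Q₁.filt_mono mv.le₁).mono (show k ≤ 200000 * k by omega)) hL hn.le (by omega)
  have X := (a1.mul mv.filt₁ Q₁).mono (show _ ≤ 10000000000 * k by omega)
  have Y := (Q₂.mul mv.filt₂ a2.symm).mono (show _ ≤ 10000000000 * k by omega)
  -- z₁U₁z₂ ≈ U₂ and z₂z₂' = 1. The left side is over the first subalgebra and the right side over
  -- the second, so ξ can be found between them; by `QInv.nr_inv` the same holds for the inverses.
  have n1 : Nr ν c (10000000000 * k) (z₁ * U₁) (U₂ * z₂') := by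
    have := (a6.trans hU).mul_right a2.2.1
    rw [Matrix.mul_assoc _ z₂ z₂', a5, Matrix.mul_one] at this
    exact this.mono (by omega)
  have n2 := X.nr_inv Y n1
  obtain ⟨ξ, b1, b2, b3, -⟩ := mv.exists_cia (X.1.mono (show _ ≤ 100000000000 * k by omega))
    (Y.1.mono (by omega)) (n1.mono (by omega)) (by omega)
  obtain ⟨ξ', d1, d2, -, -⟩ := mv.exists_cia (X.2.1.mono (show _ ≤ 100000000000 * k by omega))
    (Y.2.1.mono (by omega)) (n2.mono (by omega)) (by omega)
  have X' := X.mono (show _ ≤ 100000000000 * k + 2 by omega)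
  have Y' := Y.mono (show _ ≤ 100000000000 * k + 2 by omega)
  have e1 := X'.of_nr' (b1.filt_mono mv.le₁₂₁) (b2.symm.mono (by omega)) (d1.filt_mono mv.le₁₂₁)
    (d2.symm.mono (by omega))
  refine ⟨_, _, _, ξ, ξ', ⟨b1.mono (by omega), d1.mono (by omega), e1.2.2.1.mono (by omega),
    e1.2.2.2.mono (by omega)⟩, ?_, ?_⟩
  · intro g1 g2
    have w1 : Cy ν S₁ 1 (c.q l) z₁ := a1.cy (by omega)
    have w2 : Cy ν S₁ 1 (c.q l) U₁ := Q₁.cy (by omega)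
    have w3 : Cy ν S₁ 1 (c.q l) (z₁ * U₁) := X.cy (by omega)
    have w4 : Cy ν S₁ 1 (c.q (20000 * (200000 * k))) (1 : Matrix (Λ ⊕ Λ) (Λ ⊕ Λ) R) :=
      (QInv.one mv.filt₁ hk).cy (by omega)
    have w5 : Cy ν S₁ 1 (c.q l) (1 : Matrix (Λ ⊕ Λ) (Λ ⊕ Λ) R) :=
      (QInv.one mv.filt₁ hk).cy (by omega)
    -- [ξ] = [z₁U₁] = [z₁] + [U₁], and [z₁] = 0 because z₁ is homotopic to 1 over the first
    -- subalgebra.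
    have r1 := kcls_eq_of_HT mv.filt₁ (HT.line_one X' (b1.filt_mono mv.le₁₂₁)
      (b2.symm.mono (by omega)) (by omega)) w3 g1
    have r2 := kcls_mul mv.filt₁ a1 (Q₁.mono (by omega)) (by omega) w1 w2 w3
    have r3 := kcls_eq_of_HT mv.filt₁ (a7.mono (c.q_le (show _ ≤ l by omega))) w5 w1
    rw [← r1, r2, ← r3, kcls_one_eq_zero mv.filt₁, zero_add, s1.kcls_eq mv.filt₁ w2 g2]
  · intro g1 g2
    have w1 : Cy ν S₂ 1 (c.q l) z₂ := a2.cy (by omega)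
    have w1' : Cy ν S₂ 1 (c.q l) z₂' := a2.symm.cy (by omega)
    have w2 : Cy ν S₂ 1 (c.q l) U₂ := Q₂.cy (by omega)
    have w3 : Cy ν S₂ 1 (c.q l) (U₂ * z₂') := Y.cy (by omega)
    have w5 : Cy ν S₂ 1 (c.q l) (1 : Matrix (Λ ⊕ Λ) (Λ ⊕ Λ) R) :=
      (QInv.one mv.filt₂ hk).cy (by omega)
    have r1 := kcls_eq_of_HT mv.filt₂ (HT.line_one Y' (b1.filt_mono mv.le₁₂₂)
      (b3.symm.mono (by omega)) (by omega)) w3 g1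
    have r2 := kcls_mul mv.filt₂ (Q₂.mono (show k ≤ 2400000000 * k by omega))
      (a2.symm.mono (by omega)) (by omega) w2 w1' w3
    have r3 := kcls_eq_of_HT mv.filt₂ (a8.mono (c.q_le (show _ ≤ l by omega))) w5 w1
    have r4 := kcls_inv mv.filt₂ a2 (by omega) w1 w1'
    rw [← r3, kcls_one_eq_zero mv.filt₂, zero_add] at r4
    rw [← r1, r2, r4, add_zero, s2.kcls_eq mv.filt₂ w2 g2]

/-- A quasi-invertible with trivial boundary is a product of quasi-invertibles over the two
subalgebras. -/
theorem MV.exists_split (mv : MV ν νs π c K S S₁ S₂ S₁₂ T) {u v : Matrix ι ι R}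
    {e : Matrix Ω Ω R} (hu : QInv ν c S k u v) (pu : u.map π = 1)
    (hp : Patch ν c S₁ S₂ k u e) {h₁ : Cy ν S₁₂ 0 (c.q k) e}
    {h₂ : Cy ν S₁₂ 0 (c.q k) (1 : Matrix ι ι R)}
    (h : kcls ν S₁₂ 0 (c.q k) e h₁ = kcls ν S₁₂ 0 (c.q k) 1 h₂)
    (hl : 1000000000000000000 * k ≤ l) :
    ∃ (Λ : Type) (_ : Fintype Λ) (_ : DecidableEq Λ) (a a' b b' : Matrix Λ Λ R),
      QInv ν c S₁ (100000000000 * k) a a' ∧ QInv ν c S₂ (100000000000 * k) b b' ∧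
      Nr νs c (100000000000 * k) (a.map π) 1 ∧ Nr νs c (100000000000 * k) (b.map π) 1 ∧
      ∀ (h1 : Cy ν S 1 (c.q l) u) (h2 : Cy ν S 1 (c.q l) a) (h3 : Cy ν S 1 (c.q l) b),
        kcls ν S 1 (c.q l) u h1 = kcls ν S 1 (c.q l) a h2 + kcls ν S 1 (c.q l) b h3 := by
  have hk := hu.1.pos
  obtain ⟨J, _, _, hm⟩ := exists_mvN_of_kcls_eq mv.filt₁₂ hk h
  rw [Matrix.fromBlocks_one] at hm
  have hp1 := (hp.diag (Patch.one (ι := J) mv.filt₁ mv.filt₂ hk)).mono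
    (show k ≤ 36 * (402000 * k) by omega)
  obtain ⟨α₁, β₁, α₂, β₂, hP⟩ := (hp1.mvN mv.filt₁ mv.filt₂ hm
    (QId.one mv.filt₁₂ (by omega)) mv.le₁₂₁ mv.le₁₂₂).mono (show _ ≤ 200000000 * k by omega)
  -- Once the glued idempotent is replaced by an identity matrix, the frames are inverse pairs, and
  -- the transition β₁α₂ is close to u with an identity added.
  have Q₁ : QInv ν c S₁ (200000000 * k) β₁ α₁ := ⟨hP.cb₁, hP.ca₁, hP.ba₁, hP.ab₁⟩
  have Q₂ : QInv ν c S₂ (200000000 * k) α₂ β₂ := ⟨hP.ca₂, hP.cb₂, hP.ab₂, hP.ba₂⟩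
  have qs := mv.π_qinv Q₁
  have q1 := mv.sc_qinv mv.filt₁ qs
  have q2 := mv.sc_qinv mv.filt₂ qs
  have qs' := mv.sc_qinv mv.filt qs
  -- The factors are normalized to a = β₁π(α₁) and b = π(β₁)α₂. The inserted scalar matrices are
  -- approximate inverses of each other, so their classes cancel, and both images under π become
  -- close to 1.
  have A := (Q₁.mul mv.filt₁ q1.symm).mono (show _ ≤ 1000000000 * k by omega)
  have B := (q2.mul mv.filt₂ Q₂).mono (show _ ≤ 1000000000 * k by omega)
  refine ⟨_, _, _, _, _, _, _, A.mono (by omega), B.mono (by omega), ?_, ?_, ?_⟩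
  · rw [Matrix.map_mul, sc_map]; exact qs.2.2.1.mono (by omega)
  · rw [Matrix.map_mul, sc_map, ← Matrix.map_mul]
    have := mv.π_nr hP.glue
    rw [map_blocks_π, pu, map_π_one, Matrix.fromBlocks_one] at this
    exact this.mono (by omega)
  · intro g1 g2 g3
    have y1 := Q₁.filt_mono mv.le₁
    have y2 := Q₂.filt_mono mv.le₂
    have c1 : Cy ν S 1 (c.q l) β₁ := y1.cy (by omega)
    have c2 : Cy ν S 1 (c.q l) α₂ := y2.cy (by omega)
    have c3 : Cy ν S 1 (c.q l) (sc R (α₁.map π)) := qs'.symm.cy (by omega)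
    have c4 : Cy ν S 1 (c.q l) (sc R (β₁.map π)) := qs'.cy (by omega)
    have y3 := (y1.mul mv.filt y2).mono (show _ ≤ 1000000000 * k by omega)
    have c5 : Cy ν S 1 (c.q l) (β₁ * α₂) := y3.cy (by omega)
    have y4 := hu.diag (QInv.one (ι := J) mv.filt hk)
    have c6 : Cy ν S 1 (c.q l) (Matrix.fromBlocks u 0 0 (1 : Matrix J J R)) := y4.cy (by omega)
    rw [kcls_mul mv.filt y1 qs'.symm (by omega) c1 c3, kcls_mul mv.filt qs' y2 (by omega) c4 c2,
      ← (Stab.diag_one u J).kcls_eq mv.filt c6 g1, ← kcls_eq_of_HT mv.filt (HT.line_one y3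
        (y4.1.mono (by omega)) (hP.glue.mono (by omega)) (by omega)) c5 c6,
      kcls_mul mv.filt y1 y2 (by omega) c1 c2 c5]
    have := kcls_inv mv.filt qs' (by omega) c4 c3
    rw [add_comm] at this
    rw [add_assoc, ← add_assoc (kcls ν S 1 (c.q l) (sc R (α₁.map π)) c3), this, zero_add]

theorem MvN.enlarge (hS : IsFilt S) (hk : 1 ≤ k) {e : Matrix ι ι R} {f : Matrix κ κ R}
    (h : MvN ν c S k (Matrix.fromBlocks e 0 0 (1 : Matrix J J R))
      (Matrix.fromBlocks f 0 0 (1 : Matrix J J R))) (J' : Type) [Fintype J'] [DecidableEq J'] :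
    MvN ν c S k (Matrix.fromBlocks e 0 0 (1 : Matrix (J ⊕ J') (J ⊕ J') R))
      (Matrix.fromBlocks f 0 0 (1 : Matrix (J ⊕ J') (J ⊕ J') R)) := by
  have h1 := (h.diag (MvN.refl (QId.one (ι := J') hS hk))).submatrix
    (Equiv.sumAssoc ι J J').symm (Equiv.sumAssoc κ J J').symm
  have key : ∀ {ι : Type} [Fintype ι] [DecidableEq ι] (e : Matrix ι ι R),
      (Matrix.fromBlocks (Matrix.fromBlocks e 0 0 (1 : Matrix J J R)) 0 0
        (1 : Matrix J' J' R)).submatrix (Equiv.sumAssoc ι J J').symm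
        (Equiv.sumAssoc ι J J').symm =
      Matrix.fromBlocks e 0 0 (1 : Matrix (J ⊕ J') (J ⊕ J') R) := by
    intro ι _ _ e
    ext (i | i | i) (j | j | j) <;> simp [Matrix.one_apply]
  rwa [key, key] at h1

theorem MvN.one_equiv {e : Matrix ι ι R} {f : Matrix κ κ R}
    (h : MvN ν c S k (Matrix.fromBlocks e 0 0 (1 : Matrix J J R))
      (Matrix.fromBlocks f 0 0 (1 : Matrix J J R))) (σ : J' ≃ J) :
    MvN ν c S k (Matrix.fromBlocks e 0 0 (1 : Matrix J' J' R))
      (Matrix.fromBlocks f 0 0 (1 : Matrix J' J' R)) := by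
  have h1 := h.submatrix ((Equiv.refl ι).sumCongr σ) ((Equiv.refl κ).sumCongr σ)
  have key : ∀ {ι : Type} [Fintype ι] [DecidableEq ι] (e : Matrix ι ι R),
      (Matrix.fromBlocks e 0 0 (1 : Matrix J J R)).submatrix ((Equiv.refl ι).sumCongr σ)
        ((Equiv.refl ι).sumCongr σ) = Matrix.fromBlocks e 0 0 (1 : Matrix J' J' R) := by
    intro ι _ _ e
    ext (i | i) (j | j) <;> simp [Matrix.one_apply]
  rwa [key, key] at h1

/-- An idempotent over the intersection that is trivial over both subalgebras is a boundary. -/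
theorem MV.exists_bd (mv : MV ν νs π c K S S₁ S₂ S₁₂ T) {e : Matrix Ω Ω R} (hk : 1 ≤ k)
    {h₁ : Cy ν S₁ 0 (c.q k) e} {h₂ : Cy ν S₂ 0 (c.q k) e}
    {h₁' : Cy ν S₁ 0 (c.q k) (1 : Matrix ι ι R)} {h₂' : Cy ν S₂ 0 (c.q k) (1 : Matrix ι ι R)}
    (h : kcls ν S₁ 0 (c.q k) e h₁ = kcls ν S₁ 0 (c.q k) 1 h₁')
    (h' : kcls ν S₂ 0 (c.q k) e h₂ = kcls ν S₂ 0 (c.q k) 1 h₂') :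
    ∃ (J : Type) (_ : Fintype J) (_ : DecidableEq J) (u v : Matrix (ι ⊕ J) (ι ⊕ J) R),
      QInv ν c S (10000000000 * k) u v ∧ Nr νs c (10000000000 * k) (u.map π) 1 ∧
      Patch ν c S₁ S₂ (10000000000 * k) u (Matrix.fromBlocks e 0 0 (1 : Matrix J J R)) := by
  obtain ⟨J₁, _, _, m1⟩ := exists_mvN_of_kcls_eq mv.filt₁ hk h
  obtain ⟨J₂, _, _, m2⟩ := exists_mvN_of_kcls_eq mv.filt₂ hk h'
  -- The two trivializations come with different identity summands J₁ and J₂; both are enlarged to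
  -- J₁ ⊕ J₂.
  have m1' := m1.enlarge mv.filt₁ (by omega) J₂
  have m2' := (m2.enlarge mv.filt₂ (by omega) J₁).one_equiv (Equiv.sumComm J₁ J₂)
  rw [Matrix.fromBlocks_one] at m1' m2'
  obtain ⟨s₁, t₁, cs₁, ct₁, st₁, ts₁⟩ := m1'.mono (show _ ≤ 20000000 * k by omega)
  obtain ⟨s₂, t₂, cs₂, ct₂, st₂, ts₂⟩ := m2'.mono (show _ ≤ 20000000 * k by omega)
  set E := Matrix.fromBlocks e 0 0 (1 : Matrix (J₁ ⊕ J₂) (J₁ ⊕ J₂) R) with hE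
  -- The equivalences of E with 1 over the two subalgebras are frames, and u is defined as their
  -- transition matrix t₁s₂.
  have P0 : Patch ν c S₁ S₂ (20000000 * k) (t₁ * s₂) E :=
    ⟨s₁, t₁, s₂, t₂, cs₁, ct₁, cs₂, ct₂, st₁, st₂, ts₁, ts₂, Nr.refl _ _⟩
  have key : ∀ {s s' : Matrix (Ω ⊕ J₁ ⊕ J₂) (ι ⊕ J₁ ⊕ J₂) R}
      {t t' : Matrix (ι ⊕ J₁ ⊕ J₂) (Ω ⊕ J₁ ⊕ J₂) R} {S' S'' : ℝ →o Submodule ℂ R},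
      Ctl ν c S' (20000000 * k) s → Ctl ν c S' (20000000 * k) t →
      Nr ν c (20000000 * k) (s * t) E → Nr ν c (20000000 * k) (s' * t') E →
      Nr ν c (20000000 * k) (t * s) 1 → Nr ν c (100000000 * k) (t * s' * (t' * s)) 1 := by
    intro s s' t t' S' S'' cs ct h1 h2 h3
    have a1 := ((h2.trans h1.symm).mul_left ct).mul_right cs
    have a2 := (h3.mul_right ct).mul_right cs
    rw [show t * (s' * t') * s = t * s' * (t' * s) by simp only [Matrix.mul_assoc]] at a1
    rw [Matrix.one_mul, show t * s * t * s = t * (s * t) * s by simp only [Matrix.mul_assoc]] at a2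
    exact ((a1.trans a2).trans h3).mono (by omega)
  have q0 : QInv ν c S (100000000 * k) (t₁ * s₂) (t₂ * s₁) :=
    ⟨((ct₁.filt_mono mv.le₁).mul mv.filt (cs₂.filt_mono mv.le₂)).mono (by omega),
      ((ct₂.filt_mono mv.le₂).mul mv.filt (cs₁.filt_mono mv.le₁)).mono (by omega),
      key (S'' := S) cs₁ ct₁ st₁ st₂ ts₁, key (S'' := S) cs₂ ct₂ st₂ st₁ ts₂⟩
  have qs := mv.π_qinv q0
  -- Multiplying u on the right by an inverse of its scalar part is a change of the second frame, so
  -- it does not affect the gluing and makes π(u) ≈ 1.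
  have P1 := (P0.mono (show _ ≤ 100000000 * k by omega)).mul mv.filt₁ mv.filt₂
    (QInv.one mv.filt₁ (by omega)) (mv.sc_qinv mv.filt₂ qs.symm)
  rw [Matrix.one_mul] at P1
  refine ⟨_, _, _, _, _, (q0.mul mv.filt (mv.sc_qinv mv.filt qs.symm)).mono (by omega), ?_,
    P1.mono (by omega)⟩
  rw [Matrix.map_mul, sc_map]
  exact qs.2.2.1.mono (by omega)

theorem kcls_sub_stab {S : ℝ →o Submodule ℂ R} {i : Fin 2} {q : Param} (hS : IsFilt S)
    (hq : q.Good) {e : Matrix Ω Ω R} (h1 : Cy ν S i q e)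
    (h2 : Cy ν S i q (1 : Matrix ι ι R)) (h3 : Cy ν S i q (1 : Matrix J J R))
    (h4 : Cy ν S i q (Matrix.fromBlocks e 0 0 (1 : Matrix J J R)))
    (h5 : Cy ν S i q (1 : Matrix (ι ⊕ J) (ι ⊕ J) R)) :
    kcls ν S i q _ h4 - kcls ν S i q 1 h5 = kcls ν S i q e h1 - kcls ν S i q 1 h2 := by
  rw [kcls_diag hS hq h1 h3 h4, kcls_one_sum hS hq h5 h2 h3, add_sub_add_right_eq_sub]

/-- g = [[1 - e, s], [t, 1 - f]] exchanges the ranges of e and f and is the identity on their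
complements, so it is its own approximate inverse. Similarity by such a g is what Whitehead's lemma
can process. -/
theorem MvN.exists_swap (hS : IsFilt S) {e : Matrix ι ι R} {f : Matrix κ κ R}
    (he : QId ν c S k e) (hf : QId ν c S k f) (h : MvN ν c S k e f) :
    ∃ g : Matrix (ι ⊕ κ) (ι ⊕ κ) R, QInv ν c S (100 * k) g g ∧
      Nr ν c (100 * k) (g * Matrix.fromBlocks 0 0 0 f * g) (Matrix.fromBlocks e 0 0 0) := by
  have hk := he.1.pos
  obtain ⟨s, t, cs, ct, st, ts, es, sf, ft, te⟩ := MvN.normalize hS he hf h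
  have ce := (he.compl hS).1
  have cf := (hf.compl hS).1
  have hg : Ctl ν c S (10 * k) (Matrix.fromBlocks (1 - e) s t (1 - f)) :=
    (Ctl.blocks (ce.mono (show _ ≤ 3 * k by omega)) cs ct (cf.mono (by omega))).mono (by omega)
  have id2 : ∀ {ι : Type} [Fintype ι] [DecidableEq ι] {e x : Matrix ι ι R}, QId ν c S k e →
      Nr ν c (10 * k) x e → Nr ν c (20 * k) ((1 - e) * (1 - e) + x) 1 := by
    intro ι _ _ e x h1 h2
    have := (((QId.compl hS h1).2.mono (show _ ≤ 10 * k by omega)).add h2)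
    rw [sub_add_cancel] at this
    exact this.mono (by omega)
  have off : ∀ {ι κ : Type} [Fintype ι] [DecidableEq ι] [Fintype κ] [DecidableEq κ]
      {e : Matrix ι ι R} {f : Matrix κ κ R} {x : Matrix ι κ R}, Nr ν c (10 * k) (e * x) x →
      Nr ν c (10 * k) (x * f) x → Nr ν c (20 * k) ((1 - e) * x + x * (1 - f)) 0 := by
    intro ι κ _ _ _ _ e f x h1 h2
    have a1 := (Nr.refl (ν := ν) (c := c) (10 * k) x).sub h1
    have a2 := (Nr.refl (ν := ν) (c := c) (10 * k) x).sub h2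
    have a3 := a1.add a2
    rw [sub_self, add_zero] at a3
    rw [Matrix.sub_mul, Matrix.one_mul, Matrix.mul_sub, Matrix.mul_one]
    exact a3.mono (by omega)
  have sq : Nr ν c (100 * k) (Matrix.fromBlocks (1 - e) s t (1 - f) *
      Matrix.fromBlocks (1 - e) s t (1 - f)) 1 := by
    rw [Matrix.fromBlocks_multiply, ← Matrix.fromBlocks_one, add_comm (t * s),
      add_comm (t * (1 - e))]
    exact (Nr.blocks (id2 he st) (off es sf) (off ft te) (id2 hf ts)).mono (by omega)
  refine ⟨_, ⟨hg.mono (by omega), hg.mono (by omega), sq, sq⟩, ?_⟩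
  have h1 : Nr ν c (11 * k) (Matrix.fromBlocks (1 - e) s t (1 - f) * Matrix.fromBlocks 0 0 0 f)
      (Matrix.fromBlocks 0 s 0 0) := by
    rw [Matrix.fromBlocks_multiply]
    simp only [Matrix.mul_zero, add_zero, zero_add]
    exact (Nr.blocks (Nr.refl _ _) sf (Nr.refl _ _) (hf.compl_mul.mono (by omega))).mono (by omega)
  have h2 : Nr ν c (15 * k) (Matrix.fromBlocks 0 s 0 0 * Matrix.fromBlocks (1 - e) s t (1 - f))
      (Matrix.fromBlocks e 0 0 0) := by
    rw [Matrix.fromBlocks_multiply]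
    simp only [Matrix.zero_mul, add_zero, zero_add]
    have : Nr ν c (10 * k + 1) (s * (1 - f)) 0 := by
      have := (Nr.refl (ν := ν) (c := c) (10 * k) s).sub sf
      rwa [sub_self, ← Matrix.mul_one s, Matrix.mul_assoc, Matrix.one_mul, ← Matrix.mul_sub] at this
    exact (Nr.blocks (st.mono (Nat.le_succ _)) this (Nr.refl _ _) (Nr.refl _ _)).mono (by omega)
  exact ((h1.mul_right hg).trans h2).mono (by omega)

theorem kcls_of_mvN_blocks (hS : IsFilt S) {e : Matrix Λ Λ R} {a : Matrix ι ι R}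
    (hk : 1 ≤ k) (he : QId ν c S k e) (ha : QId ν c S k a)
    (h : MvN ν c S k e (Matrix.fromBlocks a 0 0 (1 : Matrix J J R))) (hl : 20 * k ≤ l)
    (h1 : Cy ν S 0 (c.q l) e) (h2 : Cy ν S 0 (c.q l) a)
    (h3 : Cy ν S 0 (c.q l) (1 : Matrix J J R)) :
    kcls ν S 0 (c.q l) e h1 = kcls ν S 0 (c.q l) a h2 + kcls ν S 0 (c.q l) 1 h3 := by
  have hd := ha.diag (QId.one (ι := J) hS hk)
  rw [← kcls_diag hS (c.good l) h2 h3 (hd.cy (by omega))]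
  exact MvN.kcls_eq hS he hd h hl _ _

/-- Idempotents over the two subalgebras with the same class over the whole algebra come, after
stabilization, from the intersection. -/
theorem MV.exists_lift_zero (mv : MV ν νs π c K S S₁ S₂ S₁₂ T) {e₁ : Matrix ι ι R}
    {e₂ : Matrix κ κ R} (q₁ : QId ν c S₁ k e₁) (q₂ : QId ν c S₂ k e₂)
    {h₁ : Cy ν S 0 (c.q k) e₁} {h₂ : Cy ν S 0 (c.q k) e₂}
    (h : kcls ν S 0 (c.q k) e₁ h₁ = kcls ν S 0 (c.q k) e₂ h₂)
    (hK : 10000000000000000000 * k ≤ K) (hl : 10000000000000000000000000 * k ≤ l) :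
    ∃ (Ω J : Type) (_ : Fintype Ω) (_ : DecidableEq Ω) (_ : Fintype J) (_ : DecidableEq J)
      (e : Matrix Ω Ω R), QId ν c S₁₂ (10000000000000000000 * k) e ∧
      (∀ (h1 : Cy ν S₁ 0 (c.q l) e) (h2 : Cy ν S₁ 0 (c.q l) e₁)
        (h3 : Cy ν S₁ 0 (c.q l) (1 : Matrix J J R)), kcls ν S₁ 0 (c.q l) e h1 =
          kcls ν S₁ 0 (c.q l) e₁ h2 + kcls ν S₁ 0 (c.q l) 1 h3) ∧
      ∀ (h1 : Cy ν S₂ 0 (c.q l) e) (h2 : Cy ν S₂ 0 (c.q l) e₂)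
        (h3 : Cy ν S₂ 0 (c.q l) (1 : Matrix J J R)), kcls ν S₂ 0 (c.q l) e h1 =
          kcls ν S₂ 0 (c.q l) e₂ h2 + kcls ν S₂ 0 (c.q l) 1 h3 := by
  have hk := q₁.1.pos
  obtain ⟨J, _, _, hm⟩ := exists_mvN_of_kcls_eq mv.filt hk h
  set E₁ := Matrix.fromBlocks e₁ 0 0 (1 : Matrix J J R) with hE₁
  set E₂ := Matrix.fromBlocks e₂ 0 0 (1 : Matrix J J R) with hE₂
  have Q₁ : QId ν c S₁ k E₁ := q₁.diag (QId.one mv.filt₁ hk)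
  have Q₂ : QId ν c S₂ k E₂ := q₂.diag (QId.one mv.filt₂ hk)
  obtain ⟨g, qg, hg⟩ := MvN.exists_swap mv.filt
    ((Q₁.filt_mono mv.le₁).mono (show k ≤ 20000000 * k by omega))
    ((Q₂.filt_mono mv.le₂).mono (by omega)) (hm.mono (by omega))
  set b := 100 * (20000000 * k) with hb
  set F₁ := Matrix.fromBlocks (Matrix.fromBlocks E₁ 0 0 (0 : Matrix (κ ⊕ J) (κ ⊕ J) R)) 0 0
    (0 : Matrix ((ι ⊕ J) ⊕ (κ ⊕ J)) ((ι ⊕ J) ⊕ (κ ⊕ J)) R) with hF₁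
  set F₂ := Matrix.fromBlocks (Matrix.fromBlocks (0 : Matrix (ι ⊕ J) (ι ⊕ J) R) 0 0 E₂) 0 0
    (0 : Matrix ((ι ⊕ J) ⊕ (κ ⊕ J)) ((ι ⊕ J) ⊕ (κ ⊕ J)) R) with hF₂
  set D := Matrix.fromBlocks g 0 0 g with hD
  have qD : QInv ν c S b D D := qg.diag qg
  have hDF : Nr ν c b (D * F₂ * D) F₁ := by
    rw [hD, hF₂, blocks_mul_blocks, blocks_mul_blocks, Matrix.mul_zero, Matrix.zero_mul]
    exact hg.diag (Nr.refl _ _)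
  have QF₁ : QId ν c S₁ k F₁ := (Q₁.diag (QId.zero hk)).diag (QId.zero hk)
  have QF₂ : QId ν c S₂ k F₂ := ((QId.zero hk).diag Q₂).diag (QId.zero hk)
  -- As g is its own inverse, D = diag(g, g) is close to a product of six elementary matrices and
  -- factors as z₁z₂.
  obtain ⟨z₁, z₁', z₂, z₂', a1, a2, -, -, -, a6, -, -⟩ := mv.exists_factor
    (QInv.one (ν := ν) (c := c) mv.filt (show 1 ≤ b by omega)) (whl_ctl mv.filt qg)
    (by rw [whl_length]; norm_num) (by omega)
  rw [Matrix.mul_one, Matrix.one_mul] at a6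
  have nD : Nr ν c (12001 * b) D (z₁ * z₂) := (a6.trans (whl_nr qg)).symm.mono (by omega)
  set m := 12001 * b with hm'
  have A1 := a1.mono (show _ ≤ m by omega)
  have A2 := a2.mono (show _ ≤ m by omega)
  have AD := qD.mono (show _ ≤ m by omega)
  -- D is close to its inverse, hence also to z₂'z₁'.
  have nD' : Nr ν c (10 * m) D (z₂' * z₁') := by
    have pz : QInv ν c S (5 * m) (z₁ * z₂) (z₂' * z₁') :=
      ((A1.filt_mono mv.le₁).mul mv.filt (A2.filt_mono mv.le₂)).mono (by omega)
    have b1 := pz.2.2.1.symm.mul_left AD.1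
    have b2 := (nD.symm.mul_left AD.1).mul_right pz.2.1
    have b3 := AD.2.2.1.mul_right pz.2.1
    rw [Matrix.mul_one] at b1
    rw [← Matrix.mul_assoc D (z₁ * z₂)] at b1
    rw [Matrix.one_mul] at b3
    exact ((b1.trans b2).trans b3).mono (by omega)
  have c1 : Nr ν c (10 * m) (z₁' * D) z₂ := by
    have b1 := nD.mul_left A1.2.1
    have b2 := A1.2.2.2.mul_right A2.1
    rw [← Matrix.mul_assoc] at b1
    rw [Matrix.one_mul] at b2
    exact (b1.trans b2).mono (by omega)
  have c2 : Nr ν c (20 * m) (D * z₁) z₂' := by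
    have b1 := nD'.mul_right A1.1
    have b2 := A1.2.2.2.mul_left A2.2.1
    rw [Matrix.mul_assoc] at b1
    rw [Matrix.mul_one] at b2
    exact (b1.trans b2).mono (by omega)
  -- z₁'F₁z₁ ≈ (z₁'D)F₂(Dz₁) ≈ z₂F₂z₂'. The two ends lie over different subalgebras, so an
  -- idempotent over the intersection is close to both.
  have nXY : Nr ν c (50 * m) (z₁' * F₁ * z₁) (z₂ * F₂ * z₂') := by
    have b1 := ((hDF.symm.mono (show b ≤ m by omega)).mul_left A1.2.1).mul_right A1.1
    have b2 := (c1.mul_right (QF₂.1.mono (show k ≤ m by omega))).mul_right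
      ((AD.1.mul mv.filt (A1.1.filt_mono mv.le₁)))
    have b3 := c2.mul_left (A2.1.mul mv.filt₂ (QF₂.1.mono (show k ≤ m by omega)))
    rw [show z₁' * (D * F₂ * D) * z₁ = z₁' * D * F₂ * (D * z₁) by
      simp only [Matrix.mul_assoc]] at b1
    exact ((b1.trans b2).trans b3).mono (by omega)
  have X := (QF₁.mono (show k ≤ m by omega)).conj mv.filt₁ A1
  have Y := (QF₂.mono (show k ≤ m by omega)).conj mv.filt₂ A2.symm
  obtain ⟨e, ce, e1, e2, -⟩ := mv.exists_cia (X.1.mono (show _ ≤ 50 * m by omega))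
    (Y.1.mono (by omega)) nXY (by omega)
  have X' := X.mono (show _ ≤ 100 * m by omega)
  have Y' := Y.mono (show _ ≤ 100 * m by omega)
  have ce' := ce.mono (show _ ≤ 100 * m by omega)
  have qe1 := X'.of_nr (ce'.filt_mono mv.le₁₂₁) (e1.symm.mono (by omega))
  have qe2 := Y'.of_nr (ce'.filt_mono mv.le₁₂₂) (e2.symm.mono (by omega))
  have mX := (MvN.of_nr X' (e1.symm.mono (by omega))).symm
  have mY := (MvN.of_nr Y' (e2.symm.mono (by omega))).symm
  have mX2 := MvN.conj mv.filt₁ (QF₁.mono (show k ≤ m by omega)) A1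
  have mY2 := MvN.conj mv.filt₂ (QF₂.mono (show k ≤ m by omega)) A2.symm
  have mX3 := MvN.stab_zero (Q₁.diag (QId.zero (ι := κ ⊕ J) hk)) ((ι ⊕ J) ⊕ (κ ⊕ J))
  have mX4 := MvN.stab_zero Q₁ (κ ⊕ J)
  have mY3 := MvN.stab_zero ((QId.zero (ι := ι ⊕ J) (S := S₂) hk).diag Q₂) ((ι ⊕ J) ⊕ (κ ⊕ J))
  have mY4 : MvN ν c S₂ k (Matrix.fromBlocks (0 : Matrix (ι ⊕ J) (ι ⊕ J) R) 0 0 E₂) E₂ := by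
    have := (MvN.stab_zero Q₂ (ι ⊕ J)).submatrix (Equiv.sumComm _ _) (Equiv.refl _)
    rw [Equiv.coe_refl, Matrix.submatrix_id_id] at this
    convert this using 1
    ext (i | i) (j | j) <;> simp
  have mX5 := (mX3.trans mv.filt₁ QF₁ Q₁ mX4).mono (show _ ≤ 10 * m by omega)
  have mY5 := (mY3.trans mv.filt₂ QF₂ Q₂ mY4).mono (show _ ≤ 10 * m by omega)
  have mX6 := (mX2.mono (show _ ≤ 10 * m by omega)).trans mv.filt₁ (X.mono (by omega))
    (Q₁.mono (by omega)) mX5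
  have mY6 := (mY2.mono (show _ ≤ 10 * m by omega)).trans mv.filt₂ (Y.mono (by omega))
    (Q₂.mono (by omega)) mY5
  have mX7 := (mX.mono (show _ ≤ 1000 * m by omega)).trans mv.filt₁ (qe1.mono (by omega))
    (Q₁.mono (by omega)) (mX6.mono (by omega))
  have mY7 := (mY.mono (show _ ≤ 1000 * m by omega)).trans mv.filt₂ (qe2.mono (by omega))
    (Q₂.mono (by omega)) (mY6.mono (by omega))
  have hm1 : 6 * (1000 * m) ≤ 1000000000000000000 * k := by omega
  refine ⟨_, J, inferInstance, inferInstance, inferInstance, inferInstance, e, ⟨ce'.mono (by omega), qe1.2.mono (by omega)⟩, ?_, ?_⟩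
  · intro h1 h2 h3
    exact kcls_of_mvN_blocks mv.filt₁ (by omega) (qe1.mono (by omega)) (q₁.mono (by omega))
      (mX7.mono hm1) (by omega) h1 h2 h3
  · intro h1 h2 h3
    exact kcls_of_mvN_blocks mv.filt₂ (by omega) (qe2.mono (by omega)) (q₂.mono (by omega))
      (mY7.mono hm1) (by omega) h1 h2 h3

end exactness


/-! ### Relaxation maps and change of scale -/

section relaxation

variable {R : Type*} [Ring R] [Algebra ℂ R] [TopologicalSpace R] {ν : MNorm R}
  {νs : MNorm ℂ} {π : R →ₐ[ℂ] ℂ} {S S' S'' : ℝ →o Submodule ℂ R} {i : Fin 2} {q q' q'' : Param}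
  {ι κ : Type} [Fintype ι] [DecidableEq ι] [Fintype κ] [DecidableEq κ]

theorem id_contr (ν : MNorm R) (h : S ≤ S') :
    MatFilt.IsContr (ν.toMatFilt S) (ν.toMatFilt S') (RingHom.id R) :=
  ⟨continuous_id, fun r _ hx => h r hx, fun _ _ => le_rfl⟩

/-- Relaxation of the parameters and of the filtration. -/
def rlx (ν : MNorm R) (h : S ≤ S') (hq : q ≤ q') (i : Fin 2) :
    (ν.toMatFilt S).UK i q →+ (ν.toMatFilt S').UK i q' :=
  MatFilt.UKmap (id_contr ν h) hq i

theorem rlx_kcls (h : S ≤ S') (hq : q ≤ q') {a : Matrix ι ι R} (ha : Cy ν S i q a)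
    (ha' : Cy ν S' i q' a) : rlx ν h hq i (kcls ν S i q a ha) = kcls ν S' i q' a ha' :=
  rfl

theorem rlx_rlx (h : S ≤ S') (h' : S' ≤ S'') (hq : q ≤ q') (hq' : q' ≤ q'')
    (x : (ν.toMatFilt S).UK i q) :
    rlx ν h' hq' i (rlx ν h hq i x) =
      rlx ν (h.trans h') ⟨hq.1.trans hq'.1, hq.2.1.trans hq'.2.1, hq.2.2.trans hq'.2.2⟩ i x :=
  DFunLike.congr_fun (MatFilt.UK_hom_ext (f := (rlx ν h' hq' i).comp (rlx ν h hq i))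
    (g := rlx ν (h.trans h') ⟨hq.1.trans hq'.1, hq.2.1.trans hq'.2.1, hq.2.2.trans hq'.2.2⟩ i)
    fun _ _ _ => rfl) x

/-- The homomorphism induced by `π`. -/
def pim (H : MatFilt.IsContr (ν.toMatFilt S) (νs.toMatFilt topFil) (π : R →+* ℂ)) (i : Fin 2)
    (q : Param) : (ν.toMatFilt S).UK i q →+ (νs.toMatFilt topFil).UK i q :=
  MatFilt.UKmap H (Param.le_refl q) i

theorem pim_kcls (H : MatFilt.IsContr (ν.toMatFilt S) (νs.toMatFilt topFil) (π : R →+* ℂ))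
    {a : Matrix ι ι R} (ha : Cy ν S i q a) (ha' : Cy νs topFil i q (a.map π)) :
    pim H i q (kcls ν S i q a ha) = kcls νs topFil i q (a.map π) ha' :=
  rfl

theorem Cy.π_map (H : MatFilt.IsContr (ν.toMatFilt S) (νs.toMatFilt topFil) (π : R →+* ℂ))
    {a : Matrix ι ι R} (ha : Cy ν S i q a) : Cy νs topFil i q (a.map π) := by
  have h1 : Cy νs topFil i q ((a.submatrix (Fintype.equivFin ι).symm
      (Fintype.equivFin ι).symm).map π) :=
    MatFilt.IsCyc.map H (Param.le_refl q) (ha.reindex (Fintype.equivFin ι).symm)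
  have h2 := h1.reindex (Fintype.equivFin ι)
  rw [← Matrix.submatrix_map, Matrix.submatrix_submatrix] at h2
  simpa using h2

theorem pim_rlx (H : MatFilt.IsContr (ν.toMatFilt S) (νs.toMatFilt topFil) (π : R →+* ℂ))
    (H' : MatFilt.IsContr (ν.toMatFilt S') (νs.toMatFilt topFil) (π : R →+* ℂ)) (h : S ≤ S')
    (hq : q ≤ q') (x : (ν.toMatFilt S).UK i q) :
    pim H' i q' (rlx ν h hq i x) = rlx νs le_rfl hq i (pim H i q x) :=
  DFunLike.congr_fun (MatFilt.UK_hom_ext (f := (pim H' i q').comp (rlx ν h hq i))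
    (g := (rlx νs le_rfl hq i).comp (pim H i q)) fun _ _ _ => rfl) x

theorem Cy.filt_mono (h : S ≤ S') {a : Matrix ι ι R} (ha : Cy ν S i q a) : Cy ν S' i q a := by
  unfold Cy at *
  split_ifs at * with hi
  · exact ⟨fun i j => h _ (ha.1 i j), ha.2⟩
  · obtain ⟨b, hb⟩ := ha
    exact ⟨b, fun i j => h _ (hb.1 i j), fun i j => h _ (hb.2.1 i j), hb.2.2⟩

theorem rlx_refl (x : (ν.toMatFilt S).UK i q) : rlx ν le_rfl (Param.le_refl q) i x = x :=
  DFunLike.congr_fun (MatFilt.UK_hom_ext (f := rlx ν le_rfl (Param.le_refl q) i)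
    (g := AddMonoidHom.id _) fun _ _ _ => rfl) x

/-- The map induced by π does not see the filtration, so its vanishing may be tested over a larger
algebra. -/
theorem pim_eq_zero_of_rlx
    (H : MatFilt.IsContr (ν.toMatFilt S) (νs.toMatFilt topFil) (π : R →+* ℂ))
    (H' : MatFilt.IsContr (ν.toMatFilt S') (νs.toMatFilt topFil) (π : R →+* ℂ)) (h : S ≤ S')
    {x : (ν.toMatFilt S).UK i q}
    (hx : pim H' i q (rlx ν h (Param.le_refl q) i x) = 0) : pim H i q x = 0 := by
  rwa [pim_rlx H H', rlx_refl] at hx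

theorem Ctl.rescale {c c' : Scale} {k k' : ℕ} (h : c.q k ≤ c'.q k') (hk' : 1 ≤ k')
    {X : Matrix ι κ R} (hX : Ctl ν c S k X) : Ctl ν c' S k' X :=
  ⟨hk', fun i j => S.monotone h.2.1 (hX.mem i j), hX.bd.trans h.2.2⟩

theorem Nr.rescale {c c' : Scale} {k k' : ℕ} (h : c.q k ≤ c'.q k')
    {X Y : Matrix ι κ R} (hX : Nr ν c k X Y) : Nr ν c' k' X Y :=
  le_trans hX h.1

theorem QId.rescale {c c' : Scale} {k k' : ℕ} (h : c.q k ≤ c'.q k') (hk' : 1 ≤ k')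
    {e : Matrix ι ι R} (he : QId ν c S k e) : QId ν c' S k' e :=
  ⟨he.1.rescale h hk', he.2.rescale h⟩

theorem Patch.rescale {c c' : Scale} {k k' : ℕ} (h : c.q k ≤ c'.q k') (hk' : 1 ≤ k')
    {u : Matrix ι ι R} {e : Matrix κ κ R} (hp : Patch ν c S S' k u e) :
    Patch ν c' S S' k' u e := by
  obtain ⟨α₁, β₁, α₂, β₂, hp⟩ := hp
  exact ⟨α₁, β₁, α₂, β₂, hp.ca₁.rescale h hk', hp.cb₁.rescale h hk', hp.ca₂.rescale h hk',
    hp.cb₂.rescale h hk', hp.ab₁.rescale h, hp.ab₂.rescale h, hp.ba₁.rescale h, hp.ba₂.rescale h,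
    hp.glue.rescale h⟩

end relaxation

/-! ### The boundary relation -/

section boundary

variable {R : Type*} [Ring R] [Algebra ℂ R] [TopologicalSpace R]
  [IsTopologicalRing R] [ContinuousSMul ℂ R] {ν : MNorm R} {νs : MNorm ℂ} {π : R →ₐ[ℂ] ℂ}
  {c : Scale} {K : ℕ} {S S₁ S₂ S₁₂ S' S'' : ℝ →o Submodule ℂ R} {T : ℕ → Submodule ℂ R}
  {k l m n kB kD : ℕ}

/-- Every class in `K_1` is represented by a quasi-invertible. -/
theorem exists_kcls_one (hS : IsFilt S) (x : (ν.toMatFilt S).UK 1 (c.q 1)) :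
    ∃ (Λ : Type) (_ : Fintype Λ) (_ : DecidableEq Λ) (w w' : Matrix Λ Λ R), QInv ν c S 1 w w' ∧
      ∀ {l : ℕ}, 700 ≤ l → ∀ (hq : c.q 1 ≤ c.q l) (hw : Cy ν S 1 (c.q l) w),
        rlx ν le_rfl hq 1 x = kcls ν S 1 (c.q l) w hw := by
  obtain ⟨n, m, a, b, ha, hb, rfl⟩ := exists_kcls_sub hS (c.good 1) x
  obtain ⟨a', ha'⟩ := ha.qinv le_rfl
  obtain ⟨b', hb'⟩ := hb.qinv le_rfl
  refine ⟨_, inferInstance, inferInstance, _, _, ha'.diag hb'.symm, ?_⟩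
  intro l hl hq hw
  have h1 : Cy ν S 1 (c.q l) a := ha'.cy (by omega)
  have h2 : Cy ν S 1 (c.q l) b := hb'.cy (by omega)
  have h3 : Cy ν S 1 (c.q l) b' := hb'.symm.cy (by omega)
  rw [map_sub, rlx_kcls le_rfl hq ha h1, rlx_kcls le_rfl hq hb h2,
    kcls_diag hS (c.good l) h1 h3, sub_eq_add_neg, eq_neg_of_add_eq_zero_left
      (kcls_inv hS hb' (by omega) h2 h3), neg_neg]

/-- Every class in `K_0` is represented by a difference `[e] - [I_n]`. -/
theorem exists_kcls_zero (hS : IsFilt S) (x : (ν.toMatFilt S).UK 0 (c.q 1)) :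
    ∃ (Λ ι : Type) (_ : Fintype Λ) (_ : DecidableEq Λ) (_ : Fintype ι) (_ : DecidableEq ι)
      (e : Matrix Λ Λ R), QId ν c S 2 e ∧
      ∀ {l : ℕ}, 160 ≤ l → ∀ (hq : c.q 1 ≤ c.q l) (he : Cy ν S 0 (c.q l) e)
        (h1 : Cy ν S 0 (c.q l) (1 : Matrix ι ι R)),
        rlx ν le_rfl hq 0 x = kcls ν S 0 (c.q l) e he - kcls ν S 0 (c.q l) 1 h1 := by
  obtain ⟨n, m, a, b, ha, hb, rfl⟩ := exists_kcls_sub hS (c.good 1) x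
  have ha' := ha.qid le_rfl
  have hb' := hb.qid le_rfl
  refine ⟨Fin n ⊕ Fin m, Fin m, inferInstance, inferInstance, inferInstance, inferInstance, _,
    (ha'.mono (show 1 ≤ 2 by omega)).diag (hb'.compl hS), ?_⟩
  intro l hl hq he h1
  have h2 : Cy ν S 0 (c.q l) a := ha'.cy (by omega)
  have h3 : Cy ν S 0 (c.q l) b := hb'.cy (by omega)
  rw [map_sub, rlx_kcls le_rfl hq ha h2, rlx_kcls le_rfl hq hb h3]
  exact kcls_sub_eq hS le_rfl hb' (by omega) h2 h3 he h1

theorem MV.pi_contr (mv : MV ν νs π c K S S₁ S₂ S₁₂ T) (hc : Continuous π)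
    (S' : ℝ →o Submodule ℂ R) :
    MatFilt.IsContr (ν.toMatFilt S') (νs.toMatFilt topFil) (π : R →+* ℂ) :=
  ⟨hc, fun _ _ _ => trivial, fun _ a => mv.contr a⟩

/-- Every class in the kernel of `π` is represented by a quasi-invertible that is the identity
modulo the ideal. -/
theorem MV.exists_rep_one (mv : MV ν νs π c K S S₁ S₂ S₁₂ T) (hS' : IsFilt S')
    (H : MatFilt.IsContr (ν.toMatFilt S') (νs.toMatFilt topFil) (π : R →+* ℂ))
    {x : (ν.toMatFilt S').UK 1 (c.q 1)} (hx : pim H 1 _ x = 0) :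
    ∃ (Λ : Type) (_ : Fintype Λ) (_ : DecidableEq Λ) (u v : Matrix Λ Λ R),
      QInv ν c S' 20000000000000 u v ∧ u.map π = 1 ∧ v.map π = 1 ∧
      ∀ {l : ℕ}, 20000000000001 ≤ l → ∀ (hq : c.q 1 ≤ c.q l) (hu : Cy ν S' 1 (c.q l) u),
        rlx ν le_rfl hq 1 x = kcls ν S' 1 (c.q l) u hu := by
  obtain ⟨Λ, _, _, w, w', hw, h⟩ := exists_kcls_one hS' x
  have hw7 : Cy ν S' 1 (c.q 700) w := hw.cy (by omega)
  have hq7 : c.q 1 ≤ c.q 700 := c.q_le (by omega)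
  have h0 := pim_rlx H H le_rfl hq7 x
  rw [hx, map_zero, h le_rfl hq7 hw7, pim_kcls H hw7 (hw7.π_map H)] at h0
  obtain ⟨Ω, i1, i2, u, v, huv, pu, pv, h1⟩ := mv.exists_rep (l := 20000000000000) hS' hw7 (by omega) _ h0
    (by omega)
  refine ⟨Ω, i1, i2, u, v, huv.mono (by omega), pu, pv, ?_⟩
  intro l hl hq hu
  have g1 : Cy ν S' 1 (c.q 20000000000000) u := huv.cy (by omega)
  have g2 : Cy ν S' 1 (c.q 20000000000000) w := hw.cy (by omega)
  have g3 : Cy ν S' 1 (c.q l) w := hw.cy (by omega)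
  rw [h (by omega) hq g3, ← rlx_kcls le_rfl (c.q_le (show 20000000000000 ≤ l by omega)) g2 g3,
    ← h1 g1 g2, rlx_kcls le_rfl _ g1 hu]

/-- The class `g` arises from the class `x` by gluing. -/
def IsBd (ν : MNorm R) (c : Scale) (S S₁ S₂ S₁₂ : ℝ →o Submodule ℂ R) (kB kD : ℕ)
    (x : (ν.toMatFilt S).UK 1 (c.q kB)) (g : (ν.toMatFilt S₁₂).UK 0 (c.q kD)) : Prop :=
  ∃ (ι Ω : Type) (_ : Fintype ι) (_ : DecidableEq ι) (_ : Fintype Ω) (_ : DecidableEq Ω)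
    (u : Matrix ι ι R) (e : Matrix Ω Ω R) (hu : Cy ν S 1 (c.q kB) u)
    (he : Cy ν S₁₂ 0 (c.q kD) e) (h1 : Cy ν S₁₂ 0 (c.q kD) (1 : Matrix ι ι R)),
    x = kcls ν S 1 (c.q kB) u hu ∧ Patch ν c S₁ S₂ kB u e ∧ QId ν c S₁₂ kB e ∧
      g = kcls ν S₁₂ 0 (c.q kD) e he - kcls ν S₁₂ 0 (c.q kD) 1 h1

theorem IsBd.unique (mv : MV ν νs π c K S S₁ S₂ S₁₂ T) {x : (ν.toMatFilt S).UK 1 (c.q kB)}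
    {g g' : (ν.toMatFilt S₁₂).UK 0 (c.q kD)} (h : IsBd ν c S S₁ S₂ S₁₂ kB kD x g)
    (h' : IsBd ν c S S₁ S₂ S₁₂ kB kD x g') (hK : 20000000000000 * kB ≤ K)
    (hD : 20000000000000 * kB ≤ kD) : g = g' := by
  obtain ⟨ι, Ω, _, _, _, _, u, e, hu, he, h1, rfl, hp, hq, rfl⟩ := h
  obtain ⟨ι', Ω', _, _, _, _, u', e', hu', he', h1', hx, hp', hq', rfl⟩ := h'
  exact Patch.kcls_sub mv hx hp hp' hq hq' hK hD _ _ _ _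

theorem IsBd.add (hS : IsFilt S) (hS₁₂ : IsFilt S₁₂) {x x' : (ν.toMatFilt S).UK 1 (c.q kB)}
    {g g' : (ν.toMatFilt S₁₂).UK 0 (c.q kD)} (h : IsBd ν c S S₁ S₂ S₁₂ kB kD x g)
    (h' : IsBd ν c S S₁ S₂ S₁₂ kB kD x' g') : IsBd ν c S S₁ S₂ S₁₂ kB kD (x + x') (g + g') := by
  obtain ⟨ι, Ω, _, _, _, _, u, e, hu, he, h1, rfl, hp, hq, rfl⟩ := h
  obtain ⟨ι', Ω', _, _, _, _, u', e', hu', he', h1', rfl, hp', hq', rfl⟩ := h'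
  have h2 : Cy ν S₁₂ 0 (c.q kD) (1 : Matrix (ι ⊕ ι') (ι ⊕ ι') R) := by
    rw [← Matrix.fromBlocks_one]; exact h1.diag h1'
  refine ⟨_, _, _, _, _, _, _, _, hu.diag hu', he.diag he', h2, ?_, hp.diag hp', hq.diag hq', ?_⟩
  · rw [kcls_diag hS (c.good kB) hu hu']
  · rw [kcls_diag hS₁₂ (c.good kD) he he', kcls_one_sum hS₁₂ (c.good kD) h2 h1 h1']
    abel

theorem IsBd.rescale {c' : Scale} {kB' kD' : ℕ} (hB : c.q kB ≤ c'.q kB')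
    (hD : c.q kD ≤ c'.q kD') (hk : 1 ≤ kB') {x : (ν.toMatFilt S).UK 1 (c.q kB)}
    {g : (ν.toMatFilt S₁₂).UK 0 (c.q kD)} (h : IsBd ν c S S₁ S₂ S₁₂ kB kD x g) :
    IsBd ν c' S S₁ S₂ S₁₂ kB' kD' (rlx ν le_rfl hB 1 x) (rlx ν le_rfl hD 0 g) := by
  obtain ⟨ι, Ω, _, _, _, _, u, e, hu, he, h1, rfl, hp, hq, rfl⟩ := h
  refine ⟨ι, Ω, _, _, _, _, u, e, hu.mono hB, he.mono hD, h1.mono hD, rfl, hp.rescale hB hk,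
    hq.rescale hB hk, ?_⟩
  rw [map_sub]; rfl

/-- Existence of the data of the boundary map for a class in the kernel of `π`. -/
theorem MV.exists_isBd_data (mv : MV ν νs π c K S S₁ S₂ S₁₂ T) 
    (H : MatFilt.IsContr (ν.toMatFilt S) (νs.toMatFilt topFil) (π : R →+* ℂ))
    {x : (ν.toMatFilt S).UK 1 (c.q 1)} (hx : pim H 1 _ x = 0)
    (hB : 20000000000000000000 ≤ kB) (hK : kB ≤ K) :
    ∃ (Λ : Type) (_ : Fintype Λ) (_ : DecidableEq Λ) (u v : Matrix Λ Λ R)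
      (w₁ w₁' w₂ w₂' e : Matrix (Λ ⊕ Λ) (Λ ⊕ Λ) R),
      QInv ν c S 20000000000000 u v ∧ u.map π = 1 ∧ v.map π = 1 ∧
      QInv ν c S₁ (kB - 1) w₁ w₁' ∧ QInv ν c S₂ (kB - 1) w₂ w₂' ∧
      Nr ν c (kB - 1) (Matrix.fromBlocks u 0 0 v) (w₁ * w₂) ∧ QId ν c S₁₂ (kB - 1) e ∧
      Nr ν c (kB - 1) e (w₁' * Matrix.fromBlocks 1 0 0 0 * w₁) ∧
      Nr ν c (kB - 1) e (w₂ * Matrix.fromBlocks 1 0 0 0 * w₂') ∧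
      e.map π = Matrix.fromBlocks 1 0 0 0 ∧
      ∀ {l : ℕ}, 20000000000001 ≤ l → ∀ (hq : c.q 1 ≤ c.q l) (hu : Cy ν S 1 (c.q l) u),
        rlx ν le_rfl hq 1 x = kcls ν S 1 (c.q l) u hu := by
  obtain ⟨Λ, i1, i2, u, v, huv, pu, pv, h⟩ := mv.exists_rep_one mv.filt H hx
  obtain ⟨w₁, w₁', w₂, w₂', e, h1, h2, h3, h4, h5, h6, h7⟩ := mv.exists_datum huv (by omega)
  exact ⟨Λ, i1, i2, u, v, w₁, w₁', w₂, w₂', e, huv, pu, pv, h1.mono (by omega), h2.mono (by omega),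
    h3.mono (by omega), h4.mono (by omega), h5.mono (by omega), h6.mono (by omega), h7,
    fun hl => h (by omega)⟩

theorem MV.exists_isBd (mv : MV ν νs π c K S S₁ S₂ S₁₂ T)
    (H : MatFilt.IsContr (ν.toMatFilt S) (νs.toMatFilt topFil) (π : R →+* ℂ))
    {x : (ν.toMatFilt S).UK 1 (c.q 1)} (hx : pim H 1 _ x = 0) (hq : c.q 1 ≤ c.q kB)
    (hB : 20000000000000000000 ≤ kB) (hK : kB ≤ K) (hD : kB ≤ kD) :
    ∃ g : (ν.toMatFilt S₁₂).UK 0 (c.q kD), IsBd ν c S S₁ S₂ S₁₂ kB kD (rlx ν le_rfl hq 1 x) g := by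
  obtain ⟨Λ, i1, i2, u, v, w₁, w₁', w₂, w₂', e, huv, pu, pv, h1, h2, h3, h4, h5, h6, h7, h8⟩ :=
    mv.exists_isBd_data H hx hB hK
  have c1 : Cy ν S 1 (c.q kB) u := huv.cy (by omega)
  have c2 : Cy ν S₁₂ 0 (c.q kD) e := h4.cy (by omega)
  have c3 : Cy ν S₁₂ 0 (c.q kD) (1 : Matrix Λ Λ R) := (QId.one mv.filt₁₂ h4.1.pos).cy (by omega)
  exact ⟨_, Λ, _, i1, i2, _, _, u, e, c1, c2, c3, h8 (by omega) hq c1,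
    (Patch.of_datum h1 h2 h3 h5 h6).mono (by omega), h4.mono (by omega), rfl⟩

/-- The boundary of a difference of classes from the two subalgebras vanishes. -/
theorem MV.isBd_diff (mv : MV ν νs π c K S S₁ S₂ S₁₂ T) (x₁ : (ν.toMatFilt S₁).UK 1 (c.q 1))
    (x₂ : (ν.toMatFilt S₂).UK 1 (c.q 1)) (hq : c.q 1 ≤ c.q kB) (hB : 700 ≤ kB) (hD : kB ≤ kD) :
    IsBd ν c S S₁ S₂ S₁₂ kB kD (rlx ν mv.le₁ hq 1 x₁ - rlx ν mv.le₂ hq 1 x₂) 0 := by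
  obtain ⟨Λ, _, _, u, u', hu, h⟩ := exists_kcls_one mv.filt₁ x₁
  obtain ⟨Ω, _, _, v, v', hv, h'⟩ := exists_kcls_one mv.filt₂ x₂
  have r1 : rlx ν mv.le₁ hq 1 x₁ = rlx ν mv.le₁ (Param.le_refl _) 1 (rlx ν le_rfl hq 1 x₁) :=
    (rlx_rlx _ _ _ _ _).symm
  have r2 : rlx ν mv.le₂ hq 1 x₂ = rlx ν mv.le₂ (Param.le_refl _) 1 (rlx ν le_rfl hq 1 x₂) :=
    (rlx_rlx _ _ _ _ _).symm
  have c1 : Cy ν S₁ 1 (c.q kB) u := hu.cy (by omega)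
  have c2 : Cy ν S₂ 1 (c.q kB) v := hv.cy (by omega)
  have d1 : Cy ν S 1 (c.q kB) u := (hu.filt_mono mv.le₁).cy (by omega)
  have d2 : Cy ν S 1 (c.q kB) v := (hv.filt_mono mv.le₂).cy (by omega)
  have d3 : Cy ν S 1 (c.q kB) v' := (hv.symm.filt_mono mv.le₂).cy (by omega)
  rw [r1, r2, h hB hq c1, h' hB hq c2, rlx_kcls _ _ c1 d1, rlx_kcls _ _ c2 d2]
  have d4 : Cy ν S₁₂ 0 (c.q kD) (1 : Matrix (Λ ⊕ Ω) (Λ ⊕ Ω) R) :=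
    (QId.one mv.filt₁₂ le_rfl).cy (show 1 + 1 ≤ kD by omega)
  refine ⟨Λ ⊕ Ω, Λ ⊕ Ω, inferInstance, inferInstance, inferInstance, inferInstance,
    Matrix.fromBlocks u 0 0 v', 1, d1.diag d3, d4, d4, ?_, ?_, QId.one mv.filt₁₂ (by omega),
    (sub_self _).symm⟩
  · rw [kcls_diag mv.filt (c.good kB) d1 d3, sub_eq_add_neg, eq_neg_of_add_eq_zero_left
      (kcls_inv mv.filt (hv.filt_mono mv.le₂) (by omega) d2 d3), neg_neg]
  -- The class of the difference is represented by diag(u, v') = diag(u, 1) diag(1, v'), with one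
  -- factor from each subalgebra; the glued idempotent is therefore 1.
  · have := (hu.diag (QInv.one (ι := Ω) mv.filt₁ le_rfl)).mono (show 1 ≤ kB by omega)
    have := Patch.of_mul this ((QInv.one (ι := Λ) mv.filt₂ le_rfl).diag hv.symm |>.mono (by omega))
    rwa [blocks_mul_blocks, Matrix.mul_one, Matrix.one_mul] at this

/-- A boundary vanishes over the two subalgebras. -/
theorem IsBd.rlx_eq_zero (mv : MV ν νs π c K S S₁ S₂ S₁₂ T) {x : (ν.toMatFilt S).UK 1 (c.q kB)}
    {g : (ν.toMatFilt S₁₂).UK 0 (c.q kD)} (h : IsBd ν c S S₁ S₂ S₁₂ kB kD x g)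
    (hD : 20 * kB ≤ kD) :
    rlx ν mv.le₁₂₁ (Param.le_refl (c.q kD)) 0 g = 0 ∧
      rlx ν mv.le₁₂₂ (Param.le_refl (c.q kD)) 0 g = 0 := by
  obtain ⟨ι, Ω, _, _, _, _, u, e, hu, he, h1, rfl, ⟨α₁, β₁, α₂, β₂, hp⟩, hq, rfl⟩ := h
  have hk := hq.1.pos
  -- Over each subalgebra the frame itself is an equivalence between e and an identity matrix.
  constructor
  · rw [map_sub, sub_eq_zero]
    exact MvN.kcls_eq mv.filt₁ (hq.filt_mono mv.le₁₂₁) (QId.one mv.filt₁ hk)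
      ⟨α₁, β₁, hp.ca₁, hp.cb₁, hp.ab₁, hp.ba₁⟩ hD (Cy.filt_mono mv.le₁₂₁ he) (Cy.filt_mono mv.le₁₂₁ h1)
  · rw [map_sub, sub_eq_zero]
    exact MvN.kcls_eq mv.filt₂ (hq.filt_mono mv.le₁₂₂) (QId.one mv.filt₂ hk)
      ⟨α₂, β₂, hp.ca₂, hp.cb₂, hp.ab₂, hp.ba₂⟩ hD (Cy.filt_mono mv.le₁₂₂ he) (Cy.filt_mono mv.le₁₂₂ h1)

end boundary


/-! ### Exactness at the level of K-groups, at a fixed scale -/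

section exactness

variable {R : Type*} [Ring R] [Algebra ℂ R] [TopologicalSpace R]
  [IsTopologicalRing R] [ContinuousSMul ℂ R] {ν : MNorm R} {νs : MNorm ℂ} {π : R →ₐ[ℂ] ℂ}
  {c : Scale} {K : ℕ} {S S₁ S₂ S₁₂ S' S'' : ℝ →o Submodule ℂ R} {T : ℕ → Submodule ℂ R}
  {k l m n kB kD : ℕ}

theorem rlx_split {i : Fin 2} {q q' : Param} (h : S ≤ S') (hq : q ≤ q')
    (x : (ν.toMatFilt S).UK i q) :
    rlx ν h hq i x = rlx ν h (Param.le_refl q') i (rlx ν le_rfl hq i x) :=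
  (rlx_rlx _ _ _ _ _).symm

theorem rlx_split' {i : Fin 2} {q q' : Param} (h : S ≤ S') (hq : q ≤ q')
    (x : (ν.toMatFilt S).UK i q) :
    rlx ν h hq i x = rlx ν le_rfl hq i (rlx ν h (Param.le_refl q) i x) :=
  (rlx_rlx _ _ _ _ _).symm

/-- The class given by `MV.exists_lift_one` lies in the kernel of π because it agrees over the first
subalgebra with x₁, which does. -/
theorem MV.exact_one_sub (mv : MV ν νs π c K S S₁ S₂ S₁₂ T) (hc : Continuous π)
    {x₁ : (ν.toMatFilt S₁).UK 1 (c.q 1)} {x₂ : (ν.toMatFilt S₂).UK 1 (c.q 1)}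
    (p₁ : pim (mv.pi_contr hc S₁) 1 _ x₁ = 0)
    (h : rlx ν mv.le₁ (Param.le_refl _) 1 x₁ = rlx ν mv.le₂ (Param.le_refl _) 1 x₂)
    (hK : 100000000000000000000000000 ≤ K) (hl : 100000000000000000000000000000000 ≤ l)
    (hq : c.q 1 ≤ c.q l) :
    ∃ ξ : (ν.toMatFilt S₁₂).UK 1 (c.q l), pim (mv.pi_contr hc S₁₂) 1 _ ξ = 0 ∧
      rlx ν mv.le₁₂₁ (Param.le_refl _) 1 ξ = rlx ν le_rfl hq 1 x₁ ∧
      rlx ν mv.le₁₂₂ (Param.le_refl _) 1 ξ = rlx ν le_rfl hq 1 x₂ := by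
  obtain ⟨Λ, _, _, u, u', hu, g⟩ := exists_kcls_one mv.filt₁ x₁
  obtain ⟨Ω, _, _, v, v', hv, g'⟩ := exists_kcls_one mv.filt₂ x₂
  have h7 : c.q 1 ≤ c.q 700 := c.q_le (by omega)
  have c1 : Cy ν S₁ 1 (c.q 700) u := hu.cy (by omega)
  have c2 : Cy ν S₂ 1 (c.q 700) v := hv.cy (by omega)
  have d1 : Cy ν S 1 (c.q 700) u := c1.filt_mono mv.le₁
  have d2 : Cy ν S 1 (c.q 700) v := c2.filt_mono mv.le₂
  have huv : kcls ν S 1 (c.q 700) u d1 = kcls ν S 1 (c.q 700) v d2 := by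
    rw [← rlx_kcls mv.le₁ (Param.le_refl _) c1, ← rlx_kcls mv.le₂ (Param.le_refl _) c2,
      ← g le_rfl h7, ← g' le_rfl h7, ← rlx_split, ← rlx_split, rlx_split', h, ← rlx_split']
  obtain ⟨Θ, _, _, ξ, ξ', hξ, b1, b2⟩ := mv.exists_lift_one (l := l)
    (hu.mono (show 1 ≤ 700 by omega)) (hv.mono (by omega)) huv (by omega) (by omega)
  have c3 : Cy ν S₁₂ 1 (c.q l) ξ := hξ.cy (by omega)
  have r1 : rlx ν mv.le₁₂₁ (Param.le_refl _) 1 (kcls ν S₁₂ 1 (c.q l) ξ c3) =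
      rlx ν le_rfl hq 1 x₁ := by
    have c4 : Cy ν S₁ 1 (c.q l) u := hu.cy (by omega)
    rw [g (by omega) hq c4, ← b1 (c3.filt_mono mv.le₁₂₁) c4]; rfl
  refine ⟨kcls ν S₁₂ 1 (c.q l) ξ c3, ?_, r1, ?_⟩
  · refine pim_eq_zero_of_rlx _ (mv.pi_contr hc S₁) mv.le₁₂₁ ?_
    rw [r1, pim_rlx (mv.pi_contr hc S₁), p₁, map_zero]
  · have c4 : Cy ν S₂ 1 (c.q l) v := hv.cy (by omega)
    rw [g' (by omega) hq c4, ← b2 (c3.filt_mono mv.le₁₂₂) c4]; rfl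

/-- A representative u with π(u) = 1 is glued anew. By uniqueness of the boundary the new idempotent
also has [e] = [1], so `MV.exists_split` applies to it. -/
theorem MV.exact_one (mv : MV ν νs π c K S S₁ S₂ S₁₂ T) (hc : Continuous π)
    {x : (ν.toMatFilt S).UK 1 (c.q 1)} (hx : pim (mv.pi_contr hc S) 1 _ x = 0)
    (hq : c.q 1 ≤ c.q kB) (hq' : c.q 1 ≤ c.q l)
    (h : IsBd ν c S S₁ S₂ S₁₂ kB kD (rlx ν le_rfl hq 1 x) 0)
    (hB : 20000000000000000000 ≤ kB) (hD : 20000000000000 * kB ≤ kD) (hK : kD ≤ K)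
    (hl : 1000000000000000000 * kD ≤ l) :
    ∃ (x₁ : (ν.toMatFilt S₁).UK 1 (c.q l)) (x₂ : (ν.toMatFilt S₂).UK 1 (c.q l)),
      pim (mv.pi_contr hc S₁) 1 _ x₁ = 0 ∧ pim (mv.pi_contr hc S₂) 1 _ x₂ = 0 ∧
      rlx ν mv.le₁ (Param.le_refl _) 1 x₁ - rlx ν mv.le₂ (Param.le_refl _) 1 x₂ =
        rlx ν le_rfl hq' 1 x := by
  obtain ⟨Λ, i1, i2, u, v, w₁, w₁', w₂, w₂', e, huv, pu, -, h1, h2, h3, h4, h5, h6, -, h8⟩ :=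
    mv.exists_isBd_data (mv.pi_contr hc S) hx hB (by omega)
  have c1 : Cy ν S 1 (c.q kB) u := huv.cy (by omega)
  have c2 : Cy ν S₁₂ 0 (c.q kD) e := h4.cy (by omega)
  have c3 : Cy ν S₁₂ 0 (c.q kD) (1 : Matrix Λ Λ R) := (QId.one mv.filt₁₂ h4.1.pos).cy (by omega)
  have hp := (Patch.of_datum h1 h2 h3 h5 h6).mono (show kB - 1 ≤ kB by omega)
  have h9 := IsBd.unique mv h ⟨Λ, _, i1, i2, _, _, u, e, c1, c2, c3, h8 (by omega) hq c1,
    hp, h4.mono (by omega), rfl⟩ (by omega) (by omega)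
  obtain ⟨Ω, _, _, a, a', b, b', qa, qb, na, nb, hk⟩ := mv.exists_split (l := l)
    (huv.mono (show _ ≤ kD by omega)) pu (hp.mono (by omega)) (sub_eq_zero.1 h9.symm) hl
  have d1 : Cy ν S₁ 1 (c.q l) a := qa.cy (by omega)
  have d2 : Cy ν S₂ 1 (c.q l) b := qb.cy (by omega)
  have d3 : Cy ν S 1 (c.q l) u := huv.cy (by omega)
  refine ⟨kcls ν S₁ 1 (c.q l) a d1, -kcls ν S₂ 1 (c.q l) b d2, ?_, ?_, ?_⟩
  · rw [pim_kcls _ d1 (d1.π_map (mv.pi_contr hc S₁))]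
    exact kcls_of_nr_one isFilt_topFil (mv.π_ctl qa.1) na (by omega) _
  · rw [map_neg, pim_kcls _ d2 (d2.π_map (mv.pi_contr hc S₂)), neg_eq_zero]
    exact kcls_of_nr_one isFilt_topFil (mv.π_ctl qb.1) nb (by omega) _
  · rw [map_neg, sub_neg_eq_add, h8 (by omega) hq' d3, hk d3 (d1.filt_mono mv.le₁)
      (d2.filt_mono mv.le₂)]
    rfl

/-- Write the class as [e] - [1]. It vanishes over both subalgebras, so `MV.exists_bd` realizes e,
after adding an identity, as a gluing; the added identity cancels in the difference. -/
theorem MV.exact_bd (mv : MV ν νs π c K S S₁ S₂ S₁₂ T) (hc : Continuous π)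
    {g : (ν.toMatFilt S₁₂).UK 0 (c.q 1)} (hq : c.q 1 ≤ c.q l)
    (h₁ : rlx ν mv.le₁₂₁ (Param.le_refl _) 0 g = 0)
    (h₂ : rlx ν mv.le₁₂₂ (Param.le_refl _) 0 g = 0) (hl : 100000000000000 ≤ l) :
    ∃ x : (ν.toMatFilt S).UK 1 (c.q l), pim (mv.pi_contr hc S) 1 _ x = 0 ∧
      IsBd ν c S S₁ S₂ S₁₂ l l x (rlx ν le_rfl hq 0 g) := by
  obtain ⟨Λ, ι, _, _, _, _, e, he, g1⟩ := exists_kcls_zero mv.filt₁₂ g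
  have hq' : c.q 1 ≤ c.q 160 := c.q_le (by omega)
  have c1 : Cy ν S₁₂ 0 (c.q 160) e := he.cy (by omega)
  have c2 : Cy ν S₁₂ 0 (c.q 160) (1 : Matrix ι ι R) := (QId.one mv.filt₁₂ le_rfl).cy
    (show 1 + 1 ≤ 160 by omega)
  have k1 : kcls ν S₁ 0 (c.q 160) e (c1.filt_mono mv.le₁₂₁) =
      kcls ν S₁ 0 (c.q 160) 1 (c2.filt_mono mv.le₁₂₁) := by
    have h3 : rlx ν mv.le₁₂₁ hq' 0 g = 0 := by rw [rlx_split', h₁, map_zero]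
    rw [rlx_split, g1 le_rfl hq' c1 c2, map_sub] at h3
    exact sub_eq_zero.1 h3
  have k2 : kcls ν S₂ 0 (c.q 160) e (c1.filt_mono mv.le₁₂₂) =
      kcls ν S₂ 0 (c.q 160) 1 (c2.filt_mono mv.le₁₂₂) := by
    have h3 : rlx ν mv.le₁₂₂ hq' 0 g = 0 := by rw [rlx_split', h₂, map_zero]
    rw [rlx_split, g1 le_rfl hq' c1 c2, map_sub] at h3
    exact sub_eq_zero.1 h3
  obtain ⟨J, _, _, u, v, quv, nu, hp⟩ := mv.exists_bd (by omega) k1 k2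
  have c3 : Cy ν S 1 (c.q l) u := quv.cy (by omega)
  have c4 : Cy ν S₁₂ 0 (c.q l) e := he.cy (by omega)
  have o : ∀ (α : Type) [Fintype α] [DecidableEq α], Cy ν S₁₂ 0 (c.q l) (1 : Matrix α α R) :=
    fun α _ _ => (QId.one mv.filt₁₂ le_rfl).cy (show 1 + 1 ≤ l by omega)
  refine ⟨kcls ν S 1 (c.q l) u c3, ?_, ι ⊕ J, Λ ⊕ J, inferInstance, inferInstance, inferInstance,
    inferInstance, u, _, c3, c4.diag (o J), o _, rfl, hp.mono (by omega),
    (he.diag (QId.one mv.filt₁₂ (by omega))).mono (by omega), ?_⟩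
  · rw [pim_kcls _ c3 (c3.π_map (mv.pi_contr hc S))]
    exact kcls_of_nr_one isFilt_topFil (mv.π_ctl quv.1) nu (by omega) _
  · rw [g1 (by omega) hq c4 (o ι), kcls_sub_stab mv.filt₁₂ (c.good l) c4 (o ι) (o J)]

theorem MV.exact_zero (mv : MV ν νs π c K S S₁ S₂ S₁₂ T) (hc : Continuous π)
    {x₁ : (ν.toMatFilt S₁).UK 0 (c.q 1)} {x₂ : (ν.toMatFilt S₂).UK 0 (c.q 1)}
    (p₁ : pim (mv.pi_contr hc S₁) 0 _ x₁ = 0)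
    (h : rlx ν mv.le₁ (Param.le_refl _) 0 x₁ = rlx ν mv.le₂ (Param.le_refl _) 0 x₂)
    (hK : 10000000000000000000000 ≤ K) (hl : 10000000000000000000000000000 ≤ l)
    (hq : c.q 1 ≤ c.q l) :
    ∃ ξ : (ν.toMatFilt S₁₂).UK 0 (c.q l), pim (mv.pi_contr hc S₁₂) 0 _ ξ = 0 ∧
      rlx ν mv.le₁₂₁ (Param.le_refl _) 0 ξ = rlx ν le_rfl hq 0 x₁ ∧
      rlx ν mv.le₁₂₂ (Param.le_refl _) 0 ξ = rlx ν le_rfl hq 0 x₂ := by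
  obtain ⟨Λ₁, ι₁, _, _, _, _, e₁, q₁, g₁⟩ := exists_kcls_zero mv.filt₁ x₁
  obtain ⟨Λ₂, ι₂, _, _, _, _, e₂, q₂, g₂⟩ := exists_kcls_zero mv.filt₂ x₂
  have h7 : c.q 1 ≤ c.q 160 := c.q_le (by omega)
  have o : ∀ (α : Type) [Fintype α] [DecidableEq α] {l : ℕ}, 2 ≤ l →
      Cy ν S₁₂ 0 (c.q l) (1 : Matrix α α R) :=
    fun α _ _ l hl => (QId.one mv.filt₁₂ le_rfl).cy (show 1 + 1 ≤ l by omega)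
  have o₁ : ∀ (α : Type) [Fintype α] [DecidableEq α] {l : ℕ}, 2 ≤ l →
      Cy ν S₁ 0 (c.q l) (1 : Matrix α α R) := fun α _ _ l hl => (o α hl).filt_mono mv.le₁₂₁
  have o₂ : ∀ (α : Type) [Fintype α] [DecidableEq α] {l : ℕ}, 2 ≤ l →
      Cy ν S₂ 0 (c.q l) (1 : Matrix α α R) := fun α _ _ l hl => (o α hl).filt_mono mv.le₁₂₂
  have o₀ : ∀ (α : Type) [Fintype α] [DecidableEq α] {l : ℕ}, 2 ≤ l →
      Cy ν S 0 (c.q l) (1 : Matrix α α R) := fun α _ _ l hl => (o₁ α hl).filt_mono mv.le₁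
  have c1 : ∀ {l : ℕ}, 3 ≤ l → Cy ν S₁ 0 (c.q l) e₁ := fun hl => q₁.cy hl
  have c2 : ∀ {l : ℕ}, 3 ≤ l → Cy ν S₂ 0 (c.q l) e₂ := fun hl => q₂.cy hl
  have d1 := (c1 (show 3 ≤ 160 by omega)).filt_mono mv.le₁
  have d2 := (c2 (show 3 ≤ 160 by omega)).filt_mono mv.le₂
  have two : 2 ≤ 160 := by omega
  -- The negative parts [1] are moved across: equality of the differences becomes equality of the
  -- classes of e₁ and e₂, each enlarged by the identity belonging to the other.
  have key : kcls ν S 0 (c.q 160) _ (d1.diag (o₀ ι₂ two)) =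
      kcls ν S 0 (c.q 160) _ (d2.diag (o₀ ι₁ two)) := by
    have h3 : rlx ν mv.le₁ h7 0 x₁ = rlx ν mv.le₂ h7 0 x₂ := by
      rw [rlx_split', h, ← rlx_split']
    rw [rlx_split, rlx_split mv.le₂, g₁ le_rfl h7 (c1 (by omega)) (o₁ _ two),
      g₂ le_rfl h7 (c2 (by omega)) (o₂ _ two), map_sub, map_sub,
      rlx_kcls mv.le₁ _ _ d1, rlx_kcls mv.le₂ _ _ d2, rlx_kcls mv.le₁ _ _ (o₀ ι₁ two),
      rlx_kcls mv.le₂ _ _ (o₀ ι₂ two), sub_eq_sub_iff_add_eq_add] at h3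
    rw [kcls_diag mv.filt (c.good _) d1 (o₀ ι₂ two), kcls_diag mv.filt (c.good _) d2 (o₀ ι₁ two), h3]
  obtain ⟨Ω, J, _, _, _, _, e, qe, b1, b2⟩ := mv.exists_lift_zero (k := 160) (l := l)
    ((q₁.diag (QId.one mv.filt₁ (by omega))).mono (by omega))
    ((q₂.diag (QId.one mv.filt₂ (by omega))).mono (by omega)) key (by omega) (by omega)
  have hl2 : 2 ≤ l := by omega
  have ce : Cy ν S₁₂ 0 (c.q l) e := qe.cy (by omega)
  have C1 : Cy ν S₁ 0 (c.q l) e₁ := c1 (by omega)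
  have C2 : Cy ν S₂ 0 (c.q l) e₂ := c2 (by omega)
  have B1 := b1 (ce.filt_mono mv.le₁₂₁) (C1.diag (o₁ ι₂ hl2)) (o₁ J hl2)
  have B2 := b2 (ce.filt_mono mv.le₁₂₂) (C2.diag (o₂ ι₁ hl2)) (o₂ J hl2)
  rw [kcls_diag mv.filt₁ (c.good l) C1 (o₁ ι₂ hl2)] at B1
  rw [kcls_diag mv.filt₂ (c.good l) C2 (o₂ ι₁ hl2)] at B2
  -- All identities introduced on the way are subtracted again: the one used for lifting and those
  -- of both representatives.
  set ξ := kcls ν S₁₂ 0 (c.q l) e ce - kcls ν S₁₂ 0 (c.q l) 1 (o J hl2) -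
    kcls ν S₁₂ 0 (c.q l) 1 (o ι₁ hl2) - kcls ν S₁₂ 0 (c.q l) 1 (o ι₂ hl2) with hξ
  have r1 : rlx ν mv.le₁₂₁ (Param.le_refl _) 0 ξ = rlx ν le_rfl hq 0 x₁ := by
    rw [g₁ (by omega) hq C1 (o₁ ι₁ hl2), hξ, map_sub, map_sub, map_sub,
      rlx_kcls mv.le₁₂₁ _ _ (ce.filt_mono mv.le₁₂₁), rlx_kcls mv.le₁₂₁ _ _ (o₁ J hl2),
      rlx_kcls mv.le₁₂₁ _ _ (o₁ ι₁ hl2), rlx_kcls mv.le₁₂₁ _ _ (o₁ ι₂ hl2), B1]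
    abel
  refine ⟨ξ, ?_, r1, ?_⟩
  · refine pim_eq_zero_of_rlx _ (mv.pi_contr hc S₁) mv.le₁₂₁ ?_
    rw [r1, pim_rlx (mv.pi_contr hc S₁), p₁, map_zero]
  · rw [g₂ (by omega) hq C2 (o₂ ι₂ hl2), hξ, map_sub, map_sub, map_sub,
      rlx_kcls mv.le₁₂₂ _ _ (ce.filt_mono mv.le₁₂₂), rlx_kcls mv.le₁₂₂ _ _ (o₂ J hl2),
      rlx_kcls mv.le₁₂₂ _ _ (o₂ ι₁ hl2), rlx_kcls mv.le₁₂₂ _ _ (o₂ ι₂ hl2), B2]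
    abel

end exactness


/-! ### Operator norms of matrices on ℓ_p sums -/

section operatorNorm

variable {p : ℝ≥0∞} [Fact (1 ≤ p)] {E : Type*} [NormedAddCommGroup E] [NormedSpace ℂ E]
  {ι κ η ι' κ' : Type} [Fintype ι] [Fintype κ] [Fintype η] [Fintype ι'] [Fintype κ']

/-- The operator `ℓ_p^κ(E) → ℓ_p^ι(E)` given by a matrix of bounded operators on `E`. -/
def rectCLM (p : ℝ≥0∞) [Fact (1 ≤ p)] (X : Matrix ι κ (E →L[ℂ] E)) :
    PiLp p (fun _ : κ => E) →L[ℂ] PiLp p (fun _ : ι => E) :=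
  ((PiLp.continuousLinearEquiv p ℂ (fun _ : ι => E)).symm :
      (ι → E) →L[ℂ] PiLp p (fun _ : ι => E)) ∘L
    (ContinuousLinearMap.pi fun i => ∑ j, (X i j) ∘L
      (ContinuousLinearMap.proj (R := ℂ) (φ := fun _ : κ => E) j)) ∘L
    ((PiLp.continuousLinearEquiv p ℂ (fun _ : κ => E)) :
      PiLp p (fun _ : κ => E) →L[ℂ] (κ → E))

theorem rectCLM_apply (X : Matrix ι κ (E →L[ℂ] E)) (v : PiLp p (fun _ : κ => E)) (i : ι) :
    rectCLM p X v i = ∑ j, X i j (v j) := by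
  simp [rectCLM]

/-- The sum of the `p`-th powers of the norms. -/
def pSum (p : ℝ≥0∞) {V : Type*} [Norm V] (v : ι → V) : ℝ := ∑ i, ‖v i‖ ^ p.toReal

theorem toReal_pos_of_ne_top (hp : p ≠ ⊤) : 0 < p.toReal :=
  ENNReal.toReal_pos (zero_lt_one.trans_le (Fact.out : 1 ≤ p)).ne' hp

theorem pSum_nonneg {V : Type*} [SeminormedAddCommGroup V] (v : ι → V) : 0 ≤ pSum p v :=
  Finset.sum_nonneg fun _ _ => Real.rpow_nonneg (norm_nonneg _) _

theorem norm_eq_pSum (hp : p ≠ ⊤) (v : PiLp p (fun _ : ι => E)) :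
    ‖v‖ = pSum p (fun i => v i) ^ (1 / p.toReal) :=
  PiLp.norm_eq_sum (toReal_pos_of_ne_top hp) v

theorem norm_rpow_eq (hp : p ≠ ⊤) (v : PiLp p (fun _ : ι => E)) :
    ‖v‖ ^ p.toReal = pSum p (fun i => v i) := by
  rw [norm_eq_pSum hp, ← Real.rpow_mul (pSum_nonneg _),
    one_div_mul_cancel (toReal_pos_of_ne_top hp).ne', Real.rpow_one]

/-- Taking p-th powers turns the ℓ_p norm into a sum over the index set, so block decompositions can
be handled summand by summand. This needs p finite. -/
theorem rect_le_iff (hp : p ≠ ⊤) (X : Matrix ι κ (E →L[ℂ] E)) {C : ℝ} (hC : 0 ≤ C) :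
    ‖rectCLM p X‖ ≤ C ↔ ∀ v : κ → E,
      pSum p (fun i => ∑ j, X i j (v j)) ≤ C ^ p.toReal * pSum p v := by
  have hP := toReal_pos_of_ne_top hp
  rw [ContinuousLinearMap.opNorm_le_iff hC]
  constructor
  · intro h v
    have h1 := Real.rpow_le_rpow (norm_nonneg _) (h (WithLp.toLp p v)) hP.le
    rw [Real.mul_rpow hC (norm_nonneg _), norm_rpow_eq hp, norm_rpow_eq hp] at h1
    simpa only [rectCLM_apply] using h1
  · intro h v
    have h1 := h (fun j => v j)
    rw [← norm_rpow_eq hp v] at h1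
    have h2 : pSum p (fun i => ∑ j, X i j (v j)) = ‖rectCLM p X v‖ ^ p.toReal := by
      rw [norm_rpow_eq hp]; simp only [rectCLM_apply]
    rw [h2, ← Real.mul_rpow hC (norm_nonneg _)] at h1
    exact (Real.rpow_le_rpow_iff (norm_nonneg _) (mul_nonneg hC (norm_nonneg _)) hP).1 h1

theorem rect_spec (hp : p ≠ ⊤) (X : Matrix ι κ (E →L[ℂ] E)) (v : κ → E) :
    pSum p (fun i => ∑ j, X i j (v j)) ≤ ‖rectCLM p X‖ ^ p.toReal * pSum p v :=
  (rect_le_iff hp X (norm_nonneg _)).1 le_rfl v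

theorem rectCLM_add (X Y : Matrix ι κ (E →L[ℂ] E)) :
    rectCLM p (X + Y) = rectCLM p X + rectCLM p Y := by
  ext v i
  simp [rectCLM_apply, Finset.sum_add_distrib]

theorem rectCLM_smul (z : ℂ) (X : Matrix ι κ (E →L[ℂ] E)) :
    rectCLM p (z • X) = z • rectCLM p X := by
  ext v i
  simp [rectCLM_apply, Finset.smul_sum]

theorem rectCLM_mul (X : Matrix ι κ (E →L[ℂ] E)) (Y : Matrix κ η (E →L[ℂ] E)) :
    rectCLM p (X * Y) = rectCLM p X ∘L rectCLM p Y := by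
  ext v i
  simp only [rectCLM_apply, ContinuousLinearMap.comp_apply, Matrix.mul_apply,
    sum_apply, map_sum, mul_apply_eq_comp]
  exact Finset.sum_comm

theorem rectCLM_one [DecidableEq ι] : rectCLM p (1 : Matrix ι ι (E →L[ℂ] E)) =
    ContinuousLinearMap.id ℂ _ := by
  ext v i
  rw [rectCLM_apply, Finset.sum_eq_single i]
  · simp
  · intro j _ hj; simp [Matrix.one_apply_ne' hj]
  · simp

theorem continuous_rectCLM : Continuous fun X : Matrix ι κ (E →L[ℂ] E) => rectCLM p X := by
  classical
  have key : (fun X : Matrix ι κ (E →L[ℂ] E) => rectCLM p X) = fun X => ∑ i, ∑ j,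
      (((PiLp.continuousLinearEquiv p ℂ (fun _ : ι => E)).symm :
      (ι → E) →L[ℂ] PiLp p (fun _ : ι => E)) ∘L ContinuousLinearMap.single ℂ (fun _ : ι => E) i) ∘L
      (X i j) ∘L ((ContinuousLinearMap.proj (R := ℂ) (φ := fun _ : κ => E) j) ∘L
      ((PiLp.continuousLinearEquiv p ℂ (fun _ : κ => E)) :
      PiLp p (fun _ : κ => E) →L[ℂ] (κ → E))) := by
    funext X
    ext v i
    rw [rectCLM_apply]
    simp only [sum_apply, ContinuousLinearMap.comp_apply]
    simp [Pi.single_apply, Finset.sum_ite_eq, apply_ite]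
  rw [key]
  refine continuous_finsetSum _ fun i _ => continuous_finsetSum _ fun j _ => ?_
  exact continuous_const.clm_comp (((continuous_apply j).comp (continuous_apply i)).clm_comp
    continuous_const)

theorem pSum_sum {V : Type*} [Norm V] (v : ι ⊕ κ → V) :
    pSum p v = pSum p (fun i => v (Sum.inl i)) + pSum p (fun i => v (Sum.inr i)) :=
  Fintype.sum_sum_type _

theorem pSum_comp_le {V : Type*} [SeminormedAddCommGroup V] (v : ι → V) {f : ι' → ι}
    (hf : f.Injective) : pSum p (fun i => v (f i)) ≤ pSum p v := by
  classical
  have : pSum p (fun i => v (f i)) = ∑ i ∈ Finset.univ.map ⟨f, hf⟩, ‖v i‖ ^ p.toReal := by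
    rw [Finset.sum_map]; rfl
  rw [this]
  exact Finset.sum_le_sum_of_subset_of_nonneg (Finset.subset_univ _)
    fun _ _ _ => Real.rpow_nonneg (norm_nonneg _) _

/-- The operator norms of matrices over `B(E)`. -/
def opNorm (p : ℝ≥0∞) [Fact (1 ≤ p)] (hp : p ≠ ⊤) (E : Type*) [NormedAddCommGroup E]
    [NormedSpace ℂ E] : MNorm (E →L[ℂ] E) where
  nrm X := ‖rectCLM p X‖
  nonneg X := norm_nonneg _
  add_le X Y := by rw [rectCLM_add]; exact norm_add_le _ _
  smul_le z X := by rw [rectCLM_smul]; exact (norm_smul z (rectCLM p X)).le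
  mul_le X Y := by rw [rectCLM_mul]; exact ContinuousLinearMap.opNorm_comp_le _ _
  one_le := by intro ι _ _; rw [rectCLM_one]; exact ContinuousLinearMap.norm_id_le
  submatrix_le := by
    intro ι κ ι' κ' _ _ _ _ X f g hf hg
    classical
    rw [rect_le_iff hp _ (norm_nonneg _)]
    intro v
    -- A vector on the smaller index set is extended by zero, which does not change its p-sum.
    have h1 := rect_spec hp X (Function.extend g v 0)
    have h2 : pSum p (Function.extend g v (0 : κ → E)) = pSum p v := by
      unfold pSum
      rw [← Finset.sum_subset (Finset.subset_univ (Finset.univ.map ⟨g, hg⟩)), Finset.sum_map]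
      · exact Finset.sum_congr rfl fun j _ => by
          rw [Function.Embedding.coeFn_mk, hg.extend_apply]
      · intro k _ hk
        rw [Function.extend_apply' _ _ _ (by simpa using hk), Pi.zero_apply, norm_zero,
          Real.zero_rpow (toReal_pos_of_ne_top hp).ne']
    have h3 : ∀ i, ∑ k, X i k (Function.extend g v (0 : κ → E) k) = ∑ j, X i (g j) (v j) := by
      intro i
      rw [← Finset.sum_subset (Finset.subset_univ (Finset.univ.map ⟨g, hg⟩)), Finset.sum_map]
      · exact Finset.sum_congr rfl fun j _ => by
          rw [Function.Embedding.coeFn_mk, hg.extend_apply]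
      · intro k _ hk
        rw [Function.extend_apply' _ _ _ (by simpa using hk), Pi.zero_apply, map_zero]
    rw [h2] at h1
    refine le_trans ?_ h1
    simp only [h3, Matrix.submatrix_apply]
    exact pSum_comp_le (fun i => ∑ j, X i (g j) (v j)) hf
  diag_le := by
    intro ι κ ι' κ' _ _ _ _ A D
    rw [rect_le_iff hp _ (le_max_of_le_left (norm_nonneg _))]
    intro v
    have hP := (toReal_pos_of_ne_top hp).le
    rw [pSum_sum, pSum_sum v, mul_add]
    simp only [Fintype.sum_sum_type, Matrix.fromBlocks_apply₁₁, Matrix.fromBlocks_apply₁₂,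
      Matrix.fromBlocks_apply₂₁, Matrix.fromBlocks_apply₂₂, Matrix.zero_apply,
      zero_apply, Finset.sum_const_zero, add_zero, zero_add]
    exact add_le_add ((rect_spec hp A _).trans (mul_le_mul_of_nonneg_right
      (Real.rpow_le_rpow (norm_nonneg _) (le_max_left _ _) hP) (pSum_nonneg _)))
      ((rect_spec hp D _).trans (mul_le_mul_of_nonneg_right
      (Real.rpow_le_rpow (norm_nonneg _) (le_max_right _ _) hP) (pSum_nonneg _)))
  blockDiagonal_le := by
    intro ι κ o _ _ _ _ X C hC h
    rw [rect_le_iff hp _ hC]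
    intro v
    have e1 : ∀ {α : Type} [Fintype α] (w : α × o → E),
        pSum p w = ∑ k, pSum p (fun i => w (i, k)) := by
      intro α _ w
      unfold pSum
      rw [Fintype.sum_prod_type_right]
    rw [e1, e1, Finset.mul_sum]
    refine Finset.sum_le_sum fun k _ => ?_
    have e2 : ∀ i, ∑ j, Matrix.blockDiagonal X (i, k) j (v j) = ∑ j, X k i j (v (j, k)) := by
      intro i
      rw [Fintype.sum_prod_type]
      refine Finset.sum_congr rfl fun j _ => ?_
      rw [Finset.sum_eq_single k]
      · simp
      · intro k' _ hk; simp [Matrix.blockDiagonal_apply, hk.symm]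
      · simp
    simp only [e2]
    exact (rect_le_iff hp (X k) hC).1 (h k) fun j => v (j, k)
  cont := continuous_norm.comp continuous_rectCLM

end operatorNorm

/-! ### Norms on the scalars and on the unitization -/

section constructions

variable {R R' : Type*} [Ring R] [Algebra ℂ R] [TopologicalSpace R] [Ring R'] [Algebra ℂ R']
  [TopologicalSpace R']

/-- Matrix norms pulled back along a homomorphism. -/
def MNorm.comap (ν : MNorm R') (φ : R →ₐ[ℂ] R') (hφ : Continuous φ) : MNorm R where
  nrm X := ν.nrm (X.map φ)
  nonneg X := ν.nonneg _
  add_le X Y := by rw [Matrix.map_add φ (map_add φ)]; exact ν.add_le _ _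
  smul_le z X := by rw [Matrix.map_smul φ z (map_smul φ z)]; exact ν.smul_le _ _
  mul_le X Y := by rw [Matrix.map_mul]; exact ν.mul_le _ _
  one_le := by intro ι _ _; rw [Matrix.map_one φ (map_zero φ) (map_one φ)]; exact ν.one_le
  submatrix_le X f g hf hg := by rw [← Matrix.submatrix_map]; exact ν.submatrix_le _ f g hf hg
  diag_le A D := by
    rw [Matrix.fromBlocks_map, Matrix.map_zero _ (map_zero φ), Matrix.map_zero _ (map_zero φ)]
    exact ν.diag_le _ _
  blockDiagonal_le X C hC h := by
    rw [Matrix.blockDiagonal_map _ _ (map_zero φ)]; exact ν.blockDiagonal_le _ C hC h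
  cont := ν.cont.comp (continuous_id.matrix_map hφ)

/-- The maximum of two families of matrix norms. -/
def MNorm.sup (ν ν' : MNorm R) : MNorm R where
  nrm X := max (ν.nrm X) (ν'.nrm X)
  nonneg X := le_max_of_le_left (ν.nonneg X)
  add_le X Y := max_le ((ν.add_le X Y).trans (add_le_add (le_max_left _ _) (le_max_left _ _)))
    ((ν'.add_le X Y).trans (add_le_add (le_max_right _ _) (le_max_right _ _)))
  smul_le z X := max_le
    ((ν.smul_le z X).trans (mul_le_mul_of_nonneg_left (le_max_left _ _) (norm_nonneg z)))
    ((ν'.smul_le z X).trans (mul_le_mul_of_nonneg_left (le_max_right _ _) (norm_nonneg z)))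
  mul_le X Y := max_le
    ((ν.mul_le X Y).trans (mul_le_mul (le_max_left _ _) (le_max_left _ _) (ν.nonneg Y)
      (le_max_of_le_left (ν.nonneg X))))
    ((ν'.mul_le X Y).trans (mul_le_mul (le_max_right _ _) (le_max_right _ _) (ν'.nonneg Y)
      (le_max_of_le_left (ν.nonneg X))))
  one_le := max_le ν.one_le ν'.one_le
  submatrix_le X f g hf hg := max_le_max (ν.submatrix_le X f g hf hg) (ν'.submatrix_le X f g hf hg)
  diag_le A D := max_le ((ν.diag_le A D).trans (max_le_max (le_max_left _ _) (le_max_left _ _)))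
    ((ν'.diag_le A D).trans (max_le_max (le_max_right _ _) (le_max_right _ _)))
  blockDiagonal_le X C hC h := max_le
    (ν.blockDiagonal_le X C hC fun k => (le_max_left _ _).trans (h k))
    (ν'.blockDiagonal_le X C hC fun k => (le_max_right _ _).trans (h k))
  cont := ν.cont.max ν'.cont

end constructions

section scalars

/-- Multiplication by scalars on `ℂ`. -/
def scalarHom : ℂ →ₐ[ℂ] (ℂ →L[ℂ] ℂ) where
  toFun z := z • ContinuousLinearMap.id ℂ ℂ
  map_one' := one_smul _ _
  map_zero' := by ext; simp
  map_add' z w := by ext; simp [add_mul]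
  map_mul' z w := by ext; simp
  commutes' z := by ext; simp

theorem continuous_scalarHom : Continuous scalarHom :=
  show Continuous fun z : ℂ => z • ContinuousLinearMap.id ℂ ℂ by fun_prop

variable (p : ℝ≥0∞) [Fact (1 ≤ p)] (hp : p ≠ ⊤) (E : Type*) [NormedAddCommGroup E]
    [NormedSpace ℂ E]

/-- The norms of `M_n(ℂ) = B(ℓ_p^n)`. -/
def scNorm : MNorm ℂ :=
  (opNorm p hp ℂ).comap scalarHom continuous_scalarHom

/-- The norms of the unitization. -/
def unNorm : MNorm ((E →L[ℂ] E) × ℂ) :=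
  ((opNorm p hp E).comap (AlgHom.fst ℂ _ _) continuous_fst).sup
    ((scNorm p hp).comap (AlgHom.snd ℂ _ _) continuous_snd)

variable {E}

/-- The propagation subspaces of the unitization. -/
def unFil (F : ℝ →o Submodule ℂ (E →L[ℂ] E)) : ℝ →o Submodule ℂ ((E →L[ℂ] E) × ℂ) :=
  (unitization 1 F).fil

end scalars


/-! ### Scalar matrices on `SQ_p` spaces -/

section amplification

open MeasureTheory

variable {p : ℝ≥0∞} [Fact (1 ≤ p)] {ι κ : Type} [Fintype ι] [Fintype κ]

theorem scNorm_spec (hp : p ≠ ⊤) (Z : Matrix ι κ ℂ) (v : κ → ℂ) :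
    pSum p (fun i => ∑ j, Z i j * v j) ≤ (scNorm p hp).nrm Z ^ p.toReal * pSum p v := by
  have h := rect_spec hp (Z.map scalarHom) v
  have e : ∀ i j, (Z.map scalarHom) i j (v j) = Z i j * v j := fun i j => by
    simp [scalarHom]
  simp only [e] at h
  exact h

theorem ofReal_pSum (hp : p ≠ ⊤) {V : Type*} [SeminormedAddCommGroup V] (v : ι → V) :
    ENNReal.ofReal (pSum p v) = ∑ i, ‖v i‖ₑ ^ p.toReal := by
  unfold pSum
  rw [ENNReal.ofReal_sum_of_nonneg fun _ _ => Real.rpow_nonneg (norm_nonneg _) _]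
  refine Finset.sum_congr rfl fun i _ => ?_
  rw [← ENNReal.ofReal_rpow_of_nonneg (norm_nonneg _) (toReal_pos_of_ne_top hp).le, ofReal_norm]

/-- Scalar matrices act on `ℓ_p^n(V)` with norm at most their norm on `ℓ_p^n`. -/
def IsAmplifiable (p : ℝ≥0∞) [Fact (1 ≤ p)] (hp : p ≠ ⊤) (V : Type*) [SeminormedAddCommGroup V]
    [NormedSpace ℂ V] : Prop :=
  ∀ ⦃ι κ : Type⦄ [Fintype ι] [Fintype κ] (Z : Matrix ι κ ℂ) (v : κ → V),
    pSum p (fun i => ∑ j, Z i j • v j) ≤ (scNorm p hp).nrm Z ^ p.toReal * pSum p v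

/-- The inequality for scalar vectors holds at almost every point of the measure space and is
integrated. -/
theorem isAmplifiable_Lp (hp : p ≠ ⊤) {Ω : Type*} [MeasurableSpace Ω] (μ : Measure Ω) :
    IsAmplifiable p hp (Lp ℂ p μ) := by
  intro ι κ _ _ Z v
  have hP := toReal_pos_of_ne_top hp
  have hp0 : p ≠ 0 := (zero_lt_one.trans_le (Fact.out : 1 ≤ p)).ne'
  have hn : ∀ f : Lp ℂ p μ, ‖f‖ₑ ^ p.toReal = ∫⁻ x, ‖f x‖ₑ ^ p.toReal ∂μ := by
    intro f
    rw [Lp.enorm_def, eLpNorm_eq_lintegral_rpow_enorm_toReal hp0 hp, ← ENNReal.rpow_mul,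
      one_div_mul_cancel hP.ne', ENNReal.rpow_one]
  have hm : ∀ f : Lp ℂ p μ, AEMeasurable (fun x => ‖f x‖ₑ ^ p.toReal) μ := fun f =>
    (Lp.aestronglyMeasurable f).enorm.pow_const _
  have hC : 0 ≤ (scNorm p hp).nrm Z ^ p.toReal := Real.rpow_nonneg ((scNorm p hp).nonneg Z) _
  have hs : ∀ {α : Type} [Fintype α] (w : α → Lp ℂ p μ),
      ENNReal.ofReal (pSum p w) = ∫⁻ x, ENNReal.ofReal (pSum p fun i => w i x) ∂μ := by
    intro α _ w
    simp only [ofReal_pSum hp, hn]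
    rw [lintegral_finsetSum' _ fun i _ => hm (w i)]
  rw [← ENNReal.ofReal_le_ofReal_iff (mul_nonneg hC (pSum_nonneg _)), ENNReal.ofReal_mul hC, hs, hs,
    ← lintegral_const_mul' _ _ ENNReal.ofReal_ne_top]
  refine lintegral_mono_ae ?_
  have ha : ∀ᵐ x ∂μ, ∀ i, (∑ j, Z i j • v j : Lp ℂ p μ) x = ∑ j, Z i j * v j x := by
    rw [ae_all_iff]
    intro i
    have h1 : ∀ᵐ x ∂μ, ∀ j, (Z i j • v j : Lp ℂ p μ) x = Z i j * v j x := by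
      rw [ae_all_iff]
      intro j
      filter_upwards [Lp.coeFn_smul (Z i j) (v j)] with x hx
      rw [hx]; rfl
    filter_upwards [h1, Lp.coeFn_fun_finsetSum Finset.univ fun j => (Z i j • v j : Lp ℂ p μ)]
      with x hx hx'
    rw [hx']
    exact Finset.sum_congr rfl fun j _ => hx j
  filter_upwards [ha] with x hx
  rw [← ENNReal.ofReal_mul hC]
  simp only [hx]
  exact ENNReal.ofReal_le_ofReal (scNorm_spec hp Z fun j => v j x)

/-- The inequality is applied to representatives whose norms exceed the quotient norms by less than
η, and then η tends to 0. -/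
theorem IsAmplifiable.quotient {hp : p ≠ ⊤} {V : Type*} [SeminormedAddCommGroup V]
    [NormedSpace ℂ V] (h : IsAmplifiable p hp V) (F : Submodule ℂ V) :
    IsAmplifiable p hp (V ⧸ F) := by
  intro ι κ _ _ Z v
  have hP := (toReal_pos_of_ne_top hp).le
  set C := (scNorm p hp).nrm Z ^ p.toReal with hCdef
  have hC : 0 ≤ C := Real.rpow_nonneg ((scNorm p hp).nonneg Z) _
  have key : ∀ η : ℝ, 0 < η → pSum p (fun i => ∑ j, Z i j • v j) ≤
      C * ∑ j, (‖v j‖ + η) ^ p.toReal := by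
    intro η hη
    choose w hw hw' using fun j => Submodule.Quotient.norm_mk_lt (v j) hη
    have h1 : pSum p (fun i => ∑ j, Z i j • v j) ≤ pSum p (fun i => ∑ j, Z i j • w j) := by
      refine Finset.sum_le_sum fun i _ => Real.rpow_le_rpow (norm_nonneg _) ?_ hP
      have : ∑ j, Z i j • v j = Submodule.Quotient.mk (p := F) (∑ j, Z i j • w j) := by
        rw [← Submodule.mkQ_apply, map_sum]
        exact Finset.sum_congr rfl fun j _ => by rw [map_smul, Submodule.mkQ_apply, hw]
      beta_reduce
      rw [this]
      exact Submodule.Quotient.norm_mk_le F _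
    refine h1.trans ((h Z w).trans (mul_le_mul_of_nonneg_left ?_ hC))
    exact Finset.sum_le_sum fun j _ => Real.rpow_le_rpow (norm_nonneg _) (hw' j).le hP
  have ht : Filter.Tendsto (fun η : ℝ => C * ∑ j, (‖v j‖ + η) ^ p.toReal)
      (nhdsWithin 0 (Set.Ioi 0)) (nhds (C * pSum p v)) := by
    have hc : Continuous fun η : ℝ => C * ∑ j, (‖v j‖ + η) ^ p.toReal :=
      continuous_const.mul (continuous_finsetSum _ fun j _ =>
        (continuous_const.add continuous_id).rpow_const fun _ => Or.inr hP)
    have := hc.tendsto 0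
    simp only [add_zero] at this
    exact this.mono_left nhdsWithin_le_nhds
  refine ge_of_tendsto ht ?_
  filter_upwards [self_mem_nhdsWithin] with η hη
  exact key η hη

theorem IsAmplifiable.of_isometry {hp : p ≠ ⊤} {V W : Type*} [SeminormedAddCommGroup V]
    [NormedSpace ℂ V] [SeminormedAddCommGroup W] [NormedSpace ℂ W] (h : IsAmplifiable p hp W)
    (J : V →ₗᵢ[ℂ] W) : IsAmplifiable p hp V := by
  intro ι κ _ _ Z v
  have h1 := h Z fun j => J (v j)
  have h2 : ∀ i, ∑ j, Z i j • J (v j) = J (∑ j, Z i j • v j) := fun i => by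
    rw [map_sum]; exact Finset.sum_congr rfl fun j _ => (map_smul J _ _).symm
  simp only [h2, pSum, J.norm_map] at h1
  exact h1

theorem IsSQp.isAmplifiable (hp : p ≠ ⊤) {E : Type*} [NormedAddCommGroup E] [NormedSpace ℂ E]
    (h : IsSQp p E) : IsAmplifiable p hp E := by
  obtain ⟨Ω, _, μ, F, -, ⟨J⟩⟩ := h
  exact ((isAmplifiable_Lp hp μ).quotient F).of_isometry J

theorem IsAmplifiable.opNorm_le {hp : p ≠ ⊤} {E : Type*} [NormedAddCommGroup E]
    [NormedSpace ℂ E] (h : IsAmplifiable p hp E) (Z : Matrix ι κ ℂ) :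
    (opNorm p hp E).nrm (Z.map fun z => z • (1 : E →L[ℂ] E)) ≤ (scNorm p hp).nrm Z := by
  refine (rect_le_iff hp _ ((scNorm p hp).nonneg Z)).2 fun v => ?_
  simpa using h Z v

end amplification

/-! ### Algebra part and scalar part of a matrix over the unitization -/

section unitization

variable {p : ℝ≥0∞} [Fact (1 ≤ p)] {hp : p ≠ ⊤} {E : Type*} [NormedAddCommGroup E]
  [NormedSpace ℂ E] {F F' : ℝ →o Submodule ℂ (E →L[ℂ] E)} {ι κ : Type} [Fintype ι] [Fintype κ]

theorem mem_unFil {r : ℝ} {x : (E →L[ℂ] E) × ℂ} :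
    x ∈ unFil F r ↔ x.1 - x.2 • 1 ∈ F r := Iff.rfl

theorem unFil_mono (h : F ≤ F') : unFil F ≤ unFil F' := fun r _ hx => h r hx

theorem isFilt_unFil (h : ∀ r r', 0 < r → 0 < r' → ∀ x ∈ F r, ∀ y ∈ F r', x * y ∈ F (r + r')) :
    IsFilt (unFil F) := by
  refine ⟨fun r => ?_, fun {r r'} hr hr' {x y} hx hy => ?_⟩
  · rw [mem_unFil]
    simp
  · rw [mem_unFil] at *
    have e : (x * y).1 - (x * y).2 • (1 : E →L[ℂ] E) = (x.1 - x.2 • 1) * (y.1 - y.2 • 1) +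
        x.2 • (y.1 - y.2 • 1) + y.2 • (x.1 - x.2 • 1) := by
      simp only [Prod.fst_mul, Prod.snd_mul, mul_sub, sub_mul, smul_sub, smul_mul_assoc,
        mul_smul_comm, mul_one, one_mul, smul_smul, mul_comm y.2 x.2]
      abel
    rw [e]
    refine Submodule.add_mem _ (Submodule.add_mem _ (h _ _ hr hr' _ hx _ hy) ?_) ?_
    · exact Submodule.smul_mem _ _ (F.monotone (by linarith) hy)
    · exact Submodule.smul_mem _ _ (F.monotone (by linarith) hx)

/-- The matrix over the unitization with given parts in the algebra and in the scalars. -/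
def mkUn (a : Matrix ι κ (E →L[ℂ] E)) (Z : Matrix ι κ ℂ) : Matrix ι κ ((E →L[ℂ] E) × ℂ) :=
  Matrix.of fun i j => (a i j + Z i j • 1, Z i j)

/-- The part of a matrix over the unitization that lies in the algebra. -/
def algPart (X : Matrix ι κ ((E →L[ℂ] E) × ℂ)) : Matrix ι κ (E →L[ℂ] E) :=
  Matrix.of fun i j => (X i j).1 - (X i j).2 • 1

theorem mkUn_algPart (X : Matrix ι κ ((E →L[ℂ] E) × ℂ)) :
    mkUn (algPart X) (X.map Prod.snd) = X := by
  ext i j <;> simp [mkUn, algPart]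

theorem mkUn_sub (a a' : Matrix ι κ (E →L[ℂ] E)) (Z Z' : Matrix ι κ ℂ) :
    mkUn a Z - mkUn a' Z' = mkUn (a - a') (Z - Z') := by
  ext i j
  · simp [mkUn, sub_smul]; abel
  · simp [mkUn]

theorem mkUn_mem {a : Matrix ι κ (E →L[ℂ] E)} {Z : Matrix ι κ ℂ} {r : ℝ} {i : ι} {j : κ} :
    mkUn a Z i j ∈ unFil F r ↔ a i j ∈ F r := by
  rw [mem_unFil]; simp [mkUn]

theorem nrm_mkUn_le (h : IsAmplifiable p hp E) (a : Matrix ι κ (E →L[ℂ] E)) (Z : Matrix ι κ ℂ) :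
    (unNorm p hp E).nrm (mkUn a Z) ≤ (opNorm p hp E).nrm a + (scNorm p hp).nrm Z := by
  refine max_le ?_ ?_
  · have e : (mkUn a Z).map (AlgHom.fst ℂ (E →L[ℂ] E) ℂ) =
        a + Z.map fun z => z • (1 : E →L[ℂ] E) := by ext i j; simp [mkUn]
    exact (congrArg (opNorm p hp E).nrm e).le.trans (((opNorm p hp E).add_le _ _).trans
      (add_le_add le_rfl (h.opNorm_le Z)))
  · have e : (mkUn a Z).map (AlgHom.snd ℂ (E →L[ℂ] E) ℂ) = Z := by ext i j; simp [mkUn]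
    exact (congrArg (scNorm p hp).nrm e).le.trans
      (le_add_of_nonneg_left ((opNorm p hp E).nonneg a))

theorem nrm_snd_le (X : Matrix ι κ ((E →L[ℂ] E) × ℂ)) :
    (scNorm p hp).nrm (X.map Prod.snd) ≤ (unNorm p hp E).nrm X := le_max_right _ _

/-- The algebra part is the operator minus its scalar part, and amplification bounds the latter by
the norm of the matrix; hence the factor 2. -/
theorem nrm_algPart_le (h : IsAmplifiable p hp E) (X : Matrix ι κ ((E →L[ℂ] E) × ℂ)) :
    (opNorm p hp E).nrm (algPart X) ≤ 2 * (unNorm p hp E).nrm X := by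
  have e : algPart X = X.map (AlgHom.fst ℂ (E →L[ℂ] E) ℂ) -
      (X.map Prod.snd).map fun z => z • (1 : E →L[ℂ] E) := by ext i j; simp [algPart]
  rw [e, two_mul]
  exact ((opNorm p hp E).sub_le _ _).trans (add_le_add (le_max_left _ _)
    ((h.opNorm_le _).trans (nrm_snd_le X)))

theorem algPart_sub (X Y : Matrix ι κ ((E →L[ℂ] E) × ℂ)) :
    algPart (X - Y) = algPart X - algPart Y := by
  ext i j; simp [algPart, sub_smul]; abel

end unitization


/-! ### Mayer-Vietoris pairs at a fixed scale -/

section pairs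

variable {p : ℝ≥0∞} [Fact (1 ≤ p)] {hp : p ≠ ⊤} {E : Type*} [NormedAddCommGroup E]
  [NormedSpace ℂ E]

/-- Complete intersection approximation for rectangular matrices. -/
theorem FilteredSQpAlgebra.HasCIA.rect {ct : ℝ} {S₁ S₂ : Submodule ℂ (E →L[ℂ] E)}
    (h : FilteredSQpAlgebra.HasCIA p ct S₁ S₂) {η : ℝ} (hη : 0 < η) {ι κ : Type} [Fintype ι]
    [Fintype κ] (x y : Matrix ι κ (E →L[ℂ] E)) (hx : ∀ i j, x i j ∈ S₁) (hy : ∀ i j, y i j ∈ S₂)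
    (hxy : (opNorm p hp E).nrm (x - y) < η) : ∃ z : Matrix ι κ (E →L[ℂ] E),
      (∀ i j, z i j ∈ S₁ ∧ z i j ∈ S₂) ∧ (opNorm p hp E).nrm (z - x) < ct * η ∧
      (opNorm p hp E).nrm (z - y) < ct * η := by
  classical
  set e := Fintype.equivFin (ι ⊕ κ)
  -- A rectangular matrix is treated as the off-diagonal corner of a square one, and the approximant
  -- is cut back to that corner.
  set b : Matrix ι κ (E →L[ℂ] E) → Matrix (Fin _) (Fin _) (E →L[ℂ] E) := fun a =>
    (Matrix.fromBlocks 0 a 0 0 : Matrix (ι ⊕ κ) (ι ⊕ κ) _).submatrix e.symm e.symm with hb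
  have hmem : ∀ {S : Submodule ℂ (E →L[ℂ] E)} {a : Matrix ι κ (E →L[ℂ] E)},
      (∀ i j, a i j ∈ S) → ∀ i j, b a i j ∈ S := by
    intro S a ha i j
    simp only [hb, Matrix.submatrix_apply]
    rcases e.symm i with i | i <;> rcases e.symm j with j | j <;> simp [ha]
  have hsub : b x - b y = b (x - y) := by
    ext1 i j
    simp only [hb, Matrix.submatrix_apply, Matrix.sub_apply]
    rcases e.symm i with i | i <;> rcases e.symm j with j | j <;> simp
  have hn : matNorm p (b x - b y) < η := by
    refine lt_of_le_of_lt ?_ hxy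
    rw [hsub]
    refine ((opNorm p hp E).reindex _ e.symm e.symm).le.trans
      (((opNorm p hp E).offDiag_le _ _).trans ?_)
    rw [MNorm.zero, max_eq_left (MNorm.nonneg _ _)]
  obtain ⟨z, hz, hzn⟩ := h η hη _ (b x) (b y) (hmem hx) (hmem hy) hn
  have key : ∀ a : Matrix ι κ (E →L[ℂ] E), (opNorm p hp E).nrm
      (z.submatrix (fun i => e (Sum.inl i)) (fun j => e (Sum.inr j)) - a) ≤ matNorm p (z - b a) := by
    intro a
    have : z.submatrix (fun i => e (Sum.inl i)) (fun j => e (Sum.inr j)) - a =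
        (z - b a).submatrix (fun i => e (Sum.inl i)) (fun j => e (Sum.inr j)) := by
      ext1 i j; simp [hb]
    rw [this]
    exact (opNorm p hp E).submatrix_le _ _ _ (e.injective.comp Sum.inl_injective)
      (e.injective.comp Sum.inr_injective)
  exact ⟨_, fun i j => hz _ _, (key x).trans_lt ((le_max_left _ _).trans_lt hzn),
    (key y).trans_lt ((le_max_right _ _).trans_lt hzn)⟩

/-- Coercive decomposition for matrices with general index sets. -/
theorem FilteredSQpAlgebra.IsDecompPair.reindex {A : FilteredSQpAlgebra p E} {s ct : ℝ}
    {Δ₁ Δ₂ : Submodule ℂ (E →L[ℂ] E)} (h : A.IsDecompPair s ct Δ₁ Δ₂) {r : ℝ} (hr : 0 < r)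
    (hrs : r ≤ s) {ι : Type} [Fintype ι] (a : Matrix ι ι (E →L[ℂ] E))
    (ha : ∀ i j, a i j ∈ A.fil r) : ∃ x y : Matrix ι ι (E →L[ℂ] E), a = x + y ∧
      (∀ i j, x i j ∈ Δ₁ ⊓ A.fil r) ∧ (∀ i j, y i j ∈ Δ₂ ⊓ A.fil r) ∧
      (opNorm p hp E).nrm x ≤ ct * (opNorm p hp E).nrm a ∧
      (opNorm p hp E).nrm y ≤ ct * (opNorm p hp E).nrm a := by
  classical
  set e := Fintype.equivFin ι
  obtain ⟨x, y, hx, hy, hn, hxy⟩ := h r hr hrs _ (a.submatrix e.symm e.symm) fun i j => ha _ _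
  have hn' : max (matNorm p x) (matNorm p y) ≤ ct * (opNorm p hp E).nrm a :=
    hn.trans_eq (congrArg (ct * ·) ((opNorm p hp E).reindex a e.symm e.symm))
  refine ⟨x.submatrix e e, y.submatrix e e, ?_, fun i j => hx _ _, fun i j => hy _ _, ?_, ?_⟩
  · have := congrArg (fun m => m.submatrix e e) hxy
    simpa [Matrix.submatrix_add] using this
  · exact ((opNorm p hp E).reindex x e e).le.trans ((le_max_left _ _).trans hn')
  · exact ((opNorm p hp E).reindex y e e).le.trans ((le_max_right _ _).trans hn')

variable (A : FilteredSQpAlgebra p E)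

theorem FilteredSQpAlgebra.isFilt_unFil : IsFilt (unFil A.fil) :=
  QuantK.isFilt_unFil A.isFiltration.mul_mem

theorem FilteredSQpAlgebra.isFilt_unFil_sub (B : NonUnitalSubalgebra ℂ (E →L[ℂ] E)) :
    IsFilt (unFil (A.sub B)) :=
  QuantK.isFilt_unFil fun r r' hr hr' x hx y hy =>
    ⟨B.mul_mem hx.1 hy.1, A.isFiltration.mul_mem r r' hr hr' x hx.2 y hy.2⟩

variable {A}

/-- A controlled Mayer-Vietoris pair at a fixed scale. -/
theorem FilteredSQpAlgebra.IsMVPair.exists_MV {A₁ A₂ : NonUnitalSubalgebra ℂ (E →L[ℂ] E)}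
    {s ct : ℝ} (h : A.IsMVPair s ct A₁ A₂) (hp : p ≠ ⊤) {c : Scale} {K : ℕ}
    (hM : 3 * ct + 1 ≤ c.M) (hδ : c.δ ≤ 1) (hK : K * c.ρ ≤ s) :
    ∃ T, MV (unNorm p hp E) (scNorm p hp) (AlgHom.snd ℂ (E →L[ℂ] E) ℂ) c K (unFil A.fil)
      (unFil (A.sub A₁)) (unFil (A.sub A₂)) (unFil (A.sub (A₁ ⊓ A₂))) T := by
  obtain ⟨hs, hc, Δ₁, Δ₂, -, -, hdec, hn₁, hn₂, hcia⟩ := h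
  have hE := IsSQp.isAmplifiable hp A.isSQp
  have hkK : ∀ {k : ℕ}, k ≤ K → k * c.ρ ≤ s := fun hk =>
    (mul_le_mul_of_nonneg_right (Nat.cast_le.2 hk) c.ρ_pos.le).trans hK
  have hk0 : ∀ {k : ℕ}, 1 ≤ k → 0 < k * c.ρ := fun hk =>
    mul_pos (by exact_mod_cast hk) c.ρ_pos
  -- Elements of the first summand are embedded with scalar part 0, so π kills them.
  refine ⟨fun k => (Δ₁ ⊓ A.fil (k * c.ρ)).map (LinearMap.inl ℂ (E →L[ℂ] E) ℂ), ?_⟩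
  have hTS : ∀ k : ℕ, (Δ₁ ⊓ A.fil (k * c.ρ)).map (LinearMap.inl ℂ (E →L[ℂ] E) ℂ) ≤
      unFil A.fil (k * c.ρ) := by
    rintro k _ ⟨x, hx, rfl⟩
    rw [mem_unFil]
    simpa using hx.2
  refine
    { filt := A.isFilt_unFil
      filt₁ := A.isFilt_unFil_sub A₁
      filt₂ := A.isFilt_unFil_sub A₂
      filt₁₂ := A.isFilt_unFil_sub _
      le₁ := unFil_mono (A.sub_le A₁)
      le₂ := unFil_mono (A.sub_le A₂)
      le₁₂₁ := unFil_mono (A.sub_mono inf_le_left)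
      le₁₂₂ := unFil_mono (A.sub_mono inf_le_right)
      δ_le := hδ
      lift := ?_
      contr := fun X => le_max_right _ _
      dec := ?_
      T_le := hTS
      π_T := ?_
      nbhd := ?_
      cia := ?_ }
  · intro ι κ _ _ Z
    have e : Z.map (algebraMap ℂ ((E →L[ℂ] E) × ℂ)) = mkUn 0 Z := by
      ext i j
      · simp [mkUn, Algebra.algebraMap_eq_smul_one]
      · simp [mkUn, Algebra.algebraMap_eq_smul_one]
    rw [e]
    refine (nrm_mkUn_le hE 0 Z).trans ?_
    rw [MNorm.zero, zero_add]
  · intro k ι _ _ X hk hX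
    obtain ⟨x, y, hxy, hx, hy, hxn, hyn⟩ := hdec.reindex (hp := hp) (hk0 hX.pos) (hkK hk)
      (algPart X) hX.mem
    have ha : (opNorm p hp E).nrm (algPart X) ≤ 2 * c.M ^ k :=
      (nrm_algPart_le hE X).trans (mul_le_mul_of_nonneg_left hX.bd two_pos.le)
    have ha' : ct * (opNorm p hp E).nrm (algPart X) ≤ ct * (2 * c.M ^ k) :=
      mul_le_mul_of_nonneg_left ha hc.le
    have hM' : (3 * ct + 1) * c.M ^ k ≤ c.M ^ (k + 1) := by
      rw [pow_succ']; exact mul_le_mul_of_nonneg_right hM (c.pow_pos k).le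
    have hck : 0 ≤ ct * c.M ^ k := mul_nonneg hc.le (c.pow_pos k).le
    have hk1 := c.pow_pos k
    -- The whole scalar part goes to the second summand. Its norm is at most 2c M^k + M^k ≤ M^(k+1),
    -- which explains part of the requirement M ≥ 3c + 1.
    refine ⟨mkUn x 0, mkUn y (X.map Prod.snd), ?_, ?_, ?_, by omega, ?_, ?_⟩
    · rw [← mkUn_algPart X, hxy]
      ext i j
      · simp [mkUn, algPart]; abel
      · simp [mkUn, algPart]
    · intro i j
      exact ⟨x i j, hx i j, by simp [mkUn]⟩
    · refine (nrm_mkUn_le hE x 0).trans ?_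
      rw [MNorm.zero, add_zero]
      linarith
    · intro i j
      rw [mkUn_mem]
      refine ⟨hn₂.nbhd_le ?_, A.fil.monotone (mul_le_mul_of_nonneg_right
        (Nat.cast_le.2 (Nat.le_succ k)) c.ρ_pos.le) (hy i j).2⟩
      exact Submodule.mem_sup_left (Submodule.mem_sup_left (Submodule.mem_sup_left (hy i j).1))
    · refine (nrm_mkUn_le hE y _).trans ?_
      have := (nrm_snd_le (hp := hp) X).trans hX.bd
      linarith
  · rintro k _ ⟨x, hx, rfl⟩
    rfl
  · rintro k l m g _ h hk1 hk hl1 hl hm1 hm hg ⟨x, hx, rfl⟩ hh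
    have h1 : g * LinearMap.inl ℂ (E →L[ℂ] E) ℂ x * h ∈ unFil A.fil ((l + k + m : ℕ) * c.ρ) := by
      have := A.isFilt_unFil.mul_mem (add_pos (hk0 hl1) (hk0 hk1)) (hk0 hm1)
        (A.isFilt_unFil.mul_mem (hk0 hl1) (hk0 hk1) hg (hTS k ⟨x, hx, rfl⟩)) hh
      convert this using 2
      push_cast; ring
    refine ⟨hn₁.nbhd_le ?_, h1⟩
    -- All propagations in use are at most Kρ ≤ s, so the neighborhood of radius 5s is large enough.
    have hle : ∀ {j : ℕ}, j ≤ K → A.fil (j * c.ρ) ≤ A.fil (5 * s) := fun hj =>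
      A.fil.monotone ((hkK hj).trans (by linarith))
    have hg' := hle hl hg
    have hh' := hle hm hh
    -- Expanding g and h into algebra and scalar parts gives one term in each of Δ₁, A_{5s}Δ₁,
    -- Δ₁A_{5s} and A_{5s}Δ₁A_{5s}.
    have e : (g * LinearMap.inl ℂ (E →L[ℂ] E) ℂ x * h).1 -
        (g * LinearMap.inl ℂ (E →L[ℂ] E) ℂ x * h).2 • (1 : E →L[ℂ] E) =
        (g.2 * h.2) • x + h.2 • ((g.1 - g.2 • 1) * x) + g.2 • (x * (h.1 - h.2 • 1)) +
        (g.1 - g.2 • 1) * x * (h.1 - h.2 • 1) := by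
      simp only [LinearMap.inl_apply, Prod.fst_mul, Prod.snd_mul, mul_zero, zero_mul, zero_smul,
        sub_zero, mul_sub, sub_mul, smul_sub, smul_mul_assoc, mul_smul_comm, mul_one, one_mul,
        smul_smul, mul_comm h.2 g.2]
      abel
    have e' : (LinearMap.fst ℂ (E →L[ℂ] E) ℂ -
        (LinearMap.snd ℂ (E →L[ℂ] E) ℂ).smulRight (1 : E →L[ℂ] E))
        (g * LinearMap.inl ℂ (E →L[ℂ] E) ℂ x * h) = (g * LinearMap.inl ℂ (E →L[ℂ] E) ℂ x * h).1 -
        (g * LinearMap.inl ℂ (E →L[ℂ] E) ℂ x * h).2 • (1 : E →L[ℂ] E) := rfl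
    rw [e', e]
    refine Submodule.add_mem _ (Submodule.add_mem _ (Submodule.add_mem _ ?_ ?_) ?_) ?_
    · exact Submodule.smul_mem _ _ (Submodule.mem_sup_left (Submodule.mem_sup_left
        (Submodule.mem_sup_left hx.1)))
    · exact Submodule.smul_mem _ _ (Submodule.mem_sup_left (Submodule.mem_sup_left
        (Submodule.mem_sup_right (Submodule.mul_mem_mul hg' hx.1))))
    · exact Submodule.smul_mem _ _ (Submodule.mem_sup_left
        (Submodule.mem_sup_right (Submodule.mul_mem_mul hx.1 hh')))
    · exact Submodule.mem_sup_right
        (Submodule.mul_mem_mul (Submodule.mul_mem_mul hg' hx.1) hh')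
  · intro k l ι κ _ _ _ _ X Y hk hX hY hXY
    have hη : 0 < c.M ^ l * c.δ := mul_pos (c.pow_pos l) c.δ_pos
    -- Passing to algebra parts doubles the error; 3 in place of 2 supplies the strict inequality
    -- that the approximation property requires.
    have hd : (opNorm p hp E).nrm (algPart X - algPart Y) < 3 * (c.M ^ l * c.δ) := by
      rw [← algPart_sub]
      have := (nrm_algPart_le hE (X - Y)).trans (mul_le_mul_of_nonneg_left hXY two_pos.le)
      linarith
    obtain ⟨z, hz, hzx, hzy⟩ := (hcia _ (hk0 hX.pos) (hkK hk)).rect (hp := hp) (by linarith)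
      (algPart X) (algPart Y) hX.mem hY.mem hd
    have hM' : (3 * ct + 1) * (c.M ^ l * c.δ) ≤ c.M ^ (l + 1) * c.δ := by
      rw [pow_succ', mul_assoc]; exact mul_le_mul_of_nonneg_right hM hη.le
    -- The approximant inherits the scalar part of X, so it has the same image under π. Against Y
    -- the scalar parts differ by at most one further error, whence 3c + 1.
    refine ⟨mkUn z (X.map Prod.snd), ?_, ?_, ?_, ?_⟩
    · intro i j
      rw [mkUn_mem]
      exact ⟨⟨(hz i j).1.1, (hz i j).2.1⟩, (hz i j).1.2⟩
    · unfold Nr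
      have e : mkUn z (X.map Prod.snd) - X = mkUn (z - algPart X) 0 := by
        rw [← sub_self (X.map Prod.snd), ← mkUn_sub, mkUn_algPart]
      rw [e]
      have h1 := nrm_mkUn_le (hp := hp) hE (z - algPart X) (X.map Prod.snd - X.map Prod.snd)
      rw [sub_self, MNorm.zero, add_zero] at h1
      linarith
    · unfold Nr
      conv_lhs => rw [← mkUn_algPart Y, mkUn_sub]
      have h1 := nrm_mkUn_le (hp := hp) hE (z - algPart Y) (X.map Prod.snd - Y.map Prod.snd)
      have h2 := (nrm_snd_le (hp := hp) (X - Y)).trans hXY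
      rw [Matrix.map_sub _ fun _ _ => rfl] at h2
      linarith
    · ext i j; simp [mkUn]

end pairs


/-! ### From scales to control pairs -/

section control

variable {ct : ℝ} {q q' : Param}

theorem Param.le_trans {q q' q'' : Param} (h : q ≤ q') (h' : q' ≤ q'') : q ≤ q'' :=
  ⟨h.1.trans h'.1, h.2.1.trans h'.2.1, h.2.2.trans h'.2.2⟩

/-- The parameters are in the admissible range. -/
def Param.Pos (q : Param) : Prop := 0 < q.ε ∧ 0 < q.r ∧ 1 ≤ q.N

/-- The scale on which constructions with input parameters `q` take place. -/
def scaleOf (hct : 0 < ct) (q : Param) (hq : q.Pos) : Scale :=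
  ⟨q.N + (3 * ct + 3), q.r, q.ε, by linarith [hq.2.2], hq.2.1, hq.1⟩

/-- The control pair `(λ_N, h) = ((N + 3c + 3)^k, k)`. -/
def powPair (hct : 0 < ct) (k : ℕ) (hk : 1 ≤ k) : ControlPair where
  lam N := (N + (3 * ct + 3)) ^ k
  h _ _ := k
  one_le_lam N hN := one_le_pow₀ (by linarith)
  lam_mono N N' hN h := pow_le_pow_left₀ (by linarith) (by linarith) k
  one_le_h _ _ _ _ _ := by exact_mod_cast hk
  h_anti _ _ _ _ _ _ _ := le_rfl

/-- By definition `(powPair hct k hk).toControl.app q` is `(scaleOf hct q hq).q k`; the statements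
below use this identification silently. -/
theorem le_scaleOf (hct : 0 < ct) (hq : q.Pos) {k : ℕ} (hk : 1 ≤ k) :
    q ≤ (scaleOf hct q hq).q k := by
  refine Param.le_trans (q' := (scaleOf hct q hq).q 1) ⟨?_, ?_, ?_⟩ (Scale.q_le _ hk)
  · simp only [Scale.q, pow_one]
    exact le_mul_of_one_le_left hq.1.le (scaleOf hct q hq).one_le
  · simp [Scale.q, scaleOf]
  · simp only [Scale.q, scaleOf, pow_one]; linarith

theorem scaleOf_mono (hct : 0 < ct) (hq : q.Pos) (hq' : q'.Pos) (h : q ≤ q') (k : ℕ) :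
    (scaleOf hct q hq).q k ≤ (scaleOf hct q' hq').q k := by
  have h1 : (scaleOf hct q hq).M ^ k ≤ (scaleOf hct q' hq').M ^ k :=
    pow_le_pow_left₀ (Scale.M_pos _).le (by simp only [scaleOf]; linarith [h.2.2]) k
  exact ⟨mul_le_mul h1 h.1 hq.1.le (Scale.pow_pos _ _).le,
    mul_le_mul_of_nonneg_left h.2.1 (Nat.cast_nonneg k), h1⟩

theorem Control.Dom.pos {C : Control} {s : ℝ} (h : C.Dom s q) : q.Pos :=
  ⟨h.1, h.2.2.1, h.2.2.2.1⟩

end control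

/-! ### The controlled boundary morphism -/

section boundary

variable {p : ℝ≥0∞} [Fact (1 ≤ p)] {hp : p ≠ ⊤} {E : Type*} [NormedAddCommGroup E]
  [NormedSpace ℂ E] {A : FilteredSQpAlgebra p E} {A₁ A₂ : NonUnitalSubalgebra ℂ (E →L[ℂ] E)}
  {s ct : ℝ} {kB kD K : ℕ} {q q' : Param}

/-- `π` is contractive on the unitization. -/
theorem snd_contr (F : ℝ →o Submodule ℂ (E →L[ℂ] E)) :
    MatFilt.IsContr ((unNorm p hp E).toMatFilt (unFil F)) ((scNorm p hp).toMatFilt topFil)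
      (AlgHom.snd ℂ (E →L[ℂ] E) ℂ : (E →L[ℂ] E) × ℂ →+* ℂ) :=
  pi_contr F

/-- The inclusion of the quantitative `K`-group of an algebra into that of its unitization. -/
def uk (hp : p ≠ ⊤) {F : ℝ →o Submodule ℂ (E →L[ℂ] E)} {i : Fin 2} {q : Param} :
    QK p i F q →+ ((unNorm p hp E).toMatFilt (unFil F)).UK i q :=
  (QK p i F q).subtype

section uk

variable {F F' : ℝ →o Submodule ℂ (E →L[ℂ] E)} {i : Fin 2}

/-- `unNorm` and `unFil` unfold to the norms and subspaces of `unitization`, so the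
inclusion-induced maps are relaxation maps by definition. -/
theorem uk_map (hF : F ≤ F') (h : q ≤ q') (x : QK p i F q) :
    uk hp (QK.map p i hF h x) = rlx (unNorm p hp E) (unFil_mono hF) h i (uk hp x) := rfl

theorem uk_injective : Function.Injective (uk hp : QK p i F q →+ _) := Subtype.val_injective

theorem pim_uk (x : QK p i F q) : pim (snd_contr (hp := hp) F) i q (uk hp x) = 0 := x.2

theorem exists_uk {y : ((unNorm p hp E).toMatFilt (unFil F)).UK i q}
    (hy : pim (snd_contr F) i q y = 0) : ∃ x : QK p i F q, uk hp x = y :=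
  ⟨⟨y, hy⟩, rfl⟩

end uk

/-- The boundary relation for a pair of subalgebras. -/
abbrev IsBdOf (hp : p ≠ ⊤) (c : Scale) (A : FilteredSQpAlgebra p E)
    (A₁ A₂ : NonUnitalSubalgebra ℂ (E →L[ℂ] E)) (kB kD : ℕ)
    (x : ((unNorm p hp E).toMatFilt (unFil A.fil)).UK 1 (c.q kB))
    (g : ((unNorm p hp E).toMatFilt (unFil (A.sub (A₁ ⊓ A₂)))).UK 0 (c.q kD)) : Prop :=
  IsBd (unNorm p hp E) c (unFil A.fil) (unFil (A.sub A₁)) (unFil (A.sub A₂))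
    (unFil (A.sub (A₁ ⊓ A₂))) kB kD x g

theorem FilteredSQpAlgebra.IsMVPair.mv (h : A.IsMVPair s ct A₁ A₂) (hp : p ≠ ⊤) (hct : 0 < ct)
    (hq : q.Pos) (hε : q.ε ≤ 1) (hK : K * q.r ≤ s) :
    ∃ T, MV (unNorm p hp E) (scNorm p hp) (AlgHom.snd ℂ (E →L[ℂ] E) ℂ) (scaleOf hct q hq) K
      (unFil A.fil) (unFil (A.sub A₁)) (unFil (A.sub A₂)) (unFil (A.sub (A₁ ⊓ A₂))) T :=
  h.exists_MV hp (by simp only [scaleOf]; linarith [hq.2.2]) hε hK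

/-- The boundary homomorphism at fixed parameters. -/
theorem exists_bd_hom {c : Scale} {T : ℕ → Submodule ℂ ((E →L[ℂ] E) × ℂ)}
    (mv : MV (unNorm p hp E) (scNorm p hp) (AlgHom.snd ℂ (E →L[ℂ] E) ℂ) c K
      (unFil A.fil) (unFil (A.sub A₁)) (unFil (A.sub A₂)) (unFil (A.sub (A₁ ⊓ A₂))) T)
    (hq : q ≤ c.q 1) (hqB : q ≤ c.q kB) (hB : 20000000000000000000 ≤ kB)
    (hD : 20000000000000 * kB ≤ kD) (hK : kD ≤ K) :
    ∃ F : QK p 1 A.fil q →+ QK p 0 (A.sub (A₁ ⊓ A₂)) (c.q kD), ∀ x,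
      IsBdOf hp c A A₁ A₂ kB kD (rlx (unNorm p hp E) le_rfl hqB 1 (uk hp x)) (uk hp (F x)) := by
  have key : ∀ x : QK p 1 A.fil q, ∃ g : QK p 0 (A.sub (A₁ ⊓ A₂)) (c.q kD),
      IsBdOf hp c A A₁ A₂ kB kD (rlx (unNorm p hp E) le_rfl hqB 1 (uk hp x)) (uk hp g) := by
    intro x
    have hx := pim_uk (hp := hp) (QK.map p 1 le_rfl hq x)
    rw [uk_map] at hx
    obtain ⟨g, hg⟩ := mv.exists_isBd (snd_contr A.fil) hx (c.q_le (by omega)) hB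
      (show kB ≤ K by omega) (show kB ≤ kD by omega)
    rw [rlx_rlx] at hg
    -- The boundary class vanishes over the first subalgebra, so π sends it to 0.
    obtain ⟨g, rfl⟩ := exists_uk (y := g) (pim_eq_zero_of_rlx (snd_contr _) (snd_contr _)
      mv.le₁₂₁ (by rw [(hg.rlx_eq_zero mv (by omega)).1, map_zero]))
    exact ⟨g, hg⟩
  choose F hF using key
  -- The boundary relation is additive and single-valued; a choice of values is therefore a
  -- homomorphism.
  refine ⟨AddMonoidHom.mk' F fun x y => uk_injective (hp := hp) ?_, hF⟩
  have h := IsBd.add mv.filt mv.filt₁₂ (hF x) (hF y)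
  rw [← map_add, ← map_add, ← map_add] at h
  exact (hF (x + y)).unique mv h (by omega) hD

/-- The controlled boundary morphism. -/
theorem exists_bd (h : A.IsMVPair s ct A₁ A₂) (hp : p ≠ ⊤) (hct : 0 < ct) (hB1 : 1 ≤ kB)
    (hD1 : 1 ≤ kD) (hB : 20000000000000000000 ≤ kB) (hD : 20000000000000 * kB ≤ kD) :
    ∃ bd : CtrlHom (powPair hct kD hD1).toControl s (KFam p 1 A.fil)
        (KFam p 0 (A.sub (A₁ ⊓ A₂))),
      ∀ (q : Param) (hq : (powPair hct kD hD1).toControl.Dom s q) (x : QK p 1 A.fil q),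
        IsBdOf hp (scaleOf hct q hq.pos) A A₁ A₂ kB kD
          (rlx (unNorm p hp E) le_rfl (le_scaleOf hct hq.pos hB1) 1 (uk hp x))
          (uk hp (bd.map q hq x)) := by
  have key : ∀ (q : Param) (hq : (powPair hct kD hD1).toControl.Dom s q),
      ∃ F : QK p 1 A.fil q →+ QK p 0 (A.sub (A₁ ⊓ A₂)) ((scaleOf hct q hq.pos).q kD), ∀ x,
        IsBdOf hp (scaleOf hct q hq.pos) A A₁ A₂ kB kD
          (rlx (unNorm p hp E) le_rfl (le_scaleOf hct hq.pos hB1) 1 (uk hp x)) (uk hp (F x)) := by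
    intro q hq
    obtain ⟨T, mv⟩ := h.mv hp hct hq.pos (by linarith [hq.2.1]) hq.2.2.2.2.2
    exact exists_bd_hom mv (le_scaleOf hct hq.pos le_rfl) _ hB hD le_rfl
  choose F hF using key
  refine ⟨⟨fun q hq => F q hq, ?_⟩, hF⟩
  intro q q' hq hq' hle hle' (x : QK p 1 A.fil q)
  obtain ⟨T, mv⟩ := h.mv hp hct hq'.pos (by linarith [hq'.2.1]) hq'.2.2.2.2.2
  -- Boundary followed by relaxation and relaxation followed by boundary are both boundaries of the
  -- same class at the larger parameters.
  have h1 := (hF q hq x).rescale (scaleOf_mono hct hq.pos hq'.pos hle kB) hle' hB1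
  have h2 := hF q' hq' (QK.map p 1 le_rfl hle x)
  rw [uk_map, rlx_rlx] at h2
  rw [rlx_rlx] at h1
  exact uk_injective (h1.unique mv h2 (by omega) hD)

end boundary


/-! ### Comparison with boundary data -/

section boundaryMap

variable {p : ℝ≥0∞} [Fact (1 ≤ p)] {hp : p ≠ ⊤} {E : Type*} [NormedAddCommGroup E]
  [NormedSpace ℂ E] {A : FilteredSQpAlgebra p E} {A₁ A₂ : NonUnitalSubalgebra ℂ (E →L[ℂ] E)}
  {s ct : ℝ} {kB kD K : ℕ} {q q' : Param}

theorem dsum_one_zero {n m : ℕ} :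
    dsum (1 : Matrix (Fin n) (Fin n) ℂ) (0 : Matrix (Fin m) (Fin m) ℂ) =
      pad 0 (n + m) (1 : Matrix (Fin n) (Fin n) ℂ) := by
  rw [pad_add, dsum, Matrix.diagonal_zero]

theorem qi_pad_one {νs : MNorm ℂ} {c : Scale} {n l k : ℕ} (h : n ≤ l) (hk : 2 ≤ k) :
    QI νs topFil (c.q k) (pad 0 l (1 : Matrix (Fin n) (Fin n) ℂ)) := by
  obtain ⟨m, rfl⟩ := Nat.exists_eq_add_of_le h
  rw [← dsum_one_zero]
  have h1 : QId νs c topFil 1 (Matrix.fromBlocks (1 : Matrix (Fin n) (Fin n) ℂ) 0 0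
      (0 : Matrix (Fin m) (Fin m) ℂ)) :=
    (QId.one isFilt_topFil le_rfl).diag (QId.zero le_rfl)
  have h2 := (h1.cy (l := k) hk).reindex finSumFinEquiv.symm
  exact (if_pos rfl : Cy _ _ 0 _ _ = _).mp h2

theorem dsum_reindex {R : Type*} [Ring R] {n m : ℕ} (a : Matrix (Fin n) (Fin n) R)
    (b : Matrix (Fin m) (Fin m) R) :
    (dsum a b).submatrix finSumFinEquiv finSumFinEquiv = Matrix.fromBlocks a 0 0 b := by
  simp [dsum]

theorem fromBlocks_reindex {R : Type*} [Ring R] {α β : Type} {n m : ℕ} (a : Matrix α α R)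
    (b : Matrix β β R) (f : Fin n ≃ α) (g : Fin m ≃ β) :
    (Matrix.fromBlocks a 0 0 b).submatrix (finSumFinEquiv.symm.trans (Equiv.sumCongr f g))
      (finSumFinEquiv.symm.trans (Equiv.sumCongr f g)) =
      dsum (a.submatrix f f) (b.submatrix g g) := by
  unfold dsum
  ext i j
  simp only [Matrix.submatrix_apply, Equiv.trans_apply]
  rcases finSumFinEquiv.symm i with i | i <;> rcases finSumFinEquiv.symm j with j | j <;> simp

theorem Nr.lt {R : Type*} [Ring R] [Algebra ℂ R] [TopologicalSpace R] {ν : MNorm R} {c : Scale}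
    {k l : ℕ} {ι κ : Type} [Fintype ι] [Fintype κ] {X Y : Matrix ι κ R} (h : Nr ν c k X Y)
    (hl : k + 1 ≤ l) : ν.nrm (X - Y) < (c.q l).ε :=
  lt_of_le_of_lt h (c.pow_lt hl)

/-- Boundary data determine the boundary relation. -/
theorem isBdOf_of_datum {c : Scale} (hB1 : 1 ≤ kB) {n m : ℕ}
    {u : Matrix (Fin n) (Fin n) ((E →L[ℂ] E) × ℂ)} {v : Matrix (Fin m) (Fin m) ((E →L[ℂ] E) × ℂ)}
    {w₁ w₁' w₂ w₂' e : Matrix (Fin (n + m)) (Fin (n + m)) ((E →L[ℂ] E) × ℂ)}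
    (h : A.IsBoundaryDatum A₁ A₂ (c.q kB) u v w₁ w₁' w₂ w₂' e)
    (hu : Cy (unNorm p hp E) (unFil A.fil) 1 (c.q kB) u)
    (he : Cy (unNorm p hp E) (unFil (A.sub (A₁ ⊓ A₂))) 0 (c.q kD) e)
    (hI : Cy (unNorm p hp E) (unFil (A.sub (A₁ ⊓ A₂))) 0 (c.q kD)
      (1 : Matrix (Fin n) (Fin n) ((E →L[ℂ] E) × ℂ))) :
    IsBdOf hp c A A₁ A₂ kB kD (ucls _ _ 1 _ u hu) (ucls _ _ 0 _ e he - ucls _ _ 0 _ 1 hI) := by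
  have f₁₂ := A.isFilt_unFil_sub (A₁ ⊓ A₂)
  have h1 : QInv (unNorm p hp E) c (unFil (A.sub A₁)) kB w₁ w₁' := QP.qinv h.w₁_inv hB1
  have h2 : QInv (unNorm p hp E) c (unFil (A.sub A₂)) kB w₂ w₂' := QP.qinv h.w₂_inv hB1
  have h3 : Nr (unNorm p hp E) c kB (dsum u v) (w₁ * w₂) := h.uv_near.le
  have h4 : QId (unNorm p hp E) c (unFil (A.sub (A₁ ⊓ A₂))) kB e := QI.qid h.e_idem hB1
  have h5 : Nr (unNorm p hp E) c kB e (w₁' * dsum 1 0 * w₁) := h.e_near₁.le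
  have h6 : Nr (unNorm p hp E) c kB e (w₂ * dsum 1 0 * w₂') := h.e_near₂.le
  replace h3 := h3.reindex finSumFinEquiv finSumFinEquiv
  replace h5 := h5.reindex finSumFinEquiv finSumFinEquiv
  replace h6 := h6.reindex finSumFinEquiv finSumFinEquiv
  rw [dsum_reindex, ← Matrix.submatrix_mul_equiv _ _ _ finSumFinEquiv] at h3
  rw [← Matrix.submatrix_mul_equiv _ _ _ finSumFinEquiv,
    ← Matrix.submatrix_mul_equiv _ _ _ finSumFinEquiv, dsum_reindex] at h5 h6
  refine ⟨Fin n, Fin n ⊕ Fin m, inferInstance, inferInstance, inferInstance, inferInstance, u,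
    e.submatrix finSumFinEquiv finSumFinEquiv, hu, he.reindex _, hI, ?_,
    Patch.of_datum (h1.reindex _) (h2.reindex _) h3 h5 h6, h4.reindex _, ?_⟩
  · rw [kcls_fin A.isFilt_unFil (c.good kB)]
  · rw [kcls_reindex f₁₂ (c.good kD) he, kcls_fin f₁₂ (c.good kD), kcls_fin f₁₂ (c.good kD)]

/-- Boundary data exist. -/
theorem exists_isBoundaryDatum {c : Scale} {T : ℕ → Submodule ℂ ((E →L[ℂ] E) × ℂ)}
    (mv : MV (unNorm p hp E) (scNorm p hp) (AlgHom.snd ℂ (E →L[ℂ] E) ℂ) c K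
      (unFil A.fil) (unFil (A.sub A₁)) (unFil (A.sub A₂)) (unFil (A.sub (A₁ ⊓ A₂))) T)
    (hq : q ≤ c.q 1) (hqB : q ≤ c.q kB) (hB : 20000000000000000000 ≤ kB) (hK : kB ≤ K)
    (x : QK p 1 A.fil q) :
    ∃ (n m : ℕ) (u : Matrix (Fin n) (Fin n) ((E →L[ℂ] E) × ℂ))
      (v : Matrix (Fin m) (Fin m) ((E →L[ℂ] E) × ℂ))
      (w₁ w₁' w₂ w₂' e : Matrix (Fin (n + m)) (Fin (n + m)) ((E →L[ℂ] E) × ℂ)),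
      A.Represents (c.q kB) u x ∧ A.IsBoundaryDatum A₁ A₂ (c.q kB) u v w₁ w₁' w₂ w₂' e := by
  have hx := pim_uk (hp := hp) (QK.map p 1 le_rfl hq x)
  rw [uk_map] at hx
  obtain ⟨Λ, _, _, u, v, w₁, w₁', w₂, w₂', e, huv, pu, pv, h1, h2, h3, h4, h5, h6, h7, h8⟩ :=
    mv.exists_isBd_data (snd_contr A.fil) hx hB hK
  set f := (Fintype.equivFin Λ).symm
  set g := finSumFinEquiv.symm.trans (Equiv.sumCongr f f)
  have cu : Cy (unNorm p hp E) (unFil A.fil) 1 (c.q kB) u := huv.cy (by omega)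
  have cv : Cy (unNorm p hp E) (unFil A.fil) 1 (c.q kB) v := huv.symm.cy (by omega)
  have hone : ∀ {w : Matrix Λ Λ ((E →L[ℂ] E) × ℂ)}, w.map (AlgHom.snd ℂ (E →L[ℂ] E) ℂ) = 1 →
      (w.submatrix f f).map Prod.snd = 1 := by
    intro w hw
    have := congrArg (fun m => m.submatrix f f) hw
    rw [Matrix.submatrix_one_equiv] at this
    exact this
  have hz : (0 : Matrix Λ Λ ((E →L[ℂ] E) × ℂ)).submatrix f f = 0 := rfl
  have h3' := h3.reindex g g
  have h5' := h5.reindex g g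
  have h6' := h6.reindex g g
  rw [fromBlocks_reindex, ← Matrix.submatrix_mul_equiv _ _ _ g] at h3'
  rw [← Matrix.submatrix_mul_equiv _ _ _ g, ← Matrix.submatrix_mul_equiv _ _ _ g,
    fromBlocks_reindex, Matrix.submatrix_one_equiv, hz] at h5' h6'
  refine ⟨_, _, u.submatrix f f, v.submatrix f f, w₁.submatrix g g, w₁'.submatrix g g,
    w₂.submatrix g g, w₂'.submatrix g g, e.submatrix g g, ⟨hqB, cu.reindex f, ?_⟩, ?_⟩
  · have h9 := h8 (l := kB) (by omega) (c.q_le (by omega)) cu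
    rw [rlx_rlx, ← kcls_reindex A.isFilt_unFil (c.good kB) cu f (cu.reindex f),
      kcls_fin A.isFilt_unFil (c.good kB)] at h9
    exact h9
  · exact
      { u_inv := cu.reindex f
        u_pi := hone pu
        v_inv := cv.reindex f
        v_pi := hone pv
        uv_htpy := by
          -- The Whitehead homotopy between diag(u, v) and 1 takes place at an index below kB, so
          -- the parameters prescribed for the datum leave ample room.
          have h9 := ((huv.HT_one mv.filt (l := 700 * 20000000000000) le_rfl).symm.mono
            (q' := ⟨2 * (c.q kB).ε, 2 * (c.q kB).r, 2 * ((c.q kB).N + (c.q kB).ε)⟩) ?_).reindex g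
          · rw [fromBlocks_reindex, Matrix.submatrix_one_equiv] at h9
            exact (if_neg (by decide) : HT _ _ 1 _ _ _ = _).mp h9
          · have h10 : c.q (700 * 20000000000000) ≤ c.q kB := c.q_le (by omega)
            have h11 : 0 < (c.q kB).ε := mul_pos (c.pow_pos kB) c.δ_pos
            have h12 : 0 ≤ (c.q kB).r := mul_nonneg (Nat.cast_nonneg kB) c.ρ_pos.le
            have h13 : 0 < (c.q kB).N := c.pow_pos kB
            exact ⟨h10.1.trans (by simp only; linarith), h10.2.1.trans (by simp only; linarith),
              h10.2.2.trans (by simp only; linarith)⟩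
        w₁_inv := (h1.qp (by omega)).reindex g
        w₂_inv := (h2.qp (by omega)).reindex g
        uv_near := h3'.lt (by omega)
        e_idem := by
          have h9 := (h4.cy (l := kB) (by omega)).reindex g
          exact (if_pos rfl : Cy _ _ 0 _ _ = _).mp h9
        e_near₁ := h5'.lt (by omega)
        e_near₂ := h6'.lt (by omega)
        e_pi := by
          have h9 : (e.submatrix g g).map Prod.snd = pad 0 _
              (1 : Matrix (Fin (Fintype.card Λ)) (Fin (Fintype.card Λ)) ℂ) := by
            have h10 := fromBlocks_reindex (1 : Matrix Λ Λ ℂ) (0 : Matrix Λ Λ ℂ) f f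
            rw [Matrix.submatrix_one_equiv] at h10
            rw [← dsum_one_zero]
            exact (congrArg (fun m => m.submatrix g g) h7).trans h10
          -- π(e) equals the standard projection exactly, so the constant homotopy suffices.
          rw [h9, pad_pad _ (by omega)]
          exact JoinedIn.refl (qi_pad_one (νs := scNorm p hp) (by omega) (by omega)) }

/-- The controlled boundary morphism is the boundary map. -/
theorem isBoundaryMap (h : A.IsMVPair s ct A₁ A₂) (hct : 0 < ct) (hB1 : 1 ≤ kB)
    (hD1 : 1 ≤ kD) (hB : 20000000000000000000 ≤ kB) (hD : 20000000000000 * kB ≤ kD)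
    {bd : CtrlHom (powPair hct kD hD1).toControl s (KFam p 1 A.fil) (KFam p 0 (A.sub (A₁ ⊓ A₂)))}
    (hbd : ∀ (q : Param) (hq : (powPair hct kD hD1).toControl.Dom s q) (x : QK p 1 A.fil q),
        IsBdOf hp (scaleOf hct q hq.pos) A A₁ A₂ kB kD
          (rlx (unNorm p hp E) le_rfl (le_scaleOf hct hq.pos hB1) 1 (uk hp x))
          (uk hp (bd.map q hq x))) :
    A.IsBoundaryMap A₁ A₂ (powPair hct kB hB1) (powPair hct kD hD1) bd := by
  intro q hq x
  obtain ⟨T, mv⟩ := h.mv hp hct hq.pos (by linarith [hq.2.1]) hq.2.2.2.2.2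
  refine ⟨exists_isBoundaryDatum mv (le_scaleOf hct hq.pos le_rfl) (le_scaleOf hct hq.pos hB1)
    hB (by omega) x, ?_⟩
  rintro n m u v w₁ w₁' w₂ w₂' e ⟨hle, hu, hux⟩ hdat
  have he : Cy (unNorm p hp E) (unFil (A.sub (A₁ ⊓ A₂))) 0 ((scaleOf hct q hq.pos).q kD) e :=
    (QI.qid (ν := unNorm p hp E) (c := scaleOf hct q hq.pos) (k := kB) hdat.e_idem hB1).cy
      (by omega)
  have hI : Cy (unNorm p hp E) (unFil (A.sub (A₁ ⊓ A₂))) 0 ((scaleOf hct q hq.pos).q kD)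
      (1 : Matrix (Fin n) (Fin n) ((E →L[ℂ] E) × ℂ)) :=
    (QId.one mv.filt₁₂ le_rfl).cy (by omega)
  have hux' : rlx (unNorm p hp E) le_rfl (le_scaleOf hct hq.pos hB1) 1 (uk hp x) =
      ucls (unNorm p hp E) (unFil A.fil) 1 ((scaleOf hct q hq.pos).q kB) u hu := hux
  have h1 := hbd q hq x
  rw [hux'] at h1
  have h2 := h1.unique mv (isBdOf_of_datum (c := scaleOf hct q hq.pos) (hp := hp) hB1 hdat hu he hI)
    (by omega) hD
  exact ⟨he, hI, h2⟩

end boundaryMap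


/-! ### Controlled exactness -/

section exactness

variable {p : ℝ≥0∞} [Fact (1 ≤ p)] {hp : p ≠ ⊤} {E : Type*} [NormedAddCommGroup E]
  [NormedSpace ℂ E] {A : FilteredSQpAlgebra p E} {A₁ A₂ : NonUnitalSubalgebra ℂ (E →L[ℂ] E)}
  {s ct : ℝ} {kB kD kP K : ℕ} {q q' : Param}

theorem continuous_snd_hom : Continuous (AlgHom.snd ℂ (E →L[ℂ] E) ℂ) := continuous_snd

theorem Control.Dom.le_of_id {k : ℕ} {hk : 1 ≤ k} {hct : 0 < ct}
    (h : Control.id.Dom s ((powPair hct k hk).toControl.app q)) : k * q.r ≤ s := by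
  have := h.2.2.2.2.2
  simpa [Control.app, Control.id, powPair, ControlPair.toControl] using this

theorem id_app_le {q₀ : Param} (h : q ≤ q₀) : Control.id.app q ≤ q₀ :=
  ⟨(one_mul q.ε).le.trans h.1, (one_mul q.r).le.trans h.2.1, h.2.2⟩

section glue

variable {i : Fin 2} {F F₁ F₂ F' : ℝ →o Submodule ℂ (E →L[ℂ] E)} {P D : ControlPair}

/-- Exactness at the direct sum. -/
theorem isExactAt_inclPair_inclDiff (h₁ : F ≤ F₁) (h₂ : F ≤ F₂) (h₁' : F₁ ≤ F') (h₂' : F₂ ≤ F')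
    (H : ∀ q, Control.id.Dom s q → Control.id.Dom s (P.toControl.app q) →
      ∀ (y₁ : QK p i F₁ q) (y₂ : QK p i F₂ q),
      QK.map p i h₁' (Control.le_id_app q) y₁ = QK.map p i h₂' (Control.le_id_app q) y₂ →
      ∃ (h : q ≤ P.toControl.app q) (x : QK p i F (P.toControl.app q)),
        QK.map p i h₁ (Param.le_refl _) x = QK.map p i le_rfl h y₁ ∧
        QK.map p i h₂ (Param.le_refl _) x = QK.map p i le_rfl h y₂) :
    IsExactAt P s (inclPair p i s h₁ h₂) (inclDiff p i s h₁' h₂') := by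
  constructor
  · intro q hf hg (x : QK p i F q)
    change QK.map p i h₁' (Control.le_id_app (Control.id.app q))
      (QK.map p i h₁ (Control.le_id_app q) x) -
      QK.map p i h₂' (Control.le_id_app (Control.id.app q))
      (QK.map p i h₂ (Control.le_id_app q) x) = 0
    rw [QK.map_map i h₁ h₁' (h₁.trans h₁') _ _ (Param.le_trans (Control.le_id_app q)
      (Control.le_id_app _)), QK.map_map i h₂ h₂' (h₁.trans h₁') _ _
      (Param.le_trans (Control.le_id_app q) (Control.le_id_app _)), sub_self]
  · intro q hf hg (y : QK p i F₁ q × QK p i F₂ q) hy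
    obtain ⟨hle, x, e₁, e₂⟩ := H q hg hf y.1 y.2 (sub_eq_zero.1 hy)
    have hle' := Param.le_trans hle (Control.le_id_app (P.toControl.app q))
    refine ⟨hle', x, Prod.ext ?_ ?_⟩
    · change QK.map p i h₁ (Control.le_id_app (P.toControl.app q)) x = QK.map p i le_rfl hle' y.1
      have := congrArg (QK.map p i le_rfl (Control.le_id_app (P.toControl.app q))) e₁
      rwa [QK.map_map i _ _ h₁ _ _ (Control.le_id_app _), QK.map_map i _ _ le_rfl _ _ hle'] at this
    · change QK.map p i h₂ (Control.le_id_app (P.toControl.app q)) x = QK.map p i le_rfl hle' y.2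
      have := congrArg (QK.map p i le_rfl (Control.le_id_app (P.toControl.app q))) e₂
      rwa [QK.map_map i _ _ h₂ _ _ (Control.le_id_app _), QK.map_map i _ _ le_rfl _ _ hle'] at this

end glue

theorem uk_map_eq {i : Fin 2} {F₁ F₂ F' : ℝ →o Submodule ℂ (E →L[ℂ] E)} {c : Scale}
    (h₁ : F₁ ≤ F') (h₂ : F₂ ≤ F') (hq : q ≤ c.q 1) {y₁ : QK p i F₁ q} {y₂ : QK p i F₂ q}
    (h : QK.map p i h₁ (Control.le_id_app q) y₁ = QK.map p i h₂ (Control.le_id_app q) y₂) :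
    rlx (unNorm p hp E) (unFil_mono h₁) (Param.le_refl _) i
        (rlx (unNorm p hp E) le_rfl hq i (uk hp y₁)) =
      rlx (unNorm p hp E) (unFil_mono h₂) (Param.le_refl _) i
        (rlx (unNorm p hp E) le_rfl hq i (uk hp y₂)) := by
  have h' := congrArg (fun z => uk hp (QK.map p i le_rfl (id_app_le hq) z)) h
  simp only [QK.map_map i h₁ le_rfl h₁ _ (id_app_le hq) hq,
    QK.map_map i h₂ le_rfl h₂ _ (id_app_le hq) hq, uk_map] at h'
  rw [← rlx_split, ← rlx_split]
  exact h'

theorem isExactAt_one_sum (h : A.IsMVPair s ct A₁ A₂) (hp : p ≠ ⊤) (hct : 0 < ct)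
    (hP : 1 ≤ kP) (hl : 100000000000000000000000000000000 ≤ kP) :
    IsExactAt (powPair hct kP hP) s
      (inclPair p 1 s (A.sub_mono inf_le_left) (A.sub_mono inf_le_right) :
        CtrlHom Control.id s (KFam p 1 (A.sub (A₁ ⊓ A₂))) _)
      (inclDiff p 1 s (A.sub_le A₁) (A.sub_le A₂)) := by
  refine isExactAt_inclPair_inclDiff _ _ _ _ fun q hg hf y₁ y₂ hy => ?_
  obtain ⟨T, mv⟩ := h.mv hp hct hg.pos (by linarith [hg.2.1]) hf.le_of_id
  have hq1 := le_scaleOf hct hg.pos le_rfl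
  have hle := le_scaleOf hct hg.pos hP
  obtain ⟨ξ, h1, h2, h3⟩ := mv.exact_one_sub continuous_snd_hom
    (pim_uk (hp := hp) (QK.map p 1 le_rfl hq1 y₁)) (uk_map_eq _ _ hq1 hy) (by omega) hl
    (Scale.q_le _ hP)
  obtain ⟨ξ, rfl⟩ := exists_uk h1
  rw [uk_map, rlx_rlx] at h2
  rw [rlx_rlx] at h3
  exact ⟨hle, ξ, uk_injective h2, uk_injective h3⟩

theorem isExactAt_zero_sum (h : A.IsMVPair s ct A₁ A₂) (hp : p ≠ ⊤) (hct : 0 < ct)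
    (hP : 1 ≤ kP) (hl : 10000000000000000000000000000 ≤ kP) :
    IsExactAt (powPair hct kP hP) s
      (inclPair p 0 s (A.sub_mono inf_le_left) (A.sub_mono inf_le_right) :
        CtrlHom Control.id s (KFam p 0 (A.sub (A₁ ⊓ A₂))) _)
      (inclDiff p 0 s (A.sub_le A₁) (A.sub_le A₂)) := by
  refine isExactAt_inclPair_inclDiff _ _ _ _ fun q hg hf y₁ y₂ hy => ?_
  obtain ⟨T, mv⟩ := h.mv hp hct hg.pos (by linarith [hg.2.1]) hf.le_of_id
  have hq1 := le_scaleOf hct hg.pos le_rfl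
  have hle := le_scaleOf hct hg.pos hP
  obtain ⟨ξ, h1, h2, h3⟩ := mv.exact_zero continuous_snd_hom
    (pim_uk (hp := hp) (QK.map p 0 le_rfl hq1 y₁)) (uk_map_eq _ _ hq1 hy) (by omega) hl
    (Scale.q_le _ hP)
  obtain ⟨ξ, rfl⟩ := exists_uk h1
  rw [uk_map, rlx_rlx] at h2
  rw [rlx_rlx] at h3
  exact ⟨hle, ξ, uk_injective h2, uk_injective h3⟩

variable {hct : 0 < ct} {hD1 : 1 ≤ kD} {hB1 : 1 ≤ kB}
  {bd : CtrlHom (powPair hct kD hD1).toControl s (KFam p 1 A.fil) (KFam p 0 (A.sub (A₁ ⊓ A₂)))}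

theorem isExactAt_one (h : A.IsMVPair s ct A₁ A₂) (hP : 1 ≤ kP)
    (hB : 20000000000000000000 ≤ kB) (hD : 20000000000000 * kB ≤ kD)
    (hl : 1000000000000000000 * kD ≤ kP)
    (hbd : ∀ (q : Param) (hq : (powPair hct kD hD1).toControl.Dom s q) (x : QK p 1 A.fil q),
        IsBdOf hp (scaleOf hct q hq.pos) A A₁ A₂ kB kD
          (rlx (unNorm p hp E) le_rfl (le_scaleOf hct hq.pos hB1) 1 (uk hp x))
          (uk hp (bd.map q hq x))) :
    IsExactAt (powPair hct kP hP) s (inclDiff p 1 s (A.sub_le A₁) (A.sub_le A₂)) bd := by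
  constructor
  · intro q hf hg (x : QK p 1 (A.sub A₁) q × QK p 1 (A.sub A₂) q)
    obtain ⟨T, mv⟩ := h.mv hp hct hg.pos (by linarith [hg.2.1]) hg.2.2.2.2.2
    have hq1 := le_scaleOf hct hg.pos le_rfl
    have hqB := le_scaleOf hct hg.pos hB1
    have hq0 := Param.le_trans (Control.le_id_app q) hq1
    have h1 := mv.isBd_diff (kB := kB) (kD := kD)
      (rlx (unNorm p hp E) le_rfl hq0 1 (uk hp x.1))
      (rlx (unNorm p hp E) le_rfl hq0 1 (uk hp x.2))
      (Scale.q_le _ hB1) (by omega) (by omega)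
    rw [rlx_rlx, rlx_rlx] at h1
    have h2 := hbd _ hg (QK.map p 1 (A.sub_le A₁) (Control.le_id_app q) x.1 -
      QK.map p 1 (A.sub_le A₂) (Control.le_id_app q) x.2)
    rw [map_sub (uk hp), map_sub, uk_map, uk_map, rlx_rlx, rlx_rlx] at h2
    exact uk_injective (hp := hp) ((h2.unique mv h1 (by omega) hD).trans (map_zero _).symm)
  · intro q hf hg (y : QK p 1 A.fil q) hy
    obtain ⟨T, mv⟩ := h.mv hp hct hg.pos (by linarith [hg.2.1]) hf.le_of_id
    have hq1 := le_scaleOf hct hg.pos le_rfl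
    have hle := le_scaleOf hct hg.pos hP
    have h1 := hbd q hg y
    rw [show bd.map q hg y = 0 from hy] at h1
    have h2 : IsBdOf hp (scaleOf hct q hg.pos) A A₁ A₂ kB kD
        (rlx (unNorm p hp E) le_rfl (Scale.q_le _ hB1) 1
          (rlx (unNorm p hp E) le_rfl hq1 1 (uk hp y))) 0 := by
      rw [rlx_rlx]
      exact h1
    obtain ⟨x₁, x₂, p₁, p₂, h3⟩ := mv.exact_one continuous_snd_hom
      (pim_uk (hp := hp) (QK.map p 1 le_rfl hq1 y)) (Scale.q_le _ hB1) (Scale.q_le _ hP) h2 hB hD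
      (by omega) hl
    obtain ⟨x₁, rfl⟩ := exists_uk p₁
    obtain ⟨x₂, rfl⟩ := exists_uk p₂
    rw [uk_map, rlx_rlx, ← uk_map (A.sub_le A₁), ← uk_map (A.sub_le A₂), ← map_sub,
      ← uk_map le_rfl hle] at h3
    have h4 := congrArg (QK.map p 1 le_rfl (Control.le_id_app ((scaleOf hct q hg.pos).q kP)))
      (uk_injective h3)
    have hle' := Param.le_trans hle (Control.le_id_app ((scaleOf hct q hg.pos).q kP))
    rw [map_sub, QK.map_map 1 _ _ (A.sub_le A₁) _ _ (Control.le_id_app _),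
      QK.map_map 1 _ _ (A.sub_le A₂) _ _ (Control.le_id_app _),
      QK.map_map 1 _ _ le_rfl _ _ hle'] at h4
    exact ⟨hle', (x₁, x₂), h4⟩

theorem isExactAt_zero (h : A.IsMVPair s ct A₁ A₂) (hP : 1 ≤ kP)
    (hB : 20000000000000000000 ≤ kB) (hD : 20000000000000 * kB ≤ kD)
    (hl : kD ≤ kP)
    (hbd : ∀ (q : Param) (hq : (powPair hct kD hD1).toControl.Dom s q) (x : QK p 1 A.fil q),
        IsBdOf hp (scaleOf hct q hq.pos) A A₁ A₂ kB kD
          (rlx (unNorm p hp E) le_rfl (le_scaleOf hct hq.pos hB1) 1 (uk hp x))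
          (uk hp (bd.map q hq x))) :
    IsExactAt (powPair hct kP hP) s bd
      (inclPair p 0 s (A.sub_mono inf_le_left) (A.sub_mono inf_le_right)) := by
  constructor
  · intro q hf hg (x : QK p 1 A.fil q)
    obtain ⟨T, mv⟩ := h.mv hp hct hf.pos (by linarith [hf.2.1]) hf.2.2.2.2.2
    obtain ⟨h1, h2⟩ := (hbd q hf x).rlx_eq_zero mv (by omega)
    refine Prod.ext (uk_injective (hp := hp) ?_) (uk_injective (hp := hp) ?_)
    · have := congrArg (rlx (unNorm p hp E) le_rfl (Control.le_id_app _) 0) h1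
      rw [rlx_rlx, map_zero] at this
      exact this.trans (map_zero _).symm
    · have := congrArg (rlx (unNorm p hp E) le_rfl (Control.le_id_app _) 0) h2
      rw [rlx_rlx, map_zero] at this
      exact this.trans (map_zero _).symm
  · intro q hf hg (y : QK p 0 (A.sub (A₁ ⊓ A₂)) q) hy
    -- ∂ is assumed to be defined at the enlarged parameters, which bounds kD · kP · r and so leaves
    -- room for a construction of index kP at the parameters q.
    have hK : kP * q.r ≤ s := by
      have h1 : kD * (kP * q.r) ≤ s := hf.2.2.2.2.2
      have h2 : (1 : ℝ) ≤ kD := by exact_mod_cast hD1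
      have h3 : 0 ≤ kP * q.r := mul_nonneg (Nat.cast_nonneg kP) hg.pos.2.1.le
      nlinarith
    obtain ⟨T, mv⟩ := h.mv hp hct hg.pos (by linarith [hg.2.1]) hK
    have hq1 := le_scaleOf hct hg.pos le_rfl
    have hle := le_scaleOf hct hg.pos hP
    have y1 : QK.map p 0 (A.sub_mono inf_le_left) (Control.le_id_app q) y = 0 :=
      congrArg Prod.fst hy
    have y2 : QK.map p 0 (A.sub_mono inf_le_right) (Control.le_id_app q) y = 0 :=
      congrArg Prod.snd hy
    have z : ∀ {F' : ℝ →o Submodule ℂ (E →L[ℂ] E)} (hF : A.sub (A₁ ⊓ A₂) ≤ F'),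
        QK.map p 0 hF (Control.le_id_app q) y = 0 →
        rlx (unNorm p hp E) (unFil_mono hF) (Param.le_refl _) 0
          (rlx (unNorm p hp E) le_rfl hq1 0 (uk hp y)) = 0 := by
      intro F' hF hz
      have := congrArg (fun z => uk hp (QK.map p 0 le_rfl (id_app_le hq1) z)) hz
      simp only [QK.map_map 0 hF le_rfl hF _ (id_app_le hq1) hq1, uk_map, map_zero] at this
      rw [← rlx_split]
      exact this
    obtain ⟨x, px, hx⟩ := mv.exact_bd continuous_snd_hom (Scale.q_le _ hP) (z _ y1) (z _ y2)
      (show 100000000000000 ≤ kP by omega)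
    obtain ⟨x, rfl⟩ := exists_uk px
    -- The lift x lives at index kP of the scale of q, and these parameters are the starting point
    -- of a second scale. The gluing is transported to that scale, where ∂x is defined, and compared
    -- with ∂x by uniqueness.
    have hB' : (scaleOf hct q hg.pos).q kP ≤ (scaleOf hct _ hf.pos).q kB :=
      le_scaleOf hct hf.pos hB1
    have hD' : (scaleOf hct q hg.pos).q kP ≤ (scaleOf hct _ hf.pos).q kD :=
      le_scaleOf hct hf.pos hD1
    have h1 := hx.rescale (c := scaleOf hct q hg.pos) (kB := kP) (kD := kP)
      (c' := scaleOf hct _ hf.pos) hB' hD' hB1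
    rw [rlx_rlx, rlx_rlx] at h1
    have h2 := hbd _ hf x
    obtain ⟨T', mv'⟩ := h.mv hp hct hf.pos (by linarith [hf.2.1]) hf.2.2.2.2.2
    have hle' := Param.le_trans hle hD'
    refine ⟨hle', x, uk_injective (hp := hp) ?_⟩
    exact h2.unique mv' h1 (by omega) hD

end exactness

end QuantK

end

theorem mainTheorem2 (c : ℝ) (hc : 0 < c) :
    ∃ P D B : QuantK.ControlPair,
      ∀ (p : ENNReal) [Fact (1 ≤ p)] (_ : p ≠ ⊤) (E : Type u) [NormedAddCommGroup E]
        [NormedSpace ℂ E] [CompleteSpace E] (A : QuantK.FilteredSQpAlgebra.{u, v} p E) (s : ℝ)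
        (A₁ A₂ : NonUnitalSubalgebra ℂ (E →L[ℂ] E)) (_ : A.IsMVPair s c A₁ A₂),
        ∃ bd : QuantK.CtrlHom D.toControl s (QuantK.KFam p 1 A.fil)
            (QuantK.KFam p 0 (A.sub (A₁ ⊓ A₂))),
          A.IsBoundaryMap A₁ A₂ B D bd ∧
          QuantK.IsExactAt P s
            (QuantK.inclPair p 1 s (A.sub_mono inf_le_left) (A.sub_mono inf_le_right) :
              QuantK.CtrlHom QuantK.Control.id s (QuantK.KFam p 1 (A.sub (A₁ ⊓ A₂))) _)
            (QuantK.inclDiff p 1 s (A.sub_le A₁) (A.sub_le A₂)) ∧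
          QuantK.IsExactAt P s
            (QuantK.inclDiff p 1 s (A.sub_le A₁) (A.sub_le A₂)) bd ∧
          QuantK.IsExactAt P s bd
            (QuantK.inclPair p 0 s (A.sub_mono inf_le_left) (A.sub_mono inf_le_right)) ∧
          QuantK.IsExactAt P s
            (QuantK.inclPair p 0 s (A.sub_mono inf_le_left) (A.sub_mono inf_le_right) :
              QuantK.CtrlHom QuantK.Control.id s (QuantK.KFam p 0 (A.sub (A₁ ⊓ A₂))) _)
            (QuantK.inclDiff p 0 s (A.sub_le A₁) (A.sub_le A₂)) := by
  -- The indices are kept opaque; only their lower bounds matter. kB pays for the boundary data, kD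
  -- for the uniqueness of the boundary, and kP for the lifts in all four exactness statements.
  obtain ⟨kB, hB⟩ : ∃ k : ℕ, 20000000000000000000 ≤ k := ⟨_, le_rfl⟩
  obtain ⟨kD, hD⟩ : ∃ k : ℕ, 20000000000000 * kB ≤ k := ⟨_, le_rfl⟩
  obtain ⟨kP, hP⟩ : ∃ k : ℕ, 100000000000000000000000000000000 * kD ≤ k := ⟨_, le_rfl⟩
  have hB1 : 1 ≤ kB := by omega
  have hD1 : 1 ≤ kD := by omega
  have hP1 : 1 ≤ kP := by omega
  refine ⟨QuantK.powPair hc kP hP1, QuantK.powPair hc kD hD1, QuantK.powPair hc kB hB1, ?_⟩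
  intro p _ hp E _ _ _ A s A₁ A₂ h
  obtain ⟨bd, hbd⟩ := QuantK.exists_bd h hp hc hB1 hD1 hB hD
  exact ⟨bd, QuantK.isBoundaryMap h hc hB1 hD1 hB hD hbd,
    QuantK.isExactAt_one_sum h hp hc hP1 (by omega),
    QuantK.isExactAt_one (hB1 := hB1) h hP1 hB hD (by omega) hbd,
    QuantK.isExactAt_zero (hB1 := hB1) h hP1 hB hD (by omega) hbd,
    QuantK.isExactAt_zero_sum h hp hc hP1 (by omega)⟩
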